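/- **Setting.** For each unit there are covariates $X$ (in a standard Borel space $\mathcal X$), a binary treatment $Z$, real potential post-treatment values $S_1,S_0$ and integrable real potential outcomes $Y_1,Y_0$; one observes $V=(Y,S,Z,X)$ with $S=S_Z$, $Y=Y_Z$. Let $U=(S_1,S_0)$. *Causal model.* (i) $Z\perp (S_0,S_1,Y_0,Y_1)\mid X$; (ii) $\mathbb P(S_1\le s_1,S_0\le s_0\mid X)=\mathbb C\{\mathbb P(S_1\le s_1\mid X),\mathbb P(S_0\le s_0\mid X)\}$ for a known copula $\mathbb C(u,v)=\int_0^u\!\int_0^v c$ with $c$ continuously differentiable on $(0,1)^2$; (iii) $\mathbb E(Y_1\mid S_1,S_0,X)=\mathbb E(Y_1\mid S_1,X)$ and $\mathbb E(Y_0\mid S_1,S_0,X)=\mathbb E(Y_0\mid S_0,X)$. *Nonparametric model.* The law of $V$ factorizes as $p(X)p(Z\mid X)p(S\mid Z,X)p(Y\mid S,Z,X)$ and is unrestricted except that $0<\pi(x)=\mathbb P(Z=1\mid X=x)<1$ and $S$ has a conditional density $p_z(s,x)$ given $Z=z,X=x$. Write $\mathbb F_z(s,x)=\int_{-\infty}^s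 p_z(t,x)\,dt$, $\mu_z(s,x)=\mathbb E(Y\mid Z=z,S=s,X=x)$, $e(s_1,s_0,x)=c(\mathbb F_1(s_1,x),\mathbb F_0(s_0,x))\,p_1(s_1,x)\,p_0(s_0,x)$ and $e(s_1,s_0)=\mathbb E\{e(s_1,s_0,X)\}$. *Parameter.* For a weight $w_0\ge 0$ and a working model $f_0(s_1,s_0;\eta)$ that is twice continuously differentiable in $\eta\in\mathbb R^q$, with gradient $\dot f_0$ and Hessian $\ddot f_0$ in $\eta$, let $m_0(S_1,S_0)=\mathbb E(Y_0\mid S_1,S_0)$ and let $\eta_0$ be the unique minimizer over $\mathbb R^q$ of $\mathbb E[w_0(S_1,S_0)\{m_0(S_1,S_0)-f_0(S_1,S_0;\eta)\}^2]$. For an arbitrary law in the nonparametric model put $L(\eta)=\iint w_0\{m_0-f_0(\cdot;\eta)\}^2 e(s_1,s_0)\,ds_1ds_0$ with $m_0(s_1,s_0)=\mathbb E\{e(s_1,s_0,X)\mu_0(s_0,X)\}/e(s_1,s_0)$. *Formulas.* Let $$H_0=\mathbb E\big(w_0(S_1,S_0)[\dot f_0\dot f_0^{T}-\{m_0(S_1,S_0)-f_0\}\ddot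 f_0]\big)\quad\text{at }(S_1,S_0;\eta_0),$$ $$\nu_0(s_1,s_0,x)=w_0(s_1,s_0)\dot f_0(s_1,s_0;\eta_0)e(s_1,s_0,x)\{\mu_0(s_0,x)-f_0(s_1,s_0;\eta_0)\},$$ $$r_u=1-\frac{\dot c_u}{c}\{1(S\le s_1)-\mathbb F_1(s_1,X)\},\qquad r_v=1-\frac{\dot c_v}{c}\{1(S\le s_0)-\mathbb F_0(s_0,X)\},$$ where $c$ and its partial derivatives $\dot c_u,\dot c_v$ are evaluated at $(\mathbb F_1(s_1,X),\mathbb F_0(s_0,X))$, and $$k_1(X)=\iint\nu_0(s_1,s_0,X)\,ds_1ds_0,$$ $$k_2(S,Z,X)=\frac{Z}{\pi(X)}\Big\{\frac{\int\nu_0(S,s_0,X)ds_0}{p_1(S,X)}-\iint\nu_0 r_u\,ds_1ds_0\Big\}+\frac{1-Z}{1-\pi(X)}\Big\{\frac{\int\nu_0(s_1,S,X)ds_1}{p_0(S,X)}-\iint\nu_0 r_v\,ds_1ds_0\Big\},$$ $$k_3(Y,S,Z,X)=\frac{1-Z}{1-\pi(X)}\,\frac{\int w_0(s_1,S)\dot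 f_0(s_1,S;\eta_0)e(s_1,S,X)ds_1}{p_0(S,X)}\{Y-\mu_0(S,X)\}.$$ *Regularity.* $H_0$ is invertible; $k_1+k_2+k_3$ has finite variance; and for some $\delta>0$ there are measurable functions $b(s_1,s_0)$ and $\Psi(u,v)$ such that (a) for $\|\eta-\eta_0\|<\delta$, $b$ bounds $|f_0|$ and the entries of $\dot f_0,\ddot f_0$; (b) for $u,v,u',v'\in(0,1)$ with $|u'-u|\le\delta u(1-u)$ and $|v'-v|\le\delta v(1-v)$, $u(1-u)|\dot c_u(u',v')|+v(1-v)|\dot c_v(u',v')|\le\Psi(u,v)$; (c) $$\mathbb E\iint w_0\{\mathbb E(|Y|\mid Z=0,S=s_0,X)+b\}^2(c+\Psi)(\mathbb F_1(s_1,X),\mathbb F_0(s_0,X))\,p_1(s_1,X)p_0(s_0,X)\,ds_1ds_0<\infty.$$ A *regular submodel* through the law $P$ of $V$ with score $\mathfrak s$ is a curve $P_\theta$ in the nonparametric model with $dP_\theta=g_\theta\,dP$ for $\theta$ near $0$, $|g_\theta-1|\le B|\theta|$ for a constant $B$, and $\partial_\theta g_\theta|_{\theta=0}=\mathfrak s$,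 both $P$-almost everywhere. The *tangent space* is the closed linear span in $L^2(P)$ of the scores of regular submodels. **Theorem S1.** Under these conditions: 1. (Identification.) For every full-data law satisfying the causal model whose observed law belongs to the nonparametric model, $\mathbb E[w_0(S_1,S_0)\{m_0(S_1,S_0)-f_0(S_1,S_0;\eta)\}^2]=L(\eta)$ for all $\eta$. 2. The efficient influence function of $\eta_0$ is $$\varphi_0(V)=H_0^{-1}\{k_1(X)+k_2(S,Z,X)+k_3(Y,S,Z,X)\}.$$ That is, $\varphi_0$ is square integrable with mean zero, its coordinates lie in the tangent space, and there is a neighbourhood $N$ of $\eta_0$ such that along every regular submodel, for all $\theta$ near $0$, the objective $L_\theta$ of $P_\theta$ has a unique minimizer $\eta_{0,\theta}$ over $N$, with $\eta_{0,0}=\eta_0$ and $$\frac{d}{d\theta}\eta_{0,\theta}\Big|_{\theta=0}=\mathbb E\{\varphi_0(V)\mathfrak s(V)\}.$$ The same derivative formula holds for every curve of minimizers of $L_\theta$ over all of $\mathbb R^q$ that tends to $\eta_0$ as $\theta\to0$. One may take $N=\mathbb R^q$ if $f_0$ is affine in $\eta$, or if $|f_0(\cdot;\eta)|\le b$ for all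 $\eta$ and the minimum at $\eta_0$ is well separated (the infimum of the objective over $\|\eta-\eta_0\|\ge\rho$ exceeds its value at $\eta_0$ for every $\rho>0$). -/

import Mathlib

open MeasureTheory ProbabilityTheory Filter
open scoped Topology ENNReal

noncomputable section

namespace PCE

/-! ### Copula densities -/

/-- The function `ℂ(u,v) = ∫₀ᵘ ∫₀ᵛ c` with mixed derivative `c`. -/
def copulaCDF (c : ℝ → ℝ → ℝ) (u v : ℝ) : ℝ :=
  ∫ a in Set.Ioo 0 u ×ˢ Set.Ioo 0 v, c a.1 a.2

/-- `c` is the density of a copula (a distribution on the unit square with uniform margins) and is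
continuously differentiable inside the square. -/
structure IsCopulaDensity (c : ℝ → ℝ → ℝ) : Prop where
  measurable : Measurable (Function.uncurry c)
  nonneg : ∀ u ∈ Set.Ioo (0 : ℝ) 1, ∀ v ∈ Set.Ioo (0 : ℝ) 1, 0 ≤ c u v
  margin_left : ∀ u ∈ Set.Icc (0 : ℝ) 1, copulaCDF c u 1 = u
  margin_right : ∀ v ∈ Set.Icc (0 : ℝ) 1, copulaCDF c 1 v = v
  contDiffOn : ContDiffOn ℝ 1 (Function.uncurry c) (Set.Ioo 0 1 ×ˢ Set.Ioo 0 1)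

/-- The partial derivative of `c` in its first argument. -/
def dcu (c : ℝ → ℝ → ℝ) (u v : ℝ) : ℝ := deriv (fun a => c a v) u

/-- The partial derivative of `c` in its second argument. -/
def dcv (c : ℝ → ℝ → ℝ) (u v : ℝ) : ℝ := deriv (fun a => c u a) v

/-! ### The nonparametric model for the observed data -/

/-- The space of observed data `v = (x, z, s, y)`; `z = true` means treatment, `z = false` control. -/
abbrev Obs (𝒳 : Type*) := ((𝒳 × Bool) × ℝ) × ℝ

/-- A member of the nonparametric model, given by the factors of the likelihood
`p(x) p(z ∣ x) p(s ∣ z, x) p(y ∣ s, z, x)`. The only restrictions are overlap,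
`0 < ℙ(Z = 1 ∣ X) < 1`, and that `S` has a density given `(Z, X)`. -/
structure ObsModel (𝒳 : Type*) [MeasurableSpace 𝒳] where
  /-- the law of `X` -/
  PX : Measure 𝒳
  isProb : IsProbabilityMeasure PX
  /-- the law of `Z` given `X` -/
  trt : Kernel 𝒳 Bool
  isMarkov_trt : IsMarkovKernel trt
  overlap : ∀ x, 0 < (trt x).real {true} ∧ (trt x).real {true} < 1
  /-- `p z x s` is the density at `s` of `S` given `Z = z` and `X = x` -/
  p : Bool → 𝒳 → ℝ → ℝ
  measurable_p : ∀ z, Measurable (Function.uncurry (p z))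
  p_nonneg : ∀ z x s, 0 ≤ p z x s
  lintegral_p : ∀ z x, ∫⁻ s, ENNReal.ofReal (p z x s) = 1
  /-- the law of `Y` given `((X, Z), S)` -/
  out : Kernel ((𝒳 × Bool) × ℝ) ℝ
  isMarkov_out : IsMarkovKernel out

namespace ObsModel

variable {𝒳 : Type*} [MeasurableSpace 𝒳]

/-- The law of `S` given `(X, Z)`. -/
def postKernel (M : ObsModel 𝒳) : Kernel (𝒳 × Bool) ℝ :=
  Kernel.withDensity (Kernel.const _ volume) (fun a s => ENNReal.ofReal (M.p a.2 a.1 s))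

/-- The law of the observed data `((X, Z), S), Y`. -/
def law (M : ObsModel 𝒳) : Measure (Obs 𝒳) :=
  ((M.PX ⊗ₘ M.trt) ⊗ₘ M.postKernel) ⊗ₘ M.out

/-- The treatment probability `π(x) = ℙ(Z = 1 ∣ X = x)`. -/
def prop (M : ObsModel 𝒳) (x : 𝒳) : ℝ := (M.trt x).real {true}

/-- The conditional distribution function `𝔽_z(s, x) = ℙ(S ≤ s ∣ Z = z, X = x)`. -/
def F (M : ObsModel 𝒳) (z : Bool) (s : ℝ) (x : 𝒳) : ℝ := ∫ t in Set.Iic s, M.p z x t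

/-- The outcome mean `μ_z(s, x) = 𝔼(Y ∣ Z = z, S = s, X = x)`. -/
def mu (M : ObsModel 𝒳) (z : Bool) (s : ℝ) (x : 𝒳) : ℝ := ∫ y, y ∂(M.out ((x, z), s))

/-- The principal density `e(s₁, s₀, x)`. -/
def e (M : ObsModel 𝒳) (c : ℝ → ℝ → ℝ) (s₁ s₀ : ℝ) (x : 𝒳) : ℝ :=
  c (M.F true s₁ x) (M.F false s₀ x) * M.p true x s₁ * M.p false x s₀

/-- The marginal density `e(s₁, s₀)` of the principal stratum. -/
def eU (M : ObsModel 𝒳) (c : ℝ → ℝ → ℝ) (s₁ s₀ : ℝ) : ℝ := ∫ x, M.e c s₁ s₀ x ∂M.PX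

/-- The identified mean surface
`m₀(s₁, s₀) = 𝔼{e(s₁, s₀, X) μ₀(s₀, X)} / e(s₁, s₀)` of the control potential outcome. -/
def m0 (M : ObsModel 𝒳) (c : ℝ → ℝ → ℝ) (s₁ s₀ : ℝ) : ℝ :=
  (∫ x, M.e c s₁ s₀ x * M.mu false s₀ x ∂M.PX) / M.eU c s₁ s₀

/-- The identified projection objective
`∬ w(s₁, s₀) {m₀(s₁, s₀) - f(s₁, s₀; η)}² e(s₁, s₀) ds₁ ds₀`, possibly infinite. -/
def loss (M : ObsModel 𝒳) {q : ℕ} (c w : ℝ → ℝ → ℝ) (f : ℝ → ℝ → (Fin q → ℝ) → ℝ)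
    (η : Fin q → ℝ) : ℝ≥0∞ :=
  ∫⁻ s : ℝ × ℝ, ENNReal.ofReal
    (w s.1 s.2 * (M.m0 c s.1 s.2 - f s.1 s.2 η) ^ 2 * M.eU c s.1 s.2)

end ObsModel

/-! ### The causal model -/

/-- The space of full data `(x, z, (s₁, s₀), (y₁, y₀))`. -/
abbrev Full (𝒳 : Type*) := 𝒳 × Bool × (ℝ × ℝ) × (ℝ × ℝ)

namespace Full

variable {𝒳 : Type*}

def cov (ω : Full 𝒳) : 𝒳 := ω.1
def trt (ω : Full 𝒳) : Bool := ω.2.1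
/-- the principal stratum `U = (S₁, S₀)` -/
def U (ω : Full 𝒳) : ℝ × ℝ := ω.2.2.1
def S1 (ω : Full 𝒳) : ℝ := ω.2.2.1.1
def S0 (ω : Full 𝒳) : ℝ := ω.2.2.1.2
def Y1 (ω : Full 𝒳) : ℝ := ω.2.2.2.1
def Y0 (ω : Full 𝒳) : ℝ := ω.2.2.2.2

/-- The observed data: `S = S_Z` and `Y = Y_Z`. -/
def obs (ω : Full 𝒳) : Obs 𝒳 :=
  (((ω.cov, ω.trt), if ω.trt then ω.S1 else ω.S0), if ω.trt then ω.Y1 else ω.Y0)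

theorem measurable_cov [MeasurableSpace 𝒳] : Measurable (cov : Full 𝒳 → 𝒳) := measurable_fst

end Full

section Causal

variable {𝒳 : Type*} [MeasurableSpace 𝒳]

/-- The σ-algebra generated by a random variable on the full data space. -/
abbrev sig {β : Type*} [MeasurableSpace β] (g : Full 𝒳 → β) : MeasurableSpace (Full 𝒳) :=
  MeasurableSpace.comap g inferInstance

/-- Full-data laws satisfying treatment ignorability, the copula model for `(S₁, S₀)` given `X`, and
principal ignorability. -/
structure IsCausalLaw [StandardBorelSpace 𝒳] (c : ℝ → ℝ → ℝ) (Q : Measure (Full 𝒳))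
    [IsProbabilityMeasure Q] : Prop where
  integrable_Y1 : Integrable Full.Y1 Q
  integrable_Y0 : Integrable Full.Y0 Q
  /-- `Z ⫫ (S₀, S₁, Y₀, Y₁) ∣ X` -/
  ignorability : CondIndepFun (sig Full.cov) Full.measurable_cov.comap_le Full.trt
    (fun ω => (ω.S0, ω.S1, ω.Y0, ω.Y1)) Q
  /-- `ℙ(S₁ ≤ s₁, S₀ ≤ s₀ ∣ X) = ℂ{ℙ(S₁ ≤ s₁ ∣ X), ℙ(S₀ ≤ s₀ ∣ X)}` -/
  copula : ∀ᵐ x ∂(Q.map Full.cov), ∀ s₁ s₀ : ℝ,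
    (condDistrib Full.U Full.cov Q x).real (Set.Iic s₁ ×ˢ Set.Iic s₀) =
      copulaCDF c ((condDistrib Full.S1 Full.cov Q x).real (Set.Iic s₁))
        ((condDistrib Full.S0 Full.cov Q x).real (Set.Iic s₀))
  /-- `𝔼(Y₁ ∣ S₁, S₀, X)` is free of `S₀` -/
  principal_one : Q[Full.Y1 | sig (fun ω => (ω.U, ω.cov))] =ᵐ[Q]
    Q[Full.Y1 | sig (fun ω => (ω.S1, ω.cov))]
  /-- `𝔼(Y₀ ∣ S₁, S₀, X)` is free of `S₁` -/
  principal_zero : Q[Full.Y0 | sig (fun ω => (ω.U, ω.cov))] =ᵐ[Q]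
    Q[Full.Y0 | sig (fun ω => (ω.S0, ω.cov))]

/-- The random variable `m₀(S₁, S₀) = 𝔼(Y₀ ∣ S₁, S₀)`. -/
def meanY0 (Q : Measure (Full 𝒳)) : Full 𝒳 → ℝ := Q[Full.Y0 | sig Full.U]

/-- The projection objective `𝔼[w(S₁, S₀) {m₀(S₁, S₀) - f(S₁, S₀; η)}²]`, possibly infinite. -/
def causalLoss {q : ℕ} (w : ℝ → ℝ → ℝ) (f : ℝ → ℝ → (Fin q → ℝ) → ℝ) (Q : Measure (Full 𝒳))
    (η : Fin q → ℝ) : ℝ≥0∞ :=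
  ∫⁻ ω, ENNReal.ofReal (w ω.S1 ω.S0 * (meanY0 Q ω - f ω.S1 ω.S0 η) ^ 2) ∂Q

end Causal

/-! ### Derivatives of the working model and the matrix `H₀` -/

/-- `∂ f / ∂ η_i`. -/
def df {q : ℕ} (f : ℝ → ℝ → (Fin q → ℝ) → ℝ) (s₁ s₀ : ℝ) (η : Fin q → ℝ) (i : Fin q) : ℝ :=
  fderiv ℝ (f s₁ s₀) η (Pi.single i 1)

/-- `∂² f / ∂ η_i ∂ η_j`. -/
def ddf {q : ℕ} (f : ℝ → ℝ → (Fin q → ℝ) → ℝ) (s₁ s₀ : ℝ) (η : Fin q → ℝ) (i j : Fin q) : ℝ :=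
  fderiv ℝ (fun η' => df f s₁ s₀ η' j) η (Pi.single i 1)

/-- `H₀ = 𝔼(w [ḟ ḟᵀ - {m₀ - f} f̈])`, evaluated at `(S₁, S₀)` and `η`. -/
def H0 {𝒳 : Type*} [MeasurableSpace 𝒳] {q : ℕ} (w : ℝ → ℝ → ℝ) (f : ℝ → ℝ → (Fin q → ℝ) → ℝ)
    (Q : Measure (Full 𝒳)) (η : Fin q → ℝ) : Matrix (Fin q) (Fin q) ℝ :=
  Matrix.of fun i j => ∫ ω, w ω.S1 ω.S0 *
    (df f ω.S1 ω.S0 η i * df f ω.S1 ω.S0 η j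
      - (meanY0 Q ω - f ω.S1 ω.S0 η) * ddf f ω.S1 ω.S0 η i j) ∂Q

/-! ### The terms of the efficient influence function -/

namespace ObsModel

variable {𝒳 : Type*} [MeasurableSpace 𝒳] {q : ℕ}

/-- `ν₀(s₁, s₀, x) = w ḟ e(s₁, s₀, x) {μ₀(s₀, x) - f}`. -/
def nu0 (M : ObsModel 𝒳) (c w : ℝ → ℝ → ℝ) (f : ℝ → ℝ → (Fin q → ℝ) → ℝ) (η : Fin q → ℝ)
    (s₁ s₀ : ℝ) (x : 𝒳) (i : Fin q) : ℝ :=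
  w s₁ s₀ * df f s₁ s₀ η i * M.e c s₁ s₀ x * (M.mu false s₀ x - f s₁ s₀ η)

/-- `r_u(s₁, s₀, s, x) = 1 - (ċ_u / c) {1(s ≤ s₁) - 𝔽₁(s₁, x)}`. -/
def ru (M : ObsModel 𝒳) (c : ℝ → ℝ → ℝ) (s₁ s₀ s : ℝ) (x : 𝒳) : ℝ :=
  1 - dcu c (M.F true s₁ x) (M.F false s₀ x) / c (M.F true s₁ x) (M.F false s₀ x) *
    ((Set.Iic s₁).indicator (fun _ => (1 : ℝ)) s - M.F true s₁ x)

/-- `r_v(s₁, s₀, s, x) = 1 - (ċ_v / c) {1(s ≤ s₀) - 𝔽₀(s₀, x)}`. -/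
def rv (M : ObsModel 𝒳) (c : ℝ → ℝ → ℝ) (s₁ s₀ s : ℝ) (x : 𝒳) : ℝ :=
  1 - dcv c (M.F true s₁ x) (M.F false s₀ x) / c (M.F true s₁ x) (M.F false s₀ x) *
    ((Set.Iic s₀).indicator (fun _ => (1 : ℝ)) s - M.F false s₀ x)

/-- `z / π(x)`. -/
def ipw1 (M : ObsModel 𝒳) (z : Bool) (x : 𝒳) : ℝ := (if z then 1 else 0) / M.prop x

/-- `(1 - z) / (1 - π(x))`. -/
def ipw0 (M : ObsModel 𝒳) (z : Bool) (x : 𝒳) : ℝ := (if z then 0 else 1) / (1 - M.prop x)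

def k1 (M : ObsModel 𝒳) (c w : ℝ → ℝ → ℝ) (f : ℝ → ℝ → (Fin q → ℝ) → ℝ) (η : Fin q → ℝ)
    (x : 𝒳) (i : Fin q) : ℝ :=
  ∫ t : ℝ × ℝ, M.nu0 c w f η t.1 t.2 x i

def k2 (M : ObsModel 𝒳) (c w : ℝ → ℝ → ℝ) (f : ℝ → ℝ → (Fin q → ℝ) → ℝ) (η : Fin q → ℝ)
    (s : ℝ) (z : Bool) (x : 𝒳) (i : Fin q) : ℝ :=
  M.ipw1 z x * ((∫ s₀, M.nu0 c w f η s s₀ x i) / M.p true x s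
      - ∫ t : ℝ × ℝ, M.nu0 c w f η t.1 t.2 x i * M.ru c t.1 t.2 s x)
  + M.ipw0 z x * ((∫ s₁, M.nu0 c w f η s₁ s x i) / M.p false x s
      - ∫ t : ℝ × ℝ, M.nu0 c w f η t.1 t.2 x i * M.rv c t.1 t.2 s x)

def k3 (M : ObsModel 𝒳) (c w : ℝ → ℝ → ℝ) (f : ℝ → ℝ → (Fin q → ℝ) → ℝ) (η : Fin q → ℝ)
    (y s : ℝ) (z : Bool) (x : 𝒳) (i : Fin q) : ℝ :=
  M.ipw0 z x * ((∫ s₁, w s₁ s * df f s₁ s η i * M.e c s₁ s x) / M.p false x s)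
    * (y - M.mu false s x)

/-- `k₁(X) + k₂(S, Z, X) + k₃(Y, S, Z, X)` as a function of the observed data. -/
def kSum (M : ObsModel 𝒳) (c w : ℝ → ℝ → ℝ) (f : ℝ → ℝ → (Fin q → ℝ) → ℝ) (η : Fin q → ℝ)
    (v : Obs 𝒳) (i : Fin q) : ℝ :=
  M.k1 c w f η v.1.1.1 i + M.k2 c w f η v.1.2 v.1.1.2 v.1.1.1 i
    + M.k3 c w f η v.2 v.1.2 v.1.1.2 v.1.1.1 i

end ObsModel

/-! ### Regular submodels, the tangent space and efficient influence functions -/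

section EIF

variable {𝒳 : Type*} [MeasurableSpace 𝒳]

/-- `Mθ` is a regular one-dimensional submodel of the nonparametric model through `M` with score
`s`: near `θ = 0` the law of `Mθ θ` has a likelihood ratio `g θ` with respect to `M.law` such that
`(g θ - 1) / θ` is bounded uniformly in `θ` and converges to `s` as `θ → 0`
(so `g 0 = 1` and `s = ∂ log g θ / ∂ θ` at `θ = 0`). -/
def IsRegularSubmodel (M : ObsModel 𝒳) (Mθ : ℝ → ObsModel 𝒳) (s : Obs 𝒳 → ℝ) : Prop :=
  ∃ (g : ℝ → Obs 𝒳 → ℝ) (B : ℝ),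
    (∀ᶠ θ in 𝓝 (0 : ℝ), Measurable (g θ) ∧ (∀ v, 0 ≤ g θ v) ∧
      (Mθ θ).law = M.law.withDensity (fun v => ENNReal.ofReal (g θ v)) ∧
      ∀ᵐ v ∂M.law, |g θ v - 1| ≤ B * |θ|) ∧
    ∀ᵐ v ∂M.law, HasDerivAt (fun θ => g θ v) (s v) 0

/-- The tangent space at `M`: the closed linear span in `L²` of the scores of regular submodels. -/
def tangentSpace (M : ObsModel 𝒳) : Submodule ℝ (Lp ℝ 2 M.law) :=
  (Submodule.span ℝ {h : Lp ℝ 2 M.law | ∃ (Mθ : ℝ → ObsModel 𝒳) (s : Obs 𝒳 → ℝ),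
    IsRegularSubmodel M Mθ s ∧ h =ᵐ[M.law] s}).topologicalClosure

/-- `η` is the unique minimizer of `L` over `N`. -/
def IsUniqueMinOn {E : Type*} (L : E → ℝ≥0∞) (N : Set E) (η : E) : Prop :=
  η ∈ N ∧ ∀ η' ∈ N, η' ≠ η → L η < L η'

/-- `φ` is the efficient influence function at `M` of the parameter `argmin L(M', ·)`, whose value
at `M` is `η₀`: each coordinate of `φ` is square integrable with mean zero and lies in the tangent
space, and `φ` represents the pathwise derivative. Near `M` the parameter is the minimizer over the
neighbourhood `N` of `η₀`; along submodels where a global minimizer exists and is continuous at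
`θ = 0` it may equally be taken to be that global minimizer. -/
structure IsEIF {q : ℕ} (L : ObsModel 𝒳 → (Fin q → ℝ) → ℝ≥0∞) (N : Set (Fin q → ℝ))
    (M : ObsModel 𝒳) (η₀ : Fin q → ℝ) (φ : Obs 𝒳 → Fin q → ℝ) : Prop where
  memLp : ∀ i, MemLp (fun v => φ v i) 2 M.law
  mean_zero : ∀ i, ∫ v, φ v i ∂M.law = 0
  mem_tangent : ∀ i, (memLp i).toLp (fun v => φ v i) ∈ tangentSpace M
  deriv_min : ∀ (Mθ : ℝ → ObsModel 𝒳) (s : Obs 𝒳 → ℝ), IsRegularSubmodel M Mθ s →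
    ∃ η : ℝ → Fin q → ℝ, η 0 = η₀ ∧
      (∀ᶠ θ in 𝓝 (0 : ℝ), IsUniqueMinOn (L (Mθ θ)) N (η θ)) ∧
      HasDerivAt η (fun i => ∫ v, φ v i * s v ∂M.law) 0
  deriv_argmin : ∀ (Mθ : ℝ → ObsModel 𝒳) (s : Obs 𝒳 → ℝ), IsRegularSubmodel M Mθ s →
    ∀ η : ℝ → Fin q → ℝ, Tendsto η (𝓝 0) (𝓝 η₀) →
      (∀ᶠ θ in 𝓝 (0 : ℝ), ∀ η', L (Mθ θ) (η θ) ≤ L (Mθ θ) η') →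
      HasDerivAt η (fun i => ∫ v, φ v i * s v ∂M.law) 0

end EIF

/-! ### Regularity conditions -/

/-- Smoothness and moment conditions. `b` dominates the working model and its first two derivatives
near `η₀`; `Ψ` dominates the weighted partial derivatives of the copula density, uniformly over small
relative perturbations of its arguments; and `w (|Y| + b)²` is integrable in the sense of `moment`. -/
structure IsRegular {𝒳 : Type*} [MeasurableSpace 𝒳] {q : ℕ} (c w : ℝ → ℝ → ℝ)
    (f : ℝ → ℝ → (Fin q → ℝ) → ℝ) (M : ObsModel 𝒳) (η₀ : Fin q → ℝ) (b Ψ : ℝ → ℝ → ℝ) (δ : ℝ) :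
    Prop where
  pos : 0 < δ
  measurable_w : Measurable (Function.uncurry w)
  w_nonneg : ∀ s₁ s₀, 0 ≤ w s₁ s₀
  measurable_f : ∀ η, Measurable (fun s : ℝ × ℝ => f s.1 s.2 η)
  contDiff_f : ∀ s₁ s₀, ContDiff ℝ 2 (f s₁ s₀)
  measurable_b : Measurable (Function.uncurry b)
  measurable_Ψ : Measurable (Function.uncurry Ψ)
  bound_f : ∀ s₁ s₀, ∀ η ∈ Metric.ball η₀ δ, |f s₁ s₀ η| ≤ b s₁ s₀
  bound_df : ∀ s₁ s₀, ∀ η ∈ Metric.ball η₀ δ, ∀ i, |df f s₁ s₀ η i| ≤ b s₁ s₀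
  bound_ddf : ∀ s₁ s₀, ∀ η ∈ Metric.ball η₀ δ, ∀ i j, |ddf f s₁ s₀ η i j| ≤ b s₁ s₀
  bound_c : ∀ u ∈ Set.Ioo (0 : ℝ) 1, ∀ v ∈ Set.Ioo (0 : ℝ) 1,
    ∀ u' ∈ Set.Ioo (0 : ℝ) 1, ∀ v' ∈ Set.Ioo (0 : ℝ) 1,
      |u' - u| ≤ δ * (u * (1 - u)) → |v' - v| ≤ δ * (v * (1 - v)) →
        u * (1 - u) * |dcu c u' v'| + v * (1 - v) * |dcv c u' v'| ≤ Ψ u v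
  moment : ∫⁻ x, (∫⁻ s : ℝ × ℝ,
      ENNReal.ofReal (w s.1 s.2)
        * ((∫⁻ y, ‖y‖ₑ ∂(M.out ((x, false), s.2))) + ENNReal.ofReal (b s.1 s.2)) ^ 2
        * ENNReal.ofReal ((c (M.F true s.1 x) (M.F false s.2 x)
            + Ψ (M.F true s.1 x) (M.F false s.2 x)) * M.p true x s.1 * M.p false x s.2))
      ∂M.PX < ∞

/-- A condition under which the minimizer is globally stable: the working model is affine in `η`, or
it is dominated by `b` for all `η` and `η₀` is a well-separated minimizer of `L`. -/
def IsGloballyStable {q : ℕ} (f : ℝ → ℝ → (Fin q → ℝ) → ℝ) (b : ℝ → ℝ → ℝ)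
    (L : (Fin q → ℝ) → ℝ≥0∞) (η₀ : Fin q → ℝ) : Prop :=
  (∀ s₁ s₀, ∃ (a : (Fin q → ℝ) →ₗ[ℝ] ℝ) (k : ℝ), ∀ η, f s₁ s₀ η = a η + k) ∨
  ((∀ s₁ s₀ η, |f s₁ s₀ η| ≤ b s₁ s₀) ∧
    ∀ ρ > 0, ∃ κ : ℝ≥0∞, 0 < κ ∧ ∀ η, ρ ≤ ‖η - η₀‖ → L η₀ + κ ≤ L η)

end PCE

end

noncomputable section

namespace PCE

/-! ### Minimizers of families with approximately linear gradients -/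

/-! Identification. Given `X`, treatment ignorability equates the laws of `S₁`, of `S₀` and of `(S₀,
Y₀)` with observed conditional laws in the matching arm. These laws of `S` have densities, so the
probability integral transform turns the copula equation into the density `e(·, ·, x)` for `U` given
`X = x` (`condDistrib_U`). Principal ignorability gives `𝔼(Y₀ ∣ U, X) = μ₀(S₀, X)`, and averaging
over `X` given `U` gives `m₀` (`meanY0_eq`).

Reduction to least squares. The objective contains the quotient `m₀`, which is awkward to perturb.
By the bias-variance identity (`loss_add_varLoss`), replacing `m₀(s₁, s₀)` by `μ₀(s₀, x)` and
integrating over `x` as well adds a finite term free of `η`. The minimizers are then those of a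
weighted least squares problem on `𝒳 × ℝ × ℝ` with regression function `μ₀`. Its reference measure
has density `w (c + Ψ) p₁ p₀`, and the law enters through the weight `r = c / (c + Ψ)` and through
`μ₀`. The summand `Ψ` is needed because a perturbed copula density is controlled by `c + O(θ) Ψ` and
not by a multiple of `c`.

Perturbation. The objective depends on the law only, and near `0` every regular submodel has the law
of a curve of tilts of `M` with bounded likelihood ratios (`IsRegularSubmodel.exists_curve`).
Iterated conditional averages of the ratio give the ratios of all factors of the likelihood. A
density ratio within `ε` of one moves a distribution function `F` by `O(ε) F (1 - F)`, since the
lower and the upper tail both move by relative amounts. This is exactly the scale on which `Ψ`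
bounds the derivatives of `c`. Hence `μ₀` and `r` are Lipschitz in `θ` with integrable bounds
(`isPath`).

Minimizers. Up to the factor `-2` the gradient of the criterion is a map `G θ η`, which near `η₀` is
uniformly close to a linear map with matrix `-H₀` and is differentiable in `θ` at `(0, η₀)`, with
derivative `d` say. A quantitative inverse function argument gives zeros `η θ` with derivative `H₀⁻¹
d` (`exists_zero_curve`). Minimality makes `H₀` positive semidefinite and invertibility makes it
positive definite, so each such zero is the unique minimizer over a fixed ball
(`IsBase.exists_min_curve`). Convexity or separation makes it global in the two special cases.

Influence function. Inverse probability weights turn averages of `k₂` and `k₃` against a score into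
averages over one treatment arm, and Fubini's theorem identifies the total with `d`
(`integral_kSum_mul`). The same identity for the constant function `1` shows that the mean of `k₁ +
k₂ + k₃` is the gradient at `η₀`, which vanishes. Every bounded mean-zero function is a score, so by
density the tangent space contains all square integrable mean-zero functions, and membership of `φ₀`
follows. -/

theorem abs_dotProduct_le {q : ℕ} (x y : Fin q → ℝ) : |x ⬝ᵥ y| ≤ q * ‖x‖ * ‖y‖ := by
  calc |x ⬝ᵥ y| ≤ ∑ i, |x i * y i| := Finset.abs_sum_le_sum_abs _ _
    _ ≤ ∑ _i : Fin q, ‖x‖ * ‖y‖ := by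
        refine Finset.sum_le_sum fun i _ => ?_
        rw [abs_mul]
        exact mul_le_mul (norm_le_pi_norm x i) (norm_le_pi_norm y i) (abs_nonneg _) (norm_nonneg _)
    _ = q * ‖x‖ * ‖y‖ := by simp [mul_assoc]

/-- The constant is a positive lower bound of the quadratic form on the compact unit sphere of the
sup norm; homogeneity does the rest. -/
theorem exists_dotProduct_mulVec_ge {q : ℕ} {H : Matrix (Fin q) (Fin q) ℝ} (hH : H.PosDef) :
    ∃ c₀ > 0, ∀ v, c₀ * ‖v‖ ^ 2 ≤ v ⬝ᵥ H.mulVec v := by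
  have hc : Continuous fun v : Fin q → ℝ => v ⬝ᵥ H.mulVec v := by fun_prop
  obtain ⟨c₀, h0, h1⟩ := (isCompact_sphere (0 : Fin q → ℝ) 1).exists_forall_le'
    (f := fun v => v ⬝ᵥ H.mulVec v) hc.continuousOn (a := 0) (fun v hv => by
      have hv0 : v ≠ 0 := by
        rintro rfl
        simp at hv
      simpa using hH.dotProduct_mulVec_pos hv0)
  refine ⟨c₀, h0, fun v => ?_⟩
  rcases eq_or_ne v 0 with rfl | hv
  · simp
  have hn : ‖v‖ ≠ 0 := norm_ne_zero_iff.2 hv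
  have := h1 (‖v‖⁻¹ • v) (by simp [norm_smul, hn])
  simp only [Matrix.mulVec_smul, dotProduct_smul, smul_dotProduct, smul_eq_mul] at this
  have h2 : c₀ * ‖v‖ ^ 2 ≤ (‖v‖⁻¹ * (‖v‖⁻¹ * (v ⬝ᵥ H.mulVec v))) * ‖v‖ ^ 2 :=
    mul_le_mul_of_nonneg_right this (by positivity)
  calc c₀ * ‖v‖ ^ 2 ≤ _ := h2
    _ = v ⬝ᵥ H.mulVec v := by field_simp

/-- A function whose gradient is `-2 G` with `G` close to `-H (η - η')`, and a zero of `G`. -/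
theorem lt_of_gradient_approx {q : ℕ} {H : Matrix (Fin q) (Fin q) ℝ} {c₀ ε₀ r : ℝ}
    (hH : ∀ v, c₀ * ‖v‖ ^ 2 ≤ v ⬝ᵥ H.mulVec v) (hε : q * ε₀ < c₀) {η₀ : Fin q → ℝ}
    {L : (Fin q → ℝ) → ℝ} {G : (Fin q → ℝ) → Fin q → ℝ} {L' : (Fin q → ℝ) → (Fin q → ℝ) →L[ℝ] ℝ}
    (hL : ∀ η ∈ Metric.ball η₀ r, HasFDerivAt L (L' η) η)
    (hL' : ∀ η ∈ Metric.ball η₀ r, ∀ v, L' η v = -2 * (G η ⬝ᵥ v))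
    (hG : ∀ η ∈ Metric.ball η₀ r, ∀ η' ∈ Metric.ball η₀ r,
      ‖G η - G η' + H.mulVec (η - η')‖ ≤ ε₀ * ‖η - η'‖)
    {η₁ η : Fin q → ℝ} (h1 : η₁ ∈ Metric.ball η₀ r) (hz : G η₁ = 0) (h : η ∈ Metric.ball η₀ r)
    (hne : η ≠ η₁) : L η₁ < L η := by
  set v := η - η₁ with hv
  have hv0 : 0 < ‖v‖ := norm_pos_iff.2 (sub_ne_zero.2 hne)
  have hseg : ∀ t ∈ Set.Icc (0 : ℝ) 1, η₁ + t • v ∈ Metric.ball η₀ r := fun t ht =>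
    (convex_ball η₀ r).add_smul_sub_mem h1 h ht
  have hd : ∀ t ∈ Set.Icc (0 : ℝ) 1,
      HasDerivAt (fun t : ℝ => L (η₁ + t • v)) (-2 * (G (η₁ + t • v) ⬝ᵥ v)) t := by
    intro t ht
    have h3 : HasDerivAt (fun t : ℝ => η₁ + t • v) v t := by
      simpa using ((hasDerivAt_id t).smul_const v).const_add η₁
    have := (hL _ (hseg t ht)).comp_hasDerivAt t h3
    rwa [hL' _ (hseg t ht)] at this
  -- By the mean value theorem the increment of `L` is `-2 G · v` at an interior point `η₁ + t v`.
  -- There `G` equals `-t H v` up to `ε₀ t ‖v‖`, so the increment is at least `2 t (c₀ - q ε₀)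
  -- ‖v‖²`. The factor `q` comes from bounding a dot product by sup norms.
  obtain ⟨t, ht, he⟩ := exists_hasDerivAt_eq_slope (fun t : ℝ => L (η₁ + t • v))
    (fun t => -2 * (G (η₁ + t • v) ⬝ᵥ v)) zero_lt_one
    (fun t ht => (hd t ht).continuousAt.continuousWithinAt)
    (fun t ht => hd t (Set.Ioo_subset_Icc_self ht))
  have e1 : η₁ + v = η := by simp [hv]
  simp only [one_smul, zero_smul, add_zero, sub_zero, div_one, e1] at he
  have hG1 := hG _ (hseg t (Set.Ioo_subset_Icc_self ht)) _ h1
  rw [hz, sub_zero, add_sub_cancel_left, Matrix.mulVec_smul, norm_smul, Real.norm_of_nonneg ht.1.le]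
    at hG1
  set R := G (η₁ + t • v) + t • H.mulVec v with hR
  have e2 : G (η₁ + t • v) = R - t • H.mulVec v := by simp [hR]
  rw [e2, sub_dotProduct, smul_dotProduct, smul_eq_mul, dotProduct_comm (H.mulVec v)] at he
  have h4 := abs_le.1 (abs_dotProduct_le R v)
  have h5 := hH v
  have h6 : (q : ℝ) * ‖R‖ * ‖v‖ ≤ q * (ε₀ * (t * ‖v‖)) * ‖v‖ := by gcongr
  have h7 : 0 < (c₀ - q * ε₀) * t * ‖v‖ ^ 2 := by
    have := ht.1
    have : 0 < c₀ - q * ε₀ := by linarith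
    positivity
  have h8 : t * (c₀ * ‖v‖ ^ 2) ≤ t * (v ⬝ᵥ H.mulVec v) := mul_le_mul_of_nonneg_left h5 ht.1.le
  nlinarith

/-- If `L'` has a local minimum where its gradient vanishes, the approximating matrix is positive
semidefinite. -/
theorem dotProduct_mulVec_nonneg_of_min {q : ℕ} {H : Matrix (Fin q) (Fin q) ℝ} {r : ℝ} (hr : 0 < r)
    {η₀ : Fin q → ℝ}
    {L : (Fin q → ℝ) → ℝ} {G : (Fin q → ℝ) → Fin q → ℝ} {L' : (Fin q → ℝ) → (Fin q → ℝ) →L[ℝ] ℝ}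
    (hL : ∀ η ∈ Metric.ball η₀ r, HasFDerivAt L (L' η) η)
    (hL' : ∀ η ∈ Metric.ball η₀ r, ∀ v, L' η v = -2 * (G η ⬝ᵥ v))
    (hG : ∀ ε > 0, ∃ ρ > 0, ∀ η ∈ Metric.ball η₀ ρ,
      ‖G η - G η₀ + H.mulVec (η - η₀)‖ ≤ ε * ‖η - η₀‖)
    (hz : G η₀ = 0) (hmin : ∀ η ∈ Metric.ball η₀ r, L η₀ ≤ L η) (v : Fin q → ℝ) :
    0 ≤ v ⬝ᵥ H.mulVec v := by
  -- It suffices to lose an arbitrary multiple of `‖v‖²`; the `+ 1` in the denominator covers `q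
  -- ‖v‖² = 0`.
  suffices h : ∀ ε > 0, -(q * ε * ‖v‖ ^ 2) ≤ v ⬝ᵥ H.mulVec v by
    refine le_of_forall_pos_le_add fun ε hε => ?_
    have h1 := h (ε / (q * ‖v‖ ^ 2 + 1)) (by positivity)
    have h2 : q * (ε / (q * ‖v‖ ^ 2 + 1)) * ‖v‖ ^ 2 ≤ ε := by
      rw [mul_div_assoc', div_mul_eq_mul_div, div_le_iff₀ (by positivity)]
      nlinarith
    linarith
  intro ε hε
  rcases eq_or_ne v 0 with rfl | hv
  · simp
  have hv0 : 0 < ‖v‖ := norm_pos_iff.2 hv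
  obtain ⟨ρ, hρ, hG⟩ := hG ε hε
  -- The direction `v` is rescaled to length `m`, so that the whole segment lies in both balls; the
  -- quadratic form scales back at the end.
  set m := min ρ r / 2 with hm
  have hm0 : 0 < m := by positivity
  set u := (m / ‖v‖) • v with hu
  have hun : ‖u‖ = m := by
    rw [hu, norm_smul, Real.norm_of_nonneg (by positivity)]
    field_simp
  have hmem : ∀ t ∈ Set.Icc (0 : ℝ) 1, η₀ + t • u ∈ Metric.ball η₀ (min ρ r) := by
    intro t ht
    rw [mem_ball_iff_norm, add_sub_cancel_left, norm_smul, Real.norm_of_nonneg ht.1, hun]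
    nlinarith [ht.1, ht.2, lt_min hρ hr]
  have hd : ∀ t ∈ Set.Icc (0 : ℝ) 1,
      HasDerivAt (fun t : ℝ => L (η₀ + t • u)) (-2 * (G (η₀ + t • u) ⬝ᵥ u)) t := by
    intro t ht
    have h3 : HasDerivAt (fun t : ℝ => η₀ + t • u) u t := by
      simpa using ((hasDerivAt_id t).smul_const u).const_add η₀
    have hb := Metric.ball_subset_ball (min_le_right ρ r) (hmem t ht)
    have := (hL _ hb).comp_hasDerivAt t h3
    rwa [hL' _ hb] at this
  obtain ⟨t, ht, he⟩ := exists_hasDerivAt_eq_slope (fun t : ℝ => L (η₀ + t • u))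
    (fun t => -2 * (G (η₀ + t • u) ⬝ᵥ u)) zero_lt_one
    (fun t ht => (hd t ht).continuousAt.continuousWithinAt)
    (fun t ht => hd t (Set.Ioo_subset_Icc_self ht))
  simp only [one_smul, zero_smul, add_zero, sub_zero, div_one] at he
  have h0 := hmin (η₀ + u) (by
    simpa using Metric.ball_subset_ball (min_le_right ρ r) (hmem 1 (by simp)))
  have hG1 := hG _ (Metric.ball_subset_ball (min_le_left ρ r)
    (hmem t (Set.Ioo_subset_Icc_self ht)))
  rw [hz, sub_zero, add_sub_cancel_left, Matrix.mulVec_smul, norm_smul, Real.norm_of_nonneg ht.1.le]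
    at hG1
  set R := G (η₀ + t • u) + t • H.mulVec u with hR
  have e2 : G (η₀ + t • u) = R - t • H.mulVec u := by simp [hR]
  rw [e2, sub_dotProduct, smul_dotProduct, smul_eq_mul, dotProduct_comm (H.mulVec u)] at he
  have h4 := abs_le.1 (abs_dotProduct_le R u)
  have h6 : (q : ℝ) * ‖R‖ * ‖u‖ ≤ q * (ε * (t * ‖u‖)) * ‖u‖ := by gcongr
  have h7 : 0 ≤ t * (u ⬝ᵥ H.mulVec u + q * ε * ‖u‖ ^ 2) := by nlinarith
  have h8 : 0 ≤ u ⬝ᵥ H.mulVec u + q * ε * ‖u‖ ^ 2 := nonneg_of_mul_nonneg_right h7 ht.1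
  have h9 : u ⬝ᵥ H.mulVec u = (m / ‖v‖) ^ 2 * (v ⬝ᵥ H.mulVec v) := by
    simp only [hu, Matrix.mulVec_smul, dotProduct_smul, smul_dotProduct, smul_eq_mul]
    ring
  have h10 : ‖u‖ ^ 2 = (m / ‖v‖) ^ 2 * ‖v‖ ^ 2 := by
    rw [hun]
    field_simp
  rw [h9, h10] at h8
  have h11 : 0 ≤ (m / ‖v‖) ^ 2 * (v ⬝ᵥ H.mulVec v + q * ε * ‖v‖ ^ 2) := by linarith
  have := nonneg_of_mul_nonneg_right h11 (by positivity)
  linarith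

/-- Existence and differentiability of zeros of a family of maps approximating `-H`. -/
theorem exists_zero_curve {q : ℕ} {H : Matrix (Fin q) (Fin q) ℝ} (hH : IsUnit H.det) :
    ∃ ε₁ > 0, ∀ ε₀ < ε₁, ∀ (r : ℝ), 0 < r → ∀ (η₀ d : Fin q → ℝ) (G : ℝ → (Fin q → ℝ) → Fin q → ℝ),
      (∀ᶠ θ in 𝓝 (0 : ℝ), ∀ η ∈ Metric.ball η₀ r, ∀ η' ∈ Metric.ball η₀ r,
        ‖G θ η - G θ η' + H.mulVec (η - η')‖ ≤ ε₀ * ‖η - η'‖) →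
      (∀ ε > 0, ∃ ρ > 0, ∀ᶠ θ in 𝓝 (0 : ℝ), ∀ η ∈ Metric.ball η₀ ρ,
        ‖G θ η - G θ η₀ + H.mulVec (η - η₀)‖ ≤ ε * ‖η - η₀‖) →
      G 0 η₀ = 0 → HasDerivAt (fun θ => G θ η₀) d 0 →
      ∃ η : ℝ → Fin q → ℝ, η 0 = η₀ ∧ (∀ᶠ θ in 𝓝 (0 : ℝ), η θ ∈ Metric.ball η₀ r ∧ G θ (η θ) = 0) ∧
        HasDerivAt η (H⁻¹.mulVec d) 0 := by
  set T : (Fin q → ℝ) →L[ℝ] (Fin q → ℝ) := LinearMap.toContinuousLinearMap (Matrix.toLin' H)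
  set S : (Fin q → ℝ) →L[ℝ] (Fin q → ℝ) := LinearMap.toContinuousLinearMap (Matrix.toLin' H⁻¹)
  have hT : ∀ v, T v = H.mulVec v := fun v => by simp [T]
  have hS : ∀ v, S v = H⁻¹.mulVec v := fun v => by simp [S]
  have hTS : ∀ v, T (S v) = v := fun v => by
    rw [hT, hS, Matrix.mulVec_mulVec, Matrix.mul_nonsing_inv _ hH, Matrix.one_mulVec]
  have hST : ∀ v, S (T v) = v := fun v => by
    rw [hT, hS, Matrix.mulVec_mulVec, Matrix.nonsing_inv_mul _ hH, Matrix.one_mulVec]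
  -- The `+ 1` keeps `K` positive when `q = 0`, where `S = 0`.
  set K : NNReal := ‖S‖₊ + 1 with hK
  have hK0 : (0 : ℝ) < K := by positivity
  let sy : (-T).NonlinearRightInverse :=
    { toFun := fun y => -S y
      nnnorm := K
      bound' := fun y => by
        rw [norm_neg]
        refine (S.le_opNorm y).trans ?_
        gcongr
        simp [hK]
      right_inv' := fun y => by simp [hTS] }
  -- With `ε₀` below half of `K⁻¹`, the image of a ball of radius `R` about `η₀` covers the ball of
  -- radius `K⁻¹ R / 2` about `G θ η₀`. Radius `2 K ‖G θ η₀‖` therefore reaches the value `0`.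
  refine ⟨(K : ℝ)⁻¹ / 2, by positivity, fun ε₀ hε₀ r hr η₀ d G hG hG' hz hd => ?_⟩
  have hlin : ∀ᶠ θ in 𝓝 (0 : ℝ), ApproximatesLinearOn (G θ) (-T) (Metric.ball η₀ r) ε₀.toNNReal := by
    filter_upwards [hG] with θ h η hη η' hη'
    have := h η hη η' hη'
    simp only [_root_.neg_apply, sub_neg_eq_add, hT]
    exact this.trans (mul_le_mul_of_nonneg_right (Real.le_coe_toNNReal _) (norm_nonneg _))
  have hsmall : ∀ᶠ θ in 𝓝 (0 : ℝ), 2 * K * ‖G θ η₀‖ < r := by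
    have h1 : Tendsto (fun θ => 2 * K * ‖G θ η₀‖) (𝓝 0) (𝓝 (2 * K * ‖G 0 η₀‖)) :=
      (hd.continuousAt.norm).const_mul _
    rw [hz, norm_zero, mul_zero] at h1
    exact h1.eventually_lt_const hr
  have hex : ∀ᶠ θ in 𝓝 (0 : ℝ), ∃ x ∈ Metric.closedBall η₀ (2 * K * ‖G θ η₀‖), G θ x = 0 := by
    filter_upwards [hlin, hsmall] with θ h1 h2
    have := h1.surjOn_closedBall_of_nonlinearRightInverse sy (ε := 2 * K * ‖G θ η₀‖) (b := η₀)
      (by positivity) (Metric.closedBall_subset_ball h2)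
    refine this ?_
    rw [mem_closedBall_iff_norm, zero_sub, norm_neg]
    have h3 : ((K : ℝ)⁻¹ / 2) ≤ (K : ℝ)⁻¹ - ε₀.toNNReal := by
      have : (ε₀.toNNReal : ℝ) ≤ (K : ℝ)⁻¹ / 2 := by
        rw [Real.coe_toNNReal']
        exact max_le hε₀.le (by positivity)
      linarith
    calc ‖G θ η₀‖ = ((K : ℝ)⁻¹ / 2) * (2 * K * ‖G θ η₀‖) := by field_simp
      _ ≤ _ := by gcongr
  classical
  set η : ℝ → Fin q → ℝ := fun θ =>
    if h : ∃ x ∈ Metric.closedBall η₀ (2 * K * ‖G θ η₀‖), G θ x = 0 then h.choose else η₀ with hη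
  have hηs : ∀ᶠ θ in 𝓝 (0 : ℝ), ‖η θ - η₀‖ ≤ 2 * K * ‖G θ η₀‖ ∧ G θ (η θ) = 0 := by
    filter_upwards [hex] with θ h
    simp only [hη, dif_pos h]
    exact ⟨mem_closedBall_iff_norm.1 h.choose_spec.1, h.choose_spec.2⟩
  -- At `θ = 0` the search radius is zero, which forces the chosen zero to be `η₀`.
  have h0 : η 0 = η₀ := by
    have := hηs.self_of_nhds.1
    rw [hz, norm_zero, mul_zero] at this
    exact sub_eq_zero.1 (norm_le_zero_iff.1 this)
  refine ⟨η, h0, ?_, ?_⟩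
  · filter_upwards [hηs, hsmall] with θ h1 h2
    exact ⟨mem_ball_iff_norm.2 (h1.1.trans_lt h2), h1.2⟩
  have hGO : (fun θ => G θ η₀) =O[𝓝 0] fun θ : ℝ => θ := by
    have := hd.isBigO_sub
    simpa [hz] using this
  have hηO : (fun θ => η θ - η₀) =O[𝓝 0] fun θ : ℝ => θ := by
    refine Asymptotics.IsBigO.trans ?_ hGO
    exact Asymptotics.IsBigO.of_bound (2 * K) (hηs.mono fun θ h => h.1)
  have hηt : Tendsto η (𝓝 0) (𝓝 η₀) := by
    rw [tendsto_iff_norm_sub_tendsto_zero, ← tendsto_zero_iff_norm_tendsto_zero]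
    exact hηO.trans_tendsto tendsto_id
  -- The linearization error is `o(‖η θ - η₀‖)`, and `η θ - η₀ = O(θ)` because the search radius is
  -- `O(θ)`.
  have hR : (fun θ => G θ (η θ) - G θ η₀ + T (η θ - η₀)) =o[𝓝 0] fun θ : ℝ => θ := by
    refine Asymptotics.IsLittleO.trans_isBigO (Asymptotics.IsLittleO.of_bound ?_) hηO
    intro ε hε
    obtain ⟨ρ, hρ, h⟩ := hG' ε hε
    filter_upwards [h, hηt (Metric.ball_mem_nhds η₀ hρ)] with θ h1 h2
    rw [hT]
    exact h1 _ h2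
  have hd' : (fun θ => G θ η₀ - θ • d) =o[𝓝 0] fun θ : ℝ => θ := by
    have := hasDerivAt_iff_isLittleO.1 hd
    simpa [hz] using this
  rw [hasDerivAt_iff_isLittleO]
  have h5 := (S.isBigO_comp (fun θ => (G θ (η θ) - G θ η₀ + T (η θ - η₀)) + (G θ η₀ - θ • d))
    (𝓝 0)).trans_isLittleO (hR.add hd')
  -- Since `G θ (η θ) = 0`, applying `S = H⁻¹` to the two `o(θ)` remainders leaves exactly the
  -- remainder of `η`.
  have h6 : (fun θ : ℝ => η θ - η 0 - (θ - 0) • H⁻¹.mulVec d) =ᶠ[𝓝 0]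
      fun θ => S ((G θ (η θ) - G θ η₀ + T (η θ - η₀)) + (G θ η₀ - θ • d)) := by
    filter_upwards [hηs] with θ h
    rw [h.2, zero_sub, neg_add_eq_sub, sub_add_sub_cancel, map_sub, hST, map_smul, hS, h0, sub_zero]
  simpa using h6.trans_isLittleO h5

section

/-! ### Differentiating integrals over a parameter in `ℝ^q` -/

/-- The `i`-th partial derivative. -/
def pd {q : ℕ} (g : (Fin q → ℝ) → ℝ) (η : Fin q → ℝ) (i : Fin q) : ℝ :=
  fderiv ℝ g η (Pi.single i 1)

theorem clm_apply_eq_sum {q : ℕ} (T : (Fin q → ℝ) →L[ℝ] ℝ) (v : Fin q → ℝ) :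
    T v = ∑ i, v i * T (Pi.single i 1) := by
  conv_lhs => rw [pi_eq_sum_univ' v]
  rw [map_sum]
  refine Finset.sum_congr rfl fun i _ => ?_
  rw [map_smul, smul_eq_mul]

theorem clm_norm_le {q : ℕ} (T : (Fin q → ℝ) →L[ℝ] ℝ) {C : ℝ} (hC : 0 ≤ C)
    (h : ∀ i, |T (Pi.single i 1)| ≤ C) : ‖T‖ ≤ q * C := by
  refine T.opNorm_le_bound (by positivity) fun v => ?_
  rw [clm_apply_eq_sum]
  calc ‖∑ i, v i * T (Pi.single i 1)‖ ≤ ∑ i : Fin q, ‖v i * T (Pi.single i 1)‖ := norm_sum_le _ _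
    _ ≤ ∑ _i : Fin q, ‖v‖ * C := by
        refine Finset.sum_le_sum fun i _ => ?_
        rw [norm_mul]
        exact mul_le_mul (norm_le_pi_norm v i) (h i) (norm_nonneg _) (norm_nonneg _)
    _ = q * C * ‖v‖ := by simp; ring

theorem clm_eq_sum_proj {q : ℕ} (T : (Fin q → ℝ) →L[ℝ] ℝ) :
    T = ∑ i, T (Pi.single i 1) • (ContinuousLinearMap.proj i : (Fin q → ℝ) →L[ℝ] ℝ) := by
  ext v
  rw [clm_apply_eq_sum]
  simp [mul_comm]

variable {Ω : Type*} [MeasurableSpace Ω]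

/-- Measurability of `f` is known only for each fixed `η`, so the derivative is obtained as a limit
of difference quotients. -/
theorem measurable_pd {q : ℕ} {f : Ω → (Fin q → ℝ) → ℝ} (hf : ∀ η, Measurable fun ω => f ω η)
    (hd : ∀ ω, Differentiable ℝ (f ω)) (η : Fin q → ℝ) (i : Fin q) :
    Measurable fun ω => pd (f ω) η i := by
  refine measurable_of_tendsto_metrizable (f := fun (n : ℕ) ω =>
    (n : ℝ) • (f ω (η + (n : ℝ)⁻¹ • Pi.single i 1) - f ω η)) (fun n => ?_) ?_
  · exact ((hf _).sub (hf _)).const_mul (n : ℝ)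
  · rw [tendsto_pi_nhds]
    intro ω
    exact ((hd ω η).hasFDerivAt.lim_real (Pi.single i 1)).comp tendsto_natCast_atTop_atTop

/-- Differentiation under the integral sign with all hypotheses on partial derivatives, since
measurability and bounds are available only coordinatewise. The Fréchet derivative is reassembled
from its coordinates at the cost of a factor `q`. -/
theorem hasFDerivAt_integral_pd {q : ℕ} {τ : Measure Ω} {h : Ω → (Fin q → ℝ) → ℝ} {bound : Ω → ℝ}
    {s : Set (Fin q → ℝ)} (hs : IsOpen s)
    (hm : ∀ η, AEMeasurable (fun ω => h ω η) τ) (hd : ∀ ω, Differentiable ℝ (h ω))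
    (hint : ∀ η ∈ s, Integrable (fun ω => h ω η) τ)
    (hpm : ∀ η i, AEMeasurable (fun ω => pd (h ω) η i) τ)
    (hb : ∀ᵐ ω ∂τ, ∀ η ∈ s, ∀ i, |pd (h ω) η i| ≤ bound ω) (hbi : Integrable bound τ)
    {η : Fin q → ℝ} (hη : η ∈ s) :
    ∃ T : (Fin q → ℝ) →L[ℝ] ℝ, HasFDerivAt (fun η => ∫ ω, h ω η ∂τ) T η ∧
      ∀ i, T (Pi.single i 1) = ∫ ω, pd (h ω) η i ∂τ := by
  have hF'm : AEStronglyMeasurable (fun ω => fderiv ℝ (h ω) η) τ := by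
    have : (fun ω => fderiv ℝ (h ω) η) = fun ω => ∑ i, pd (h ω) η i •
        (ContinuousLinearMap.proj i : (Fin q → ℝ) →L[ℝ] ℝ) := by
      ext1 ω
      exact clm_eq_sum_proj _
    rw [this]
    refine Finset.aestronglyMeasurable_fun_sum _ fun i _ => ?_
    exact (hpm η i).aestronglyMeasurable.smul_const _
  have hbn : ∀ᵐ ω ∂τ, ∀ η ∈ s, ‖fderiv ℝ (h ω) η‖ ≤ q * |bound ω| := by
    filter_upwards [hb] with ω hω η hη
    exact clm_norm_le _ (abs_nonneg _) fun i => (hω η hη i).trans (le_abs_self _)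
  have hbi' : Integrable (fun ω => (q : ℝ) * |bound ω|) τ := hbi.abs.const_mul _
  have key := hasFDerivAt_integral_of_dominated_of_fderiv_le (hs.mem_nhds hη)
    (Eventually.of_forall fun η => (hm η).aestronglyMeasurable) (hint η hη) hF'm hbn hbi'
    (Eventually.of_forall fun ω η _ => (hd ω η).hasFDerivAt)
  refine ⟨_, key, fun i => ?_⟩
  rw [ContinuousLinearMap.integral_apply]
  · rfl
  · exact Integrable.mono' hbi' hF'm (hbn.mono fun ω h => h η hη)

/-! ### The working model and the perturbed weights -/

/-- A working model `f` with weights `r₀` and regression function `m₀` over a measure space. -/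
structure IsBase {q : ℕ} (τ : Measure Ω) (f : Ω → (Fin q → ℝ) → ℝ) (A b m₀ r₀ : Ω → ℝ)
    (η₀ : Fin q → ℝ) (δ : ℝ) : Prop where
  pos : 0 < δ
  measurable_f : ∀ η, Measurable fun ω => f ω η
  contDiff : ∀ ω, ContDiff ℝ 2 (f ω)
  bound_f : ∀ ω, ∀ η ∈ Metric.ball η₀ δ, |f ω η| ≤ b ω
  bound_pd : ∀ ω, ∀ η ∈ Metric.ball η₀ δ, ∀ i, |pd (f ω) η i| ≤ b ω
  bound_pd2 : ∀ ω, ∀ η ∈ Metric.ball η₀ δ, ∀ i j, |pd (fun η' => pd (f ω) η' j) η i| ≤ b ω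
  A_nonneg : ∀ ω, 0 ≤ A ω
  moment : Integrable (fun ω => (A ω + b ω) ^ 2) τ
  measurable_m : AEMeasurable m₀ τ
  measurable_r : AEMeasurable r₀ τ
  bound_m : ∀ᵐ ω ∂τ, |m₀ ω| ≤ A ω
  r_nonneg : ∀ᵐ ω ∂τ, 0 ≤ r₀ ω
  r_le : ∀ᵐ ω ∂τ, r₀ ω ≤ 1

/-- A path through `(m₀, r₀)`, Lipschitz and differentiable at `θ = 0`. -/
structure IsPath (τ : Measure Ω) (A m₀ r₀ : Ω → ℝ) (m r : ℝ → Ω → ℝ) (m' r' : Ω → ℝ) (K ε : ℝ) :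
    Prop where
  pos : 0 < ε
  K_nonneg : 0 ≤ K
  small : K * ε ≤ 1
  measurable_m : ∀ θ, |θ| < ε → AEMeasurable (m θ) τ
  measurable_r : ∀ θ, |θ| < ε → AEMeasurable (r θ) τ
  measurable_m' : AEMeasurable m' τ
  measurable_r' : AEMeasurable r' τ
  zero_m : m 0 = m₀
  zero_r : r 0 = r₀
  r_nonneg : ∀ᵐ ω ∂τ, ∀ θ, |θ| < ε → 0 ≤ r θ ω
  lip_m : ∀ᵐ ω ∂τ, ∀ θ, |θ| < ε → |m θ ω - m₀ ω| ≤ K * |θ| * A ω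
  lip_r : ∀ᵐ ω ∂τ, ∀ θ, |θ| < ε → |r θ ω - r₀ ω| ≤ K * |θ|
  deriv_m : ∀ᵐ ω ∂τ, HasDerivAt (fun θ => m θ ω) (m' ω) 0
  deriv_r : ∀ᵐ ω ∂τ, HasDerivAt (fun θ => r θ ω) (r' ω) 0

/-- The gradient, up to the factor `-2`, of the least squares criterion. -/
def lsGrad {q : ℕ} (τ : Measure Ω) (f : Ω → (Fin q → ℝ) → ℝ) (m r : Ω → ℝ) (η : Fin q → ℝ) :
    Fin q → ℝ :=
  fun i => ∫ ω, pd (f ω) η i * (m ω - f ω η) * r ω ∂τ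

/-- Half the Hessian of the least squares criterion. -/
def lsHess {q : ℕ} (τ : Measure Ω) (f : Ω → (Fin q → ℝ) → ℝ) (m r : Ω → ℝ) (η : Fin q → ℝ) :
    Matrix (Fin q) (Fin q) ℝ :=
  Matrix.of fun i j => ∫ ω, (pd (f ω) η i * pd (f ω) η j
    - (m ω - f ω η) * pd (fun η' => pd (f ω) η' j) η i) * r ω ∂τ

/-- The least squares criterion. -/
def lsLoss {q : ℕ} (τ : Measure Ω) (f : Ω → (Fin q → ℝ) → ℝ) (m r : Ω → ℝ) (η : Fin q → ℝ) : ℝ≥0∞ :=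
  ∫⁻ ω, ENNReal.ofReal ((m ω - f ω η) ^ 2 * r ω) ∂τ

section Base

variable {q : ℕ} {τ : Measure Ω} {f : Ω → (Fin q → ℝ) → ℝ} {A b m₀ r₀ : Ω → ℝ} {η₀ : Fin q → ℝ}
  {δ : ℝ}

theorem differentiable_pd {g : (Fin q → ℝ) → ℝ} (hg : ContDiff ℝ 2 g) (i : Fin q) :
    Differentiable ℝ fun η => pd g η i := by
  have : ContDiff ℝ 1 (fderiv ℝ g) := hg.fderiv_right (by norm_num)
  exact (this.differentiable (by norm_num)).clm_apply (differentiable_const _)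

theorem continuous_pd {g : (Fin q → ℝ) → ℝ} (hg : ContDiff ℝ 1 g) (i : Fin q) :
    Continuous fun η => pd g η i :=
  (hg.continuous_fderiv (by norm_num)).clm_apply continuous_const

theorem contDiff_pd {g : (Fin q → ℝ) → ℝ} (hg : ContDiff ℝ 2 g) (i : Fin q) :
    ContDiff ℝ 1 fun η => pd g η i :=
  (hg.fderiv_right (m := 1) (by norm_num)).clm_apply contDiff_const

theorem pd_pd_symm {g : (Fin q → ℝ) → ℝ} (hg : ContDiff ℝ 2 g) (η : Fin q → ℝ) (i j : Fin q) :
    pd (fun η' => pd g η' j) η i = pd (fun η' => pd g η' i) η j := by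
  have hs : IsSymmSndFDerivAt ℝ g η := hg.contDiffAt.isSymmSndFDerivAt (by simp)
  have hd : DifferentiableAt ℝ (fderiv ℝ g) η :=
    (hg.fderiv_right (m := 1) (by norm_num)).differentiable (by norm_num) η
  have h : ∀ k l : Fin q, pd (fun η' => pd g η' l) η k =
      fderiv ℝ (fderiv ℝ g) η (Pi.single k 1) (Pi.single l 1) := by
    intro k l
    unfold pd
    rw [fderiv_clm_apply hd (differentiableAt_const _)]
    simp
  rw [h, h]
  exact hs _ _

namespace IsBase

variable (hB : IsBase τ f A b m₀ r₀ η₀ δ)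
include hB

theorem b_nonneg (ω : Ω) : 0 ≤ b ω :=
  (abs_nonneg _).trans (hB.bound_f ω η₀ (Metric.mem_ball_self hB.pos))

theorem differentiable (ω : Ω) : Differentiable ℝ (f ω) := (hB.contDiff ω).differentiable (by norm_num)

theorem measurable_pd (η : Fin q → ℝ) (i : Fin q) : Measurable fun ω => pd (f ω) η i :=
  PCE.measurable_pd hB.measurable_f hB.differentiable η i

theorem measurable_pd2 (η : Fin q → ℝ) (i j : Fin q) :
    Measurable fun ω => pd (fun η' => pd (f ω) η' j) η i :=
  PCE.measurable_pd (f := fun ω η' => pd (f ω) η' j) (fun η => hB.measurable_pd η j)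
    (fun ω => differentiable_pd (hB.contDiff ω) j) η i

/-- The constant path makes every estimate along a path available at the base point. -/
theorem isPath_const : IsPath τ A m₀ r₀ (fun _ => m₀) (fun _ => r₀) 0 0 0 1 where
  pos := one_pos
  K_nonneg := le_rfl
  small := by simp
  measurable_m _ _ := hB.measurable_m
  measurable_r _ _ := hB.measurable_r
  measurable_m' := aemeasurable_const
  measurable_r' := aemeasurable_const
  zero_m := rfl
  zero_r := rfl
  r_nonneg := hB.r_nonneg.mono fun _ h _ _ => h
  lip_m := by simp
  lip_r := by simp
  deriv_m := Eventually.of_forall fun _ => hasDerivAt_const _ _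
  deriv_r := Eventually.of_forall fun _ => hasDerivAt_const _ _

end IsBase

/-! ### Bounds and Lipschitz estimates of the integrands along a path -/

namespace IsPath

variable {m r : ℝ → Ω → ℝ} {m' r' : Ω → ℝ} {K ε : ℝ}
  (hP : IsPath τ A m₀ r₀ m r m' r' K ε) (hB : IsBase τ f A b m₀ r₀ η₀ δ)
include hP

theorem K_mul_le {θ : ℝ} (hθ : |θ| < ε) : K * |θ| ≤ 1 :=
  (mul_le_mul_of_nonneg_left hθ.le hP.K_nonneg).trans hP.small

include hB

theorem bound_m : ∀ᵐ ω ∂τ, ∀ θ, |θ| < ε → |m θ ω| ≤ 2 * A ω := by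
  filter_upwards [hP.lip_m, hB.bound_m] with ω h1 h2 θ hθ
  have h3 := h1 θ hθ
  have h4 := mul_le_mul_of_nonneg_right (hP.K_mul_le hθ) (hB.A_nonneg ω)
  have := abs_sub_abs_le_abs_sub (m θ ω) (m₀ ω)
  linarith

theorem bound_r : ∀ᵐ ω ∂τ, ∀ θ, |θ| < ε → |r θ ω| ≤ 2 := by
  filter_upwards [hP.lip_r, hB.r_nonneg, hB.r_le] with ω h1 h2 h3 θ hθ
  have h4 := h1 θ hθ
  have h5 := hP.K_mul_le hθ
  have := abs_sub_abs_le_abs_sub (r θ ω) (r₀ ω)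
  rw [abs_of_nonneg h2] at this
  linarith

/-- The bound of the criterion. -/
theorem bound_loss : ∀ᵐ ω ∂τ, ∀ θ, |θ| < ε → ∀ x, |x| ≤ b ω →
    |(m θ ω - x) ^ 2 * r θ ω| ≤ 8 * (A ω + b ω) ^ 2 := by
  filter_upwards [hP.bound_m hB, hP.bound_r hB] with ω h1 h2 θ hθ x hx
  have hA := hB.A_nonneg ω
  have hb := hB.b_nonneg ω
  have h3 : |m θ ω - x| ≤ 2 * (A ω + b ω) := by
    have := abs_sub (m θ ω) x
    have := h1 θ hθ
    linarith
  rw [abs_mul, abs_pow]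
  calc |m θ ω - x| ^ 2 * |r θ ω| ≤ (2 * (A ω + b ω)) ^ 2 * 2 := by gcongr; exact h2 θ hθ
    _ = _ := by ring

/-- The reals `x` and `y` stand for values of `f` and of its partial derivatives. Quantifying over
them inside makes the exceptional null set independent of `η` and `θ`, as differentiation under the
integral requires. -/
theorem bound_grad : ∀ᵐ ω ∂τ, ∀ θ, |θ| < ε → ∀ x y, |x| ≤ b ω → |y| ≤ b ω →
    |y * (m θ ω - x) * r θ ω| ≤ 4 * (A ω + b ω) ^ 2 := by
  filter_upwards [hP.bound_m hB, hP.bound_r hB] with ω h1 h2 θ hθ x y hx hy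
  have hA := hB.A_nonneg ω
  have hb := hB.b_nonneg ω
  have h3 : |m θ ω - x| ≤ 2 * (A ω + b ω) := by
    have := abs_sub (m θ ω) x
    have := h1 θ hθ
    linarith
  rw [abs_mul, abs_mul]
  calc |y| * |m θ ω - x| * |r θ ω| ≤ (A ω + b ω) * (2 * (A ω + b ω)) * 2 := by
        gcongr
        · linarith
        · exact h2 θ hθ
    _ = _ := by ring

theorem bound_hess : ∀ᵐ ω ∂τ, ∀ θ, |θ| < ε → ∀ x y y' z, |x| ≤ b ω → |y| ≤ b ω → |y'| ≤ b ω →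
    |z| ≤ b ω → |(y * y' - (m θ ω - x) * z) * r θ ω| ≤ 6 * (A ω + b ω) ^ 2 := by
  filter_upwards [hP.bound_m hB, hP.bound_r hB] with ω h1 h2 θ hθ x y y' z hx hy hy' hz
  have hA := hB.A_nonneg ω
  have hb := hB.b_nonneg ω
  have h3 : |m θ ω - x| ≤ 2 * (A ω + b ω) := by
    have := abs_sub (m θ ω) x
    have := h1 θ hθ
    linarith
  have h4 : |y * y' - (m θ ω - x) * z| ≤ 3 * (A ω + b ω) ^ 2 := by
    calc |y * y' - (m θ ω - x) * z| ≤ |y * y'| + |(m θ ω - x) * z| := abs_sub _ _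
      _ ≤ (A ω + b ω) * (A ω + b ω) + (2 * (A ω + b ω)) * (A ω + b ω) := by
        rw [abs_mul, abs_mul]
        gcongr <;> linarith
      _ = _ := by ring
  rw [abs_mul]
  calc |y * y' - (m θ ω - x) * z| * |r θ ω| ≤ (3 * (A ω + b ω) ^ 2) * 2 := by
        gcongr
        exact h2 θ hθ
    _ = _ := by ring

/-- The difference is telescoped into a change of `m` and a change of `r`, each of relative size `K
|θ|`; likewise for the gradient and the Hessian. -/
theorem lip_loss : ∀ᵐ ω ∂τ, ∀ θ, |θ| < ε → ∀ x, |x| ≤ b ω →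
    |(m θ ω - x) ^ 2 * r θ ω - (m₀ ω - x) ^ 2 * r₀ ω| ≤ 7 * K * |θ| * (A ω + b ω) ^ 2 := by
  filter_upwards [hP.bound_m hB, hP.bound_r hB, hP.lip_m, hP.lip_r, hB.bound_m] with
    ω h1 h2 h3 h4 h5 θ hθ x hx
  have hA := hB.A_nonneg ω
  have hb := hB.b_nonneg ω
  have hK := hP.K_nonneg
  have h6 : |m₀ ω - x| ≤ A ω + b ω := by
    have := abs_sub (m₀ ω) x
    linarith
  have h7 : |m θ ω + m₀ ω - 2 * x| ≤ 3 * (A ω + b ω) := by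
    have e1 := abs_sub (m θ ω + m₀ ω) (2 * x)
    have e2 := abs_add_le (m θ ω) (m₀ ω)
    have := h1 θ hθ
    rw [abs_mul, abs_two] at e1
    linarith
  have e : (m θ ω - x) ^ 2 * r θ ω - (m₀ ω - x) ^ 2 * r₀ ω =
      (m θ ω - m₀ ω) * (m θ ω + m₀ ω - 2 * x) * r θ ω + (m₀ ω - x) ^ 2 * (r θ ω - r₀ ω) := by ring
  rw [e]
  calc _ ≤ |(m θ ω - m₀ ω) * (m θ ω + m₀ ω - 2 * x) * r θ ω| + |(m₀ ω - x) ^ 2 * (r θ ω - r₀ ω)| :=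
        abs_add_le _ _
    _ ≤ (K * |θ| * (A ω + b ω)) * (3 * (A ω + b ω)) * 2 + (A ω + b ω) ^ 2 * (K * |θ|) := by
        rw [abs_mul, abs_mul, abs_mul, abs_pow]
        have := h3 θ hθ
        have h8 : K * |θ| * A ω ≤ K * |θ| * (A ω + b ω) := by gcongr; linarith
        gcongr
        · linarith
        · exact h2 θ hθ
        · exact h4 θ hθ
    _ = _ := by ring

theorem lip_grad : ∀ᵐ ω ∂τ, ∀ θ, |θ| < ε → ∀ x y, |x| ≤ b ω → |y| ≤ b ω →
    |y * (m θ ω - x) * r θ ω - y * (m₀ ω - x) * r₀ ω| ≤ 3 * K * |θ| * (A ω + b ω) ^ 2 := by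
  filter_upwards [hP.bound_r hB, hP.lip_m, hP.lip_r, hB.bound_m] with ω h2 h3 h4 h5 θ hθ x y hx hy
  have hA := hB.A_nonneg ω
  have hb := hB.b_nonneg ω
  have hK := hP.K_nonneg
  have h6 : |m₀ ω - x| ≤ A ω + b ω := by
    have := abs_sub (m₀ ω) x
    linarith
  have e : y * (m θ ω - x) * r θ ω - y * (m₀ ω - x) * r₀ ω =
      y * (m θ ω - m₀ ω) * r θ ω + y * (m₀ ω - x) * (r θ ω - r₀ ω) := by ring
  rw [e]
  calc _ ≤ |y * (m θ ω - m₀ ω) * r θ ω| + |y * (m₀ ω - x) * (r θ ω - r₀ ω)| := abs_add_le _ _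
    _ ≤ (A ω + b ω) * (K * |θ| * (A ω + b ω)) * 2 + (A ω + b ω) * (A ω + b ω) * (K * |θ|) := by
        rw [abs_mul, abs_mul, abs_mul, abs_mul]
        have := h3 θ hθ
        have h8 : K * |θ| * A ω ≤ K * |θ| * (A ω + b ω) := by gcongr; linarith
        gcongr
        · linarith
        · linarith
        · exact h2 θ hθ
        · linarith
        · exact h4 θ hθ
    _ = _ := by ring

theorem lip_hess : ∀ᵐ ω ∂τ, ∀ θ, |θ| < ε → ∀ x y y' z, |x| ≤ b ω → |y| ≤ b ω → |y'| ≤ b ω →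
    |z| ≤ b ω → |(y * y' - (m θ ω - x) * z) * r θ ω - (y * y' - (m₀ ω - x) * z) * r₀ ω| ≤
      4 * K * |θ| * (A ω + b ω) ^ 2 := by
  filter_upwards [hP.bound_r hB, hP.lip_m, hP.lip_r, hB.bound_m] with
    ω h2 h3 h4 h5 θ hθ x y y' z hx hy hy' hz
  have hA := hB.A_nonneg ω
  have hb := hB.b_nonneg ω
  have hK := hP.K_nonneg
  have h6 : |m₀ ω - x| ≤ A ω + b ω := by
    have := abs_sub (m₀ ω) x
    linarith
  have h7 : |y * y' - (m₀ ω - x) * z| ≤ 2 * (A ω + b ω) ^ 2 := by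
    calc |y * y' - (m₀ ω - x) * z| ≤ |y * y'| + |(m₀ ω - x) * z| := abs_sub _ _
      _ ≤ (A ω + b ω) * (A ω + b ω) + (A ω + b ω) * (A ω + b ω) := by
        rw [abs_mul, abs_mul]
        gcongr <;> linarith
      _ = _ := by ring
  have e : (y * y' - (m θ ω - x) * z) * r θ ω - (y * y' - (m₀ ω - x) * z) * r₀ ω =
      (y * y' - (m₀ ω - x) * z) * (r θ ω - r₀ ω) - (m θ ω - m₀ ω) * z * r θ ω := by ring
  rw [e]
  calc _ ≤ |(y * y' - (m₀ ω - x) * z) * (r θ ω - r₀ ω)| + |(m θ ω - m₀ ω) * z * r θ ω| := abs_sub _ _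
    _ ≤ (2 * (A ω + b ω) ^ 2) * (K * |θ|) + (K * |θ| * (A ω + b ω)) * (A ω + b ω) * 2 := by
        rw [abs_mul, abs_mul, abs_mul]
        have := h3 θ hθ
        have h8 : K * |θ| * A ω ≤ K * |θ| * (A ω + b ω) := by gcongr; linarith
        gcongr
        · exact h4 θ hθ
        · linarith
        · linarith
        · exact h2 θ hθ
    _ = _ := by ring

end IsPath

end Base

end

section

/-! ### Derivatives of the least squares criterion and of its gradient -/

section Smooth

variable {q : ℕ}

theorem pd_sq {g : (Fin q → ℝ) → ℝ} (hg : Differentiable ℝ g) (m r : ℝ) (η : Fin q → ℝ) (i : Fin q) :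
    pd (fun η => (m - g η) ^ 2 * r) η i = -2 * (pd g η i * (m - g η) * r) := by
  have h := (((hasFDerivAt_const m η).sub (hg η).hasFDerivAt).pow 2).mul_const r
  unfold pd
  rw [HasFDerivAt.fderiv (f := fun η => (m - g η) ^ 2 * r) h]
  simp
  ring

/-- Symmetry of the second derivative is used to match the order of the indices in `lsHess`. -/
theorem pd_grad {g : (Fin q → ℝ) → ℝ} (hg : ContDiff ℝ 2 g) (m r : ℝ) (η : Fin q → ℝ) (i j : Fin q) :
    pd (fun η => pd g η i * (m - g η) * r) η j =
      -((pd g η i * pd g η j - (m - g η) * pd (fun η' => pd g η' j) η i) * r) := by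
  have hd : Differentiable ℝ g := hg.differentiable (by norm_num)
  have h := ((differentiable_pd hg i η).hasFDerivAt.mul
    ((hasFDerivAt_const m η).sub (hd η).hasFDerivAt)).mul_const r
  rw [pd_pd_symm hg η i j]
  conv_lhs => unfold pd
  rw [HasFDerivAt.fderiv (f := fun η => fderiv ℝ g η (Pi.single i 1) * (m - g η) * r) h]
  unfold pd
  simp
  ring

end Smooth

variable {Ω : Type*} [MeasurableSpace Ω]
variable {q : ℕ} {τ : Measure Ω} {f : Ω → (Fin q → ℝ) → ℝ} {A b m₀ r₀ : Ω → ℝ} {η₀ : Fin q → ℝ}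
  {δ : ℝ}

namespace IsPath

variable {m r : ℝ → Ω → ℝ} {m' r' : Ω → ℝ} {K ε : ℝ}
  (hP : IsPath τ A m₀ r₀ m r m' r' K ε) (hB : IsBase τ f A b m₀ r₀ η₀ δ)
include hP hB

theorem aemeasurable_loss {θ : ℝ} (hθ : |θ| < ε) (η : Fin q → ℝ) :
    AEMeasurable (fun ω => (m θ ω - f ω η) ^ 2 * r θ ω) τ :=
  (((hP.measurable_m θ hθ).sub (hB.measurable_f η).aemeasurable).pow_const 2).mul
    (hP.measurable_r θ hθ)

theorem aemeasurable_grad {θ : ℝ} (hθ : |θ| < ε) (η : Fin q → ℝ) (i : Fin q) :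
    AEMeasurable (fun ω => pd (f ω) η i * (m θ ω - f ω η) * r θ ω) τ :=
  ((hB.measurable_pd η i).aemeasurable.mul
    ((hP.measurable_m θ hθ).sub (hB.measurable_f η).aemeasurable)).mul (hP.measurable_r θ hθ)

theorem aemeasurable_hess {θ : ℝ} (hθ : |θ| < ε) (η : Fin q → ℝ) (i j : Fin q) :
    AEMeasurable (fun ω => (pd (f ω) η i * pd (f ω) η j
      - (m θ ω - f ω η) * pd (fun η' => pd (f ω) η' j) η i) * r θ ω) τ :=
  (((hB.measurable_pd η i).mul (hB.measurable_pd η j)).aemeasurable.sub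
    (((hP.measurable_m θ hθ).sub (hB.measurable_f η).aemeasurable).mul
      (hB.measurable_pd2 η i j).aemeasurable)).mul (hP.measurable_r θ hθ)

theorem integrable_loss_of_le {θ : ℝ} (hθ : |θ| < ε) {η : Fin q → ℝ} (hη : ∀ ω, |f ω η| ≤ b ω) :
    Integrable (fun ω => (m θ ω - f ω η) ^ 2 * r θ ω) τ :=
  Integrable.mono' (hB.moment.const_mul 8) (hP.aemeasurable_loss hB hθ η).aestronglyMeasurable
    ((hP.bound_loss hB).mono fun ω h => h θ hθ _ (hη ω))

theorem integrable_loss {θ : ℝ} (hθ : |θ| < ε) {η : Fin q → ℝ} (hη : η ∈ Metric.ball η₀ δ) :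
    Integrable (fun ω => (m θ ω - f ω η) ^ 2 * r θ ω) τ :=
  hP.integrable_loss_of_le hB hθ fun ω => hB.bound_f ω η hη

theorem integrable_grad {θ : ℝ} (hθ : |θ| < ε) {η : Fin q → ℝ} (hη : η ∈ Metric.ball η₀ δ)
    (i : Fin q) : Integrable (fun ω => pd (f ω) η i * (m θ ω - f ω η) * r θ ω) τ :=
  Integrable.mono' (hB.moment.const_mul 4) (hP.aemeasurable_grad hB hθ η i).aestronglyMeasurable
    ((hP.bound_grad hB).mono fun ω h => h θ hθ _ _ (hB.bound_f ω η hη) (hB.bound_pd ω η hη i))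

theorem integrable_hess {θ : ℝ} (hθ : |θ| < ε) {η : Fin q → ℝ} (hη : η ∈ Metric.ball η₀ δ)
    (i j : Fin q) : Integrable (fun ω => (pd (f ω) η i * pd (f ω) η j
      - (m θ ω - f ω η) * pd (fun η' => pd (f ω) η' j) η i) * r θ ω) τ :=
  Integrable.mono' (hB.moment.const_mul 6) (hP.aemeasurable_hess hB hθ η i j).aestronglyMeasurable
    ((hP.bound_hess hB).mono fun ω h => h θ hθ _ _ _ _ (hB.bound_f ω η hη) (hB.bound_pd ω η hη i)
      (hB.bound_pd ω η hη j) (hB.bound_pd2 ω η hη i j))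

theorem lsLoss_eq_of_le {θ : ℝ} (hθ : |θ| < ε) {η : Fin q → ℝ} (hη : ∀ ω, |f ω η| ≤ b ω) :
    lsLoss τ f (m θ) (r θ) η = ENNReal.ofReal (∫ ω, (m θ ω - f ω η) ^ 2 * r θ ω ∂τ) :=
  (ofReal_integral_eq_lintegral_ofReal (hP.integrable_loss_of_le hB hθ hη)
    (hP.r_nonneg.mono fun _ h => mul_nonneg (sq_nonneg _) (h θ hθ))).symm

theorem lsLoss_eq {θ : ℝ} (hθ : |θ| < ε) {η : Fin q → ℝ} (hη : η ∈ Metric.ball η₀ δ) :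
    lsLoss τ f (m θ) (r θ) η = ENNReal.ofReal (∫ ω, (m θ ω - f ω η) ^ 2 * r θ ω ∂τ) :=
  hP.lsLoss_eq_of_le hB hθ fun _ => hB.bound_f _ η hη

omit hB in
theorem integral_loss_nonneg {θ : ℝ} (hθ : |θ| < ε) (η : Fin q → ℝ) :
    0 ≤ ∫ ω, (m θ ω - f ω η) ^ 2 * r θ ω ∂τ :=
  integral_nonneg_of_ae (hP.r_nonneg.mono fun _ h => mul_nonneg (sq_nonneg _) (h θ hθ))

theorem hasFDerivAt_loss {θ : ℝ} (hθ : |θ| < ε) {η : Fin q → ℝ} (hη : η ∈ Metric.ball η₀ δ) :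
    ∃ T : (Fin q → ℝ) →L[ℝ] ℝ,
      HasFDerivAt (fun η => ∫ ω, (m θ ω - f ω η) ^ 2 * r θ ω ∂τ) T η ∧
      ∀ v, T v = -2 * (lsGrad τ f (m θ) (r θ) η ⬝ᵥ v) := by
  obtain ⟨T, hT, hT'⟩ := hasFDerivAt_integral_pd (τ := τ)
    (h := fun ω η => (m θ ω - f ω η) ^ 2 * r θ ω)
    (bound := fun ω => 8 * (A ω + b ω) ^ 2) (s := Metric.ball η₀ δ) Metric.isOpen_ball
    (hP.aemeasurable_loss hB hθ)
    (fun ω => (((differentiable_const _).sub (hB.differentiable ω)).pow 2).mul_const _)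
    (fun η hη => hP.integrable_loss hB hθ hη)
    (fun η i => by
      simp_rw [pd_sq (hB.differentiable _)]
      exact (hP.aemeasurable_grad hB hθ η i).const_mul _)
    (by
      filter_upwards [hP.bound_grad hB] with ω h η hη i
      have := h θ hθ _ _ (hB.bound_f ω η hη) (hB.bound_pd ω η hη i)
      rw [pd_sq (hB.differentiable _), abs_mul, abs_neg, abs_two]
      linarith)
    (hB.moment.const_mul 8) hη
  refine ⟨T, hT, fun v => ?_⟩
  rw [clm_apply_eq_sum, dotProduct, Finset.mul_sum]
  refine Finset.sum_congr rfl fun i _ => ?_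
  rw [hT']
  simp_rw [pd_sq (hB.differentiable _)]
  rw [integral_const_mul, lsGrad]
  ring

theorem hasFDerivAt_grad {θ : ℝ} (hθ : |θ| < ε) {η : Fin q → ℝ} (hη : η ∈ Metric.ball η₀ δ)
    (i : Fin q) :
    ∃ T : (Fin q → ℝ) →L[ℝ] ℝ, HasFDerivAt (fun η => lsGrad τ f (m θ) (r θ) η i) T η ∧
      ∀ j, T (Pi.single j 1) = -lsHess τ f (m θ) (r θ) η i j := by
  obtain ⟨T, hT, hT'⟩ := hasFDerivAt_integral_pd (τ := τ)
    (h := fun ω η => pd (f ω) η i * (m θ ω - f ω η) * r θ ω)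
    (bound := fun ω => 6 * (A ω + b ω) ^ 2) (s := Metric.ball η₀ δ) Metric.isOpen_ball
    (fun η => hP.aemeasurable_grad hB hθ η i)
    (fun ω => ((differentiable_pd (hB.contDiff ω) i).mul
      ((differentiable_const _).sub (hB.differentiable ω))).mul_const _)
    (fun η hη => hP.integrable_grad hB hθ hη i)
    (fun η j => by
      simp_rw [pd_grad (hB.contDiff _)]
      exact (hP.aemeasurable_hess hB hθ η i j).neg)
    (by
      filter_upwards [hP.bound_hess hB] with ω h η hη j
      rw [pd_grad (hB.contDiff _), abs_neg]
      exact h θ hθ _ _ _ _ (hB.bound_f ω η hη) (hB.bound_pd ω η hη i)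
        (hB.bound_pd ω η hη j) (hB.bound_pd2 ω η hη i j))
    (hB.moment.const_mul 6) hη
  refine ⟨T, hT, fun j => ?_⟩
  rw [hT']
  simp_rw [pd_grad (hB.contDiff _)]
  rw [integral_neg, lsHess, Matrix.of_apply]

theorem abs_lsHess_sub_le {θ : ℝ} (hθ : |θ| < ε) {η : Fin q → ℝ} (hη : η ∈ Metric.ball η₀ δ)
    (i j : Fin q) : |lsHess τ f (m θ) (r θ) η i j - lsHess τ f m₀ r₀ η i j| ≤
      4 * K * |θ| * ∫ ω, (A ω + b ω) ^ 2 ∂τ := by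
  have h0 := hB.isPath_const.integrable_hess hB (θ := 0) (by simp) hη i j
  simp only [lsHess, Matrix.of_apply]
  rw [← integral_sub (hP.integrable_hess hB hθ hη i j) h0, ← integral_const_mul]
  rw [← Real.norm_eq_abs]
  refine norm_integral_le_of_norm_le (hB.moment.const_mul _) ?_
  filter_upwards [hP.lip_hess hB] with ω h
  exact h θ hθ _ _ _ _ (hB.bound_f ω η hη) (hB.bound_pd ω η hη i)
    (hB.bound_pd ω η hη j) (hB.bound_pd2 ω η hη i j)

theorem abs_loss_sub_le {θ : ℝ} (hθ : |θ| < ε) {η : Fin q → ℝ} (hη : ∀ ω, |f ω η| ≤ b ω) :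
    |(∫ ω, (m θ ω - f ω η) ^ 2 * r θ ω ∂τ) - ∫ ω, (m₀ ω - f ω η) ^ 2 * r₀ ω ∂τ| ≤
      7 * K * |θ| * ∫ ω, (A ω + b ω) ^ 2 ∂τ := by
  have h0 := hB.isPath_const.integrable_loss_of_le hB (θ := 0) (by simp) hη
  rw [← integral_sub (hP.integrable_loss_of_le hB hθ hη) h0, ← integral_const_mul]
  rw [← Real.norm_eq_abs]
  refine norm_integral_le_of_norm_le (hB.moment.const_mul _) ?_
  filter_upwards [hP.lip_loss hB] with ω h
  exact h θ hθ _ (hη ω)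

/-- The path is differentiable at `θ = 0` only, so the dominated theorem is used in the form that
needs a Lipschitz bound relative to the base point and no derivative nearby. -/
theorem hasDerivAt_lsGrad :
    HasDerivAt (fun θ => lsGrad τ f (m θ) (r θ) η₀)
      (fun i => ∫ ω, pd (f ω) η₀ i * (m' ω * r₀ ω + (m₀ ω - f ω η₀) * r' ω) ∂τ) 0 := by
  have hη := Metric.mem_ball_self (x := η₀) hB.pos
  rw [hasDerivAt_pi]
  intro i
  set F' : Ω → ℝ →L[ℝ] ℝ := fun ω => ContinuousLinearMap.toSpanSingleton ℝ
    (pd (f ω) η₀ i * (m' ω * r₀ ω + (m₀ ω - f ω η₀) * r' ω)) with hF'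
  have hm : AEStronglyMeasurable (fun ω =>
      pd (f ω) η₀ i * (m' ω * r₀ ω + (m₀ ω - f ω η₀) * r' ω)) τ :=
    ((hB.measurable_pd η₀ i).aemeasurable.mul ((hP.measurable_m'.mul hB.measurable_r).add
      ((hB.measurable_m.sub (hB.measurable_f η₀).aemeasurable).mul
        hP.measurable_r'))).aestronglyMeasurable
  have hF'm : AEStronglyMeasurable F' τ :=
    (ContinuousLinearMap.toSpanSingletonCLE (𝕜 := ℝ) (E := ℝ)).continuous.comp_aestronglyMeasurable
      hm
  have hz : |(0 : ℝ)| < ε := by simpa using hP.pos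
  have key := hasFDerivAt_integral_of_dominated_loc_of_lip' (μ := τ) (𝕜 := ℝ)
    (F := fun θ ω => pd (f ω) η₀ i * (m θ ω - f ω η₀) * r θ ω) (F' := F') (x₀ := 0)
    (bound := fun ω => 3 * K * (A ω + b ω) ^ 2) (s := Metric.ball 0 ε) (Metric.ball_mem_nhds _ hP.pos)
    (fun θ hθ => (hP.aemeasurable_grad hB (by simpa using hθ) η₀ i).aestronglyMeasurable)
    (hP.integrable_grad hB hz hη i) hF'm ?_ (hB.moment.const_mul _) ?_
  · have h1 := key.2.hasDerivAt
    rw [ContinuousLinearMap.integral_apply key.1] at h1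
    simpa [lsGrad, hF'] using h1
  · filter_upwards [hP.lip_grad hB] with ω h θ hθ
    have := h θ (by simpa using hθ) _ _ (hB.bound_f ω η₀ hη) (hB.bound_pd ω η₀ hη i)
    simp only [hP.zero_m, hP.zero_r, sub_zero, Real.norm_eq_abs]
    linarith
  · filter_upwards [hP.deriv_m, hP.deriv_r] with ω h1 h2
    have h3 := ((h1.sub_const (f ω η₀)).const_mul (pd (f ω) η₀ i)).mul h2
    rw [hasDerivAt_iff_hasFDerivAt] at h3
    have h4 : pd (f ω) η₀ i * m' ω * r 0 ω + pd (f ω) η₀ i * (m 0 ω - f ω η₀) * r' ω =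
        pd (f ω) η₀ i * (m' ω * r₀ ω + (m₀ ω - f ω η₀) * r' ω) := by
      rw [hP.zero_m, hP.zero_r]
      ring
    rw [h4] at h3
    exact h3

end IsPath

/-! ### Stationarity, positive definiteness and the curve of local minimizers -/

namespace IsBase

variable (hB : IsBase τ f A b m₀ r₀ η₀ δ)
include hB

theorem continuousAt_lsHess (i j : Fin q) :
    ContinuousAt (fun η => lsHess τ f m₀ r₀ η i j) η₀ := by
  have hP := hB.isPath_const
  refine continuousAt_of_dominated (bound := fun ω => 6 * (A ω + b ω) ^ 2) ?_ ?_
    (hB.moment.const_mul _) ?_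
  · exact Eventually.of_forall fun η =>
      (hP.aemeasurable_hess hB (θ := 0) (by simp) η i j).aestronglyMeasurable
  · filter_upwards [Metric.ball_mem_nhds η₀ hB.pos] with η hη
    filter_upwards [hP.bound_hess hB] with ω h
    exact h 0 (by simp) _ _ _ _ (hB.bound_f ω η hη) (hB.bound_pd ω η hη i)
      (hB.bound_pd ω η hη j) (hB.bound_pd2 ω η hη i j)
  · refine Eventually.of_forall fun ω => Continuous.continuousAt ?_
    have h1 := continuous_pd ((hB.contDiff ω).of_le (by norm_num))
    have h2 : Continuous fun η => pd (fun η' => pd (f ω) η' j) η i :=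
      continuous_pd (contDiff_pd (hB.contDiff ω) j) i
    exact (((h1 i).mul (h1 j)).sub ((continuous_const.sub (hB.differentiable ω).continuous).mul
      h2)).mul_const _

/-- The Jacobian of `lsGrad` is `-lsHess`. It moves by `O(|θ|)` along the path, uniformly in `η`,
and is continuous in `η` at the base point; the mean value inequality on a ball concludes. The
radius `ρ` is chosen before the path, which is why one neighbourhood serves all submodels. -/
theorem exists_lsGrad_approx {κ : ℝ} (hκ : 0 < κ) : ∃ ρ, 0 < ρ ∧ ρ ≤ δ ∧
    ∀ (m r : ℝ → Ω → ℝ) (m' r' : Ω → ℝ) (K ε : ℝ), IsPath τ A m₀ r₀ m r m' r' K ε →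
      ∀ᶠ θ in 𝓝 (0 : ℝ), ∀ η ∈ Metric.ball η₀ ρ, ∀ η' ∈ Metric.ball η₀ ρ,
        ‖lsGrad τ f (m θ) (r θ) η - lsGrad τ f (m θ) (r θ) η'
          + (lsHess τ f m₀ r₀ η₀).mulVec (η - η')‖ ≤ κ * ‖η - η'‖ := by
  -- Each entry of the Jacobian error costs `2 κ'`, once for `θ` and once for `η`, and the operator
  -- norm costs `q`; `q + 1` avoids dividing by zero.
  set κ' := κ / (2 * (q + 1)) with hκ'
  have hκ0 : 0 < κ' := by positivity
  have h1 : ∀ᶠ η in 𝓝 η₀, ∀ i j, |lsHess τ f m₀ r₀ η i j - lsHess τ f m₀ r₀ η₀ i j| < κ' := by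
    refine eventually_all.2 fun i => eventually_all.2 fun j => ?_
    have := (hB.continuousAt_lsHess i j).eventually (Metric.ball_mem_nhds _ hκ0)
    simpa [Real.dist_eq] using this
  obtain ⟨ρ, hρ, h1⟩ := Metric.eventually_nhds_iff_ball.1 h1
  refine ⟨min ρ δ, lt_min hρ hB.pos, min_le_right _ _, fun m r m' r' K ε hP => ?_⟩
  have h2 : ∀ᶠ θ in 𝓝 (0 : ℝ), 4 * K * |θ| * ∫ ω, (A ω + b ω) ^ 2 ∂τ < κ' := by
    have : Tendsto (fun θ : ℝ => 4 * K * |θ| * ∫ ω, (A ω + b ω) ^ 2 ∂τ) (𝓝 0) (𝓝 0) := by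
      have : Continuous fun θ : ℝ => 4 * K * |θ| * ∫ ω, (A ω + b ω) ^ 2 ∂τ := by fun_prop
      simpa using this.tendsto 0
    exact this.eventually_lt_const hκ0
  filter_upwards [h2, Metric.ball_mem_nhds (0 : ℝ) hP.pos] with θ h2 hθ η hη η' hη'
  have hθ : |θ| < ε := by simpa using hθ
  rw [pi_norm_le_iff_of_nonneg (by positivity)]
  intro i
  have hH : ∀ v, (lsHess τ f m₀ r₀ η₀).mulVec v i = ∑ j, v j * lsHess τ f m₀ r₀ η₀ i j := by
    intro v
    simp only [Matrix.mulVec, dotProduct]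
    exact Finset.sum_congr rfl fun j _ => mul_comm _ _
  set T₀ : (Fin q → ℝ) →L[ℝ] ℝ := LinearMap.toContinuousLinearMap
    ((LinearMap.proj i).comp (Matrix.toLin' (lsHess τ f m₀ r₀ η₀))) with hT₀
  have hT₀' : ∀ v, T₀ v = (lsHess τ f m₀ r₀ η₀).mulVec v i := fun v => by simp [hT₀]
  have hder : ∀ x ∈ Metric.ball η₀ (min ρ δ), ∃ T : (Fin q → ℝ) →L[ℝ] ℝ,
      HasFDerivAt (fun η => lsGrad τ f (m θ) (r θ) η i + T₀ η) T x ∧ ‖T‖ ≤ κ := by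
    intro x hx
    have hxδ := Metric.ball_subset_ball (min_le_right ρ δ) hx
    obtain ⟨T, hT, hT'⟩ := hP.hasFDerivAt_grad hB hθ hxδ i
    refine ⟨T + T₀, hT.add T₀.hasFDerivAt, ?_⟩
    refine (clm_norm_le _ (C := 2 * κ') (by positivity) fun j => ?_).trans ?_
    · have e1 := h1 x (Metric.ball_subset_ball (min_le_left ρ δ) hx) i j
      have e2 := hP.abs_lsHess_sub_le hB hθ hxδ i j
      rw [add_apply, hT', hT₀', Matrix.mulVec_single_one, Matrix.col_apply]
      have e3 : -lsHess τ f (m θ) (r θ) x i j + lsHess τ f m₀ r₀ η₀ i j =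
        -((lsHess τ f (m θ) (r θ) x i j - lsHess τ f m₀ r₀ x i j) +
          (lsHess τ f m₀ r₀ x i j - lsHess τ f m₀ r₀ η₀ i j)) := by ring
      rw [e3, abs_neg]
      refine (abs_add_le _ _).trans ?_
      linarith
    · rw [hκ', mul_div_assoc', mul_div_assoc', div_le_iff₀ (by positivity)]
      nlinarith
  choose! T hT hTn using hder
  have := (convex_ball η₀ (min ρ δ)).norm_image_sub_le_of_norm_hasFDerivWithin_le
    (fun x hx => (hT x hx).hasFDerivWithinAt) hTn hη' hη
  simp only [Pi.add_apply, Pi.sub_apply, ← hT₀', map_sub]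
  rw [sub_add_sub_comm]
  exact this

theorem lsHess_isSymm (η : Fin q → ℝ) : (lsHess τ f m₀ r₀ η).IsHermitian := by
  ext i j
  simp only [Matrix.conjTranspose_apply, star_trivial, lsHess, Matrix.of_apply]
  congr 1
  ext ω
  rw [pd_pd_symm (hB.contDiff ω) η j i]
  ring

theorem lsGrad_eq_zero (hmin : ∀ η, lsLoss τ f m₀ r₀ η₀ ≤ lsLoss τ f m₀ r₀ η) :
    lsGrad τ f m₀ r₀ η₀ = 0 ∧ ∀ η ∈ Metric.ball η₀ δ,
      ∫ ω, (m₀ ω - f ω η₀) ^ 2 * r₀ ω ∂τ ≤ ∫ ω, (m₀ ω - f ω η) ^ 2 * r₀ ω ∂τ := by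
  have hP := hB.isPath_const
  have h0 : |(0 : ℝ)| < 1 := by simp
  have hη := Metric.mem_ball_self (x := η₀) hB.pos
  have hle : ∀ η ∈ Metric.ball η₀ δ,
      ∫ ω, (m₀ ω - f ω η₀) ^ 2 * r₀ ω ∂τ ≤ ∫ ω, (m₀ ω - f ω η) ^ 2 * r₀ ω ∂τ := by
    intro η hη'
    have := hmin η
    rw [hP.lsLoss_eq hB h0 hη, hP.lsLoss_eq hB h0 hη'] at this
    exact (ENNReal.ofReal_le_ofReal_iff (hP.integral_loss_nonneg h0 η)).1 this
  refine ⟨?_, hle⟩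
  obtain ⟨T, hT, hT'⟩ := hP.hasFDerivAt_loss hB h0 hη
  have hl : IsLocalMin (fun η => ∫ ω, (m₀ ω - f ω η) ^ 2 * r₀ ω ∂τ) η₀ := by
    filter_upwards [Metric.ball_mem_nhds η₀ hB.pos] with η h
    exact hle η h
  have hT0 := hl.hasFDerivAt_eq_zero hT
  ext i
  have := hT' (Pi.single i 1)
  rw [hT0] at this
  simpa using this

/-- The second-order necessary condition at a minimum gives semidefiniteness, and invertibility
upgrades it. Hence positive definiteness need not be assumed. -/
theorem lsHess_posDef (hH : IsUnit (lsHess τ f m₀ r₀ η₀).det)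
    (hmin : ∀ η, lsLoss τ f m₀ r₀ η₀ ≤ lsLoss τ f m₀ r₀ η) : (lsHess τ f m₀ r₀ η₀).PosDef := by
  have hP := hB.isPath_const
  have hd : ∀ η ∈ Metric.ball η₀ δ, _ := fun η hη =>
    hP.hasFDerivAt_loss hB (θ := 0) (by simp) hη
  choose! L' hL hL' using hd
  have hps : (lsHess τ f m₀ r₀ η₀).PosSemidef := by
    refine Matrix.PosSemidef.of_dotProduct_mulVec_nonneg (hB.lsHess_isSymm η₀) fun v => ?_
    rw [star_trivial]
    refine dotProduct_mulVec_nonneg_of_min hB.pos hL hL' (fun ε hε => ?_)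
      (hB.lsGrad_eq_zero hmin).1 (hB.lsGrad_eq_zero hmin).2 v
    obtain ⟨ρ, hρ, _, h⟩ := hB.exists_lsGrad_approx hε
    exact ⟨ρ, hρ, fun η hη => (h _ _ _ _ _ _ hP).self_of_nhds η hη η₀ (Metric.mem_ball_self hρ)⟩
  exact hps.posDef_iff_isUnit.2 ((Matrix.isUnit_iff_isUnit_det _).2 hH)

/-- Local existence, uniqueness and differentiability of the least squares minimizer. -/
theorem exists_min_curve (hH : IsUnit (lsHess τ f m₀ r₀ η₀).det)
    (hmin : ∀ η, lsLoss τ f m₀ r₀ η₀ ≤ lsLoss τ f m₀ r₀ η) :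
    ∃ ρ, 0 < ρ ∧ ρ ≤ δ ∧ ∀ (m r : ℝ → Ω → ℝ) (m' r' : Ω → ℝ) (K ε : ℝ),
      IsPath τ A m₀ r₀ m r m' r' K ε → ∃ η : ℝ → Fin q → ℝ, η 0 = η₀ ∧
        (∀ᶠ θ in 𝓝 (0 : ℝ), IsUniqueMinOn (lsLoss τ f (m θ) (r θ)) (Metric.ball η₀ ρ) (η θ)) ∧
        HasDerivAt η ((lsHess τ f m₀ r₀ η₀)⁻¹.mulVec
          (fun i => ∫ ω, pd (f ω) η₀ i * (m' ω * r₀ ω + (m₀ ω - f ω η₀) * r' ω) ∂τ)) 0 := by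
  have hpd := hB.lsHess_posDef hH hmin
  obtain ⟨c₀, hc₀, hc⟩ := exists_dotProduct_mulVec_ge hpd
  obtain ⟨ε₁, hε₁, hcurve⟩ := exists_zero_curve hH
  -- Small enough both for the existence of zeros (`κ < ε₁`) and for the uniqueness of the minimizer
  -- (`q κ < c₀`).
  set κ := min (ε₁ / 2) (c₀ / (q + 1)) with hκ
  have hκ0 : 0 < κ := by positivity
  have hκ1 : κ < ε₁ := (min_le_left _ _).trans_lt (by linarith)
  have hκ2 : q * κ < c₀ := by
    have h1 : κ ≤ c₀ / (q + 1) := min_le_right _ _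
    rw [le_div_iff₀ (by positivity)] at h1
    linarith
  obtain ⟨ρ, hρ, hρδ, happ⟩ := hB.exists_lsGrad_approx hκ0
  refine ⟨ρ, hρ, hρδ, fun m r m' r' K ε hP => ?_⟩
  obtain ⟨η, h0, hη, hder⟩ := hcurve κ hκ1 ρ hρ η₀ _ (fun θ => lsGrad τ f (m θ) (r θ))
    (happ m r m' r' K ε hP) (fun ε' hε' => by
      obtain ⟨ρ', hρ', _, h⟩ := hB.exists_lsGrad_approx hε'
      exact ⟨ρ', hρ', (h m r m' r' K ε hP).mono fun θ hθ η hη =>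
        hθ η hη η₀ (Metric.mem_ball_self hρ')⟩)
    (by rw [hP.zero_m, hP.zero_r]; exact (hB.lsGrad_eq_zero hmin).1) (hP.hasDerivAt_lsGrad hB)
  refine ⟨η, h0, ?_, hder⟩
  filter_upwards [hη, happ m r m' r' K ε hP, Metric.ball_mem_nhds (0 : ℝ) hP.pos] with θ h1 h2 hθ
  have hθ : |θ| < ε := by simpa using hθ
  refine ⟨h1.1, fun η' hη' hne => ?_⟩
  have hd : ∀ η ∈ Metric.ball η₀ ρ, _ := fun η hη =>
    hP.hasFDerivAt_loss hB hθ (Metric.ball_subset_ball hρδ hη)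
  choose! L' hL hL' using hd
  have hlt := lt_of_gradient_approx hc hκ2 hL hL' h2 h1.1 h1.2 hη' hne
  rw [hP.lsLoss_eq hB hθ (Metric.ball_subset_ball hρδ h1.1),
    hP.lsLoss_eq hB hθ (Metric.ball_subset_ball hρδ hη')]
  exact (ENNReal.ofReal_lt_ofReal_iff_of_nonneg (hP.integral_loss_nonneg hθ _)).2 hlt

end IsBase

/-- For a working model affine in the parameter a strict local minimizer is global. -/
theorem isUniqueMinOn_univ_of_affine {m r : Ω → ℝ}
    (haff : ∀ ω, ∃ (a : (Fin q → ℝ) →ₗ[ℝ] ℝ) (k : ℝ), ∀ η, f ω η = a η + k)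
    (hm : ∀ η, AEMeasurable (fun ω => (m ω - f ω η) ^ 2 * r ω) τ)
    (hr : ∀ᵐ ω ∂τ, 0 ≤ r ω) {N : Set (Fin q → ℝ)} {η₁ : Fin q → ℝ} (hN : N ∈ 𝓝 η₁)
    (h : IsUniqueMinOn (lsLoss τ f m r) N η₁) :
    IsUniqueMinOn (lsLoss τ f m r) Set.univ η₁ := by
  refine ⟨Set.mem_univ _, fun η _ hne => ?_⟩
  by_contra hle
  rw [not_lt] at hle
  -- The criterion is convex when `f` is affine in `η`. A competitor `η` that is no worse than `η₁`
  -- would make the whole segment no worse, including points of `N` other than `η₁`.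
  have hconv : ∀ t ∈ Set.Icc (0 : ℝ) 1,
      lsLoss τ f m r (η₁ + t • (η - η₁)) ≤ lsLoss τ f m r η₁ := by
    intro t ht
    have h1 : lsLoss τ f m r (η₁ + t • (η - η₁)) ≤
        ENNReal.ofReal (1 - t) * lsLoss τ f m r η₁ + ENNReal.ofReal t * lsLoss τ f m r η := by
      unfold lsLoss
      rw [← lintegral_const_mul'' _ (hm η₁).ennreal_ofReal,
        ← lintegral_const_mul'' _ (hm η).ennreal_ofReal,
        ← lintegral_add_left' ((hm η₁).ennreal_ofReal.const_mul _)]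
      refine lintegral_mono_ae ?_
      filter_upwards [hr] with ω hω
      have ht' : 0 ≤ 1 - t := by linarith [ht.2]
      rw [← ENNReal.ofReal_mul ht', ← ENNReal.ofReal_mul ht.1,
        ← ENNReal.ofReal_add (by positivity) (mul_nonneg ht.1 (by positivity))]
      refine ENNReal.ofReal_le_ofReal ?_
      obtain ⟨a, k, ha⟩ := haff ω
      simp only [ha, map_add, map_smul, map_sub, smul_eq_mul]
      have : 0 ≤ t * (1 - t) * (a η - a η₁) ^ 2 * r ω := by
        have := ht.1
        positivity
      linarith [show ((1 - t) * ((m ω - (a η₁ + k)) ^ 2 * r ω) + t * ((m ω - (a η + k)) ^ 2 * r ω)) -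
        (m ω - (a η₁ + t * (a η - a η₁) + k)) ^ 2 * r ω =
          t * (1 - t) * (a η - a η₁) ^ 2 * r ω by ring]
    refine h1.trans ?_
    calc _ ≤ ENNReal.ofReal (1 - t) * lsLoss τ f m r η₁ + ENNReal.ofReal t * lsLoss τ f m r η₁ := by
          gcongr
      _ = lsLoss τ f m r η₁ := by
          rw [← add_mul, ← ENNReal.ofReal_add (by linarith [ht.2]) ht.1, sub_add_cancel,
            ENNReal.ofReal_one, one_mul]
  have ht : Tendsto (fun t : ℝ => η₁ + t • (η - η₁)) (𝓝[>] 0) (𝓝 η₁) := by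
    have : Continuous fun t : ℝ => η₁ + t • (η - η₁) := by fun_prop
    have h2 := this.tendsto 0
    rw [zero_smul, add_zero] at h2
    exact h2.mono_left nhdsWithin_le_nhds
  have hIoo : Set.Ioo (0 : ℝ) 1 ∈ 𝓝[>] (0 : ℝ) := Ioo_mem_nhdsGT one_pos
  obtain ⟨t, htN, ht⟩ := ((ht.eventually hN).and hIoo).exists
  refine absurd (h.2 _ htN ?_) (not_lt.2 (hconv t ⟨ht.1.le, ht.2.le⟩))
  intro he
  have : t • (η - η₁) = 0 := by simpa using he
  rcases smul_eq_zero.1 this with h3 | h3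
  · exact ht.1.ne' h3
  · exact hne (sub_eq_zero.1 h3)

/-- For a dominated working model and a well separated minimizer, local minimizers are eventually
global. -/
theorem IsPath.isUniqueMinOn_univ_of_separated {m r : ℝ → Ω → ℝ} {m' r' : Ω → ℝ} {K ε : ℝ}
    (hP : IsPath τ A m₀ r₀ m r m' r' K ε) (hB : IsBase τ f A b m₀ r₀ η₀ δ)
    (hb : ∀ ω η, |f ω η| ≤ b ω) {ρ : ℝ} (hρ : 0 < ρ) {κ : ℝ≥0∞} (hκ : 0 < κ)
    (hsep : ∀ η, ρ ≤ ‖η - η₀‖ → lsLoss τ f m₀ r₀ η₀ + κ ≤ lsLoss τ f m₀ r₀ η)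
    {η : ℝ → Fin q → ℝ}
    (hη : ∀ᶠ θ in 𝓝 (0 : ℝ), IsUniqueMinOn (lsLoss τ f (m θ) (r θ)) (Metric.ball η₀ ρ) (η θ)) :
    ∀ᶠ θ in 𝓝 (0 : ℝ), IsUniqueMinOn (lsLoss τ f (m θ) (r θ)) Set.univ (η θ) := by
  -- The gap `κ` may be infinite; a finite positive real below it is all that is used.
  obtain ⟨κ', hκ'0, hκ'⟩ : ∃ κ' : ℝ, 0 < κ' ∧ ENNReal.ofReal κ' ≤ κ := by
    rcases eq_or_ne κ ∞ with rfl | h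
    · exact ⟨1, one_pos, le_top⟩
    · exact ⟨κ.toReal, ENNReal.toReal_pos hκ.ne' h, (ENNReal.ofReal_toReal h).le⟩
  -- The criterion moves by less than half the gap at `η₀` and at the competitor. The bound is
  -- uniform over all `η` because `b` dominates `f` globally.
  have h2 : ∀ᶠ θ in 𝓝 (0 : ℝ), 7 * K * |θ| * ∫ ω, (A ω + b ω) ^ 2 ∂τ < κ' / 2 := by
    have : Tendsto (fun θ : ℝ => 7 * K * |θ| * ∫ ω, (A ω + b ω) ^ 2 ∂τ) (𝓝 0) (𝓝 0) := by
      have : Continuous fun θ : ℝ => 7 * K * |θ| * ∫ ω, (A ω + b ω) ^ 2 ∂τ := by fun_prop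
      simpa using this.tendsto 0
    exact this.eventually_lt_const (by positivity)
  filter_upwards [hη, h2, Metric.ball_mem_nhds (0 : ℝ) hP.pos] with θ h1 h2 hθ
  have hθ : |θ| < ε := by simpa using hθ
  refine ⟨Set.mem_univ _, fun η' _ hne => ?_⟩
  by_cases hη' : η' ∈ Metric.ball η₀ ρ
  · exact h1.2 η' hη' hne
  have h3 : lsLoss τ f (m θ) (r θ) (η θ) ≤ lsLoss τ f (m θ) (r θ) η₀ := by
    rcases eq_or_ne η₀ (η θ) with h | h
    · rw [← h]
    · exact (h1.2 η₀ (Metric.mem_ball_self hρ) h).le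
  refine h3.trans_lt ?_
  have hP0 := hB.isPath_const
  have h0 : |(0 : ℝ)| < 1 := by simp
  have h4 := hsep η' (by simpa [dist_eq_norm] using hη')
  rw [hP0.lsLoss_eq_of_le hB h0 fun ω => hb ω η₀, hP0.lsLoss_eq_of_le hB h0 fun ω => hb ω η'] at h4
  have h5 := (add_le_add_right hκ' _).trans h4
  rw [← ENNReal.ofReal_add (hP0.integral_loss_nonneg h0 η₀) hκ'0.le,
    ENNReal.ofReal_le_ofReal_iff (hP0.integral_loss_nonneg h0 η')] at h5
  rw [hP.lsLoss_eq_of_le hB hθ fun ω => hb ω η₀, hP.lsLoss_eq_of_le hB hθ fun ω => hb ω η',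
    ENNReal.ofReal_lt_ofReal_iff_of_nonneg (hP.integral_loss_nonneg hθ _)]
  have e1 := abs_le.1 (hP.abs_loss_sub_le hB hθ fun ω => hb ω η₀)
  have e2 := abs_le.1 (hP.abs_loss_sub_le hB hθ fun ω => hb ω η')
  linarith [e1.2, e2.1]

end

section

/-! ### Tilting a kernel by a bounded likelihood ratio -/

section Tilt

variable {α β : Type*} [MeasurableSpace α] [MeasurableSpace β]

/-- The average of `h` over the second coordinate. -/
def kav (κ : Kernel α β) (h : α × β → ℝ) (a : α) : ℝ := ∫ b, h (a, b) ∂κ a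

theorem measurable_kav (κ : Kernel α β) [IsSFiniteKernel κ] {h : α × β → ℝ} (hh : Measurable h) :
    Measurable (kav κ h) :=
  (hh.stronglyMeasurable.integral_kernel_prod_right').measurable

theorem integrable_of_bdd (ν : Measure β) [IsFiniteMeasure ν] {h : β → ℝ} (hh : Measurable h) {C : ℝ}
    (hC : ∀ b, |h b| ≤ C) : Integrable h ν :=
  Integrable.of_bound hh.aestronglyMeasurable C (Eventually.of_forall hC)

theorem abs_kav_le (κ : Kernel α β) [IsMarkovKernel κ] {h : α × β → ℝ} {C : ℝ}
    (hC : ∀ v, |h v| ≤ C) (a : α) : |kav κ h a| ≤ C := by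
  have := norm_integral_le_of_norm_le_const (μ := κ a) (f := fun b => h (a, b)) (C := C)
    (Eventually.of_forall fun b => hC (a, b))
  simpa [kav] using this

theorem abs_kav_sub_one_le (κ : Kernel α β) [IsMarkovKernel κ] {h : α × β → ℝ} (hh : Measurable h)
    {C : ℝ} (hC : ∀ v, |h v - 1| ≤ C) (a : α) : |kav κ h a - 1| ≤ C := by
  have hb : ∀ v, |h v| ≤ C + 1 := fun v => by
    have := abs_sub_abs_le_abs_sub (h v) 1
    rw [abs_one] at this
    linarith [hC v]
  have h1 : kav κ h a - 1 = kav κ (fun v => h v - 1) a := by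
    simp only [kav]
    have hi : Integrable (fun b => h (a, b)) (κ a) :=
      integrable_of_bdd _ (hh.comp measurable_prodMk_left) fun b => hb (a, b)
    rw [integral_sub hi (integrable_const _)]
    simp
  rw [h1]
  exact abs_kav_le κ hC a

theorem le_kav (κ : Kernel α β) [IsMarkovKernel κ] {h : α × β → ℝ} (hh : Measurable h) {l u : ℝ}
    (hl : ∀ v, l ≤ h v) (hu : ∀ v, h v ≤ u) (a : α) : l ≤ kav κ h a ∧ kav κ h a ≤ u := by
  have hi : Integrable (fun b => h (a, b)) (κ a) :=
    integrable_of_bdd _ (hh.comp measurable_prodMk_left) fun b =>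
      abs_le_max_abs_abs (hl (a, b)) (hu (a, b))
  constructor
  · have := integral_mono (integrable_const l) hi fun b => hl (a, b)
    simpa [kav] using this
  · have := integral_mono hi (integrable_const u) fun b => hu (a, b)
    simpa [kav] using this

/-- A bounded positive likelihood ratio. -/
structure IsRatio (g : α → ℝ) : Prop where
  measurable : Measurable g
  ge : ∀ v, 1 / 2 ≤ g v
  le : ∀ v, g v ≤ 3 / 2

theorem IsRatio.pos {g : α → ℝ} (hg : IsRatio g) (v : α) : 0 < g v :=
  lt_of_lt_of_le (by norm_num) (hg.ge v)

theorem IsRatio.kav {g : α × β → ℝ} (hg : IsRatio g) (κ : Kernel α β) [IsMarkovKernel κ] :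
    IsRatio (kav κ g) where
  measurable := measurable_kav κ hg.measurable
  ge a := (le_kav κ hg.measurable hg.ge hg.le a).1
  le a := (le_kav κ hg.measurable hg.ge hg.le a).2

theorem IsRatio.integrable {g : α → ℝ} (hg : IsRatio g) (ν : Measure α) [IsFiniteMeasure ν] :
    Integrable g ν :=
  integrable_of_bdd ν hg.measurable (C := 3 / 2) fun v => by
    rw [abs_of_pos (hg.pos v)]
    exact hg.le v

/-- The kernel with density `g / kav κ g` with respect to `κ`. -/
def tiltKernel (κ : Kernel α β) [IsSFiniteKernel κ] (g : α × β → ℝ) : Kernel α β :=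
  κ.withDensity fun a b => ENNReal.ofReal (g (a, b) / kav κ g a)

theorem measurable_tilt_density (κ : Kernel α β) [IsSFiniteKernel κ] {g : α × β → ℝ}
    (hg : Measurable g) : Measurable fun v : α × β => g v / kav κ g v.1 :=
  hg.div ((measurable_kav κ hg).comp measurable_fst)

theorem tiltKernel_apply (κ : Kernel α β) [IsSFiniteKernel κ] {g : α × β → ℝ}
    (hg : Measurable g) (a : α) :
    tiltKernel κ g a = (κ a).withDensity fun b => ENNReal.ofReal (g (a, b) / kav κ g a) :=
  Kernel.withDensity_apply _ (measurable_tilt_density κ hg).ennreal_ofReal a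

theorem isMarkovKernel_tilt (κ : Kernel α β) [IsMarkovKernel κ] {g : α × β → ℝ} (hg : IsRatio g) :
    IsMarkovKernel (tiltKernel κ g) := by
  refine ⟨fun a => ⟨?_⟩⟩
  have hg' := hg.kav κ
  rw [tiltKernel_apply κ hg.measurable, withDensity_apply _ MeasurableSet.univ, Measure.restrict_univ,
    ← ofReal_integral_eq_lintegral_ofReal]
  · rw [integral_div, show ∫ b, g (a, b) ∂κ a = kav κ g a from rfl, div_self (hg'.pos a).ne',
      ENNReal.ofReal_one]
  · refine Integrable.div_const (integrable_of_bdd _ (hg.measurable.comp measurable_prodMk_left)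
      (C := 3 / 2) fun b => ?_) _
    rw [Function.comp_apply, abs_of_pos (hg.pos _)]
    exact hg.le _
  · exact Eventually.of_forall fun b => (div_pos (hg.pos _) (hg'.pos a)).le

/-- The chain rule for likelihood ratios: `g` is the product of its conditional average, which tilts
the marginal, and of `g` divided by that average, which tilts the conditional law. -/
theorem compProd_tilt (μ : Measure α) [SFinite μ] (κ : Kernel α β) [IsMarkovKernel κ] {g : α × β → ℝ}
    (hg : IsRatio g) :
    (μ.withDensity fun a => ENNReal.ofReal (kav κ g a)) ⊗ₘ tiltKernel κ g =
      (μ ⊗ₘ κ).withDensity fun v => ENNReal.ofReal (g v) := by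
  have := isMarkovKernel_tilt κ hg
  have hg' := hg.kav κ
  ext s hs
  rw [Measure.compProd_apply hs, withDensity_apply _ hs, ← lintegral_indicator hs,
    Measure.lintegral_compProd (hg.measurable.ennreal_ofReal.indicator hs),
    lintegral_withDensity_eq_lintegral_mul _ hg'.measurable.ennreal_ofReal
      (Kernel.measurable_kernel_prodMk_left hs)]
  refine lintegral_congr fun a => ?_
  rw [Pi.mul_apply, tiltKernel_apply κ hg.measurable, withDensity_apply _ (measurable_prodMk_left hs),
    ← lintegral_const_mul, ← lintegral_indicator (measurable_prodMk_left hs)]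
  · refine lintegral_congr fun b => ?_
    by_cases hb : (a, b) ∈ s
    · rw [Set.indicator_of_mem hb, Set.indicator_of_mem (by exact hb),
        ← ENNReal.ofReal_mul (hg'.pos a).le, mul_div_cancel₀ _ (hg'.pos a).ne']
    · rw [Set.indicator_of_notMem hb, Set.indicator_of_notMem (by exact hb)]
  · exact ((measurable_tilt_density κ hg.measurable).comp measurable_prodMk_left).ennreal_ofReal

theorem integral_tiltKernel (κ : Kernel α β) [IsMarkovKernel κ] {g : α × β → ℝ}
    (hg : IsRatio g) (a : α) (h : β → ℝ) :
    ∫ b, h b ∂(tiltKernel κ g a) = ∫ b, g (a, b) / kav κ g a * h b ∂κ a := by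
  rw [tiltKernel_apply κ hg.measurable, integral_withDensity_eq_integral_toReal_smul]
  · refine integral_congr_ae (Eventually.of_forall fun b => ?_)
    simp only [smul_eq_mul]
    rw [ENNReal.toReal_ofReal (div_pos (hg.pos _) ((hg.kav κ).pos a)).le]
  · exact ((measurable_tilt_density κ hg.measurable).comp measurable_prodMk_left).ennreal_ofReal
  · exact Eventually.of_forall fun b => ENNReal.ofReal_lt_top

theorem compProd_ext [MeasurableSpace.CountableOrCountablyGenerated α β] {μ ν : Measure α}
    [IsFiniteMeasure μ] [IsFiniteMeasure ν] {κ η : Kernel α β} [IsMarkovKernel κ] [IsMarkovKernel η]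
    (h : μ ⊗ₘ κ = ν ⊗ₘ η) : μ = ν ∧ κ =ᵐ[μ] η := by
  have h1 : μ = ν := by
    rw [← Measure.fst_compProd μ κ, h, Measure.fst_compProd]
  subst h1
  exact ⟨rfl, Kernel.ae_eq_of_compProd_eq h⟩

end Tilt

/-! ### Structure of the observed data law -/

namespace ObsModel

variable {𝒳 : Type*} [MeasurableSpace 𝒳] (M : ObsModel 𝒳)

instance : IsProbabilityMeasure M.PX := M.isProb
instance : IsMarkovKernel M.trt := M.isMarkov_trt
instance : IsMarkovKernel M.out := M.isMarkov_out

theorem measurable_p_joint : Measurable fun v : (𝒳 × Bool) × ℝ => M.p v.1.2 v.1.1 v.2 := by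
  have : (fun v : (𝒳 × Bool) × ℝ => M.p v.1.2 v.1.1 v.2) =
      fun v => if v.1.2 = true then M.p true v.1.1 v.2 else M.p false v.1.1 v.2 := by
    ext v
    cases h : v.1.2 <;> simp
  rw [this]
  refine Measurable.ite ((measurable_snd.comp measurable_fst) (measurableSet_singleton true)) ?_ ?_
  · exact (M.measurable_p true).comp ((measurable_fst.comp measurable_fst).prodMk measurable_snd)
  · exact (M.measurable_p false).comp ((measurable_fst.comp measurable_fst).prodMk measurable_snd)

theorem measurable_p_right (z : Bool) (x : 𝒳) : Measurable (M.p z x) :=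
  (M.measurable_p z).comp measurable_prodMk_left

theorem postKernel_apply (a : 𝒳 × Bool) :
    M.postKernel a = volume.withDensity fun s => ENNReal.ofReal (M.p a.2 a.1 s) := by
  rw [postKernel, Kernel.withDensity_apply _ M.measurable_p_joint.ennreal_ofReal, Kernel.const_apply]

instance : IsMarkovKernel M.postKernel := by
  refine ⟨fun a => ⟨?_⟩⟩
  rw [M.postKernel_apply, withDensity_apply _ MeasurableSet.univ, Measure.restrict_univ]
  exact M.lintegral_p _ _

instance : IsProbabilityMeasure M.law := by
  unfold law
  infer_instance

theorem integrable_p (z : Bool) (x : 𝒳) : Integrable (M.p z x) := by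
  refine ⟨(M.measurable_p_right z x).aestronglyMeasurable, ?_⟩
  rw [hasFiniteIntegral_iff_ofReal (Eventually.of_forall (M.p_nonneg z x)), M.lintegral_p]
  exact ENNReal.one_lt_top

theorem integral_p (z : Bool) (x : 𝒳) : ∫ s, M.p z x s = 1 := by
  rw [integral_eq_lintegral_of_nonneg_ae (Eventually.of_forall (M.p_nonneg z x))
    (M.measurable_p_right z x).aestronglyMeasurable, M.lintegral_p, ENNReal.toReal_one]

theorem integral_post (a : 𝒳 × Bool) (h : ℝ → ℝ) :
    ∫ s, h s ∂(M.postKernel a) = ∫ s, M.p a.2 a.1 s * h s := by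
  rw [M.postKernel_apply, integral_withDensity_eq_integral_toReal_smul]
  · refine integral_congr_ae (Eventually.of_forall fun s => ?_)
    simp only [smul_eq_mul]
    rw [ENNReal.toReal_ofReal (M.p_nonneg _ _ _)]
  · exact (M.measurable_p_right _ _).ennreal_ofReal
  · exact Eventually.of_forall fun b => ENNReal.ofReal_lt_top

theorem lintegral_post (a : 𝒳 × Bool) {h : ℝ → ℝ≥0∞} (hh : Measurable h) :
    ∫⁻ s, h s ∂(M.postKernel a) = ∫⁻ s, ENNReal.ofReal (M.p a.2 a.1 s) * h s := by
  rw [M.postKernel_apply, lintegral_withDensity_eq_lintegral_mul _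
    (M.measurable_p_right _ _).ennreal_ofReal hh]
  rfl

theorem ae_post_iff (a : 𝒳 × Bool) {P : ℝ → Prop} :
    (∀ᵐ s ∂(M.postKernel a), P s) ↔ ∀ᵐ s, 0 < M.p a.2 a.1 s → P s := by
  rw [M.postKernel_apply, ae_withDensity_iff (M.measurable_p_right _ _).ennreal_ofReal]
  refine eventually_congr (Eventually.of_forall fun s => ?_)
  rw [ne_eq, ENNReal.ofReal_eq_zero, not_le]

theorem trt_singleton_pos (x : 𝒳) (z : Bool) : 0 < (M.trt x).real {z} := by
  have h := M.overlap x
  cases z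
  · have : (M.trt x).real {false} = 1 - (M.trt x).real {true} := by
      have h1 := probReal_compl_eq_one_sub (μ := M.trt x) (measurableSet_singleton true)
      rwa [show ({true} : Set Bool)ᶜ = {false} by ext b; cases b <;> simp] at h1
    rw [this]
    linarith [h.2]
  · exact h.1

/-- Overlap gives both arms positive probability, so nothing can fail on a null set of treatments.
-/
theorem ae_trt_iff (x : 𝒳) {P : Bool → Prop} : (∀ᵐ z ∂(M.trt x), P z) ↔ ∀ z, P z := by
  refine ⟨fun h z => ?_, fun h => Eventually.of_forall h⟩
  by_contra hz
  have h1 : (M.trt x) {z} ≤ (M.trt x) {z | ¬ P z} := measure_mono (by simpa using hz)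
  have h2 := M.trt_singleton_pos x z
  rw [measureReal_def, measure_mono_null (by simpa using hz) (ae_iff.1 h)] at h2
  simp at h2

theorem ae_XZ {P : 𝒳 × Bool → Prop} (h : ∀ᵐ a ∂(M.PX ⊗ₘ M.trt), P a) :
    ∀ᵐ x ∂M.PX, ∀ z, P (x, z) := by
  filter_upwards [Measure.ae_ae_of_ae_compProd h] with x hx
  exact (M.ae_trt_iff x).1 hx

theorem ae_XZS {P : (𝒳 × Bool) × ℝ → Prop}
    (h : ∀ᵐ a ∂((M.PX ⊗ₘ M.trt) ⊗ₘ M.postKernel), P a) :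
    ∀ᵐ x ∂M.PX, ∀ z, ∀ᵐ s, 0 < M.p z x s → P ((x, z), s) := by
  filter_upwards [M.ae_XZ (Measure.ae_ae_of_ae_compProd h)] with x hx z
  exact (M.ae_post_iff (x, z)).1 (hx z)

theorem measurable_mu (z : Bool) : Measurable fun v : ℝ × 𝒳 => M.mu z v.1 v.2 := by
  have h : Measurable fun a : (𝒳 × Bool) × ℝ => ∫ y, y ∂(M.out a) :=
    measurable_kav M.out (h := fun v => v.2) measurable_snd
  exact h.comp (g := fun a => ∫ y, y ∂(M.out a)) (f := fun v : ℝ × 𝒳 => ((v.2, z), v.1)) (by fun_prop)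

theorem measurable_F (z : Bool) : Measurable fun v : ℝ × 𝒳 => M.F z v.1 v.2 := by
  have h : StronglyMeasurable fun v : (ℝ × 𝒳) × ℝ => (Set.Iic v.1.1).indicator (M.p z v.1.2) v.2 := by
    refine Measurable.stronglyMeasurable ?_
    have : (fun v : (ℝ × 𝒳) × ℝ => (Set.Iic v.1.1).indicator (M.p z v.1.2) v.2) =
        {v : (ℝ × 𝒳) × ℝ | v.2 ≤ v.1.1}.indicator fun v => M.p z v.1.2 v.2 := by
      ext v
      simp [Set.indicator]
    rw [this]
    refine Measurable.indicator ?_ (measurableSet_le measurable_snd (by fun_prop))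
    exact (M.measurable_p z).comp ((measurable_snd.comp measurable_fst).prodMk measurable_snd)
  have := (h.integral_prod_right' (ν := volume)).measurable
  convert this using 2 with v
  rw [F, ← integral_indicator measurableSet_Iic]

theorem F_eq (z : Bool) (s : ℝ) (x : 𝒳) : M.F z s x = (M.postKernel (x, z)).real (Set.Iic s) := by
  rw [F, measureReal_def, M.postKernel_apply, withDensity_apply _ measurableSet_Iic,
    integral_eq_lintegral_of_nonneg_ae (Eventually.of_forall (M.p_nonneg z x))
      (M.measurable_p_right z x).aestronglyMeasurable]

theorem measurable_e {c : ℝ → ℝ → ℝ} (hc : Measurable (Function.uncurry c)) :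
    Measurable fun v : 𝒳 × ℝ × ℝ => M.e c v.2.1 v.2.2 v.1 := by
  unfold e
  refine Measurable.mul (Measurable.mul ?_ ?_) ?_
  · exact hc.comp (((M.measurable_F true).comp (f := fun v : 𝒳 × ℝ × ℝ => (v.2.1, v.1))
      (by fun_prop)).prodMk ((M.measurable_F false).comp (f := fun v : 𝒳 × ℝ × ℝ => (v.2.2, v.1))
      (by fun_prop)))
  · exact (M.measurable_p true).comp (by fun_prop : Measurable fun v : 𝒳 × ℝ × ℝ => (v.1, v.2.1))
  · exact (M.measurable_p false).comp (by fun_prop : Measurable fun v : 𝒳 × ℝ × ℝ => (v.1, v.2.2))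

/-! ### The criterion depends only on the law -/

/-- Uniqueness of disintegration, applied from the outcome down to the covariates. The outcome
kernel is recovered only where `S` has positive density. -/
theorem law_ext [StandardBorelSpace 𝒳] {M M' : ObsModel 𝒳} (h : M.law = M'.law) :
    M.PX = M'.PX ∧ ∀ᵐ x ∂M.PX, ∀ z, M.postKernel (x, z) = M'.postKernel (x, z) ∧
      ∀ᵐ s, 0 < M.p z x s → M.out ((x, z), s) = M'.out ((x, z), s) := by
  obtain ⟨h1, h2⟩ := compProd_ext h
  obtain ⟨h3, h4⟩ := compProd_ext h1
  obtain ⟨h5, -⟩ := compProd_ext h3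
  refine ⟨h5, ?_⟩
  filter_upwards [M.ae_XZS h2, M.ae_XZ h4] with x hx hx' z
  exact ⟨hx' z, hx z⟩

theorem p_ae_eq {M M' : ObsModel 𝒳} {a : 𝒳 × Bool} (h : M.postKernel a = M'.postKernel a) :
    M.p a.2 a.1 =ᵐ[volume] M'.p a.2 a.1 := by
  rw [M.postKernel_apply, M'.postKernel_apply, withDensity_eq_iff
    (M.measurable_p_right _ _).ennreal_ofReal.aemeasurable
    (M'.measurable_p_right _ _).ennreal_ofReal.aemeasurable (by rw [M.lintegral_p]; simp)] at h
  filter_upwards [h] with s hs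
  rwa [ENNReal.ofReal_eq_ofReal_iff (M.p_nonneg _ _ _) (M'.p_nonneg _ _ _)] at hs

theorem e_ae_eq [StandardBorelSpace 𝒳] {M M' : ObsModel 𝒳} (h : M.law = M'.law) (c : ℝ → ℝ → ℝ) :
    ∀ᵐ x ∂M.PX, ∀ᵐ s : ℝ × ℝ, M.e c s.1 s.2 x = M'.e c s.1 s.2 x ∧
      M.e c s.1 s.2 x * M.mu false s.2 x = M'.e c s.1 s.2 x * M'.mu false s.2 x := by
  filter_upwards [(law_ext h).2] with x hx
  have hF : ∀ z s, M.F z s x = M'.F z s x := fun z s => by rw [M.F_eq, M'.F_eq, (hx z).1]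
  have h1 : ∀ᵐ s : ℝ × ℝ, M.p true x s.1 = M'.p true x s.1 :=
    Measure.quasiMeasurePreserving_fst.ae (p_ae_eq (hx true).1)
  have h2 : ∀ᵐ s : ℝ × ℝ, M.p false x s.2 = M'.p false x s.2 :=
    Measure.quasiMeasurePreserving_snd.ae (p_ae_eq (hx false).1)
  have h3 : ∀ᵐ s : ℝ × ℝ, 0 < M.p false x s.2 → M.out ((x, false), s.2) = M'.out ((x, false), s.2) :=
    Measure.quasiMeasurePreserving_snd.ae (hx false).2
  filter_upwards [h1, h2, h3] with s e1 e2 e3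
  have e4 : M.e c s.1 s.2 x = M'.e c s.1 s.2 x := by
    simp only [e, hF, e1, e2]
  refine ⟨e4, ?_⟩
  -- Where `p₀` vanishes the outcome kernels may differ, but both products with `e` are zero.
  rcases (M.p_nonneg false x s.2).eq_or_lt with h0 | h0
  · simp [e, ← h0, ← e2]
  · rw [e4, mu, mu, e3 h0]

/-- A regular submodel prescribes laws only, so this invariance permits replacing its members by
explicit tilts of `M`. -/
theorem loss_eq_of_law_eq [StandardBorelSpace 𝒳] {q : ℕ} {M M' : ObsModel 𝒳} (h : M.law = M'.law)
    {c : ℝ → ℝ → ℝ} (hc : Measurable (Function.uncurry c)) (w : ℝ → ℝ → ℝ)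
    (f : ℝ → ℝ → (Fin q → ℝ) → ℝ) (η : Fin q → ℝ) : M.loss c w f η = M'.loss c w f η := by
  have hPX := (law_ext h).1
  have key : ∀ᵐ s : ℝ × ℝ, ∀ᵐ x ∂M.PX, M.e c s.1 s.2 x = M'.e c s.1 s.2 x ∧
      M.e c s.1 s.2 x * M.mu false s.2 x = M'.e c s.1 s.2 x * M'.mu false s.2 x := by
    refine (Measure.ae_ae_comm ?_).1 (e_ae_eq h c)
    have m1 := M.measurable_e hc
    have m2 := M'.measurable_e hc
    have m3 : Measurable fun v : 𝒳 × ℝ × ℝ => M.mu false v.2.2 v.1 :=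
      (M.measurable_mu false).comp (by fun_prop : Measurable fun v : 𝒳 × ℝ × ℝ => (v.2.2, v.1))
    have m4 : Measurable fun v : 𝒳 × ℝ × ℝ => M'.mu false v.2.2 v.1 :=
      (M'.measurable_mu false).comp (by fun_prop : Measurable fun v : 𝒳 × ℝ × ℝ => (v.2.2, v.1))
    exact (measurableSet_eq_fun m1 m2).inter (measurableSet_eq_fun (m1.mul m3) (m2.mul m4))
  refine lintegral_congr_ae ?_
  filter_upwards [key] with s hs
  have e1 : M.eU c s.1 s.2 = M'.eU c s.1 s.2 := by
    rw [eU, eU, ← hPX]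
    exact integral_congr_ae (hs.mono fun x hx => hx.1)
  have e2 : M.m0 c s.1 s.2 = M'.m0 c s.1 s.2 := by
    rw [m0, m0, e1, ← hPX]
    congr 1
    exact integral_congr_ae (hs.mono fun x hx => hx.2)
  rw [e1, e2]

/-! ### Tilting a member of the model -/

/-- `𝔼(h ∣ X, Z, S)`. -/
def avS (h : Obs 𝒳 → ℝ) : (𝒳 × Bool) × ℝ → ℝ := kav M.out h

/-- `𝔼(h ∣ X, Z)`. -/
def avZ (h : Obs 𝒳 → ℝ) : 𝒳 × Bool → ℝ := kav M.postKernel (M.avS h)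

/-- `𝔼(h ∣ X)`. -/
def avX (h : Obs 𝒳 → ℝ) : 𝒳 → ℝ := kav M.trt (M.avZ h)

theorem integral_avX {h : Obs 𝒳 → ℝ} (hi : Integrable h M.law) :
    ∫ x, M.avX h x ∂M.PX = ∫ v, h v ∂M.law := by
  have i1 : Integrable (M.avS h) ((M.PX ⊗ₘ M.trt) ⊗ₘ M.postKernel) := hi.integral_compProd
  have i2 : Integrable (M.avZ h) (M.PX ⊗ₘ M.trt) := i1.integral_compProd
  rw [law, Measure.integral_compProd hi]
  change _ = ∫ v, M.avS h v ∂_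
  rw [Measure.integral_compProd i1]
  change _ = ∫ v, M.avZ h v ∂_
  rw [Measure.integral_compProd i2]
  rfl

variable {g : Obs 𝒳 → ℝ}

theorem isRatio_avS (hg : IsRatio g) : IsRatio (M.avS g) := hg.kav _

theorem isRatio_avZ (hg : IsRatio g) : IsRatio (M.avZ g) := (M.isRatio_avS hg).kav _

theorem isRatio_avX (hg : IsRatio g) : IsRatio (M.avX g) := (M.isRatio_avZ hg).kav _

/-- The member of the model whose law has density `g` with respect to the law of `M`. -/
def tilt (g : Obs 𝒳 → ℝ) (hg : IsRatio g) (h1 : ∫ v, g v ∂M.law = 1) : ObsModel 𝒳 where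
  PX := M.PX.withDensity fun x => ENNReal.ofReal (M.avX g x)
  isProb := by
    refine ⟨?_⟩
    have hX := M.isRatio_avX hg
    rw [withDensity_apply _ MeasurableSet.univ, Measure.restrict_univ,
      ← ofReal_integral_eq_lintegral_ofReal (hX.integrable _) (Eventually.of_forall fun x =>
        (hX.pos x).le), M.integral_avX (hg.integrable _), h1, ENNReal.ofReal_one]
  trt := tiltKernel M.trt (M.avZ g)
  isMarkov_trt := isMarkovKernel_tilt _ (M.isRatio_avZ hg)
  overlap x := by
    have hZ := M.isRatio_avZ hg
    have hm := isMarkovKernel_tilt M.trt hZ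
    have key : ∀ z : Bool, 0 < (tiltKernel M.trt (M.avZ g) x).real {z} := by
      intro z
      have hne : (M.trt x) {z} ≠ 0 := by
        intro h0
        have := M.trt_singleton_pos x z
        rw [measureReal_def, h0] at this
        simp at this
      refine ENNReal.toReal_pos ?_ (measure_ne_top _ _)
      rw [tiltKernel_apply _ hZ.measurable, withDensity_apply _ (measurableSet_singleton z),
        lintegral_singleton]
      refine mul_ne_zero ?_ hne
      rw [ne_eq, ENNReal.ofReal_eq_zero, not_le]
      exact div_pos (hZ.pos _) ((hZ.kav M.trt).pos x)
    refine ⟨key true, ?_⟩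
    have h2 := probReal_compl_eq_one_sub (μ := tiltKernel M.trt (M.avZ g) x)
      (measurableSet_singleton true)
    rw [show ({true} : Set Bool)ᶜ = {false} by ext b; cases b <;> simp] at h2
    linarith [key false]
  -- The ratio of two successive conditional averages is the likelihood ratio of `S` given `(X, Z)`.
  p z x s := M.avS g ((x, z), s) / M.avZ g (x, z) * M.p z x s
  measurable_p z := by
    refine Measurable.mul (Measurable.div ?_ ?_) (M.measurable_p z)
    · exact (M.isRatio_avS hg).measurable.comp
        (by fun_prop : Measurable fun v : 𝒳 × ℝ => ((v.1, z), v.2))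
    · exact (M.isRatio_avZ hg).measurable.comp (by fun_prop : Measurable fun v : 𝒳 × ℝ => (v.1, z))
  p_nonneg z x s := mul_nonneg
    (div_pos ((M.isRatio_avS hg).pos _) ((M.isRatio_avZ hg).pos _)).le (M.p_nonneg z x s)
  lintegral_p z x := by
    have hS := M.isRatio_avS hg
    have hm := (isMarkovKernel_tilt M.postKernel hS).isProbabilityMeasure (x, z)
    have h2 := hm.measure_univ
    rw [tiltKernel_apply _ hS.measurable, withDensity_apply _ MeasurableSet.univ,
      Measure.restrict_univ, M.lintegral_post] at h2
    · rw [← h2]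
      refine lintegral_congr fun s => ?_
      rw [← ENNReal.ofReal_mul (M.p_nonneg _ _ _), mul_comm]
      rfl
    · exact ((measurable_tilt_density _ hS.measurable).comp measurable_prodMk_left).ennreal_ofReal
  out := tiltKernel M.out g
  isMarkov_out := isMarkovKernel_tilt _ hg

variable (hg : IsRatio g) (h1 : ∫ v, g v ∂M.law = 1)

theorem tilt_postKernel : (M.tilt g hg h1).postKernel = tiltKernel M.postKernel (M.avS g) := by
  have hS := M.isRatio_avS hg
  ext a : 1
  have hm : Measurable fun s => ENNReal.ofReal (M.avS g (a, s) / kav M.postKernel (M.avS g) a) :=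
    ((measurable_tilt_density _ hS.measurable).comp measurable_prodMk_left).ennreal_ofReal
  rw [postKernel_apply, tiltKernel_apply _ hS.measurable, M.postKernel_apply,
    ← withDensity_mul _ (M.measurable_p_right _ _).ennreal_ofReal hm]
  congr 1
  ext s
  rw [Pi.mul_apply, ← ENNReal.ofReal_mul (M.p_nonneg _ _ _), mul_comm]
  rfl

/-- The ratios of the factors telescope: `avX`, `avZ / avX`, `avS / avZ` and `g / avS` multiply to
`g`. -/
theorem tilt_law : (M.tilt g hg h1).law = M.law.withDensity fun v => ENNReal.ofReal (g v) := by
  have e1 := compProd_tilt M.PX M.trt (M.isRatio_avZ hg)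
  have e2 := compProd_tilt (M.PX ⊗ₘ M.trt) M.postKernel (M.isRatio_avS hg)
  have e3 := compProd_tilt ((M.PX ⊗ₘ M.trt) ⊗ₘ M.postKernel) M.out hg
  rw [law, law, tilt_postKernel, ← e3]
  change (((M.PX.withDensity fun x => ENNReal.ofReal (M.avX g x)) ⊗ₘ tiltKernel M.trt (M.avZ g)) ⊗ₘ
    tiltKernel M.postKernel (M.avS g)) ⊗ₘ tiltKernel M.out g = _
  congr 1
  exact (congrArg (· ⊗ₘ tiltKernel M.postKernel (M.avS g)) e1).trans e2

theorem tilt_mu (z : Bool) (s : ℝ) (x : 𝒳) : (M.tilt g hg h1).mu z s x =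
    ∫ y, g (((x, z), s), y) / M.avS g ((x, z), s) * y ∂(M.out ((x, z), s)) :=
  integral_tiltKernel M.out hg _ _

end ObsModel

end

/-! ### The probability integral transform -/

theorem continuous_cdf (P : Measure ℝ) [IsProbabilityMeasure P] [NullSingletonClass P] : Continuous (cdf P) := by
  rw [continuous_iff_continuousAt]
  intro s
  rw [(monotone_cdf P).continuousAt_iff_leftLim_eq_rightLim, StieltjesFunction.rightLim_eq]
  have h1 := (cdf P).measure_singleton s
  rw [measure_cdf, measure_singleton] at h1
  have h2 := (ENNReal.ofReal_eq_zero.1 h1.symm)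
  exact le_antisymm ((monotone_cdf P).leftLim_le le_rfl) (by linarith)

theorem exists_cdf_eq (P : Measure ℝ) [IsProbabilityMeasure P] [NullSingletonClass P] {u : ℝ}
    (hu : u ∈ Set.Ioo (0 : ℝ) 1) : ∃ s, cdf P s = u := by
  refine mem_range_of_exists_le_of_exists_ge (continuous_cdf P) ?_ ?_
  · obtain ⟨s, hs⟩ := ((tendsto_cdf_atBot P).eventually_lt_const hu.1).exists
    exact ⟨s, hs.le⟩
  · obtain ⟨s, hs⟩ := ((tendsto_cdf_atTop P).eventually_const_lt hu.2).exists
    exact ⟨s, hs.le⟩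

/-- The distribution function is continuous without atoms, so every level in `(0, 1)` is attained.
Attained levels slightly above `u` give the upper bound, and the level `u` itself gives the lower
bound, even where the function is flat. -/
theorem measure_cdf_le (P : Measure ℝ) [IsProbabilityMeasure P] [NullSingletonClass P] {u : ℝ}
    (hu : u ∈ Set.Icc (0 : ℝ) 1) : P {s | cdf P s ≤ u} = ENNReal.ofReal u := by
  apply le_antisymm
  · rcases hu.2.eq_or_lt with rfl | h1
    · simpa using prob_le_one
    refine le_of_forall_gt_imp_ge_of_dense fun a ha => ?_
    rcases eq_or_ne a ∞ with rfl | hat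
    · exact le_top
    have ha' : u < a.toReal := (ENNReal.ofReal_lt_iff_lt_toReal hu.1 hat).1 ha
    obtain ⟨u', hu1, hu2⟩ := exists_between (lt_min ha' h1)
    obtain ⟨s, hs⟩ := exists_cdf_eq P (u := u') ⟨hu.1.trans_lt hu1, hu2.trans_le (min_le_right _ _)⟩
    have hsub : {t | cdf P t ≤ u} ⊆ Set.Iic s := by
      intro t ht
      by_contra hlt
      rw [Set.mem_Iic, not_le] at hlt
      have := monotone_cdf P hlt.le
      rw [hs] at this
      exact absurd (this.trans ht) (not_le.2 hu1)
    refine (measure_mono hsub).trans ?_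
    rw [← ofReal_cdf, hs]
    exact (ENNReal.ofReal_le_iff_le_toReal hat).2 (hu2.le.trans (min_le_left _ _))
  · rcases hu.1.eq_or_lt with rfl | h0
    · simp
    rcases hu.2.eq_or_lt with rfl | h1
    · have : {s | cdf P s ≤ 1} = Set.univ := by
        ext s
        simp [cdf_le_one]
      rw [this]
      simp
    obtain ⟨s, hs⟩ := exists_cdf_eq P ⟨h0, h1⟩
    rw [← hs, ofReal_cdf]
    exact measure_mono fun t ht => monotone_cdf P ht

theorem map_cdf (P : Measure ℝ) [IsProbabilityMeasure P] [NullSingletonClass P] :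
    P.map (cdf P) = volume.restrict (Set.Ioo (0 : ℝ) 1) := by
  have hm : Measurable (cdf P) := (monotone_cdf P).measurable
  have : IsProbabilityMeasure (P.map (cdf P)) := Measure.isProbabilityMeasure_map hm.aemeasurable
  refine Measure.ext_of_Iic _ _ fun u => ?_
  rw [Measure.map_apply hm measurableSet_Iic, Measure.restrict_apply measurableSet_Iic]
  change P {s | cdf P s ≤ u} = _
  rcases le_or_gt 1 u with h1 | h1
  · rw [Set.inter_eq_self_of_subset_right fun x hx => hx.2.le.trans h1, Real.volume_Ioo]
    have : {s | cdf P s ≤ u} = Set.univ := by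
      ext s
      simpa using (cdf_le_one P s).trans h1
    rw [this]
    simp
  rcases lt_or_ge u 0 with h0 | h0
  · have e1 : {s | cdf P s ≤ u} = ∅ := by
      ext s
      simpa using h0.trans_le (cdf_nonneg P s)
    have e2 : Set.Iic u ∩ Set.Ioo 0 1 = ∅ := by
      ext s
      simp only [Set.mem_inter_iff, Set.mem_Iic, Set.mem_Ioo, Set.mem_empty_iff_false, iff_false]
      rintro ⟨h2, h3, -⟩
      linarith
    rw [e1, e2]
    simp
  · have e2 : Set.Iic u ∩ Set.Ioo 0 1 = Set.Ioc 0 u := by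
      ext s
      simp only [Set.mem_inter_iff, Set.mem_Iic, Set.mem_Ioo, Set.mem_Ioc]
      constructor
      · rintro ⟨h2, h3, -⟩
        exact ⟨h3, h2⟩
      · rintro ⟨h2, h3⟩
        exact ⟨h3, h2, h3.trans_lt h1⟩
    rw [e2, Real.volume_Ioc, sub_zero, measure_cdf_le P ⟨h0, h1.le⟩]

theorem ae_cdf_mem (P : Measure ℝ) [IsProbabilityMeasure P] [NullSingletonClass P] :
    ∀ᵐ s ∂P, cdf P s ∈ Set.Ioo (0 : ℝ) 1 := by
  have hm : Measurable (cdf P) := (monotone_cdf P).measurable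
  have h : ∀ᵐ u ∂(P.map (cdf P)), u ∈ Set.Ioo (0 : ℝ) 1 := by
    rw [map_cdf]
    exact ae_restrict_mem measurableSet_Ioo
  exact ae_of_ae_map hm.aemeasurable h

/-- A flat piece of the distribution function to the right of `s` carries no mass. Rectangles can
thus be pulled back through the transform although it need not be injective. -/
theorem Iic_ae_eq (P : Measure ℝ) [IsProbabilityMeasure P] [NullSingletonClass P] (s : ℝ) :
    Set.Iic s =ᵐ[P] (cdf P) ⁻¹' Set.Iic (cdf P s) := by
  refine ae_eq_of_subset_of_measure_ge (fun t ht => monotone_cdf P ht) ?_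
    measurableSet_Iic.nullMeasurableSet (measure_ne_top _ _)
  rw [← ofReal_cdf]
  exact (measure_cdf_le P ⟨cdf_nonneg P s, cdf_le_one P s⟩).le

/-! ### Copulas -/

theorem measure_ext_Iic_prod {μ ν : Measure (ℝ × ℝ)} [IsFiniteMeasure μ]
    (h : ∀ s t, μ (Set.Iic s ×ˢ Set.Iic t) = ν (Set.Iic s ×ˢ Set.Iic t))
    (huniv : μ Set.univ = ν Set.univ) : μ = ν := by
  have hsp : IsCountablySpanning (Set.range (Set.Iic : ℝ → Set ℝ)) :=
    ⟨fun n : ℕ => Set.Iic (n : ℝ), fun n => ⟨n, rfl⟩, by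
      ext x
      obtain ⟨n, hn⟩ := exists_nat_ge x
      simpa using ⟨n, hn⟩⟩
  have hg : MeasurableSpace.generateFrom (Set.range (Set.Iic : ℝ → Set ℝ)) =
      (inferInstance : MeasurableSpace ℝ) := by
    rw [← borel_eq_generateFrom_Iic, BorelSpace.measurable_eq (α := ℝ)]
  refine ext_of_generate_finite _ (generateFrom_eq_prod hg hg hsp hsp).symm
    (isPiSystem_Iic.prod isPiSystem_Iic) ?_ huniv
  rintro _ ⟨_, ⟨s, rfl⟩, _, ⟨t, rfl⟩, rfl⟩
  exact h s t

namespace IsCopulaDensity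

variable {c : ℝ → ℝ → ℝ} (hc : IsCopulaDensity c)
include hc

/-- A nonintegrable `c` would have Bochner integral `0` over the square, contradicting the margin
condition at `1`. -/
theorem integrableOn : IntegrableOn (fun a : ℝ × ℝ => c a.1 a.2) (Set.Ioo 0 1 ×ˢ Set.Ioo 0 1) := by
  by_contra h
  have h1 := hc.margin_left 1 (by simp)
  rw [copulaCDF, integral_undef h] at h1
  exact zero_ne_one h1

theorem lintegral_eq {u v : ℝ} (hu : u ≤ 1) (hv : v ≤ 1) :
    ∫⁻ a in Set.Ioo 0 u ×ˢ Set.Ioo 0 v, ENNReal.ofReal (c a.1 a.2) =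
      ENNReal.ofReal (copulaCDF c u v) := by
  have hsub : Set.Ioo 0 u ×ˢ Set.Ioo 0 v ⊆ Set.Ioo (0 : ℝ) 1 ×ˢ Set.Ioo (0 : ℝ) 1 :=
    Set.prod_mono (Set.Ioo_subset_Ioo_right hu) (Set.Ioo_subset_Ioo_right hv)
  rw [copulaCDF, ofReal_integral_eq_lintegral_ofReal (hc.integrableOn.mono_set hsub)]
  filter_upwards [ae_restrict_mem (measurableSet_Ioo.prod measurableSet_Ioo)] with a ha
  exact hc.nonneg _ (hsub ha).1 _ (hsub ha).2

end IsCopulaDensity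

theorem restrict_Ioo_restrict_Iic (u : ℝ) (hu : u ≤ 1) :
    (volume.restrict (Set.Ioo (0 : ℝ) 1)).restrict (Set.Iic u) = volume.restrict (Set.Ioo 0 u) := by
  rw [Measure.restrict_restrict measurableSet_Iic]
  rcases hu.eq_or_lt with rfl | h
  · rw [Set.inter_eq_self_of_subset_right fun x hx => hx.2.le]
  · have : Set.Iic u ∩ Set.Ioo 0 1 = Set.Ioc 0 u := by
      ext s
      simp only [Set.mem_inter_iff, Set.mem_Iic, Set.mem_Ioo, Set.mem_Ioc]
      constructor
      · rintro ⟨h2, h3, -⟩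
        exact ⟨h3, h2⟩
      · rintro ⟨h2, h3⟩
        exact ⟨h3, h2, h3.trans_lt h⟩
    rw [this, Measure.restrict_congr_set Ioo_ae_eq_Ioc.symm]

/-- The probability integral transform maps the product measure to Lebesgue measure on the square
and, up to a null set, the quadrant to a rectangle at the origin, over which `c` integrates to the
copula function. -/
theorem lintegral_copula_Iic {c : ℝ → ℝ → ℝ} (hc : IsCopulaDensity c) (P P' : Measure ℝ)
    [IsProbabilityMeasure P] [NullSingletonClass P] [IsProbabilityMeasure P'] [NullSingletonClass P'] (s t : ℝ) :
    ∫⁻ a in Set.Iic s ×ˢ Set.Iic t, ENNReal.ofReal (c (cdf P a.1) (cdf P' a.2)) ∂(P.prod P') =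
      ENNReal.ofReal (copulaCDF c (cdf P s) (cdf P' t)) := by
  have hm : Measurable (cdf P) := (monotone_cdf P).measurable
  have hm' : Measurable (cdf P') := (monotone_cdf P').measurable
  have hcm : Measurable fun a : ℝ × ℝ => ENNReal.ofReal (c a.1 a.2) :=
    hc.measurable.ennreal_ofReal
  have hset : (Set.Iic s ×ˢ Set.Iic t : Set (ℝ × ℝ)) =ᵐ[P.prod P']
      (Prod.map (cdf P) (cdf P')) ⁻¹' (Set.Iic (cdf P s) ×ˢ Set.Iic (cdf P' t)) := by
    have h1 := Measure.quasiMeasurePreserving_fst (μ := P) (ν := P') |>.preimage_ae_eq (Iic_ae_eq P s)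
    have h2 := Measure.quasiMeasurePreserving_snd (μ := P) (ν := P') |>.preimage_ae_eq (Iic_ae_eq P' t)
    exact h1.inter h2
  rw [Measure.restrict_congr_set hset]
  have h3 := setLIntegral_map (μ := P.prod P') (g := Prod.map (cdf P) (cdf P'))
    (s := Set.Iic (cdf P s) ×ˢ Set.Iic (cdf P' t)) (measurableSet_Iic.prod measurableSet_Iic) hcm
    (hm.prodMap hm')
  have h4 : ∫⁻ a in Prod.map (cdf P) (cdf P') ⁻¹' (Set.Iic (cdf P s) ×ˢ Set.Iic (cdf P' t)),
      ENNReal.ofReal (c (cdf P a.1) (cdf P' a.2)) ∂(P.prod P') =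
      ∫⁻ a in Set.Iic (cdf P s) ×ˢ Set.Iic (cdf P' t), ENNReal.ofReal (c a.1 a.2)
        ∂((P.prod P').map (Prod.map (cdf P) (cdf P'))) := h3.symm
  rw [h4, ← Measure.map_prod_map _ _ hm hm', map_cdf, map_cdf, ← Measure.prod_restrict,
    restrict_Ioo_restrict_Iic _ (cdf_le_one P s), restrict_Ioo_restrict_Iic _ (cdf_le_one P' t),
    Measure.prod_restrict, ← Measure.volume_eq_prod, hc.lintegral_eq (cdf_le_one P s) (cdf_le_one P' t)]

theorem lintegral_copula {c : ℝ → ℝ → ℝ} (hc : IsCopulaDensity c) (P P' : Measure ℝ)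
    [IsProbabilityMeasure P] [NullSingletonClass P] [IsProbabilityMeasure P'] [NullSingletonClass P'] :
    ∫⁻ a, ENNReal.ofReal (c (cdf P a.1) (cdf P' a.2)) ∂(P.prod P') = 1 := by
  have hm : Measurable (cdf P) := (monotone_cdf P).measurable
  have hm' : Measurable (cdf P') := (monotone_cdf P').measurable
  have hcm : Measurable fun a : ℝ × ℝ => ENNReal.ofReal (c a.1 a.2) :=
    hc.measurable.ennreal_ofReal
  have h3 := lintegral_map (μ := P.prod P') hcm (hm.prodMap hm')
  have h4 : ∫⁻ a, ENNReal.ofReal (c (cdf P a.1) (cdf P' a.2)) ∂(P.prod P') =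
      ∫⁻ a, ENNReal.ofReal (c a.1 a.2) ∂((P.prod P').map (Prod.map (cdf P) (cdf P'))) := h3.symm
  rw [h4, ← Measure.map_prod_map _ _ hm hm', map_cdf, map_cdf,
    Measure.prod_restrict, ← Measure.volume_eq_prod, hc.lintegral_eq le_rfl le_rfl,
    hc.margin_left 1 (by simp), ENNReal.ofReal_one]

namespace ObsModel

variable {𝒳 : Type*} [MeasurableSpace 𝒳] (M : ObsModel 𝒳)

instance (a : 𝒳 × Bool) : NullSingletonClass (M.postKernel a) := by
  rw [M.postKernel_apply]
  infer_instance

theorem F_eq_cdf (z : Bool) (s : ℝ) (x : 𝒳) : M.F z s x = cdf (M.postKernel (x, z)) s := by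
  rw [F_eq, cdf_eq_real]

theorem ae_F_mem (z : Bool) (x : 𝒳) : ∀ᵐ s, 0 < M.p z x s → M.F z s x ∈ Set.Ioo (0 : ℝ) 1 := by
  simp_rw [F_eq_cdf]
  exact (M.ae_post_iff (x, z)).1 (ae_cdf_mem _)

theorem ae_F_mem_prod (x : 𝒳) : ∀ᵐ s : ℝ × ℝ, 0 < M.p true x s.1 → 0 < M.p false x s.2 →
    M.F true s.1 x ∈ Set.Ioo (0 : ℝ) 1 ∧ M.F false s.2 x ∈ Set.Ioo (0 : ℝ) 1 := by
  filter_upwards [Measure.quasiMeasurePreserving_fst.ae (M.ae_F_mem true x),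
    Measure.quasiMeasurePreserving_snd.ae (M.ae_F_mem false x)] with s h1 h2 h3 h4
  exact ⟨h1 h3, h2 h4⟩

/-- The sign of `c` is known only inside the open square. The distribution functions leave it only
on a set where a density vanishes almost everywhere. -/
theorem ae_e_nonneg {c : ℝ → ℝ → ℝ} (hc : IsCopulaDensity c) (x : 𝒳) :
    ∀ᵐ s : ℝ × ℝ, 0 ≤ M.e c s.1 s.2 x := by
  filter_upwards [M.ae_F_mem_prod x] with s hs
  rcases (M.p_nonneg true x s.1).eq_or_lt with h1 | h1
  · simp [e, ← h1]
  rcases (M.p_nonneg false x s.2).eq_or_lt with h2 | h2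
  · simp [e, ← h2]
  exact mul_nonneg (mul_nonneg (hc.nonneg _ (hs h1 h2).1 _ (hs h1 h2).2) h1.le) h2.le

theorem withDensity_e {c : ℝ → ℝ → ℝ} (hc : IsCopulaDensity c) (x : 𝒳) :
    (volume : Measure (ℝ × ℝ)).withDensity (fun s => ENNReal.ofReal (M.e c s.1 s.2 x)) =
      ((M.postKernel (x, true)).prod (M.postKernel (x, false))).withDensity
        (fun s => ENNReal.ofReal (c (cdf (M.postKernel (x, true)) s.1)
          (cdf (M.postKernel (x, false)) s.2))) := by
  have hm : Measurable (cdf (M.postKernel (x, true))) := (monotone_cdf _).measurable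
  have hm' : Measurable (cdf (M.postKernel (x, false))) := (monotone_cdf _).measurable
  have h1 : (M.postKernel (x, true)).prod (M.postKernel (x, false)) =
      (volume : Measure (ℝ × ℝ)).withDensity
        (fun s => ENNReal.ofReal (M.p true x s.1) * ENNReal.ofReal (M.p false x s.2)) := by
    rw [M.postKernel_apply, M.postKernel_apply, prod_withDensity
      (M.measurable_p_right _ _).ennreal_ofReal (M.measurable_p_right _ _).ennreal_ofReal]
    rfl
  have hcm : Measurable fun s : ℝ × ℝ => ENNReal.ofReal (c (cdf (M.postKernel (x, true)) s.1)
          (cdf (M.postKernel (x, false)) s.2)) :=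
    (hc.measurable.comp (hm.prodMap hm')).ennreal_ofReal
  rw [h1, ← withDensity_mul _ _ hcm]
  · congr 1
    ext s
    simp only [Pi.mul_apply]
    rw [e, F_eq_cdf, F_eq_cdf, ENNReal.ofReal_mul' (M.p_nonneg _ _ _),
      ENNReal.ofReal_mul' (M.p_nonneg _ _ _)]
    ring
  · exact ((M.measurable_p_right _ _).comp measurable_fst).ennreal_ofReal.mul
      ((M.measurable_p_right _ _).comp measurable_snd).ennreal_ofReal

theorem withDensity_e_Iic {c : ℝ → ℝ → ℝ} (hc : IsCopulaDensity c) (x : 𝒳) (s t : ℝ) :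
    (volume : Measure (ℝ × ℝ)).withDensity (fun s => ENNReal.ofReal (M.e c s.1 s.2 x))
      (Set.Iic s ×ˢ Set.Iic t) = ENNReal.ofReal (copulaCDF c (M.F true s x) (M.F false t x)) := by
  rw [M.withDensity_e hc, withDensity_apply _ (measurableSet_Iic.prod measurableSet_Iic),
    lintegral_copula_Iic hc, F_eq_cdf, F_eq_cdf]

theorem lintegral_e {c : ℝ → ℝ → ℝ} (hc : IsCopulaDensity c) (x : 𝒳) :
    ∫⁻ s : ℝ × ℝ, ENNReal.ofReal (M.e c s.1 s.2 x) = 1 := by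
  have h := congrArg (fun ν : Measure (ℝ × ℝ) => ν Set.univ) (M.withDensity_e hc x)
  simp only [withDensity_apply _ MeasurableSet.univ, Measure.restrict_univ] at h
  rw [h, lintegral_copula hc]

/-! ### Bias and variance -/

/-- The criterion `∬ w (μ₀ - f)² e` before averaging `μ₀` over the covariates. -/
def fullLoss {q : ℕ} (c w : ℝ → ℝ → ℝ) (f : ℝ → ℝ → (Fin q → ℝ) → ℝ) (η : Fin q → ℝ) : ℝ≥0∞ :=
  ∫⁻ x, (∫⁻ s : ℝ × ℝ, ENNReal.ofReal
    (w s.1 s.2 * (M.mu false s.2 x - f s.1 s.2 η) ^ 2 * M.e c s.1 s.2 x)) ∂M.PX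

/-- The conditional variance part of the criterion. -/
def varLoss (c w : ℝ → ℝ → ℝ) : ℝ≥0∞ :=
  ∫⁻ s : ℝ × ℝ, ∫⁻ x, ENNReal.ofReal
    (w s.1 s.2 * (M.mu false s.2 x - M.m0 c s.1 s.2) ^ 2 * M.e c s.1 s.2 x) ∂M.PX

theorem measurable_mu' : Measurable fun v : 𝒳 × ℝ × ℝ => M.mu false v.2.2 v.1 :=
  (M.measurable_mu false).comp (by fun_prop : Measurable fun v : 𝒳 × ℝ × ℝ => (v.2.2, v.1))

/-- For each `x` the density `e` has total mass one, so Tonelli's theorem makes its average over `x`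
finite for almost every stratum. -/
theorem ae_integrable_e {c : ℝ → ℝ → ℝ} (hc : IsCopulaDensity c) :
    ∀ᵐ s : ℝ × ℝ, (∀ᵐ x ∂M.PX, 0 ≤ M.e c s.1 s.2 x) ∧
      Integrable (fun x => M.e c s.1 s.2 x) M.PX := by
  have hme := M.measurable_e hc.measurable
  have h1 : ∀ᵐ s : ℝ × ℝ, ∀ᵐ x ∂M.PX, 0 ≤ M.e c s.1 s.2 x := by
    refine (Measure.ae_ae_comm ?_).1 (Eventually.of_forall fun x => M.ae_e_nonneg hc x)
    exact measurableSet_le measurable_const hme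
  have h2 : ∫⁻ s : ℝ × ℝ, ∫⁻ x, ENNReal.ofReal (M.e c s.1 s.2 x) ∂M.PX = 1 := by
    rw [← lintegral_lintegral_swap (f := fun x (s : ℝ × ℝ) => ENNReal.ofReal (M.e c s.1 s.2 x))
      hme.ennreal_ofReal.aemeasurable]
    simp [M.lintegral_e hc]
  have h3 : ∀ᵐ s : ℝ × ℝ, ∫⁻ x, ENNReal.ofReal (M.e c s.1 s.2 x) ∂M.PX < ∞ :=
    ae_lt_top' (Measurable.lintegral_prod_left'
      (f := fun v : 𝒳 × ℝ × ℝ => ENNReal.ofReal (M.e c v.2.1 v.2.2 v.1))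
      hme.ennreal_ofReal).aemeasurable (by rw [h2]; exact ENNReal.one_ne_top)
  filter_upwards [h1, h3] with s hs1 hs3
  refine ⟨hs1, (hme.comp measurable_prodMk_right).aestronglyMeasurable, ?_⟩
  rw [hasFiniteIntegral_iff_ofReal hs1]
  exact hs3

/-- Pointwise bias-variance decomposition. -/
theorem lintegral_sq_sub {α : Type*} [MeasurableSpace α] (ν : Measure α) {ε μ : α → ℝ} {W a : ℝ}
    (hε : ∀ᵐ x ∂ν, 0 ≤ ε x) (hεi : Integrable ε ν) (hμ : Measurable μ) (hW : 0 ≤ W)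
    (hμi : Integrable (fun x => ε x * μ x ^ 2) ν) :
    ENNReal.ofReal (W * ((∫ x, ε x * μ x ∂ν) / (∫ x, ε x ∂ν) - a) ^ 2 * ∫ x, ε x ∂ν) +
      ∫⁻ x, ENNReal.ofReal (W * (μ x - (∫ x, ε x * μ x ∂ν) / (∫ x, ε x ∂ν)) ^ 2 * ε x) ∂ν =
    ∫⁻ x, ENNReal.ofReal (W * (μ x - a) ^ 2 * ε x) ∂ν := by
  have hi1 : Integrable (fun x => ε x * μ x) ν := by
    refine Integrable.mono' (hεi.add hμi) (hεi.aestronglyMeasurable.mul hμ.aestronglyMeasurable) ?_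
    filter_upwards [hε] with x hx
    rw [Real.norm_eq_abs, abs_mul, abs_of_nonneg hx]
    simp only [Pi.add_apply]
    nlinarith [sq_nonneg (|μ x| - 1), sq_abs (μ x), abs_nonneg (μ x)]
  have hq : ∀ a, Integrable (fun x => W * (μ x - a) ^ 2 * ε x) ν := by
    intro a
    have e : (fun x => W * (μ x - a) ^ 2 * ε x) =
        fun x => W * (ε x * μ x ^ 2 - 2 * a * (ε x * μ x) + a ^ 2 * ε x) := by
      ext x
      ring
    rw [e]
    exact ((hμi.sub (hi1.const_mul _)).add (hεi.const_mul _)).const_mul _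
  have hval : ∀ a, ∫ x, W * (μ x - a) ^ 2 * ε x ∂ν =
      W * ((∫ x, ε x * μ x ^ 2 ∂ν) - 2 * a * (∫ x, ε x * μ x ∂ν) + a ^ 2 * ∫ x, ε x ∂ν) := by
    intro a
    have e : (fun x => W * (μ x - a) ^ 2 * ε x) =
        fun x => W * (ε x * μ x ^ 2 - 2 * a * (ε x * μ x) + a ^ 2 * ε x) := by
      ext x
      ring
    have hs : Integrable (fun x => ε x * μ x ^ 2 - 2 * a * (ε x * μ x)) ν :=
      hμi.sub (hi1.const_mul _)
    rw [e, integral_const_mul, integral_add hs (hεi.const_mul _),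
      integral_sub hμi (hi1.const_mul _), integral_const_mul, integral_const_mul]
  have hn : ∀ a, ∀ᵐ x ∂ν, 0 ≤ W * (μ x - a) ^ 2 * ε x := fun a => by
    filter_upwards [hε] with x hx
    positivity
  have hI : 0 ≤ ∫ x, ε x ∂ν := integral_nonneg_of_ae hε
  rw [← ofReal_integral_eq_lintegral_ofReal (hq _) (hn _),
    ← ofReal_integral_eq_lintegral_ofReal (hq _) (hn _),
    ← ENNReal.ofReal_add (by positivity) (integral_nonneg_of_ae (hn _)), hval, hval]
  congr 1
  -- With zero total weight the quotient has the value `0` by convention, but every integral with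
  -- weight `ε` vanishes too.
  rcases hI.eq_or_lt with h0 | h0
  · have hz : ε =ᵐ[ν] 0 := (integral_eq_zero_iff_of_nonneg_ae hε hεi).1 h0.symm
    have hz1 : ∫ x, ε x * μ x ∂ν = 0 := by
      rw [integral_congr_ae (g := fun _ => 0) (hz.mono fun x hx => by simp [hx])]
      simp
    rw [← h0, hz1]
    ring
  · field_simp
    ring

/-- For each stratum, the `e`-weighted mean square of `μ₀ - f` splits into the squared bias of the
weighted mean `m₀` and a variance free of `f` and `η`. The moment hypothesis makes the cross terms
integrable. -/
theorem loss_add_varLoss {q : ℕ} {c : ℝ → ℝ → ℝ} (hc : IsCopulaDensity c) {w : ℝ → ℝ → ℝ}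
    (hw : Measurable (Function.uncurry w)) (hw0 : ∀ s₁ s₀, 0 ≤ w s₁ s₀)
    {f : ℝ → ℝ → (Fin q → ℝ) → ℝ} (hf : ∀ η, Measurable fun s : ℝ × ℝ => f s.1 s.2 η)
    (h2 : ∫⁻ x, (∫⁻ s : ℝ × ℝ, ENNReal.ofReal
      (w s.1 s.2 * M.mu false s.2 x ^ 2 * M.e c s.1 s.2 x)) ∂M.PX < ∞) (η : Fin q → ℝ) :
    M.loss c w f η + M.varLoss c w = M.fullLoss c w f η := by
  have hme := M.measurable_e hc.measurable
  have hmu := M.measurable_mu'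
  have hw' : Measurable fun v : 𝒳 × ℝ × ℝ => w v.2.1 v.2.2 := hw.comp measurable_snd
  have hf' : Measurable fun v : 𝒳 × ℝ × ℝ => f v.2.1 v.2.2 η := (hf η).comp measurable_snd
  have hA1 : Measurable fun v : 𝒳 × ℝ × ℝ => ENNReal.ofReal
      (w v.2.1 v.2.2 * M.mu false v.2.2 v.1 ^ 2 * M.e c v.2.1 v.2.2 v.1) :=
    ((hw'.mul (hmu.pow_const 2)).mul hme).ennreal_ofReal
  have hA2 : Measurable fun v : 𝒳 × ℝ × ℝ => ENNReal.ofReal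
      (w v.2.1 v.2.2 * (M.mu false v.2.2 v.1 - f v.2.1 v.2.2 η) ^ 2 * M.e c v.2.1 v.2.2 v.1) :=
    ((hw'.mul ((hmu.sub hf').pow_const 2)).mul hme).ennreal_ofReal
  have hmom : ∀ᵐ s : ℝ × ℝ, ∫⁻ x, ENNReal.ofReal
      (w s.1 s.2 * M.mu false s.2 x ^ 2 * M.e c s.1 s.2 x) ∂M.PX < ∞ := by
    refine ae_lt_top' (hA1.lintegral_prod_left' (μ := M.PX)).aemeasurable ?_
    rw [← lintegral_lintegral_swap (f := fun x (s : ℝ × ℝ) => ENNReal.ofReal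
      (w s.1 s.2 * M.mu false s.2 x ^ 2 * M.e c s.1 s.2 x))
      hA1.aemeasurable]
    exact h2.ne
  have heU : Measurable fun s : ℝ × ℝ => M.eU c s.1 s.2 :=
    (StronglyMeasurable.integral_prod_left' (f := fun v : 𝒳 × ℝ × ℝ => M.e c v.2.1 v.2.2 v.1)
      hme.stronglyMeasurable).measurable
  have hm0 : Measurable fun s : ℝ × ℝ => M.m0 c s.1 s.2 :=
    (StronglyMeasurable.integral_prod_left'
      (f := fun v : 𝒳 × ℝ × ℝ => M.e c v.2.1 v.2.2 v.1 * M.mu false v.2.2 v.1)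
      (hme.mul hmu).stronglyMeasurable).measurable.div heU
  have hml : Measurable fun s : ℝ × ℝ => ENNReal.ofReal
      (w s.1 s.2 * (M.m0 c s.1 s.2 - f s.1 s.2 η) ^ 2 * M.eU c s.1 s.2) :=
    ((hw.mul ((hm0.sub (hf η)).pow_const 2)).mul heU).ennreal_ofReal
  rw [loss, varLoss, fullLoss, ← lintegral_add_left hml,
    lintegral_lintegral_swap (f := fun x (s : ℝ × ℝ) => ENNReal.ofReal
      (w s.1 s.2 * (M.mu false s.2 x - f s.1 s.2 η) ^ 2 * M.e c s.1 s.2 x))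
      hA2.aemeasurable]
  refine lintegral_congr_ae ?_
  filter_upwards [M.ae_integrable_e hc, hmom] with s hs hs2
  rcases (hw0 s.1 s.2).eq_or_lt with h0 | h0
  · simp [← h0]
  refine lintegral_sq_sub M.PX hs.1 hs.2 (hmu.comp measurable_prodMk_right) h0.le ?_
  have hmeas : Measurable fun x => M.e c s.1 s.2 x * M.mu false s.2 x ^ 2 :=
    ((hme.mul (hmu.pow_const 2))).comp measurable_prodMk_right
  refine ⟨hmeas.aestronglyMeasurable, ?_⟩
  rw [hasFiniteIntegral_iff_ofReal (hs.1.mono fun x hx => by positivity)]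
  have hcw : ∫⁻ x, ENNReal.ofReal (w s.1 s.2 * M.mu false s.2 x ^ 2 * M.e c s.1 s.2 x) ∂M.PX =
      ENNReal.ofReal (w s.1 s.2) *
        ∫⁻ x, ENNReal.ofReal (M.e c s.1 s.2 x * M.mu false s.2 x ^ 2) ∂M.PX := by
    rw [← lintegral_const_mul _ hmeas.ennreal_ofReal]
    refine lintegral_congr fun x => ?_
    rw [← ENNReal.ofReal_mul h0.le]
    congr 1
    ring
  rw [hcw] at hs2
  exact (ENNReal.lt_top_of_mul_ne_top_right hs2.ne (by simpa using h0))

end ObsModel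

section

/-! ### Identification -/

section Density

variable {α : Type*} [MeasurableSpace α] {μ : Measure α} {ε : α → ℝ}

theorem integral_withDensity_ofReal (hm : Measurable ε) (h0 : ∀ᵐ x ∂μ, 0 ≤ ε x) (h : α → ℝ) :
    ∫ x, h x ∂(μ.withDensity fun x => ENNReal.ofReal (ε x)) = ∫ x, ε x * h x ∂μ := by
  rw [integral_withDensity_eq_integral_toReal_smul hm.ennreal_ofReal
    (Eventually.of_forall fun _ => ENNReal.ofReal_lt_top)]
  refine integral_congr_ae (h0.mono fun x hx => ?_)
  simp only [smul_eq_mul]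
  rw [ENNReal.toReal_ofReal hx]

theorem integrable_withDensity_ofReal (hm : Measurable ε) (h0 : ∀ᵐ x ∂μ, 0 ≤ ε x) {h : α → ℝ} :
    Integrable h (μ.withDensity fun x => ENNReal.ofReal (ε x)) ↔ Integrable (fun x => ε x * h x) μ := by
  rw [integrable_withDensity_iff_integrable_smul' hm.ennreal_ofReal
    (Eventually.of_forall fun _ => ENNReal.ofReal_lt_top)]
  refine integrable_congr (h0.mono fun x hx => ?_)
  simp only [smul_eq_mul]
  rw [ENNReal.toReal_ofReal hx]

end Density

namespace Full

variable {𝒳 : Type*} [MeasurableSpace 𝒳]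

theorem measurable_trt : Measurable (trt : Full 𝒳 → Bool) := measurable_fst.comp measurable_snd
theorem measurable_U : Measurable (U : Full 𝒳 → ℝ × ℝ) :=
  measurable_fst.comp (measurable_snd.comp measurable_snd)
theorem measurable_S1 : Measurable (S1 : Full 𝒳 → ℝ) := measurable_fst.comp measurable_U
theorem measurable_S0 : Measurable (S0 : Full 𝒳 → ℝ) := measurable_snd.comp measurable_U
theorem measurable_Y : Measurable fun ω : Full 𝒳 => ω.2.2.2 :=
  measurable_snd.comp (measurable_snd.comp measurable_snd)
theorem measurable_Y1 : Measurable (Y1 : Full 𝒳 → ℝ) := measurable_fst.comp measurable_Y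
theorem measurable_Y0 : Measurable (Y0 : Full 𝒳 → ℝ) := measurable_snd.comp measurable_Y

/-- All the potential values. -/
def pot (ω : Full 𝒳) : ℝ × ℝ × ℝ × ℝ := (ω.S0, ω.S1, ω.Y0, ω.Y1)

theorem measurable_pot : Measurable (pot : Full 𝒳 → ℝ × ℝ × ℝ × ℝ) :=
  measurable_S0.prodMk (measurable_S1.prodMk (measurable_Y0.prodMk measurable_Y1))

/-- The potential post-treatment value and outcome under a treatment. -/
def sel (z : Bool) (w : ℝ × ℝ × ℝ × ℝ) : ℝ × ℝ := if z then (w.2.1, w.2.2.2) else (w.1, w.2.2.1)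

theorem measurable_sel_joint : Measurable fun v : Bool × (ℝ × ℝ × ℝ × ℝ) => sel v.1 v.2 := by
  unfold sel
  exact Measurable.ite (measurable_fst (measurableSet_singleton true)) (by fun_prop) (by fun_prop)

theorem measurable_sel (z : Bool) : Measurable (sel z) :=
  measurable_sel_joint.comp measurable_prodMk_left

omit [MeasurableSpace 𝒳] in
theorem obs_eq (ω : Full 𝒳) :
    ω.obs = (((ω.cov, ω.trt), (sel ω.trt ω.pot).1), (sel ω.trt ω.pot).2) := by
  unfold obs sel pot
  cases ω.trt <;> simp

end Full

section Causal

variable {𝒳 : Type*} [MeasurableSpace 𝒳] [StandardBorelSpace 𝒳] {c : ℝ → ℝ → ℝ}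
  {Q : Measure (Full 𝒳)} [IsProbabilityMeasure Q] {M : ObsModel 𝒳}

omit [StandardBorelSpace 𝒳] in
theorem measurable_obs : Measurable (Full.obs : Full 𝒳 → Obs 𝒳) := by
  have h : (Full.obs : Full 𝒳 → Obs 𝒳) = fun ω =>
      (((ω.cov, ω.trt), (Full.sel ω.trt ω.pot).1), (Full.sel ω.trt ω.pot).2) := by
    ext1 ω
    exact ω.obs_eq
  have hs : Measurable fun ω : Full 𝒳 => Full.sel ω.trt ω.pot :=
    Full.measurable_sel_joint.comp (Full.measurable_trt.prodMk Full.measurable_pot)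
  rw [h]
  exact ((Full.measurable_cov.prodMk Full.measurable_trt).prodMk (measurable_fst.comp hs)).prodMk
    (measurable_snd.comp hs)

omit [StandardBorelSpace 𝒳] [IsProbabilityMeasure Q] in
theorem map_cov_trt (hM : Q.map Full.obs = M.law) :
    Q.map (fun ω => (ω.cov, ω.trt)) = M.PX ⊗ₘ M.trt := by
  have h : Q.map (fun ω => (ω.cov, ω.trt)) = (Q.map Full.obs).fst.fst := by
    rw [Measure.fst, Measure.fst, Measure.map_map measurable_fst measurable_fst,
      Measure.map_map (measurable_fst.comp measurable_fst) measurable_obs]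
    rfl
  rw [h, hM, ObsModel.law, Measure.fst_compProd, Measure.fst_compProd]

omit [StandardBorelSpace 𝒳] [IsProbabilityMeasure Q] in
theorem map_cov (hM : Q.map Full.obs = M.law) : Q.map Full.cov = M.PX := by
  have h : Q.map Full.cov = (Q.map (fun ω => (ω.cov, ω.trt))).fst := by
    rw [Measure.fst, Measure.map_map measurable_fst
      (Full.measurable_cov.prodMk Full.measurable_trt)]
    rfl
  rw [h, map_cov_trt hM, Measure.fst_compProd]

/-- Treatment ignorability: the conditional law of the potential values under each arm. -/
theorem ae_map_sel (hQ : IsCausalLaw c Q) (hM : Q.map Full.obs = M.law) :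
    ∀ᵐ x ∂M.PX, ∀ z, (condDistrib Full.pot Full.cov Q x).map (Full.sel z) =
      (M.postKernel ⊗ₖ M.out) (x, z) := by
  have hct : Measurable fun ω : Full 𝒳 => (ω.cov, ω.trt) :=
    Full.measurable_cov.prodMk Full.measurable_trt
  have h1 : condDistrib Full.pot (fun ω => (ω.cov, ω.trt)) Q =ᵐ[Q.map fun ω => (ω.cov, ω.trt)]
      (condDistrib Full.pot Full.cov Q).prodMkRight Bool :=
    (condIndepFun_iff_condDistrib_prod_ae_eq_prodMkRight Full.measurable_pot Full.measurable_trt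
      Full.measurable_cov).1 hQ.ignorability
  set κ := condDistrib Full.pot Full.cov Q with hκ
  have h2 : Q.map (fun ω => ((ω.cov, ω.trt), ω.pot)) = (M.PX ⊗ₘ M.trt) ⊗ₘ κ.prodMkRight Bool := by
    rw [← compProd_map_condDistrib Full.measurable_pot.aemeasurable, Measure.compProd_congr h1,
      map_cov_trt hM]
  have ht : MeasurableSet {a : 𝒳 × Bool | a.2 = true} := measurable_snd (measurableSet_singleton true)
  have hmk : ∀ z, IsMarkovKernel ((κ.prodMkRight Bool).map (Full.sel z)) := fun z =>
    Kernel.IsMarkovKernel.map _ (Full.measurable_sel z)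
  have := hmk true
  have := hmk false
  classical
  -- The conditional laws of the selected potential values in the two arms are glued into one kernel
  -- given `(X, Z)`. Uniqueness of disintegration then compares it with `postKernel ⊗ₖ out`.
  set κ' := Kernel.piecewise ht ((κ.prodMkRight Bool).map (Full.sel true))
    ((κ.prodMkRight Bool).map (Full.sel false)) with hκ'
  have hκ'a : ∀ a, κ' a = (κ a.1).map (Full.sel a.2) := by
    intro a
    rw [hκ', Kernel.piecewise_apply]
    rcases a with ⟨x, z⟩
    cases z
    · simp [Kernel.map_apply _ (Full.measurable_sel false), Kernel.prodMkRight_apply]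
    · simp [Kernel.map_apply _ (Full.measurable_sel true), Kernel.prodMkRight_apply]
  have hs : Measurable fun v : (𝒳 × Bool) × (ℝ × ℝ × ℝ × ℝ) => (v.1, Full.sel v.1.2 v.2) :=
    measurable_fst.prodMk (Full.measurable_sel_joint.comp
      (by fun_prop : Measurable fun v : (𝒳 × Bool) × (ℝ × ℝ × ℝ × ℝ) => (v.1.2, v.2)))
  have h3 : Q.map (fun ω => ((ω.cov, ω.trt), Full.sel ω.trt ω.pot)) = (M.PX ⊗ₘ M.trt) ⊗ₘ κ' := by
    have e : Q.map (fun ω => ((ω.cov, ω.trt), Full.sel ω.trt ω.pot)) =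
        (Q.map (fun ω => ((ω.cov, ω.trt), ω.pot))).map fun v => (v.1, Full.sel v.1.2 v.2) := by
      rw [Measure.map_map hs (hct.prodMk Full.measurable_pot)]
      rfl
    rw [e, h2]
    ext B hB
    rw [Measure.map_apply hs hB, Measure.compProd_apply (hs hB), Measure.compProd_apply hB]
    refine lintegral_congr fun a => ?_
    rw [hκ'a, Measure.map_apply (Full.measurable_sel _) (measurable_prodMk_left hB)]
    rfl
  have h4 : Q.map (fun ω => ((ω.cov, ω.trt), Full.sel ω.trt ω.pot)) =
      (M.PX ⊗ₘ M.trt) ⊗ₘ (M.postKernel ⊗ₖ M.out) := by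
    rw [← Measure.compProd_assoc']
    change _ = M.law.map _
    rw [← hM, Measure.map_map MeasurableEquiv.prodAssoc.measurable measurable_obs]
    congr 1
    ext1 ω
    rw [Function.comp_apply, Full.obs_eq]
    rfl
  have h5 := (compProd_ext (h3.symm.trans h4)).2
  filter_upwards [M.ae_XZ (P := fun a => κ' a = (M.postKernel ⊗ₖ M.out) a) h5] with x hx z
  rw [← hx z, hκ'a]

omit [StandardBorelSpace 𝒳] in
theorem fst_post_out (a : 𝒳 × Bool) : ((M.postKernel ⊗ₖ M.out) a).map Prod.fst = M.postKernel a := by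
  have := Kernel.fst_compProd M.postKernel M.out
  rw [← this, Kernel.fst_apply, this]

theorem condDistrib_S1 (hQ : IsCausalLaw c Q) (hM : Q.map Full.obs = M.law) :
    ∀ᵐ x ∂M.PX, condDistrib Full.S1 Full.cov Q x = M.postKernel (x, true) := by
  have hf : Measurable fun w : ℝ × ℝ × ℝ × ℝ => w.2.1 := by fun_prop
  have h := condDistrib_comp (mβ := inferInstance) (μ := Q) Full.cov Full.measurable_pot.aemeasurable hf
  rw [map_cov hM] at h
  filter_upwards [h, ae_map_sel hQ hM] with x h1 h2
  rw [← fst_post_out, ← h2 true, Measure.map_map measurable_fst (Full.measurable_sel true)]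
  rw [Kernel.map_apply _ hf] at h1
  exact h1

theorem condDistrib_S0 (hQ : IsCausalLaw c Q) (hM : Q.map Full.obs = M.law) :
    ∀ᵐ x ∂M.PX, condDistrib Full.S0 Full.cov Q x = M.postKernel (x, false) := by
  have hf : Measurable fun w : ℝ × ℝ × ℝ × ℝ => w.1 := by fun_prop
  have h := condDistrib_comp (mβ := inferInstance) (μ := Q) Full.cov Full.measurable_pot.aemeasurable hf
  rw [map_cov hM] at h
  filter_upwards [h, ae_map_sel hQ hM] with x h1 h2
  rw [← fst_post_out, ← h2 false, Measure.map_map measurable_fst (Full.measurable_sel false)]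
  rw [Kernel.map_apply _ hf] at h1
  exact h1

/-- The conditional law of the principal stratum. -/
theorem condDistrib_U (hc : IsCopulaDensity c) (hQ : IsCausalLaw c Q) (hM : Q.map Full.obs = M.law) :
    ∀ᵐ x ∂M.PX, condDistrib Full.U Full.cov Q x =
      volume.withDensity fun s => ENNReal.ofReal (M.e c s.1 s.2 x) := by
  have h := hQ.copula
  rw [map_cov hM] at h
  filter_upwards [h, condDistrib_S1 hQ hM, condDistrib_S0 hQ hM] with x h1 h2 h3
  refine measure_ext_Iic_prod (fun s t => ?_) ?_
  · have := h1 s t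
    rw [h2, h3, ← M.F_eq, ← M.F_eq] at this
    rw [M.withDensity_e_Iic hc, ← this, measureReal_def, ENNReal.ofReal_toReal (measure_ne_top _ _)]
  · rw [measure_univ, withDensity_apply _ MeasurableSet.univ, Measure.restrict_univ, M.lintegral_e hc]

theorem map_cov_U (hc : IsCopulaDensity c) (hQ : IsCausalLaw c Q) (hM : Q.map Full.obs = M.law) :
    Q.map (fun ω => (ω.cov, ω.U)) =
      (M.PX.prod volume).withDensity fun v => ENNReal.ofReal (M.e c v.2.1 v.2.2 v.1) := by
  have hme := (M.measurable_e hc.measurable).ennreal_ofReal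
  rw [← compProd_map_condDistrib Full.measurable_U.aemeasurable, map_cov hM]
  ext B hB
  rw [Measure.compProd_apply hB, withDensity_apply _ hB, ← lintegral_indicator hB,
    lintegral_prod _ (hme.indicator hB).aemeasurable]
  refine lintegral_congr_ae ?_
  filter_upwards [condDistrib_U hc hQ hM] with x hx
  rw [hx, withDensity_apply _ (measurable_prodMk_left hB),
    ← lintegral_indicator (measurable_prodMk_left hB)]
  rfl

omit [StandardBorelSpace 𝒳] in
theorem ae_e_nonneg_prod (hc : IsCopulaDensity c) :
    ∀ᵐ v : 𝒳 × ℝ × ℝ ∂(M.PX.prod volume), 0 ≤ M.e c v.2.1 v.2.2 v.1 := by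
  refine (Measure.ae_prod_iff_ae_ae ?_).2 (Eventually.of_forall fun x => M.ae_e_nonneg hc x)
  exact measurableSet_le measurable_const (M.measurable_e hc.measurable)

/-- Treatment ignorability for the control outcome. -/
theorem condExp_Y0_S0 (hQ : IsCausalLaw c Q) (hM : Q.map Full.obs = M.law) :
    Q[Full.Y0 | sig (fun ω => (ω.S0, ω.cov))] =ᵐ[Q] fun ω => M.mu false ω.S0 ω.cov := by
  set X : Full 𝒳 → ℝ × 𝒳 := fun ω => (ω.S0, ω.cov) with hX
  have hXm : Measurable X := Full.measurable_S0.prodMk Full.measurable_cov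
  have hj : Measurable fun v : ℝ × 𝒳 => ((v.2, false), v.1) := by fun_prop
  set κ : Kernel (ℝ × 𝒳) ℝ := M.out.comap _ hj with hκ
  have hlint : ∀ h : 𝒳 × ℝ × ℝ → ℝ≥0∞, Measurable h → ∫⁻ ω, h (ω.cov, ω.S0, ω.Y0) ∂Q =
      ∫⁻ x, ∫⁻ s, ∫⁻ y, h (x, s, y) ∂M.out ((x, false), s) ∂M.postKernel (x, false) ∂M.PX := by
    intro h hh
    have hpm : Measurable fun v : 𝒳 × (ℝ × ℝ × ℝ × ℝ) => h (v.1, v.2.1, v.2.2.2.1) :=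
      hh.comp (by fun_prop)
    have e1 : ∫⁻ ω, h (ω.cov, ω.S0, ω.Y0) ∂Q =
        ∫⁻ v, h (v.1, v.2.1, v.2.2.2.1) ∂(Q.map fun ω => (ω.cov, ω.pot)) := by
      rw [lintegral_map hpm (Full.measurable_cov.prodMk Full.measurable_pot)]
      rfl
    rw [e1, ← compProd_map_condDistrib Full.measurable_pot.aemeasurable, map_cov hM,
      Measure.lintegral_compProd hpm]
    refine lintegral_congr_ae ?_
    filter_upwards [ae_map_sel hQ hM] with x hx
    have hx' : Measurable fun v : ℝ × ℝ => h (x, v) := hh.comp measurable_prodMk_left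
    rw [← Kernel.lintegral_compProd _ _ _ hx', ← hx false, lintegral_map hx' (Full.measurable_sel false)]
    rfl
  -- By ignorability, the control-arm outcome kernel is the conditional law of `Y₀` given `(S₀, X)`
  -- in the whole population.
  have hmap : Q.map (fun ω => (X ω, ω.Y0)) = Q.map X ⊗ₘ κ := by
    ext B hB
    have hi : Measurable fun v : 𝒳 × ℝ × ℝ => B.indicator (fun _ => (1 : ℝ≥0∞)) ((v.2.1, v.1), v.2.2) :=
      (measurable_const.indicator hB).comp (by fun_prop)
    have hi2 : Measurable fun v : ℝ × 𝒳 => κ v (Prod.mk v ⁻¹' B) :=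
      Kernel.measurable_kernel_prodMk_left hB
    have hi3 : Measurable fun v : 𝒳 × ℝ × ℝ => κ (v.2.1, v.1) (Prod.mk (v.2.1, v.1) ⁻¹' B) :=
      hi2.comp (f := fun v : 𝒳 × ℝ × ℝ => (v.2.1, v.1)) (by fun_prop)
    have e1 : Q.map (fun ω => (X ω, ω.Y0)) B =
        ∫⁻ ω, B.indicator (fun _ => (1 : ℝ≥0∞)) ((ω.S0, ω.cov), ω.Y0) ∂Q := by
      rw [← lintegral_indicator_one hB, lintegral_map (measurable_one.indicator hB)
        (hXm.prodMk Full.measurable_Y0)]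
      rfl
    rw [e1, hlint _ hi, Measure.compProd_apply hB, lintegral_map hi2 hXm]
    have e2 := hlint _ hi3
    simp only at e2
    rw [e2]
    refine lintegral_congr fun x => lintegral_congr fun s => ?_
    rw [lintegral_const, measure_univ, mul_one, hκ, Kernel.comap_apply,
      ← lintegral_indicator_one (measurable_prodMk_left hB)]
    rfl
  have h1 := condDistrib_ae_eq_of_measure_eq_compProd_of_measurable hXm Full.measurable_Y0 hmap
  refine (condExp_ae_eq_integral_condDistrib' hXm hQ.integrable_Y0).trans ?_
  filter_upwards [ae_of_ae_map hXm.aemeasurable h1] with ω hω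
  rw [hω, hκ, Kernel.comap_apply]
  rfl

omit [StandardBorelSpace 𝒳] in
theorem measurable_eU (hc : IsCopulaDensity c) : Measurable fun s : ℝ × ℝ => M.eU c s.1 s.2 :=
  (StronglyMeasurable.integral_prod_left' (f := fun v : 𝒳 × ℝ × ℝ => M.e c v.2.1 v.2.2 v.1)
    (M.measurable_e hc.measurable).stronglyMeasurable).measurable

omit [StandardBorelSpace 𝒳] in
theorem measurable_m0 (hc : IsCopulaDensity c) : Measurable fun s : ℝ × ℝ => M.m0 c s.1 s.2 :=
  (StronglyMeasurable.integral_prod_left'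
    (f := fun v : 𝒳 × ℝ × ℝ => M.e c v.2.1 v.2.2 v.1 * M.mu false v.2.2 v.1)
    ((M.measurable_e hc.measurable).mul M.measurable_mu').stronglyMeasurable).measurable.div
    (measurable_eU hc)

omit [StandardBorelSpace 𝒳] in
theorem ae_eU_nonneg (hc : IsCopulaDensity c) : ∀ᵐ s : ℝ × ℝ, 0 ≤ M.eU c s.1 s.2 := by
  filter_upwards [M.ae_integrable_e hc] with s hs
  exact integral_nonneg_of_ae hs.1

-- In product form the identity survives `eU = 0`: the nonnegative integrand `e` then vanishes
-- almost everywhere, hence so does the numerator of `m₀`.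
omit [StandardBorelSpace 𝒳] in
theorem ae_m0_mul_eU (hc : IsCopulaDensity c) : ∀ᵐ s : ℝ × ℝ,
    M.eU c s.1 s.2 * M.m0 c s.1 s.2 = ∫ x, M.e c s.1 s.2 x * M.mu false s.2 x ∂M.PX := by
  filter_upwards [M.ae_integrable_e hc] with s hs
  rcases eq_or_ne (M.eU c s.1 s.2) 0 with h0 | h0
  · have hz : (fun x => M.e c s.1 s.2 x) =ᵐ[M.PX] 0 :=
      (integral_eq_zero_iff_of_nonneg_ae hs.1 hs.2).1 h0
    rw [h0, zero_mul, integral_congr_ae (g := fun _ => 0) (hz.mono fun x hx => by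
      simp only [Pi.zero_apply] at hx
      rw [hx, zero_mul])]
    simp
  · rw [ObsModel.m0, mul_div_cancel₀ _ h0]

theorem map_U (hc : IsCopulaDensity c) (hQ : IsCausalLaw c Q) (hM : Q.map Full.obs = M.law) :
    Q.map Full.U = volume.withDensity fun s => ENNReal.ofReal (M.eU c s.1 s.2) := by
  have hme := (M.measurable_e hc.measurable).ennreal_ofReal
  have h : Q.map Full.U = (Q.map (fun ω => (ω.cov, ω.U))).map Prod.snd := by
    rw [Measure.map_map measurable_snd (Full.measurable_cov.prodMk Full.measurable_U)]
    rfl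
  rw [h, map_cov_U hc hQ hM]
  ext B hB
  rw [Measure.map_apply measurable_snd hB, withDensity_apply _ (measurable_snd hB),
    withDensity_apply _ hB, ← lintegral_indicator (measurable_snd hB), ← lintegral_indicator hB,
    lintegral_prod_symm _ (hme.indicator (measurable_snd hB)).aemeasurable]
  refine lintegral_congr_ae ?_
  filter_upwards [M.ae_integrable_e hc] with s hs
  by_cases hB' : s ∈ B
  · rw [Set.indicator_of_mem hB', ObsModel.eU, ofReal_integral_eq_lintegral_ofReal hs.2 hs.1]
    refine lintegral_congr fun x => ?_
    rw [Set.indicator_of_mem (by exact hB')]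
  · rw [Set.indicator_of_notMem hB']
    have : ∀ x, (Prod.snd ⁻¹' B).indicator
        (fun v : 𝒳 × ℝ × ℝ => ENNReal.ofReal (M.e c v.2.1 v.2.2 v.1)) (x, s) = 0 := fun x =>
      Set.indicator_of_notMem (by exact hB') _
    simp [this]

/-- The conditional mean of the control outcome given the principal stratum. -/
theorem meanY0_eq (hc : IsCopulaDensity c) (hQ : IsCausalLaw c Q) (hM : Q.map Full.obs = M.law) :
    meanY0 Q =ᵐ[Q] fun ω => M.m0 c ω.S1 ω.S0 := by
  have hcovU : Measurable fun ω : Full 𝒳 => (ω.cov, ω.U) :=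
    Full.measurable_cov.prodMk Full.measurable_U
  have hUcov : Measurable fun ω : Full 𝒳 => (ω.U, ω.cov) :=
    Full.measurable_U.prodMk Full.measurable_cov
  have hme := M.measurable_e hc.measurable
  have hce : Q[Full.Y0 | sig (fun ω => (ω.U, ω.cov))] =ᵐ[Q] fun ω => M.mu false ω.S0 ω.cov :=
    hQ.principal_zero.trans (condExp_Y0_S0 hQ hM)
  have hmuQ : Integrable (fun ω : Full 𝒳 => M.mu false ω.S0 ω.cov) Q := integrable_condExp.congr hce
  have hmuM : Measurable fun v : 𝒳 × ℝ × ℝ => M.mu false v.2.2 v.1 := M.measurable_mu'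
  have hmul : Integrable (fun v : 𝒳 × ℝ × ℝ => M.e c v.2.1 v.2.2 v.1 * M.mu false v.2.2 v.1)
      (M.PX.prod volume) := by
    rw [← integrable_withDensity_ofReal hme (ae_e_nonneg_prod hc), ← map_cov_U hc hQ hM,
      integrable_map_measure hmuM.aestronglyMeasurable hcovU.aemeasurable]
    exact hmuQ
  have hint0 : Integrable (fun s : ℝ × ℝ => M.eU c s.1 s.2 * M.m0 c s.1 s.2) := by
    refine hmul.integral_prod_right.congr ?_
    filter_upwards [ae_m0_mul_eU (M := M) hc] with s hs
    exact hs.symm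
  have hmm := measurable_m0 (M := M) hc
  have hint1 : Integrable (fun ω : Full 𝒳 => M.m0 c ω.S1 ω.S0) Q := by
    have : Integrable (fun s : ℝ × ℝ => M.m0 c s.1 s.2) (Q.map Full.U) := by
      rw [map_U hc hQ hM, integrable_withDensity_ofReal (measurable_eU hc) (ae_eU_nonneg hc)]
      exact hint0
    exact this.comp_measurable Full.measurable_U
  symm
  -- The conditional mean is characterized by its integrals over the events `U ∈ B`. There the tower
  -- property conditions on `(U, X)` first, and Fubini's theorem then integrates out `x`.
  refine ae_eq_condExp_of_forall_setIntegral_eq Full.measurable_U.comap_le hQ.integrable_Y0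
    (fun _ _ _ => hint1.integrableOn) ?_ ?_
  · rintro _ ⟨B, hB, rfl⟩ -
    have hsub : MeasurableSet[sig (fun ω : Full 𝒳 => (ω.U, ω.cov))] (Full.U ⁻¹' B) :=
      ⟨Prod.fst ⁻¹' B, measurable_fst hB, rfl⟩
    rw [← setIntegral_condExp hUcov.comap_le hQ.integrable_Y0 hsub,
      ← integral_indicator (Full.measurable_U hB), ← integral_indicator (Full.measurable_U hB)]
    have e1 : ∫ ω, (Full.U ⁻¹' B).indicator (fun ω : Full 𝒳 => M.m0 c ω.S1 ω.S0) ω ∂Q =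
        ∫ s : ℝ × ℝ, M.eU c s.1 s.2 * B.indicator (fun s => M.m0 c s.1 s.2) s := by
      rw [← integral_withDensity_ofReal (measurable_eU hc) (ae_eU_nonneg hc), ← map_U hc hQ hM,
        integral_map Full.measurable_U.aemeasurable (hmm.indicator hB).aestronglyMeasurable]
      rfl
    have hmi : Measurable fun v : 𝒳 × ℝ × ℝ => (Prod.snd ⁻¹' B).indicator
        (fun v : 𝒳 × ℝ × ℝ => M.mu false v.2.2 v.1) v := hmuM.indicator (measurable_snd hB)
    have e2 : ∫ ω, (Full.U ⁻¹' B).indicator (Q[Full.Y0 | sig (fun ω => (ω.U, ω.cov))]) ω ∂Q =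
        ∫ v : 𝒳 × ℝ × ℝ, M.e c v.2.1 v.2.2 v.1 * (Prod.snd ⁻¹' B).indicator
          (fun v : 𝒳 × ℝ × ℝ => M.mu false v.2.2 v.1) v ∂(M.PX.prod volume) := by
      rw [← integral_withDensity_ofReal hme (ae_e_nonneg_prod hc), ← map_cov_U hc hQ hM,
        integral_map hcovU.aemeasurable hmi.aestronglyMeasurable]
      refine integral_congr_ae ?_
      filter_upwards [hce] with ω hω
      by_cases hB' : ω.U ∈ B
      · rw [Set.indicator_of_mem (by exact hB'), Set.indicator_of_mem (by exact hB'), hω]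
        rfl
      · rw [Set.indicator_of_notMem (by exact hB'), Set.indicator_of_notMem (by exact hB')]
    rw [e1, e2, integral_prod_symm]
    · refine integral_congr_ae ?_
      filter_upwards [ae_m0_mul_eU (M := M) hc] with s hs
      by_cases hB' : s ∈ B
      · rw [Set.indicator_of_mem hB', hs]
        refine integral_congr_ae (Eventually.of_forall fun x => ?_)
        simp only
        rw [Set.indicator_of_mem (by exact hB')]
      · have : ∀ x, (Prod.snd ⁻¹' B).indicator
            (fun v : 𝒳 × ℝ × ℝ => M.mu false v.2.2 v.1) (x, s) = 0 := fun x =>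
          Set.indicator_of_notMem (by exact hB') _
        simp [Set.indicator_of_notMem hB', this]
    · refine (hmul.indicator (measurable_snd hB)).congr (Eventually.of_forall fun v => ?_)
      by_cases hB' : v ∈ (Prod.snd ⁻¹' B : Set (𝒳 × ℝ × ℝ))
      · rw [Set.indicator_of_mem hB']
        simp only
        rw [Set.indicator_of_mem hB']
      · rw [Set.indicator_of_notMem hB']
        simp only
        rw [Set.indicator_of_notMem hB', mul_zero]
  · have hU : Measurable[sig (Full.U : Full 𝒳 → ℝ × ℝ)] (Full.U : Full 𝒳 → ℝ × ℝ) :=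
      comap_measurable _
    exact (hmm.comp hU).aestronglyMeasurable

/-- Identification of the projection objective. -/
theorem causalLoss_eq (hc : IsCopulaDensity c) (hQ : IsCausalLaw c Q) (hM : Q.map Full.obs = M.law)
    {q : ℕ} {w : ℝ → ℝ → ℝ} (hw : Measurable (Function.uncurry w)) {f : ℝ → ℝ → (Fin q → ℝ) → ℝ}
    (hf : ∀ η, Measurable fun s : ℝ × ℝ => f s.1 s.2 η) (η : Fin q → ℝ) :
    causalLoss w f Q η = M.loss c w f η := by
  have hm : Measurable fun s : ℝ × ℝ =>
      ENNReal.ofReal (w s.1 s.2 * (M.m0 c s.1 s.2 - f s.1 s.2 η) ^ 2) :=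
    (hw.mul (((measurable_m0 hc).sub (hf η)).pow_const 2)).ennreal_ofReal
  have e1 : causalLoss w f Q η = ∫⁻ s, ENNReal.ofReal
      (w s.1 s.2 * (M.m0 c s.1 s.2 - f s.1 s.2 η) ^ 2) ∂(Q.map Full.U) := by
    rw [lintegral_map hm Full.measurable_U, causalLoss]
    refine lintegral_congr_ae ?_
    filter_upwards [meanY0_eq hc hQ hM] with ω hω
    rw [hω]
    rfl
  rw [e1, map_U hc hQ hM,
    lintegral_withDensity_eq_lintegral_mul _ (measurable_eU hc).ennreal_ofReal hm, ObsModel.loss]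
  refine lintegral_congr_ae ?_
  filter_upwards [ae_eU_nonneg (M := M) hc] with s hs
  rw [Pi.mul_apply, ENNReal.ofReal_mul' hs, mul_comm]

/-- This carries the expectation defining `H₀` to an integral over the plane. -/
theorem integral_U (hc : IsCopulaDensity c) (hQ : IsCausalLaw c Q) (hM : Q.map Full.obs = M.law)
    {h : ℝ → ℝ → ℝ → ℝ} (hm : Measurable fun v : ℝ × ℝ × ℝ => h v.1 v.2.1 v.2.2) :
    ∫ ω, h ω.S1 ω.S0 (meanY0 Q ω) ∂Q =
      ∫ s : ℝ × ℝ, M.eU c s.1 s.2 * h s.1 s.2 (M.m0 c s.1 s.2) := by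
  have hm' : Measurable fun s : ℝ × ℝ => h s.1 s.2 (M.m0 c s.1 s.2) :=
    hm.comp (measurable_fst.prodMk (measurable_snd.prodMk (measurable_m0 hc)))
  rw [← integral_withDensity_ofReal (measurable_eU hc) (ae_eU_nonneg hc), ← map_U hc hQ hM,
    integral_map Full.measurable_U.aemeasurable hm'.aestronglyMeasurable]
  refine integral_congr_ae ?_
  filter_upwards [meanY0_eq hc hQ hM] with ω hω
  rw [hω]
  rfl

end Causal

end

section

/-! ### Curves of likelihood ratios -/

/-- Differentiability is required at `0` alone; the Lipschitz bound relative to `F 0` supplies the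
domination. -/
theorem hasDerivAt_integral_of_lip {α : Type*} [MeasurableSpace α] {ν : Measure α} {F : ℝ → α → ℝ}
    {F' bound : α → ℝ} (hm : ∀ θ, AEStronglyMeasurable (F θ) ν) (hi : Integrable (F 0) ν)
    (hm' : AEStronglyMeasurable F' ν) (hl : ∀ᵐ a ∂ν, ∀ θ, |F θ a - F 0 a| ≤ bound a * |θ|)
    (hb : Integrable bound ν) (hd : ∀ᵐ a ∂ν, HasDerivAt (fun θ => F θ a) (F' a) 0) :
    HasDerivAt (fun θ => ∫ a, F θ a ∂ν) (∫ a, F' a ∂ν) 0 := by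
  set T : α → ℝ →L[ℝ] ℝ := fun a => ContinuousLinearMap.toSpanSingleton ℝ (F' a) with hT
  have hTm : AEStronglyMeasurable T ν :=
    (ContinuousLinearMap.toSpanSingletonCLE (𝕜 := ℝ) (E := ℝ)).continuous.comp_aestronglyMeasurable
      hm'
  have key := hasFDerivAt_integral_of_dominated_loc_of_lip' (μ := ν) (𝕜 := ℝ) (F := F) (F' := T)
    (x₀ := 0) (bound := bound) (s := Set.univ) univ_mem (fun θ _ => hm θ) hi hTm
    (hl.mono fun a ha θ _ => by simpa using ha θ) hb (hd.mono fun a ha => by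
      rw [hasDerivAt_iff_hasFDerivAt] at ha
      exact ha)
  have h1 := key.2.hasDerivAt
  rw [ContinuousLinearMap.integral_apply key.1] at h1
  simpa [hT] using h1

section Curve

variable {α β : Type*} [MeasurableSpace α] [MeasurableSpace β]

/-- A curve of likelihood ratios through `1` with bounded score `s`. -/
structure IsCurve (μ : Measure α) (g : ℝ → α → ℝ) (s : α → ℝ) (B : ℝ) : Prop where
  measurable_s : Measurable s
  bound_s : ∀ v, |s v| ≤ B
  B_nonneg : 0 ≤ B
  ratio : ∀ θ, IsRatio (g θ)
  lip : ∀ θ v, |g θ v - 1| ≤ B * |θ|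
  deriv : ∀ᵐ v ∂μ, HasDerivAt (fun θ => g θ v) (s v) 0

namespace IsCurve

variable {μ : Measure α} {B : ℝ}

theorem zero {g : ℝ → α → ℝ} {s : α → ℝ} (h : IsCurve μ g s B) (v : α) : g 0 v = 1 := by
  have := h.lip 0 v
  rw [abs_zero, mul_zero] at this
  linarith [abs_nonpos_iff.1 this]

/-- Averaging over the last coordinate keeps bounds and derivatives, so iteration yields curves of
ratios for `(X, Z, S)`, `(X, Z)` and `X`. -/
theorem kav [SFinite μ] {κ : Kernel α β} [IsMarkovKernel κ] {g : ℝ → α × β → ℝ} {s : α × β → ℝ}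
    (h : IsCurve (μ ⊗ₘ κ) g s B) : IsCurve μ (fun θ => kav κ (g θ)) (kav κ s) B where
  measurable_s := measurable_kav κ h.measurable_s
  bound_s := abs_kav_le κ h.bound_s
  B_nonneg := h.B_nonneg
  ratio θ := (h.ratio θ).kav κ
  lip θ := abs_kav_sub_one_le κ (h.ratio θ).measurable (h.lip θ)
  deriv := by
    filter_upwards [Measure.ae_ae_of_ae_compProd h.deriv] with a ha
    refine hasDerivAt_integral_of_lip (bound := fun _ => B)
      (fun θ => ((h.ratio θ).measurable.comp measurable_prodMk_left).aestronglyMeasurable)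
      (integrable_of_bdd _ ((h.ratio 0).measurable.comp measurable_prodMk_left) (C := 1) fun b => ?_)
      (h.measurable_s.comp measurable_prodMk_left).aestronglyMeasurable
      (Eventually.of_forall fun b θ => ?_) (integrable_const _) ha
    · rw [h.zero, abs_one]
    · rw [h.zero]
      exact h.lip θ _

end IsCurve

theorem abs_div_sub_one_le {g h ε : ℝ} (hg : |g - 1| ≤ ε) (hh : |h - 1| ≤ ε) (h2 : 1 / 2 ≤ h) :
    |g / h - 1| ≤ 4 * ε := by
  have hp : 0 < h := by linarith
  rw [div_sub_one hp.ne', abs_div, abs_of_pos hp, div_le_iff₀ hp]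
  have h1 : |g - h| ≤ 2 * ε := by
    have := abs_sub (g - 1) (h - 1)
    rw [sub_sub_sub_cancel_right] at this
    linarith
  have h0 : 0 ≤ ε := (abs_nonneg _).trans hg
  nlinarith

theorem hasDerivAt_div_of_one {g h : ℝ → ℝ} {s t : ℝ} (hg : HasDerivAt g s 0) (hh : HasDerivAt h t 0)
    (hg0 : g 0 = 1) (hh0 : h 0 = 1) : HasDerivAt (fun θ => g θ / h θ) (s - t) 0 := by
  have := hg.div hh (by rw [hh0]; exact one_ne_zero)
  rw [hg0, hh0, mul_one, one_mul, one_pow, div_one] at this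
  exact this

/-- The truncation of `a` to the interval `[l, u]` is a contraction. -/
theorem abs_clamp_sub_le {l u t a : ℝ} (hl : l ≤ t) (hu : t ≤ u) : |max l (min a u) - t| ≤ |a - t| := by
  rcases le_total a u with h1 | h1
  · rw [min_eq_left h1]
    rcases le_total l a with h2 | h2
    · rw [max_eq_right h2]
    · rw [max_eq_left h2, abs_of_nonpos (by linarith), abs_of_nonpos (by linarith)]
      linarith
  · rw [min_eq_right h1, max_eq_right (hl.trans hu), abs_of_nonneg (by linarith),
      abs_of_nonneg (by linarith)]
    linarith

/-- The bound is used along a sequence: a submodel gives it almost everywhere for each `θ`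
separately, and only countably many null sets can be discarded. -/
theorem abs_deriv_le {g : ℝ → ℝ} {s B : ℝ} (hd : HasDerivAt g s 0) (h0 : g 0 = 1) {u : ℕ → ℝ}
    (hu : Tendsto u atTop (𝓝[≠] 0)) (hb : ∀ᶠ n in atTop, |g (u n) - 1| ≤ B * |u n|) : |s| ≤ B := by
  have h1 := (hasDerivAt_iff_tendsto_slope.1 hd).comp hu
  refine le_of_tendsto h1.abs ?_
  filter_upwards [hb, hu.eventually self_mem_nhdsWithin] with n hn hn0
  have hn1 : 0 < |u n| := abs_pos.2 hn0
  rw [Function.comp_apply, slope_def_field, h0, sub_zero, abs_div, div_le_iff₀ hn1]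
  exact hn

/-- The tangent `1 + θ s` lies in the interval of truncation, and truncation is a contraction
towards points of that interval, so the error can only shrink. -/
theorem hasDerivAt_clamp {g : ℝ → ℝ} {s B : ℝ} (hd : HasDerivAt g s 0) (h0 : g 0 = 1)
    (hs : |s| ≤ B) : HasDerivAt (fun θ => max (1 - B * |θ|) (min (g θ) (1 + B * |θ|))) s 0 := by
  rw [hasDerivAt_iff_isLittleO] at hd ⊢
  refine (Asymptotics.IsBigO.of_bound 1 (Eventually.of_forall fun θ => ?_)).trans_isLittleO hd
  simp only [abs_zero, mul_zero, sub_zero, add_zero, h0, min_self, max_self, smul_eq_mul,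
    Real.norm_eq_abs, one_mul]
  have h1 : |θ * s| ≤ B * |θ| := by
    rw [abs_mul, mul_comm]
    exact mul_le_mul_of_nonneg_right hs (abs_nonneg _)
  have h2 := abs_le.1 h1
  have := abs_clamp_sub_le (l := 1 - B * |θ|) (u := 1 + B * |θ|) (t := 1 + θ * s) (a := g θ)
    (by linarith) (by linarith)
  rwa [← sub_sub, ← sub_sub] at this

end Curve

/-! ### Reduction of regular submodels to curves of tilts -/

section Submodel

variable {𝒳 : Type*} [MeasurableSpace 𝒳]

/-- Every regular submodel agrees near `0` with a curve of tilts of `M`. -/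
theorem IsRegularSubmodel.exists_curve {M : ObsModel 𝒳} {Mθ : ℝ → ObsModel 𝒳} {s : Obs 𝒳 → ℝ}
    (h : IsRegularSubmodel M Mθ s) : ∃ (g : ℝ → Obs 𝒳 → ℝ) (s' : Obs 𝒳 → ℝ) (B : ℝ)
      (hC : IsCurve M.law g s' B) (h1 : ∀ θ, ∫ v, g θ v ∂M.law = 1), s =ᵐ[M.law] s' ∧
      ∀ᶠ θ in 𝓝 (0 : ℝ), (Mθ θ).law = (M.tilt (g θ) (hC.ratio θ) (h1 θ)).law := by
  obtain ⟨g, B₀, hev, hd⟩ := h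
  set B := max B₀ 0 with hB
  have hB0 : 0 ≤ B := le_max_right _ _
  obtain ⟨ε₀, hε₀, hev'⟩ := Metric.eventually_nhds_iff.1 hev
  simp only [dist_zero_right, Real.norm_eq_abs] at hev'
  set ε := min ε₀ (1 / (2 * (B + 1))) with hε
  have hεp : 0 < ε := lt_min hε₀ (by positivity)
  have hBε : ∀ θ : ℝ, |θ| < ε → B * |θ| ≤ 1 / 2 := by
    intro θ hθ
    have h2 : |θ| ≤ 1 / (2 * (B + 1)) := (hθ.trans_le (min_le_right _ _)).le
    calc B * |θ| ≤ (B + 1) * (1 / (2 * (B + 1))) := by gcongr; linarith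
      _ = 1 / 2 := by field_simp
  have hb : ∀ θ : ℝ, |θ| < ε → ∀ᵐ v ∂M.law, |g θ v - 1| ≤ B * |θ| := by
    intro θ hθ
    filter_upwards [(hev' (hθ.trans_le (min_le_left _ _))).2.2.2] with v hv
    exact hv.trans (mul_le_mul_of_nonneg_right (le_max_left _ _) (abs_nonneg _))
  have hgm : ∀ θ : ℝ, |θ| < ε → Measurable (g θ) := fun θ hθ =>
    (hev' (hθ.trans_le (min_le_left _ _))).1
  have h0 : ∀ᵐ v ∂M.law, g 0 v = 1 := by
    filter_upwards [hb 0 (by simpa using hεp)] with v hv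
    rw [abs_zero, mul_zero] at hv
    linarith [abs_nonpos_iff.1 hv]
  -- a sequence of parameters tending to zero
  set u : ℕ → ℝ := fun n => ε / ((n : ℝ) + 2) with hu
  have hun : ∀ n, 0 < u n ∧ |u n| < ε := by
    intro n
    have h2 : 0 < u n := by positivity
    refine ⟨h2, ?_⟩
    rw [abs_of_pos h2, hu, div_lt_iff₀ (by positivity)]
    have : (0 : ℝ) ≤ n := n.cast_nonneg
    nlinarith
  have hut : Tendsto u atTop (𝓝[≠] 0) := by
    refine tendsto_nhdsWithin_iff.2 ⟨?_, Eventually.of_forall fun n => (hun n).1.ne'⟩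
    exact tendsto_const_nhds.div_atTop
      (tendsto_atTop_add_const_right _ _ tendsto_natCast_atTop_atTop)
  have hsB : ∀ᵐ v ∂M.law, |s v| ≤ B := by
    filter_upwards [hd, h0, ae_all_iff.2 fun n => hb (u n) (hun n).2] with v hv hv0 hvb
    exact abs_deriv_le hv hv0 hut (Eventually.of_forall hvb)
  -- The score is not assumed measurable; it is a limit of measurable difference quotients.
  have hsm : AEMeasurable s M.law := by
    refine aemeasurable_of_tendsto_metrizable_ae (f := fun (n : ℕ) v => (u n)⁻¹ * (g (u n) v - g 0 v))
      atTop (fun n => (((hgm _ (hun n).2).sub (hgm 0 (by simpa using hεp))).const_mul _).aemeasurable)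
      ?_
    filter_upwards [hd] with v hv
    have := (hasDerivAt_iff_tendsto_slope.1 hv).comp hut
    refine this.congr fun n => ?_
    rw [Function.comp_apply, slope_def_field, sub_zero, div_eq_inv_mul]
  -- A measurable version is truncated so that its bound holds at every point.
  set s' : Obs 𝒳 → ℝ := fun v => max (-B) (min (hsm.mk s v) B) with hs'
  have hss : s =ᵐ[M.law] s' := by
    filter_upwards [hsm.ae_eq_mk, hsB] with v h1 h2
    rw [hs']
    simp only
    rw [← h1, min_eq_left (abs_le.1 h2).2, max_eq_right (abs_le.1 h2).1]
  -- Truncation turns almost sure bounds into bounds everywhere. Away from `0` the ratio is set to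
  -- `1`, so that every `θ` gives a tilt.
  set G : ℝ → Obs 𝒳 → ℝ := fun θ v =>
    if |θ| < ε then max (1 - B * |θ|) (min (g θ v) (1 + B * |θ|)) else 1 with hG
  have hGb : ∀ θ v, |G θ v - 1| ≤ B * |θ| := by
    intro θ v
    have h3 : 0 ≤ B * |θ| := by positivity
    by_cases hθ : |θ| < ε
    · simp only [hG, if_pos hθ]
      rw [abs_le]
      constructor
      · linarith [le_max_left (1 - B * |θ|) (min (g θ v) (1 + B * |θ|))]
      · have : max (1 - B * |θ|) (min (g θ v) (1 + B * |θ|)) ≤ 1 + B * |θ| :=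
          max_le (by linarith) (min_le_right _ _)
        linarith
    · simp only [hG, if_neg hθ, sub_self, abs_zero]
      exact h3
  have hGg : ∀ θ, |θ| < ε → G θ =ᵐ[M.law] g θ := by
    intro θ hθ
    filter_upwards [hb θ hθ] with v hv
    have := abs_le.1 hv
    simp only [hG, if_pos hθ]
    rw [min_eq_left (by linarith), max_eq_right (by linarith)]
  have hR : ∀ θ, IsRatio (G θ) := by
    intro θ
    by_cases hθ : |θ| < ε
    · have hh : ∀ v, |G θ v - 1| ≤ 1 / 2 := fun v => (hGb θ v).trans (hBε θ hθ)
      refine ⟨?_, fun v => by linarith [(abs_le.1 (hh v)).1], fun v => by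
        linarith [(abs_le.1 (hh v)).2]⟩
      simp only [hG, if_pos hθ]
      exact measurable_const.max ((hgm θ hθ).min measurable_const)
    · simp only [hG, if_neg hθ]
      exact ⟨measurable_const, fun v => by norm_num, fun v => by norm_num⟩
  have hlaw : ∀ θ, |θ| < ε → (Mθ θ).law = M.law.withDensity fun v => ENNReal.ofReal (G θ v) := by
    intro θ hθ
    rw [(hev' (hθ.trans_le (min_le_left _ _))).2.2.1]
    exact withDensity_congr_ae ((hGg θ hθ).mono fun v hv => by simp only [hv])
  have hG1 : ∀ θ, ∫ v, G θ v ∂M.law = 1 := by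
    intro θ
    by_cases hθ : |θ| < ε
    · have h3 : (Mθ θ).law Set.univ = 1 := measure_univ
      rw [hlaw θ hθ, withDensity_apply _ MeasurableSet.univ, Measure.restrict_univ,
        ← ofReal_integral_eq_lintegral_ofReal ((hR θ).integrable _)
          (Eventually.of_forall fun v => ((hR θ).pos v).le), ENNReal.ofReal_eq_one] at h3
      exact h3
    · simp [hG, if_neg hθ]
  have hC : IsCurve M.law G s' B := by
    refine ⟨measurable_const.max (hsm.measurable_mk.min measurable_const), fun v => ?_, hB0, hR, hGb, ?_⟩
    · rw [abs_le]
      exact ⟨le_max_left _ _, max_le (by linarith) (min_le_right _ _)⟩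
    · filter_upwards [hd, h0, hsB, hss] with v h2 h3 h4 h5
      rw [← h5]
      refine (hasDerivAt_clamp h2 h3 h4).congr_of_eventuallyEq ?_
      filter_upwards [Metric.ball_mem_nhds (0 : ℝ) hεp] with θ hθ
      have : |θ| < ε := by simpa using hθ
      simp only [hG, if_pos this]
  refine ⟨G, s', B, hC, hG1, hss, ?_⟩
  filter_upwards [Metric.ball_mem_nhds (0 : ℝ) hεp] with θ hθ
  rw [ObsModel.tilt_law, hlaw θ (by simpa using hθ)]

end Submodel

/-! ### Differentiability of copula densities -/

namespace IsCopulaDensity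

variable {c : ℝ → ℝ → ℝ} (hc : IsCopulaDensity c)
include hc

theorem hasFDerivAt {u v : ℝ} (hu : u ∈ Set.Ioo (0 : ℝ) 1) (hv : v ∈ Set.Ioo (0 : ℝ) 1) :
    HasFDerivAt (Function.uncurry c) (dcu c u v • ContinuousLinearMap.fst ℝ ℝ ℝ
      + dcv c u v • ContinuousLinearMap.snd ℝ ℝ ℝ) (u, v) := by
  have hn : Set.Ioo (0 : ℝ) 1 ×ˢ Set.Ioo (0 : ℝ) 1 ∈ 𝓝 (u, v) :=
    (isOpen_Ioo.prod isOpen_Ioo).mem_nhds ⟨hu, hv⟩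
  have hd : HasFDerivAt (Function.uncurry c) (fderiv ℝ (Function.uncurry c) (u, v)) (u, v) :=
    (((hc.contDiffOn (u, v) ⟨hu, hv⟩).contDiffAt hn).differentiableAt (by norm_num)).hasFDerivAt
  have e1 : dcu c u v = fderiv ℝ (Function.uncurry c) (u, v) (1, 0) :=
    (hd.comp_hasDerivAt (f := fun a : ℝ => (a, v)) u
      ((hasDerivAt_id u).prodMk (hasDerivAt_const u v))).deriv
  have e2 : dcv c u v = fderiv ℝ (Function.uncurry c) (u, v) (0, 1) :=
    (hd.comp_hasDerivAt (f := fun a : ℝ => (u, a)) v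
      ((hasDerivAt_const v u).prodMk (hasDerivAt_id v))).deriv
  convert hd using 1
  ext <;> simp [e1, e2]

theorem hasDerivAt_comp {p q : ℝ → ℝ} {p' q' t : ℝ} (hp : HasDerivAt p p' t) (hq : HasDerivAt q q' t)
    (hu : p t ∈ Set.Ioo (0 : ℝ) 1) (hv : q t ∈ Set.Ioo (0 : ℝ) 1) :
    HasDerivAt (fun θ => c (p θ) (q θ)) (dcu c (p t) (q t) * p' + dcv c (p t) (q t) * q') t := by
  have := (hc.hasFDerivAt hu hv).comp_hasDerivAt t (hp.prodMk hq)
  simp only [add_apply, smul_apply, ContinuousLinearMap.coe_fst', ContinuousLinearMap.coe_snd',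
    smul_eq_mul] at this
  exact this

/-- A mean value inequality. -/
theorem abs_sub_le {Ψ : ℝ → ℝ → ℝ} {δ : ℝ}
    (hΨ : ∀ u ∈ Set.Ioo (0 : ℝ) 1, ∀ v ∈ Set.Ioo (0 : ℝ) 1,
      ∀ u' ∈ Set.Ioo (0 : ℝ) 1, ∀ v' ∈ Set.Ioo (0 : ℝ) 1,
        |u' - u| ≤ δ * (u * (1 - u)) → |v' - v| ≤ δ * (v * (1 - v)) →
          u * (1 - u) * |dcu c u' v'| + v * (1 - v) * |dcv c u' v'| ≤ Ψ u v)
    {u v u' v' t : ℝ} (hu : u ∈ Set.Ioo (0 : ℝ) 1) (hv : v ∈ Set.Ioo (0 : ℝ) 1)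
    (hu' : u' ∈ Set.Ioo (0 : ℝ) 1) (hv' : v' ∈ Set.Ioo (0 : ℝ) 1) (ht : t ≤ δ)
    (h1 : |u' - u| ≤ t * (u * (1 - u))) (h2 : |v' - v| ≤ t * (v * (1 - v))) :
    |c u' v' - c u v| ≤ t * Ψ u v := by
  have hu2 : 0 < u * (1 - u) := mul_pos hu.1 (by linarith [hu.2])
  have hv2 : 0 < v * (1 - v) := mul_pos hv.1 (by linarith [hv.2])
  have ht0 : 0 ≤ t := by
    have := (abs_nonneg _).trans h1
    exact nonneg_of_mul_nonneg_left this hu2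
  set p : ℝ → ℝ := fun a => u + a * (u' - u) with hp
  set q : ℝ → ℝ := fun a => v + a * (v' - v) with hq
  have hmem : ∀ {x x' a : ℝ}, x ∈ Set.Ioo (0 : ℝ) 1 → x' ∈ Set.Ioo (0 : ℝ) 1 → a ∈ Set.Icc (0 : ℝ) 1 →
      x + a * (x' - x) ∈ Set.Ioo (0 : ℝ) 1 := by
    intro x x' a hx hx' ha
    have := (convex_Ioo (0 : ℝ) 1).add_smul_sub_mem hx hx' ha
    simpa using this
  have hd : ∀ a ∈ Set.Icc (0 : ℝ) 1, HasDerivWithinAt (fun a => c (p a) (q a))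
      (dcu c (p a) (q a) * (u' - u) + dcv c (p a) (q a) * (v' - v)) (Set.Icc 0 1) a := by
    intro a ha
    refine (hc.hasDerivAt_comp (p := p) (q := q) ?_ ?_ (hmem hu hu' ha) (hmem hv hv' ha)).hasDerivWithinAt
    · have := ((hasDerivAt_id a).mul_const (u' - u)).const_add u
      rw [one_mul] at this
      exact this
    · have := ((hasDerivAt_id a).mul_const (v' - v)).const_add v
      rw [one_mul] at this
      exact this
  -- Each point of the segment is an admissible perturbation of `(u, v)`, so `Ψ u v` bounds the
  -- weighted derivatives along it; the weights are the admissible sizes of the increments.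
  have hb : ∀ a ∈ Set.Ico (0 : ℝ) 1,
      ‖dcu c (p a) (q a) * (u' - u) + dcv c (p a) (q a) * (v' - v)‖ ≤ t * Ψ u v := by
    intro a ha
    have ha' : a ∈ Set.Icc (0 : ℝ) 1 := ⟨ha.1, ha.2.le⟩
    have hsc : ∀ {x d : ℝ}, |d| ≤ t * x → 0 < x → |a * d| ≤ δ * x := by
      intro x d hx hx0
      rw [abs_mul, abs_of_nonneg ha.1]
      calc a * |d| ≤ 1 * (t * x) := mul_le_mul ha.2.le hx (abs_nonneg _) zero_le_one
        _ ≤ δ * x := by rw [one_mul]; exact mul_le_mul_of_nonneg_right ht hx0.le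
    have h3 := hΨ u hu v hv (p a) (hmem hu hu' ha') (q a) (hmem hv hv' ha')
      (by rw [hp]; simpa using hsc h1 hu2) (by rw [hq]; simpa using hsc h2 hv2)
    rw [Real.norm_eq_abs]
    calc |dcu c (p a) (q a) * (u' - u) + dcv c (p a) (q a) * (v' - v)|
        ≤ |dcu c (p a) (q a)| * |u' - u| + |dcv c (p a) (q a)| * |v' - v| := by
          rw [← abs_mul, ← abs_mul]
          exact abs_add_le _ _
      _ ≤ |dcu c (p a) (q a)| * (t * (u * (1 - u))) + |dcv c (p a) (q a)| * (t * (v * (1 - v))) := by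
          gcongr
      _ = t * (u * (1 - u) * |dcu c (p a) (q a)| + v * (1 - v) * |dcv c (p a) (q a)|) := by ring
      _ ≤ t * Ψ u v := mul_le_mul_of_nonneg_left h3 ht0
  have := norm_image_sub_le_of_norm_deriv_le_segment_01' hd hb
  simpa [hp, hq] using this

end IsCopulaDensity

end

/-! ### Perturbation of a distribution function -/

/-- Two densities whose ratio is close to one have relatively close distribution functions. -/
theorem abs_setIntegral_sub_le {p q : ℝ → ℝ} {C : ℝ} (hp0 : ∀ t, 0 ≤ p t) (hp : Integrable p)
    (hq : Integrable q) (hp1 : ∫ t, p t = 1) (hq1 : ∫ t, q t = 1) (h : ∀ t, |q t - p t| ≤ C * p t)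
    (hC : 0 ≤ C) (s : ℝ) : |(∫ t in Set.Iic s, q t) - ∫ t in Set.Iic s, p t| ≤
      2 * C * ((∫ t in Set.Iic s, p t) * (1 - ∫ t in Set.Iic s, p t)) := by
  set F := ∫ t in Set.Iic s, p t with hF
  -- Applied to the half-line and to its complement: the two integrals over the complement differ by
  -- the same amount. The change is at most `C min(F, 1 - F)`, and the minimum is at most `2 F (1 -
  -- F)`.
  have key : ∀ S : Set ℝ, |(∫ t in S, q t) - ∫ t in S, p t| ≤ C * ∫ t in S, p t := by
    intro S
    rw [← integral_sub hq.integrableOn hp.integrableOn, ← integral_const_mul]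
    exact norm_integral_le_of_norm_le (f := fun t => q t - p t) (hp.integrableOn.const_mul C)
      (Eventually.of_forall fun t => h t)
  have h1 := key (Set.Iic s)
  have h2 := key (Set.Iic s)ᶜ
  have e1 : ∫ t in (Set.Iic s)ᶜ, p t = 1 - F := by
    rw [setIntegral_compl measurableSet_Iic hp, hp1]
  have e2 : ∫ t in (Set.Iic s)ᶜ, q t = 1 - ∫ t in Set.Iic s, q t := by
    rw [setIntegral_compl measurableSet_Iic hq, hq1]
  rw [e1, e2, sub_sub_sub_cancel_left, abs_sub_comm] at h2
  rw [← hF] at h1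
  have h0 : 0 ≤ F := integral_nonneg hp0
  have h3 : F ≤ 1 := by
    rw [← hp1]
    exact setIntegral_le_integral hp (Eventually.of_forall hp0)
  rcases le_total F (1 / 2) with h4 | h4
  · refine h1.trans ?_
    have : F ≤ 2 * (F * (1 - F)) := by nlinarith
    calc C * F ≤ C * (2 * (F * (1 - F))) := mul_le_mul_of_nonneg_left this hC
      _ = _ := by ring
  · refine h2.trans ?_
    have : 1 - F ≤ 2 * (F * (1 - F)) := by nlinarith
    calc C * (1 - F) ≤ C * (2 * (F * (1 - F))) := mul_le_mul_of_nonneg_left this hC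
      _ = _ := by ring

theorem mem_Ioo_of_abs_sub_le {u u' t : ℝ} (hu : u ∈ Set.Ioo (0 : ℝ) 1)
    (h : |u' - u| ≤ t * (u * (1 - u))) (ht : t ≤ 1 / 2) : u' ∈ Set.Ioo (0 : ℝ) 1 := by
  obtain ⟨h1, h2⟩ := abs_le.1 h
  obtain ⟨h3, h4⟩ := hu
  have h5 : 0 < u * (1 - u) := mul_pos h3 (by linarith)
  have h6 : t * (u * (1 - u)) ≤ 1 / 2 * (u * (1 - u)) := mul_le_mul_of_nonneg_right ht h5.le
  constructor <;> nlinarith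

/-! ### Relative change of the law of `S` under a tilt -/

namespace ObsModel

variable {𝒳 : Type*} [MeasurableSpace 𝒳] (M : ObsModel 𝒳)

/-- The likelihood ratio of the law of `S` given `(X, Z)` under a tilt. -/
def ratS (g : Obs 𝒳 → ℝ) (z : Bool) (s : ℝ) (x : 𝒳) : ℝ := M.avS g ((x, z), s) / M.avZ g (x, z)

/-- The conditional distribution function of `S` under a tilt. -/
def tiltF (g : Obs 𝒳 → ℝ) (z : Bool) (s : ℝ) (x : 𝒳) : ℝ :=
  ∫ t in Set.Iic s, M.ratS g z t x * M.p z x t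

/-- The conditional score of `S` given `(X, Z)`. -/
def scoreS (σ : Obs 𝒳 → ℝ) (z : Bool) (s : ℝ) (x : 𝒳) : ℝ := M.avS σ ((x, z), s) - M.avZ σ (x, z)

/-- The derivative of the conditional distribution function along a submodel with score `σ`. -/
def dF (σ : Obs 𝒳 → ℝ) (z : Bool) (s : ℝ) (x : 𝒳) : ℝ :=
  ∫ t in Set.Iic s, M.scoreS σ z t x * M.p z x t

/-- The derivative of the outcome mean along a submodel with score `σ`. -/
def dmu (σ : Obs 𝒳 → ℝ) (z : Bool) (s : ℝ) (x : 𝒳) : ℝ :=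
  ∫ y, (σ (((x, z), s), y) - M.avS σ ((x, z), s)) * y ∂(M.out ((x, z), s))

theorem measurable_avS {h : Obs 𝒳 → ℝ} (hh : Measurable h) : Measurable (M.avS h) :=
  measurable_kav _ hh

theorem measurable_avZ {h : Obs 𝒳 → ℝ} (hh : Measurable h) : Measurable (M.avZ h) :=
  measurable_kav _ (M.measurable_avS hh)

theorem measurable_avX {h : Obs 𝒳 → ℝ} (hh : Measurable h) : Measurable (M.avX h) :=
  measurable_kav _ (M.measurable_avZ hh)

theorem measurable_scoreS {σ : Obs 𝒳 → ℝ} (hσ : Measurable σ) (z : Bool) :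
    Measurable fun v : ℝ × 𝒳 => M.scoreS σ z v.1 v.2 :=
  ((M.measurable_avS hσ).comp (by fun_prop : Measurable fun v : ℝ × 𝒳 => ((v.2, z), v.1))).sub
    ((M.measurable_avZ hσ).comp (by fun_prop : Measurable fun v : ℝ × 𝒳 => (v.2, z)))

section Ratio

variable {g : Obs 𝒳 → ℝ} (hg : IsRatio g) {ε : ℝ} (hε : ∀ v, |g v - 1| ≤ ε)
include hg

theorem measurable_ratS (z : Bool) : Measurable fun v : ℝ × 𝒳 => M.ratS g z v.1 v.2 :=
  ((M.isRatio_avS hg).measurable.comp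
    (by fun_prop : Measurable fun v : ℝ × 𝒳 => ((v.2, z), v.1))).div
    ((M.isRatio_avZ hg).measurable.comp (by fun_prop : Measurable fun v : ℝ × 𝒳 => (v.2, z)))

theorem ratS_pos (z : Bool) (s : ℝ) (x : 𝒳) : 0 < M.ratS g z s x :=
  div_pos ((M.isRatio_avS hg).pos _) ((M.isRatio_avZ hg).pos _)

include hε

theorem abs_avS_sub_one_le (a : (𝒳 × Bool) × ℝ) : |M.avS g a - 1| ≤ ε :=
  abs_kav_sub_one_le _ hg.measurable hε a

theorem abs_avZ_sub_one_le (a : 𝒳 × Bool) : |M.avZ g a - 1| ≤ ε :=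
  abs_kav_sub_one_le _ (M.isRatio_avS hg).measurable (M.abs_avS_sub_one_le hg hε) a

theorem abs_avX_sub_one_le (x : 𝒳) : |M.avX g x - 1| ≤ ε :=
  abs_kav_sub_one_le _ (M.isRatio_avZ hg).measurable (M.abs_avZ_sub_one_le hg hε) x

theorem abs_ratS_sub_one_le (z : Bool) (s : ℝ) (x : 𝒳) : |M.ratS g z s x - 1| ≤ 4 * ε :=
  abs_div_sub_one_le (M.abs_avS_sub_one_le hg hε _) (M.abs_avZ_sub_one_le hg hε _)
    ((M.isRatio_avZ hg).ge _)

/-- The density ratio is within `4 ε` of one, and passing to distribution functions doubles the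
constant. The factor `F (1 - F)` is the scale of the hypothesis on `Ψ`. -/
theorem abs_tiltF_sub_le (h1 : ∫ v, g v ∂M.law = 1) (z : Bool) (s : ℝ) (x : 𝒳) :
    |M.tiltF g z s x - M.F z s x| ≤ 8 * ε * (M.F z s x * (1 - M.F z s x)) := by
  have h0 : 0 ≤ ε := by
    by_contra h
    have : ∀ v, False := fun v => by linarith [(abs_nonneg _).trans (hε v)]
    exact this (((x, z), s), 0)
  have := abs_setIntegral_sub_le (q := (M.tilt g hg h1).p z x) (C := 4 * ε) (M.p_nonneg z x)
    (M.integrable_p z x) ((M.tilt g hg h1).integrable_p z x) (M.integral_p z x)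
    ((M.tilt g hg h1).integral_p z x) (fun t => ?_) (by positivity) s
  · rw [show 2 * (4 * ε) = 8 * ε by ring] at this
    exact this
  · change |M.ratS g z t x * M.p z x t - M.p z x t| ≤ _
    rw [← sub_one_mul, abs_mul, abs_of_nonneg (M.p_nonneg z x t)]
    exact mul_le_mul_of_nonneg_right (M.abs_ratS_sub_one_le hg hε z t x) (M.p_nonneg z x t)

end Ratio

end ObsModel

/-! ### Derivatives along a curve of tilts -/

namespace IsCurve

variable {𝒳 : Type*} [MeasurableSpace 𝒳] {M : ObsModel 𝒳} {g : ℝ → Obs 𝒳 → ℝ} {σ : Obs 𝒳 → ℝ} {B : ℝ}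
  (hC : IsCurve M.law g σ B)
include hC

theorem avS : IsCurve ((M.PX ⊗ₘ M.trt) ⊗ₘ M.postKernel) (fun θ => M.avS (g θ)) (M.avS σ) B := hC.kav

theorem avZ : IsCurve (M.PX ⊗ₘ M.trt) (fun θ => M.avZ (g θ)) (M.avZ σ) B := hC.avS.kav

theorem avX : IsCurve M.PX (fun θ => M.avX (g θ)) (M.avX σ) B := hC.avZ.kav

theorem ratS_zero (z : Bool) (s : ℝ) (x : 𝒳) : M.ratS (g 0) z s x = 1 := by
  rw [ObsModel.ratS, hC.avS.zero, hC.avZ.zero, div_one]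

theorem tiltF_zero (z : Bool) (s : ℝ) (x : 𝒳) : M.tiltF (g 0) z s x = M.F z s x := by
  simp only [ObsModel.tiltF, hC.ratS_zero, one_mul, ObsModel.F]

theorem hasDerivAt_ratS {z : Bool} {s : ℝ} {x : 𝒳}
    (h1 : HasDerivAt (fun θ => M.avS (g θ) ((x, z), s)) (M.avS σ ((x, z), s)) 0)
    (h2 : HasDerivAt (fun θ => M.avZ (g θ) (x, z)) (M.avZ σ (x, z)) 0) :
    HasDerivAt (fun θ => M.ratS (g θ) z s x) (M.scoreS σ z s x) 0 :=
  hasDerivAt_div_of_one h1 h2 (hC.avS.zero _) (hC.avZ.zero _)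

/-- The bound `4 B p` is integrable over the line, so a single null set of `x` serves all endpoints
`s`. -/
theorem ae_hasDerivAt_tiltF : ∀ᵐ x ∂M.PX, ∀ z s,
    HasDerivAt (fun θ => M.tiltF (g θ) z s x) (M.dF σ z s x) 0 := by
  filter_upwards [M.ae_XZS hC.avS.deriv, M.ae_XZ hC.avZ.deriv] with x hS hZ z s
  have hi : ∀ θ, Measurable fun t => M.ratS (g θ) z t x * M.p z x t := fun θ =>
    ((M.measurable_ratS (hC.ratio θ) z).comp measurable_prodMk_right).mul (M.measurable_p_right z x)
  refine hasDerivAt_integral_of_lip (bound := fun t => 4 * B * M.p z x t)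
    (fun θ => (hi θ).aestronglyMeasurable) ?_ ?_ (Eventually.of_forall fun t θ => ?_)
    ((M.integrable_p z x).integrableOn.const_mul _) ?_
  · simp only [hC.ratS_zero, one_mul]
    exact (M.integrable_p z x).integrableOn
  · exact (((M.measurable_scoreS hC.measurable_s z).comp measurable_prodMk_right).mul
      (M.measurable_p_right z x)).aestronglyMeasurable
  · rw [hC.ratS_zero, ← sub_mul, abs_mul, abs_of_nonneg (M.p_nonneg z x t)]
    have := M.abs_ratS_sub_one_le (hC.ratio θ) (hC.lip θ) z t x
    calc _ ≤ 4 * (B * |θ|) * M.p z x t := mul_le_mul_of_nonneg_right this (M.p_nonneg z x t)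
      _ = _ := by ring
  · filter_upwards [ae_restrict_of_ae (hS z)] with t ht
    -- The ratio may fail to be differentiable where the density is zero, but there the integrand is
    -- constantly zero.
    rcases (M.p_nonneg z x t).eq_or_lt with h0 | h0
    · simp only [← h0, mul_zero]
      exact hasDerivAt_const _ _
    · exact (hC.hasDerivAt_ratS (ht h0) (hZ z)).mul_const _

end IsCurve

/-! ### The dominating measure for the criterion -/

namespace ObsModel

variable {𝒳 : Type*} [MeasurableSpace 𝒳] (M : ObsModel 𝒳)

/-- `(c + Ψ)(𝔽₁(s₁, x), 𝔽₀(s₀, x))`. -/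
def env (c Ψ : ℝ → ℝ → ℝ) (v : 𝒳 × ℝ × ℝ) : ℝ :=
  c (M.F true v.2.1 v.1) (M.F false v.2.2 v.1) + Ψ (M.F true v.2.1 v.1) (M.F false v.2.2 v.1)

/-- The density of the dominating measure. -/
def domDensity (c w Ψ : ℝ → ℝ → ℝ) (v : 𝒳 × ℝ × ℝ) : ℝ :=
  w v.2.1 v.2.2 * (M.env c Ψ v * M.p true v.1 v.2.1 * M.p false v.1 v.2.2)

/-- The dominating measure. -/
def dom (c w Ψ : ℝ → ℝ → ℝ) : Measure (𝒳 × ℝ × ℝ) :=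
  (M.PX.prod volume).withDensity fun v => ENNReal.ofReal (M.domDensity c w Ψ v)

/-- `𝔼(|Y| ∣ Z = 0, S = s₀, X = x)`. -/
def absMean (v : 𝒳 × ℝ × ℝ) : ℝ := (∫⁻ y, ‖y‖ₑ ∂(M.out ((v.1, false), v.2.2))).toReal

/-- The density of the principal strata under a tilt, relative to the dominating measure. -/
def relDensity (c Ψ : ℝ → ℝ → ℝ) (g : Obs 𝒳 → ℝ) (v : 𝒳 × ℝ × ℝ) : ℝ :=
  M.avX g v.1 * (M.ratS g true v.2.1 v.1 * M.ratS g false v.2.2 v.1) *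
    c (M.tiltF g true v.2.1 v.1) (M.tiltF g false v.2.2 v.1) / M.env c Ψ v

/-- The outcome mean under a tilt. -/
def tiltMu (g : Obs 𝒳 → ℝ) (v : 𝒳 × ℝ × ℝ) : ℝ :=
  ∫ y, g (((v.1, false), v.2.2), y) / M.avS g ((v.1, false), v.2.2) * y ∂(M.out ((v.1, false), v.2.2))

/-- The derivative of the density of the principal strata along a submodel with score `σ`, divided
by the densities of the post-treatment values. -/
def dc (c : ℝ → ℝ → ℝ) (σ : Obs 𝒳 → ℝ) (v : 𝒳 × ℝ × ℝ) : ℝ :=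
  (M.avX σ v.1 + (M.scoreS σ true v.2.1 v.1 + M.scoreS σ false v.2.2 v.1)) *
      c (M.F true v.2.1 v.1) (M.F false v.2.2 v.1) +
    (dcu c (M.F true v.2.1 v.1) (M.F false v.2.2 v.1) * M.dF σ true v.2.1 v.1 +
      dcv c (M.F true v.2.1 v.1) (M.F false v.2.2 v.1) * M.dF σ false v.2.2 v.1)

theorem measurable_comp_F {h : ℝ → ℝ → ℝ} (hh : Measurable (Function.uncurry h)) :
    Measurable fun v : 𝒳 × ℝ × ℝ => h (M.F true v.2.1 v.1) (M.F false v.2.2 v.1) :=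
  hh.comp (((M.measurable_F true).comp (f := fun v : 𝒳 × ℝ × ℝ => (v.2.1, v.1))
    (by fun_prop)).prodMk ((M.measurable_F false).comp (f := fun v : 𝒳 × ℝ × ℝ => (v.2.2, v.1))
    (by fun_prop)))

theorem measurable_p1 : Measurable fun v : 𝒳 × ℝ × ℝ => M.p true v.1 v.2.1 :=
  (M.measurable_p true).comp (by fun_prop : Measurable fun v : 𝒳 × ℝ × ℝ => (v.1, v.2.1))

theorem measurable_p0 : Measurable fun v : 𝒳 × ℝ × ℝ => M.p false v.1 v.2.2 :=
  (M.measurable_p false).comp (by fun_prop : Measurable fun v : 𝒳 × ℝ × ℝ => (v.1, v.2.2))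

theorem measurable_absMean : Measurable M.absMean := by
  have h : Measurable fun a : (𝒳 × Bool) × ℝ => ∫⁻ y, ‖y‖ₑ ∂(M.out a) :=
    Measurable.lintegral_kernel measurable_enorm
  exact (h.comp (by fun_prop : Measurable fun v : 𝒳 × ℝ × ℝ => ((v.1, false), v.2.2))).ennreal_toReal

theorem absMean_nonneg (v : 𝒳 × ℝ × ℝ) : 0 ≤ M.absMean v := ENNReal.toReal_nonneg

theorem ae_F_mem_prod' : ∀ᵐ v : 𝒳 × ℝ × ℝ ∂(M.PX.prod volume), 0 < M.p true v.1 v.2.1 →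
    0 < M.p false v.1 v.2.2 →
    M.F true v.2.1 v.1 ∈ Set.Ioo (0 : ℝ) 1 ∧ M.F false v.2.2 v.1 ∈ Set.Ioo (0 : ℝ) 1 := by
  have m1 : Measurable fun v : 𝒳 × ℝ × ℝ => M.F true v.2.1 v.1 :=
    (M.measurable_F true).comp (f := fun v : 𝒳 × ℝ × ℝ => (v.2.1, v.1)) (by fun_prop)
  have m0 : Measurable fun v : 𝒳 × ℝ × ℝ => M.F false v.2.2 v.1 :=
    (M.measurable_F false).comp (f := fun v : 𝒳 × ℝ × ℝ => (v.2.2, v.1)) (by fun_prop)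
  refine (Measure.ae_prod_iff_ae_ae ?_).2 (Eventually.of_forall fun x => M.ae_F_mem_prod x)
  refine MeasurableSet.imp (measurableSet_lt measurable_const M.measurable_p1)
    (MeasurableSet.imp (measurableSet_lt measurable_const M.measurable_p0) ?_)
  exact (m1 measurableSet_Ioo).inter (m0 measurableSet_Ioo)

theorem ae_prod_of_ae {P : (𝒳 × Bool) × ℝ → Prop}
    (h : ∀ᵐ a ∂((M.PX ⊗ₘ M.trt) ⊗ₘ M.postKernel), P a) :
    ∀ᵐ v : 𝒳 × ℝ × ℝ ∂(M.PX.prod volume), (0 < M.p true v.1 v.2.1 → P ((v.1, true), v.2.1)) ∧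
      (0 < M.p false v.1 v.2.2 → P ((v.1, false), v.2.2)) := by
  -- A measurable set of full measure inside `P` is needed before null sets can be sliced in the
  -- product.
  obtain ⟨S, hS, hSm, hSP⟩ := h.exists_measurable_mem
  have key : ∀ᵐ v : 𝒳 × ℝ × ℝ ∂(M.PX.prod volume),
      (0 < M.p true v.1 v.2.1 → ((v.1, true), v.2.1) ∈ S) ∧
      (0 < M.p false v.1 v.2.2 → ((v.1, false), v.2.2) ∈ S) := by
    refine (Measure.ae_prod_iff_ae_ae ?_).2 ?_
    · refine MeasurableSet.inter (MeasurableSet.imp (measurableSet_lt measurable_const M.measurable_p1)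
        ?_) (MeasurableSet.imp (measurableSet_lt measurable_const M.measurable_p0) ?_)
      · exact (by fun_prop : Measurable fun v : 𝒳 × ℝ × ℝ => ((v.1, true), v.2.1)) hSm
      · exact (by fun_prop : Measurable fun v : 𝒳 × ℝ × ℝ => ((v.1, false), v.2.2)) hSm
    · filter_upwards [M.ae_XZS hS] with x hx
      filter_upwards [Measure.quasiMeasurePreserving_fst.ae (hx true),
        Measure.quasiMeasurePreserving_snd.ae (hx false)] with s h1 h2
      exact ⟨h1, h2⟩
  filter_upwards [key] with v hv
  exact ⟨fun h1 => hSP _ (hv.1 h1), fun h1 => hSP _ (hv.2 h1)⟩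

variable {q : ℕ} {c w : ℝ → ℝ → ℝ} {f : ℝ → ℝ → (Fin q → ℝ) → ℝ} {η₀ : Fin q → ℝ} {b Ψ : ℝ → ℝ → ℝ}
  {δ : ℝ} {M}

section

variable (hc : IsCopulaDensity c) (hR : IsRegular c w f M η₀ b Ψ δ)
include hc hR

theorem measurable_env : Measurable (M.env c Ψ) :=
  (M.measurable_comp_F hc.measurable).add (M.measurable_comp_F hR.measurable_Ψ)

theorem measurable_domDensity : Measurable (M.domDensity c w Ψ) :=
  (hR.measurable_w.comp measurable_snd).mul
    (((measurable_env hc hR).mul M.measurable_p1).mul M.measurable_p0)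

omit hc in
theorem Psi_nonneg {u v : ℝ} (hu : u ∈ Set.Ioo (0 : ℝ) 1) (hv : v ∈ Set.Ioo (0 : ℝ) 1) : 0 ≤ Ψ u v := by
  have h1 : 0 < u * (1 - u) := mul_pos hu.1 (by linarith [hu.2])
  have h2 : 0 < v * (1 - v) := mul_pos hv.1 (by linarith [hv.2])
  have h3 := hR.pos
  refine le_trans ?_ (hR.bound_c u hu v hv u hu v hv ?_ ?_)
  · positivity
  · rw [sub_self, abs_zero]
    positivity
  · rw [sub_self, abs_zero]
    positivity

theorem env_nonneg {v : 𝒳 × ℝ × ℝ} (h1 : M.F true v.2.1 v.1 ∈ Set.Ioo (0 : ℝ) 1)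
    (h0 : M.F false v.2.2 v.1 ∈ Set.Ioo (0 : ℝ) 1) : 0 ≤ M.env c Ψ v :=
  add_nonneg (hc.nonneg _ h1 _ h0) (Psi_nonneg hR h1 h0)

theorem ae_domDensity_nonneg : ∀ᵐ v ∂(M.PX.prod volume), 0 ≤ M.domDensity c w Ψ v := by
  filter_upwards [M.ae_F_mem_prod'] with v hv
  rcases (M.p_nonneg true v.1 v.2.1).eq_or_lt with h1 | h1
  · simp [domDensity, ← h1]
  rcases (M.p_nonneg false v.1 v.2.2).eq_or_lt with h0 | h0
  · simp [domDensity, ← h0]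
  obtain ⟨h2, h3⟩ := hv h1 h0
  exact mul_nonneg (hR.w_nonneg _ _) (mul_nonneg (mul_nonneg (env_nonneg hc hR h2 h3) h1.le) h0.le)

/-- The dominating density vanishes as soon as `w`, a density of `S` or `env` does, so properties
need checking only where everything is positive and the arguments of `c` are interior. -/
theorem ae_dom_iff {P : 𝒳 × ℝ × ℝ → Prop} : (∀ᵐ v ∂(M.dom c w Ψ), P v) ↔
    ∀ᵐ v ∂(M.PX.prod volume), 0 < w v.2.1 v.2.2 → 0 < M.p true v.1 v.2.1 → 0 < M.p false v.1 v.2.2 →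
      M.F true v.2.1 v.1 ∈ Set.Ioo (0 : ℝ) 1 → M.F false v.2.2 v.1 ∈ Set.Ioo (0 : ℝ) 1 →
      0 < M.env c Ψ v → P v := by
  rw [dom, ae_withDensity_iff (measurable_domDensity hc hR).ennreal_ofReal]
  have key : ∀ᵐ v ∂(M.PX.prod volume), (ENNReal.ofReal (M.domDensity c w Ψ v) ≠ 0 ↔
      (0 < w v.2.1 v.2.2 ∧ 0 < M.p true v.1 v.2.1 ∧ 0 < M.p false v.1 v.2.2 ∧
      M.F true v.2.1 v.1 ∈ Set.Ioo (0 : ℝ) 1 ∧ M.F false v.2.2 v.1 ∈ Set.Ioo (0 : ℝ) 1 ∧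
      0 < M.env c Ψ v)) := by
    filter_upwards [M.ae_F_mem_prod'] with v hv
    rw [ne_eq, ENNReal.ofReal_eq_zero, not_le, domDensity]
    constructor
    · intro h
      have hp1 : 0 < M.p true v.1 v.2.1 := by
        refine lt_of_le_of_ne (M.p_nonneg _ _ _) fun h0 => ?_
        rw [← h0] at h
        simp at h
      have hp0 : 0 < M.p false v.1 v.2.2 := by
        refine lt_of_le_of_ne (M.p_nonneg _ _ _) fun h0 => ?_
        rw [← h0] at h
        simp at h
      have hw : 0 < w v.2.1 v.2.2 := by
        refine lt_of_le_of_ne (hR.w_nonneg _ _) fun h0 => ?_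
        rw [← h0] at h
        simp at h
      have hF := hv hp1 hp0
      refine ⟨hw, hp1, hp0, hF.1, hF.2, ?_⟩
      refine lt_of_le_of_ne (env_nonneg hc hR hF.1 hF.2) fun h0 => ?_
      rw [← h0] at h
      simp at h
    · rintro ⟨h1, h2, h3, -, -, h4⟩
      positivity
  constructor
  · intro h
    filter_upwards [h, key] with v h1 h2 h3 h4 h5 h6 h7 h8
    exact h1 (h2.2 ⟨h3, h4, h5, h6, h7, h8⟩)
  · intro h
    filter_upwards [h, key] with v h1 h2 h3
    obtain ⟨h4, h5, h6, h7, h8, h9⟩ := h2.1 h3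
    exact h1 h4 h5 h6 h7 h8 h9

theorem lintegral_moment_dom : ∫⁻ v, ((∫⁻ y, ‖y‖ₑ ∂(M.out ((v.1, false), v.2.2)))
    + ENNReal.ofReal (b v.2.1 v.2.2)) ^ 2 ∂(M.dom c w Ψ) < ∞ := by
  have hA : Measurable fun a : (𝒳 × Bool) × ℝ => ∫⁻ y, ‖y‖ₑ ∂(M.out a) :=
    Measurable.lintegral_kernel measurable_enorm
  have hm : Measurable fun v : 𝒳 × ℝ × ℝ => ((∫⁻ y, ‖y‖ₑ ∂(M.out ((v.1, false), v.2.2)))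
      + ENNReal.ofReal (b v.2.1 v.2.2)) ^ 2 :=
    ((hA.comp (by fun_prop : Measurable fun v : 𝒳 × ℝ × ℝ => ((v.1, false), v.2.2))).add
      (hR.measurable_b.comp measurable_snd).ennreal_ofReal).pow_const 2
  have hD := (measurable_domDensity hc hR).ennreal_ofReal
  rw [dom, lintegral_withDensity_eq_lintegral_mul _ hD hm, lintegral_prod _ (hD.mul hm).aemeasurable]
  refine lt_of_eq_of_lt ?_ hR.moment
  refine lintegral_congr fun x => lintegral_congr fun s => ?_
  rw [Pi.mul_apply, domDensity, ENNReal.ofReal_mul (hR.w_nonneg _ _), env]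
  ring

/-- A finite integral of `(𝔼|Y| + b)²` forces `𝔼|Y| < ∞` almost everywhere for the dominating
measure, though not for every stratum. -/
theorem ae_dom_integrable : ∀ᵐ v ∂(M.dom c w Ψ),
    Integrable (fun y : ℝ => y) (M.out ((v.1, false), v.2.2)) := by
  have hA : Measurable fun a : (𝒳 × Bool) × ℝ => ∫⁻ y, ‖y‖ₑ ∂(M.out a) :=
    Measurable.lintegral_kernel measurable_enorm
  have hm : Measurable fun v : 𝒳 × ℝ × ℝ => ((∫⁻ y, ‖y‖ₑ ∂(M.out ((v.1, false), v.2.2)))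
      + ENNReal.ofReal (b v.2.1 v.2.2)) ^ 2 :=
    ((hA.comp (by fun_prop : Measurable fun v : 𝒳 × ℝ × ℝ => ((v.1, false), v.2.2))).add
      (hR.measurable_b.comp measurable_snd).ennreal_ofReal).pow_const 2
  filter_upwards [ae_lt_top hm (lintegral_moment_dom hc hR).ne] with v hv
  refine ⟨measurable_id.aestronglyMeasurable, ?_⟩
  refine lt_of_le_of_lt le_self_add (ENNReal.pow_lt_top_iff.1 hv |>.resolve_right (by norm_num))

/-- The criterion satisfies the assumptions of the general theory of least squares. -/
theorem isBase : IsBase (M.dom c w Ψ) (fun v => f v.2.1 v.2.2) M.absMean (fun v => b v.2.1 v.2.2)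
    (fun v => M.mu false v.2.2 v.1)
    (fun v => c (M.F true v.2.1 v.1) (M.F false v.2.2 v.1) / M.env c Ψ v) η₀ δ where
  pos := hR.pos
  measurable_f η := (hR.measurable_f η).comp measurable_snd
  contDiff v := hR.contDiff_f _ _
  bound_f v := hR.bound_f _ _
  bound_pd v := hR.bound_df _ _
  bound_pd2 v := hR.bound_ddf _ _
  A_nonneg := M.absMean_nonneg
  moment := by
    refine ⟨((M.measurable_absMean.add (hR.measurable_b.comp measurable_snd)).pow_const
      2).aestronglyMeasurable, ?_⟩
    refine lt_of_le_of_lt (lintegral_mono_ae ?_) (lintegral_moment_dom hc hR)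
    filter_upwards [ae_dom_integrable hc hR] with v hv
    have hb : 0 ≤ b v.2.1 v.2.2 :=
      (abs_nonneg _).trans (hR.bound_f v.2.1 v.2.2 η₀ (Metric.mem_ball_self hR.pos))
    rw [enorm_pow]
    gcongr
    rw [Real.enorm_of_nonneg (add_nonneg (M.absMean_nonneg v) hb),
      ENNReal.ofReal_add (M.absMean_nonneg v) hb, absMean]
    gcongr
    exact ENNReal.ofReal_toReal_le
  measurable_m := M.measurable_mu'.aemeasurable
  measurable_r := ((M.measurable_comp_F hc.measurable).div (measurable_env hc hR)).aemeasurable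
  bound_m := by
    filter_upwards [ae_dom_integrable hc hR] with v hv
    have := norm_integral_le_lintegral_norm (μ := M.out ((v.1, false), v.2.2)) (fun y : ℝ => y)
    simp only [ofReal_norm] at this
    exact this
  r_nonneg := by
    rw [ae_dom_iff hc hR]
    refine Eventually.of_forall fun v _ _ _ h1 h0 h => ?_
    exact div_nonneg (hc.nonneg _ h1 _ h0) h.le
  r_le := by
    rw [ae_dom_iff hc hR]
    refine Eventually.of_forall fun v _ _ _ h1 h0 h => ?_
    rw [div_le_one h, env]
    linarith [Psi_nonneg hR h1 h0]

end

/-! ### The relative density of the strata under a tilt -/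

section Path

variable {g : ℝ → Obs 𝒳 → ℝ} {σ : Obs 𝒳 → ℝ} {B : ℝ}

omit M in
theorem abs_mul_three_sub_one_le {a₁ a₂ a₃ t : ℝ} (h1 : |a₁ - 1| ≤ t) (h2 : |a₂ - 1| ≤ 4 * t)
    (h3 : |a₃ - 1| ≤ 4 * t) (ht : 32 * t ≤ 1) : |a₁ * (a₂ * a₃) - 1| ≤ 16 * t := by
  have h5 : |a₃| ≤ 9 / 8 := by
    have := abs_sub_abs_le_abs_sub a₃ 1
    rw [abs_one] at this
    linarith
  have h4 : |a₂| ≤ 9 / 8 := by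
    have := abs_sub_abs_le_abs_sub a₂ 1
    rw [abs_one] at this
    linarith
  have e : a₁ * (a₂ * a₃) - 1 = (a₁ - 1) * (a₂ * a₃) + ((a₂ - 1) * a₃ + (a₃ - 1)) := by ring
  rw [e]
  have h0 : 0 ≤ t := (abs_nonneg _).trans h1
  calc |(a₁ - 1) * (a₂ * a₃) + ((a₂ - 1) * a₃ + (a₃ - 1))|
      ≤ |a₁ - 1| * (|a₂| * |a₃|) + (|a₂ - 1| * |a₃| + |a₃ - 1|) := by
        refine (abs_add_le _ _).trans (add_le_add ?_ ((abs_add_le _ _).trans ?_))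
        · rw [abs_mul, abs_mul]
        · rw [abs_mul]
    _ ≤ t * (9 / 8 * (9 / 8)) + (4 * t * (9 / 8) + 4 * t) := by gcongr
    _ ≤ 16 * t := by linarith

variable (hc : IsCopulaDensity c) (hR : IsRegular c w f M η₀ b Ψ δ)
include hc hR

/-- The perturbation of the copula density along a tilt. -/
theorem abs_copula_tilt_sub_le {G : Obs 𝒳 → ℝ} (hg : IsRatio G) (h1 : ∫ v, G v ∂M.law = 1) {t : ℝ}
    (hG : ∀ v, |G v - 1| ≤ t) (ht : 32 * t ≤ 1) (htδ : 8 * t ≤ δ) {x : 𝒳} {s₁ s₀ : ℝ}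
    (hF1 : M.F true s₁ x ∈ Set.Ioo (0 : ℝ) 1) (hF0 : M.F false s₀ x ∈ Set.Ioo (0 : ℝ) 1) :
    0 ≤ c (M.tiltF G true s₁ x) (M.tiltF G false s₀ x) ∧
    |c (M.tiltF G true s₁ x) (M.tiltF G false s₀ x) - c (M.F true s₁ x) (M.F false s₀ x)| ≤
      8 * t * Ψ (M.F true s₁ x) (M.F false s₀ x) := by
  have e1 := M.abs_tiltF_sub_le hg hG h1 true s₁ x
  have e0 := M.abs_tiltF_sub_le hg hG h1 false s₀ x
  have m1 := mem_Ioo_of_abs_sub_le hF1 e1 (by linarith)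
  have m0 := mem_Ioo_of_abs_sub_le hF0 e0 (by linarith)
  exact ⟨hc.nonneg _ m1 _ m0, hc.abs_sub_le hR.bound_c hF1 hF0 m1 m0 htδ e1 e0⟩

/-- The product of the likelihood ratios is within `16 t` of one, and the copula density moves by at
most `8 t Ψ`, so it stays below `c + Ψ`. Dividing by `c + Ψ` leaves a bound free of the point. -/
theorem abs_relDensity_sub_le {G : Obs 𝒳 → ℝ} (hg : IsRatio G) (h1 : ∫ v, G v ∂M.law = 1) {t : ℝ}
    (hG : ∀ v, |G v - 1| ≤ t) (ht : 32 * t ≤ 1) (htδ : 8 * t ≤ δ) {v : 𝒳 × ℝ × ℝ}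
    (hF1 : M.F true v.2.1 v.1 ∈ Set.Ioo (0 : ℝ) 1) (hF0 : M.F false v.2.2 v.1 ∈ Set.Ioo (0 : ℝ) 1)
    (hE : 0 < M.env c Ψ v) :
    |M.relDensity c Ψ G v - c (M.F true v.2.1 v.1) (M.F false v.2.2 v.1) / M.env c Ψ v| ≤ 32 * t := by
  obtain ⟨h2, h3⟩ := abs_copula_tilt_sub_le hc hR hg h1 hG ht htδ hF1 hF0
  have h4 := abs_mul_three_sub_one_le (M.abs_avX_sub_one_le hg hG v.1)
    (M.abs_ratS_sub_one_le hg hG true v.2.1 v.1) (M.abs_ratS_sub_one_le hg hG false v.2.2 v.1) ht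
  have h5 := hc.nonneg _ hF1 _ hF0
  have h6 := Psi_nonneg hR hF1 hF0
  rw [relDensity, ← sub_div, abs_div, abs_of_pos hE, div_le_iff₀ hE, env]
  set C := c (M.tiltF G true v.2.1 v.1) (M.tiltF G false v.2.2 v.1)
  set C₀ := c (M.F true v.2.1 v.1) (M.F false v.2.2 v.1)
  set P := Ψ (M.F true v.2.1 v.1) (M.F false v.2.2 v.1)
  set a := M.avX G v.1 * (M.ratS G true v.2.1 v.1 * M.ratS G false v.2.2 v.1)
  have h0 : 0 ≤ t := by
    have := (abs_nonneg _).trans h4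
    linarith
  have h7 : C ≤ C₀ + P := by
    have := (abs_le.1 h3).2
    nlinarith
  have e : a * C - C₀ = (a - 1) * C + (C - C₀) := by ring
  rw [e]
  calc |(a - 1) * C + (C - C₀)| ≤ |a - 1| * C + |C - C₀| := by
        refine (abs_add_le _ _).trans ?_
        rw [abs_mul, abs_of_nonneg h2]
    _ ≤ 16 * t * (C₀ + P) + 8 * t * P := by gcongr
    _ ≤ 32 * t * (C₀ + P) := by nlinarith [mul_nonneg h0 h5, mul_nonneg h0 h6]

theorem relDensity_nonneg {G : Obs 𝒳 → ℝ} (hg : IsRatio G) (h1 : ∫ v, G v ∂M.law = 1) {t : ℝ}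
    (hG : ∀ v, |G v - 1| ≤ t) (ht : 32 * t ≤ 1) (htδ : 8 * t ≤ δ) {v : 𝒳 × ℝ × ℝ}
    (hF1 : M.F true v.2.1 v.1 ∈ Set.Ioo (0 : ℝ) 1) (hF0 : M.F false v.2.2 v.1 ∈ Set.Ioo (0 : ℝ) 1)
    (hE : 0 ≤ M.env c Ψ v) : 0 ≤ M.relDensity c Ψ G v := by
  obtain ⟨h2, -⟩ := abs_copula_tilt_sub_le hc hR hg h1 hG ht htδ hF1 hF0
  refine div_nonneg (mul_nonneg (mul_nonneg ((M.isRatio_avX hg).pos _).le ?_) h2) hE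
  exact mul_nonneg (M.ratS_pos hg _ _ _).le (M.ratS_pos hg _ _ _).le

theorem measurable_relDensity {G : Obs 𝒳 → ℝ} (hg : IsRatio G) (h1 : ∫ v, G v ∂M.law = 1) :
    Measurable (M.relDensity c Ψ G) := by
  refine Measurable.div (Measurable.mul (Measurable.mul ?_ (Measurable.mul ?_ ?_)) ?_)
    (measurable_env hc hR)
  · exact (M.isRatio_avX hg).measurable.comp measurable_fst
  · exact (M.measurable_ratS hg true).comp
      (by fun_prop : Measurable fun v : 𝒳 × ℝ × ℝ => (v.2.1, v.1))
  · exact (M.measurable_ratS hg false).comp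
      (by fun_prop : Measurable fun v : 𝒳 × ℝ × ℝ => (v.2.2, v.1))
  · exact (M.tilt G hg h1).measurable_comp_F hc.measurable

omit hc hR in
theorem tilt_mu_eq {G : Obs 𝒳 → ℝ} (hg : IsRatio G) (h1 : ∫ v, G v ∂M.law = 1) (v : 𝒳 × ℝ × ℝ) :
    (M.tilt G hg h1).mu false v.2.2 v.1 = M.tiltMu G v := M.tilt_mu hg h1 _ _ _

/-- The criterion of a tilt as an integral with respect to the dominating measure. -/
theorem fullLoss_tilt {G : Obs 𝒳 → ℝ} (hg : IsRatio G) (h1 : ∫ v, G v ∂M.law = 1) {t : ℝ}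
    (hG : ∀ v, |G v - 1| ≤ t) (ht : 32 * t ≤ 1) (htδ : 8 * t ≤ δ) (η : Fin q → ℝ) :
    (M.tilt G hg h1).fullLoss c w f η =
      lsLoss (M.dom c w Ψ) (fun v => f v.2.1 v.2.2) (M.tiltMu G) (M.relDensity c Ψ G) η := by
  have hX := M.isRatio_avX hg
  have hmu : Measurable (M.tiltMu G) := by
    have := (M.tilt G hg h1).measurable_mu'
    simp only [tilt_mu_eq] at this
    exact this
  have hf : Measurable fun v : 𝒳 × ℝ × ℝ => f v.2.1 v.2.2 η := (hR.measurable_f η).comp measurable_snd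
  have hm : Measurable fun v : 𝒳 × ℝ × ℝ =>
      ENNReal.ofReal ((M.tiltMu G v - f v.2.1 v.2.2 η) ^ 2 * M.relDensity c Ψ G v) :=
    (((hmu.sub hf).pow_const 2).mul (measurable_relDensity hc hR hg h1)).ennreal_ofReal
  have hD := (measurable_domDensity hc hR).ennreal_ofReal
  have hm2 : Measurable fun v : 𝒳 × ℝ × ℝ => ENNReal.ofReal (w v.2.1 v.2.2 *
      (M.tiltMu G v - f v.2.1 v.2.2 η) ^ 2 * (M.tilt G hg h1).e c v.2.1 v.2.2 v.1) :=
    (((hR.measurable_w.comp measurable_snd).mul ((hmu.sub hf).pow_const 2)).mul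
      ((M.tilt G hg h1).measurable_e hc.measurable)).ennreal_ofReal
  have hfl : (M.tilt G hg h1).fullLoss c w f η = ∫⁻ x, ENNReal.ofReal (M.avX G x) *
      (∫⁻ s : ℝ × ℝ, ENNReal.ofReal (w s.1 s.2 * (M.tiltMu G (x, s) - f s.1 s.2 η) ^ 2 *
        (M.tilt G hg h1).e c s.1 s.2 x)) ∂M.PX := by
    rw [fullLoss]
    change ∫⁻ x, _ ∂(M.PX.withDensity _) = _
    rw [lintegral_withDensity_eq_lintegral_mul _ hX.measurable.ennreal_ofReal]
    · refine lintegral_congr fun x => ?_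
      rw [Pi.mul_apply]
      congr 1
      refine lintegral_congr fun s => ?_
      have := tilt_mu_eq hg h1 (x, s)
      simp only at this
      rw [this]
    · refine Measurable.lintegral_prod_right' (f := fun v : 𝒳 × ℝ × ℝ => ENNReal.ofReal
        (w v.2.1 v.2.2 * ((M.tilt G hg h1).mu false v.2.2 v.1 - f v.2.1 v.2.2 η) ^ 2 *
          (M.tilt G hg h1).e c v.2.1 v.2.2 v.1)) ?_
      simp only [tilt_mu_eq]
      exact hm2
  rw [hfl, lsLoss, dom, lintegral_withDensity_eq_lintegral_mul _ hD hm]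
  have e2 : ∀ x, ENNReal.ofReal (M.avX G x) * (∫⁻ s : ℝ × ℝ, ENNReal.ofReal (w s.1 s.2 *
      (M.tiltMu G (x, s) - f s.1 s.2 η) ^ 2 * (M.tilt G hg h1).e c s.1 s.2 x)) =
      ∫⁻ s : ℝ × ℝ, ENNReal.ofReal (M.avX G x) * ENNReal.ofReal (w s.1 s.2 *
        (M.tiltMu G (x, s) - f s.1 s.2 η) ^ 2 * (M.tilt G hg h1).e c s.1 s.2 x) := fun x =>
    (lintegral_const_mul _ (hm2.comp measurable_prodMk_left)).symm
  simp only [e2]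
  rw [← lintegral_prod (fun v : 𝒳 × ℝ × ℝ => ENNReal.ofReal (M.avX G v.1) *
    ENNReal.ofReal (w v.2.1 v.2.2 * (M.tiltMu G v - f v.2.1 v.2.2 η) ^ 2 *
      (M.tilt G hg h1).e c v.2.1 v.2.2 v.1))
    ((hX.measurable.comp measurable_fst).ennreal_ofReal.mul hm2).aemeasurable]
  refine lintegral_congr_ae ?_
  filter_upwards [M.ae_F_mem_prod', ae_domDensity_nonneg hc hR] with v hv hv0
  rw [Pi.mul_apply, ← ENNReal.ofReal_mul (hX.pos _).le, ← ENNReal.ofReal_mul hv0]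
  congr 1
  have he : (M.tilt G hg h1).e c v.2.1 v.2.2 v.1 =
      c (M.tiltF G true v.2.1 v.1) (M.tiltF G false v.2.2 v.1) *
        (M.ratS G true v.2.1 v.1 * M.p true v.1 v.2.1) *
        (M.ratS G false v.2.2 v.1 * M.p false v.1 v.2.2) := rfl
  rw [he, domDensity, relDensity]
  rcases (M.p_nonneg true v.1 v.2.1).eq_or_lt with hp1 | hp1
  · rw [← hp1]; ring
  rcases (M.p_nonneg false v.1 v.2.2).eq_or_lt with hp0 | hp0
  · rw [← hp0]; ring
  obtain ⟨hF1, hF0⟩ := hv hp1 hp0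
  -- Where `c + Ψ = 0` the bound `8 t Ψ` makes the perturbed copula density vanish as well, so no
  -- mass is lost by dividing by `env`.
  rcases (env_nonneg hc hR hF1 hF0).eq_or_lt with hE | hE
  · obtain ⟨-, h3⟩ := abs_copula_tilt_sub_le hc hR hg h1 hG ht htδ hF1 hF0
    have h5 := hc.nonneg _ hF1 _ hF0
    have h6 := Psi_nonneg hR hF1 hF0
    have hE' := hE
    rw [env] at hE'
    have hC0 : c (M.F true v.2.1 v.1) (M.F false v.2.2 v.1) = 0 := by linarith
    have hP0 : Ψ (M.F true v.2.1 v.1) (M.F false v.2.2 v.1) = 0 := by linarith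
    rw [hC0, hP0, mul_zero, sub_zero] at h3
    rw [abs_nonpos_iff.1 h3, ← hE]
    ring
  · field_simp

end Path

end ObsModel

/-! ### The criterion along a curve of tilts -/

namespace ObsModel

variable {𝒳 : Type*} [MeasurableSpace 𝒳] {M : ObsModel 𝒳} {q : ℕ} {c w : ℝ → ℝ → ℝ}
  {f : ℝ → ℝ → (Fin q → ℝ) → ℝ} {η₀ : Fin q → ℝ} {b Ψ : ℝ → ℝ → ℝ} {δ : ℝ}
  {g : ℝ → Obs 𝒳 → ℝ} {σ : Obs 𝒳 → ℝ} {B : ℝ}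

theorem absMean_eq_integral {v : 𝒳 × ℝ × ℝ} (hi : Integrable (fun y : ℝ => y) (M.out ((v.1, false), v.2.2))) :
    M.absMean v = ∫ y, |y| ∂(M.out ((v.1, false), v.2.2)) := by
  rw [absMean, integral_eq_lintegral_of_nonneg_ae (Eventually.of_forall fun y => abs_nonneg y)
    hi.abs.aestronglyMeasurable]
  congr 1
  refine lintegral_congr fun y => ?_
  rw [← Real.norm_eq_abs, ofReal_norm]

theorem tiltMu_zero (hC : IsCurve M.law g σ B) (v : 𝒳 × ℝ × ℝ) :
    M.tiltMu (g 0) v = M.mu false v.2.2 v.1 := by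
  simp only [tiltMu, hC.zero, hC.avS.zero, div_one, one_mul]
  rfl

theorem abs_tiltMu_sub_le (hC : IsCurve M.law g σ B) {v : 𝒳 × ℝ × ℝ}
    (hi : Integrable (fun y : ℝ => y) (M.out ((v.1, false), v.2.2))) (θ : ℝ) :
    |M.tiltMu (g θ) v - M.mu false v.2.2 v.1| ≤ 4 * B * |θ| * M.absMean v := by
  have hG := hC.ratio θ
  have hr : ∀ y, |g θ (((v.1, false), v.2.2), y) / M.avS (g θ) ((v.1, false), v.2.2) - 1| ≤
      4 * (B * |θ|) := fun y => abs_div_sub_one_le (hC.lip θ _)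
    (M.abs_avS_sub_one_le hG (hC.lip θ) _) ((M.isRatio_avS hG).ge _)
  have hm : Measurable fun y => g θ (((v.1, false), v.2.2), y) / M.avS (g θ) ((v.1, false), v.2.2) :=
    (hG.measurable.comp measurable_prodMk_left).div_const _
  have hi1 : Integrable (fun y => g θ (((v.1, false), v.2.2), y) /
      M.avS (g θ) ((v.1, false), v.2.2) * y) (M.out ((v.1, false), v.2.2)) := by
    refine hi.bdd_mul (c := 4 * (B * |θ|) + 1) hm.aestronglyMeasurable (Eventually.of_forall fun y => ?_)
    have := abs_sub_abs_le_abs_sub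
      (g θ (((v.1, false), v.2.2), y) / M.avS (g θ) ((v.1, false), v.2.2)) 1
    rw [abs_one] at this
    rw [Real.norm_eq_abs]
    linarith [hr y]
  rw [tiltMu, mu, ← integral_sub hi1 hi, absMean_eq_integral hi, ← integral_const_mul]
  refine norm_integral_le_of_norm_le (f := fun y => g θ (((v.1, false), v.2.2), y) /
      M.avS (g θ) ((v.1, false), v.2.2) * y - y) (hi.abs.const_mul _) (Eventually.of_forall fun y => ?_)
  rw [← sub_one_mul, norm_mul, Real.norm_eq_abs, Real.norm_eq_abs, mul_assoc 4]
  exact mul_le_mul_of_nonneg_right (hr y) (abs_nonneg y)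

theorem hasDerivAt_tiltMu (hC : IsCurve M.law g σ B) {v : 𝒳 × ℝ × ℝ}
    (hi : Integrable (fun y : ℝ => y) (M.out ((v.1, false), v.2.2)))
    (h1 : ∀ᵐ y ∂(M.out ((v.1, false), v.2.2)), HasDerivAt (fun θ => g θ (((v.1, false), v.2.2), y))
      (σ (((v.1, false), v.2.2), y)) 0)
    (h2 : HasDerivAt (fun θ => M.avS (g θ) ((v.1, false), v.2.2)) (M.avS σ ((v.1, false), v.2.2)) 0) :
    HasDerivAt (fun θ => M.tiltMu (g θ) v) (M.dmu σ false v.2.2 v.1) 0 := by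
  refine hasDerivAt_integral_of_lip (bound := fun y => 4 * B * |y|) (fun θ => ?_) ?_ ?_
    (Eventually.of_forall fun y θ => ?_) (hi.abs.const_mul _) ?_
  · exact ((((hC.ratio θ).measurable.comp measurable_prodMk_left).div_const _).mul
      measurable_id).aestronglyMeasurable
  · simpa only [hC.zero, hC.avS.zero, div_one, one_mul] using hi
  · exact (((hC.measurable_s.comp measurable_prodMk_left).sub_const _).mul
      measurable_id).aestronglyMeasurable
  · rw [hC.zero, hC.avS.zero, div_one, ← sub_mul, abs_mul]
    have := abs_div_sub_one_le (hC.lip θ (((v.1, false), v.2.2), y))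
      (M.abs_avS_sub_one_le (hC.ratio θ) (hC.lip θ) ((v.1, false), v.2.2))
      ((M.isRatio_avS (hC.ratio θ)).ge _)
    calc _ ≤ 4 * (B * |θ|) * |y| := mul_le_mul_of_nonneg_right this (abs_nonneg y)
      _ = _ := by ring
  · filter_upwards [h1] with y hy
    exact (hasDerivAt_div_of_one hy h2 (hC.zero _) (hC.avS.zero _)).mul_const y

theorem relDensity_zero (hC : IsCurve M.law g σ B) (v : 𝒳 × ℝ × ℝ) :
    M.relDensity c Ψ (g 0) v = c (M.F true v.2.1 v.1) (M.F false v.2.2 v.1) / M.env c Ψ v := by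
  simp only [relDensity, hC.avX.zero, hC.ratS_zero, hC.tiltF_zero, one_mul]

/-- The product and chain rules. All likelihood ratios equal one at `θ = 0`, so the scores add. -/
theorem hasDerivAt_relDensity (hc : IsCopulaDensity c) (hC : IsCurve M.law g σ B) {v : 𝒳 × ℝ × ℝ}
    (hF1 : M.F true v.2.1 v.1 ∈ Set.Ioo (0 : ℝ) 1) (hF0 : M.F false v.2.2 v.1 ∈ Set.Ioo (0 : ℝ) 1)
    (hX : HasDerivAt (fun θ => M.avX (g θ) v.1) (M.avX σ v.1) 0)
    (h1 : HasDerivAt (fun θ => M.ratS (g θ) true v.2.1 v.1) (M.scoreS σ true v.2.1 v.1) 0)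
    (h0 : HasDerivAt (fun θ => M.ratS (g θ) false v.2.2 v.1) (M.scoreS σ false v.2.2 v.1) 0)
    (hT : ∀ z s, HasDerivAt (fun θ => M.tiltF (g θ) z s v.1) (M.dF σ z s v.1) 0) :
    HasDerivAt (fun θ => M.relDensity c Ψ (g θ) v) (M.dc c σ v / M.env c Ψ v) 0 := by
  have hcd := hc.hasDerivAt_comp (hT true v.2.1) (hT false v.2.2)
    (by rw [hC.tiltF_zero]; exact hF1) (by rw [hC.tiltF_zero]; exact hF0)
  have := ((hX.mul (h1.mul h0)).mul hcd).div_const (M.env c Ψ v)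
  refine this.congr_deriv ?_
  simp only [Pi.mul_apply, hC.avX.zero, hC.ratS_zero, hC.tiltF_zero, dc]
  ring

/-- The criterion along a curve of tilts. -/
theorem isPath (hc : IsCopulaDensity c) (hR : IsRegular c w f M η₀ b Ψ δ) (hC : IsCurve M.law g σ B)
    (h1 : ∀ θ, ∫ v, g θ v ∂M.law = 1) {ε : ℝ} (hε : 0 < ε) (hBε : 32 * (B * ε) ≤ 1)
    (hδε : 8 * (B * ε) ≤ δ) : IsPath (M.dom c w Ψ) M.absMean (fun v => M.mu false v.2.2 v.1)
    (fun v => c (M.F true v.2.1 v.1) (M.F false v.2.2 v.1) / M.env c Ψ v)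
    (fun θ => M.tiltMu (g θ)) (fun θ => M.relDensity c Ψ (g θ))
    (fun v => M.dmu σ false v.2.2 v.1) (fun v => M.dc c σ v / M.env c Ψ v) (32 * B) ε := by
  have hB0 := hC.B_nonneg
  have hθ1 : ∀ θ : ℝ, |θ| < ε → 32 * (B * |θ|) ≤ 1 := fun θ hθ =>
    le_trans (by gcongr) hBε
  have hθ2 : ∀ θ : ℝ, |θ| < ε → 8 * (B * |θ|) ≤ δ := fun θ hθ =>
    le_trans (by gcongr) hδε
  have mm : ∀ θ, Measurable (M.tiltMu (g θ)) := by
    intro θ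
    have := (M.tilt (g θ) (hC.ratio θ) (h1 θ)).measurable_mu'
    simp only [tilt_mu_eq] at this
    exact this
  have mr : ∀ θ, Measurable (M.relDensity c Ψ (g θ)) := fun θ =>
    measurable_relDensity hc hR (hC.ratio θ) (h1 θ)
  have hg : ∀ᵐ v ∂(M.dom c w Ψ),
      HasDerivAt (fun θ => M.avS (g θ) ((v.1, true), v.2.1)) (M.avS σ ((v.1, true), v.2.1)) 0 ∧
      HasDerivAt (fun θ => M.avS (g θ) ((v.1, false), v.2.2)) (M.avS σ ((v.1, false), v.2.2)) 0 ∧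
      ∀ᵐ y ∂(M.out ((v.1, false), v.2.2)), HasDerivAt (fun θ => g θ (((v.1, false), v.2.2), y))
        (σ (((v.1, false), v.2.2), y)) 0 := by
    rw [ae_dom_iff hc hR]
    filter_upwards [M.ae_prod_of_ae hC.avS.deriv,
      M.ae_prod_of_ae (Measure.ae_ae_of_ae_compProd hC.deriv)] with v h2 h3 _ hp1 hp0 _ _ _
    exact ⟨h2.1 hp1, h2.2 hp0, h3.2 hp0⟩
  have dm : ∀ᵐ v ∂(M.dom c w Ψ), HasDerivAt (fun θ => M.tiltMu (g θ) v) (M.dmu σ false v.2.2 v.1) 0 := by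
    filter_upwards [hg, ae_dom_integrable hc hR] with v h2 h3
    exact hasDerivAt_tiltMu hC h3 h2.2.2 h2.2.1
  have dr : ∀ᵐ v ∂(M.dom c w Ψ),
      HasDerivAt (fun θ => M.relDensity c Ψ (g θ) v) (M.dc c σ v / M.env c Ψ v) 0 := by
    have hx : ∀ᵐ x ∂M.PX, HasDerivAt (fun θ => M.avX (g θ) x) (M.avX σ x) 0 ∧
        (∀ z, HasDerivAt (fun θ => M.avZ (g θ) (x, z)) (M.avZ σ (x, z)) 0) ∧
        ∀ z s, HasDerivAt (fun θ => M.tiltF (g θ) z s x) (M.dF σ z s x) 0 := by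
      filter_upwards [hC.avX.deriv, M.ae_XZ hC.avZ.deriv, hC.ae_hasDerivAt_tiltF] with x h2 h3 h4
      exact ⟨h2, h3, h4⟩
    have hx' : ∀ᵐ v : 𝒳 × ℝ × ℝ ∂(M.PX.prod volume), _ := Measure.quasiMeasurePreserving_fst.ae hx
    have hF : ∀ᵐ v ∂(M.dom c w Ψ), M.F true v.2.1 v.1 ∈ Set.Ioo (0 : ℝ) 1 ∧
        M.F false v.2.2 v.1 ∈ Set.Ioo (0 : ℝ) 1 := by
      rw [ae_dom_iff hc hR]
      exact Eventually.of_forall fun v _ _ _ h2 h3 _ => ⟨h2, h3⟩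
    have hx'' := (withDensity_absolutelyContinuous (M.PX.prod volume)
      fun v => ENNReal.ofReal (M.domDensity c w Ψ v)).ae_le hx'
    filter_upwards [hg, hx'', hF] with v h2 h3 h4
    exact hasDerivAt_relDensity hc hC h4.1 h4.2 h3.1 (hC.hasDerivAt_ratS h2.1 (h3.2.1 true))
      (hC.hasDerivAt_ratS h2.2.1 (h3.2.1 false)) h3.2.2
  have hut : Tendsto (fun n : ℕ => 1 / ((n : ℝ) + 1)) atTop (𝓝[≠] 0) :=
    tendsto_nhdsWithin_iff.2 ⟨tendsto_one_div_add_atTop_nhds_zero_nat,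
      Eventually.of_forall fun n => by
        simp only [Set.mem_compl_iff, Set.mem_singleton_iff]
        positivity⟩
  -- The derivatives are measurable as limits of difference quotients along `1 / (n + 1)`.
  have hlim : ∀ {h : ℝ → 𝒳 × ℝ × ℝ → ℝ} {h' : 𝒳 × ℝ × ℝ → ℝ}, (∀ θ, Measurable (h θ)) →
      (∀ᵐ v ∂(M.dom c w Ψ), HasDerivAt (fun θ => h θ v) (h' v) 0) →
      AEMeasurable h' (M.dom c w Ψ) := by
    intro h h' hm hd
    refine aemeasurable_of_tendsto_metrizable_ae
      (f := fun (n : ℕ) v => (1 / ((n : ℝ) + 1))⁻¹ * (h (1 / ((n : ℝ) + 1)) v - h 0 v)) atTop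
      (fun n => (((hm _).sub (hm 0)).const_mul _).aemeasurable) ?_
    filter_upwards [hd] with v hv
    have := (hasDerivAt_iff_tendsto_slope.1 hv).comp hut
    refine this.congr fun n => ?_
    rw [Function.comp_apply, slope_def_field, sub_zero, div_eq_inv_mul]
  exact
    { pos := hε
      K_nonneg := by positivity
      small := by linarith
      measurable_m := fun θ _ => (mm θ).aemeasurable
      measurable_r := fun θ _ => (mr θ).aemeasurable
      measurable_m' := hlim mm dm
      measurable_r' := hlim mr dr
      zero_m := funext fun v => tiltMu_zero hC v
      zero_r := funext fun v => relDensity_zero hC v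
      r_nonneg := by
        rw [ae_dom_iff hc hR]
        exact Eventually.of_forall fun v _ _ _ hF1 hF0 hE θ hθ =>
          relDensity_nonneg hc hR (hC.ratio θ) (h1 θ) (hC.lip θ) (hθ1 θ hθ) (hθ2 θ hθ) hF1 hF0 hE.le
      lip_m := by
        filter_upwards [ae_dom_integrable hc hR] with v hv θ _
        refine (abs_tiltMu_sub_le hC hv θ).trans
          (mul_le_mul_of_nonneg_right ?_ (M.absMean_nonneg v))
        have := abs_nonneg θ
        nlinarith [mul_nonneg hB0 this]
      lip_r := by
        rw [ae_dom_iff hc hR]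
        refine Eventually.of_forall fun v _ _ _ hF1 hF0 hE θ hθ => ?_
        have := abs_relDensity_sub_le hc hR (hC.ratio θ) (h1 θ) (hC.lip θ) (hθ1 θ hθ) (hθ2 θ hθ)
          hF1 hF0 hE
        rwa [← mul_assoc] at this
      deriv_m := dm
      deriv_r := dr }

end ObsModel

section

/-! ### Inverse probability weighting -/

namespace ObsModel

variable {𝒳 : Type*} [MeasurableSpace 𝒳] (M : ObsModel 𝒳)

/-- The inverse probability weight of a treatment arm. -/
def ipw (z : Bool) (x : 𝒳) (z' : Bool) : ℝ := (if z' = z then 1 else 0) / (M.trt x).real {z}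

theorem ipw1_eq (z : Bool) (x : 𝒳) : M.ipw1 z x = M.ipw true x z := by
  cases z <;> simp [ipw1, ipw, prop]

theorem ipw0_eq (z : Bool) (x : 𝒳) : M.ipw0 z x = M.ipw false x z := by
  have h : (M.trt x).real {false} = 1 - (M.trt x).real {true} := by
    have h1 := probReal_compl_eq_one_sub (μ := M.trt x) (measurableSet_singleton true)
    rwa [show ({true} : Set Bool)ᶜ = {false} by ext b; cases b <;> simp] at h1
  cases z <;> simp [ipw0, ipw, prop, h]

theorem ipw_nonneg (z : Bool) (x : 𝒳) (z' : Bool) : 0 ≤ M.ipw z x z' :=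
  div_nonneg (by split_ifs <;> norm_num) measureReal_nonneg

theorem measurable_ipw (z : Bool) : Measurable fun v : Obs 𝒳 => M.ipw z v.1.1.1 v.1.1.2 := by
  unfold ipw
  refine Measurable.div (Measurable.ite ?_ measurable_const measurable_const) ?_
  · exact (by fun_prop : Measurable fun v : Obs 𝒳 => v.1.1.2) (measurableSet_singleton z)
  · exact ((Kernel.measurable_coe M.trt (measurableSet_singleton z)).ennreal_toReal).comp
      (by fun_prop : Measurable fun v : Obs 𝒳 => v.1.1.1)

/-- The law of `(X, S)` in a population with treatment `z`. -/
def arm (z : Bool) : Measure (𝒳 × ℝ) :=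
  (M.PX.prod volume).withDensity fun a => ENNReal.ofReal (M.p z a.1 a.2)

instance (z : Bool) : SFinite (M.arm z) := by
  unfold arm
  infer_instance

theorem measurable_armIdx (z : Bool) : Measurable fun a : 𝒳 × ℝ => ((a.1, z), a.2) := by fun_prop

/-- The law of `Y` given `(X, S)` in a population with treatment `z`. -/
def armOut (z : Bool) : Kernel (𝒳 × ℝ) ℝ := M.out.comap _ (measurable_armIdx z)

instance (z : Bool) : IsMarkovKernel (M.armOut z) := by
  unfold armOut
  infer_instance

/-- The observed data in a population with treatment `z`. -/
def armObs (z : Bool) (u : (𝒳 × ℝ) × ℝ) : Obs 𝒳 := (((u.1.1, z), u.1.2), u.2)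

theorem measurable_armObs (z : Bool) : Measurable (armObs z : (𝒳 × ℝ) × ℝ → Obs 𝒳) := by
  unfold armObs
  fun_prop

/-- The weight cancels the probability of arm `z` and kills the other arm, so what remains is the
law in a population where everyone receives `z`. -/
theorem withDensity_ipw (z : Bool) :
    M.law.withDensity (fun v => ENNReal.ofReal (M.ipw z v.1.1.1 v.1.1.2)) =
      (M.arm z ⊗ₘ M.armOut z).map (armObs z) := by
  ext S hS
  have hi : Measurable fun v : Obs 𝒳 =>
      S.indicator (fun v => ENNReal.ofReal (M.ipw z v.1.1.1 v.1.1.2)) v :=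
    (M.measurable_ipw z).ennreal_ofReal.indicator hS
  have hk : Measurable fun a : (𝒳 × Bool) × ℝ => M.out a (Prod.mk a ⁻¹' S) :=
    Kernel.measurable_kernel_prodMk_left hS
  have hi2 : Measurable fun a : (𝒳 × Bool) × ℝ =>
      ∫⁻ y, S.indicator (fun v : Obs 𝒳 => ENNReal.ofReal (M.ipw z v.1.1.1 v.1.1.2)) (a, y) ∂M.out a :=
    hi.lintegral_kernel_prod_right'
  have hi3 : Measurable fun a : 𝒳 × Bool => ∫⁻ s, ∫⁻ y, S.indicator
      (fun v : Obs 𝒳 => ENNReal.ofReal (M.ipw z v.1.1.1 v.1.1.2)) ((a, s), y) ∂M.out (a, s)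
        ∂M.postKernel a := hi2.lintegral_kernel_prod_right'
  have hpz : Measurable fun a : 𝒳 × ℝ => ENNReal.ofReal (M.p z a.1 a.2) :=
    (M.measurable_p z).ennreal_ofReal
  rw [withDensity_apply _ hS, ← lintegral_indicator hS, law, Measure.lintegral_compProd hi,
    Measure.lintegral_compProd hi2, Measure.lintegral_compProd hi3,
    Measure.map_apply (measurable_armObs z) hS,
    Measure.compProd_apply (measurable_armObs z hS), arm,
    lintegral_withDensity_eq_lintegral_mul _ hpz
      (Kernel.measurable_kernel_prodMk_left (measurable_armObs z hS)), lintegral_prod]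
  swap
  · exact (hpz.mul
      (Kernel.measurable_kernel_prodMk_left (measurable_armObs z hS))).aemeasurable
  refine lintegral_congr fun x => ?_
  have hy : ∀ z' s, ∫⁻ y, S.indicator (fun v : Obs 𝒳 => ENNReal.ofReal (M.ipw z v.1.1.1 v.1.1.2))
      (((x, z'), s), y) ∂M.out ((x, z'), s) =
      ENNReal.ofReal (M.ipw z x z') * M.out ((x, z'), s) (Prod.mk ((x, z'), s) ⁻¹' S) := by
    intro z' s
    rw [← lintegral_indicator_one (measurable_prodMk_left hS), ← lintegral_const_mul]
    · refine lintegral_congr fun y => ?_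
      by_cases hB : (((x, z'), s), y) ∈ S
      · rw [Set.indicator_of_mem hB, Set.indicator_of_mem (by exact hB), Pi.one_apply, mul_one]
      · rw [Set.indicator_of_notMem hB, Set.indicator_of_notMem (by exact hB), mul_zero]
    · exact measurable_one.indicator (measurable_prodMk_left hS)
  simp only [hy]
  rw [lintegral_fintype]
  have hz : ∀ z', z' ≠ z → (∫⁻ s, ENNReal.ofReal (M.ipw z x z') *
      M.out ((x, z'), s) (Prod.mk ((x, z'), s) ⁻¹' S) ∂M.postKernel (x, z')) * M.trt x {z'} = 0 := by
    intro z' hz'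
    simp [ipw, hz']
  rw [Finset.sum_eq_single z (fun z' _ hz' => hz z' hz') (by simp)]
  have hks : Measurable fun s => M.out ((x, z), s) (Prod.mk ((x, z), s) ⁻¹' S) :=
    hk.comp (f := fun s : ℝ => ((x, z), s)) measurable_prodMk_left
  rw [lintegral_const_mul _ hks, mul_right_comm, M.lintegral_post _ hks]
  have h1 : ENNReal.ofReal (M.ipw z x z) * M.trt x {z} = 1 := by
    have hp := M.trt_singleton_pos x z
    rw [ipw, if_pos rfl, ← ofReal_measureReal (measure_ne_top _ _), ← ENNReal.ofReal_mul (by positivity),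
      one_div, inv_mul_cancel₀ hp.ne', ENNReal.ofReal_one]
  rw [h1, one_mul]
  rfl

section Arm

variable {M} {z : Bool}

theorem integrable_ipw_iff {G : Obs 𝒳 → ℝ} (hG : Measurable G) :
    Integrable (fun v => M.ipw z v.1.1.1 v.1.1.2 * G v) M.law ↔
      Integrable (fun u => G (armObs z u)) (M.arm z ⊗ₘ M.armOut z) := by
  rw [← integrable_withDensity_ofReal (M.measurable_ipw z)
    (Eventually.of_forall fun v => M.ipw_nonneg z _ _), withDensity_ipw,
    integrable_map_measure hG.aestronglyMeasurable (measurable_armObs z).aemeasurable]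
  rfl

theorem integral_ipw {G : Obs 𝒳 → ℝ} (hG : Measurable G) :
    ∫ v, M.ipw z v.1.1.1 v.1.1.2 * G v ∂M.law =
      ∫ u, G (armObs z u) ∂(M.arm z ⊗ₘ M.armOut z) := by
  rw [← integral_withDensity_ofReal (M.measurable_ipw z)
    (Eventually.of_forall fun v => M.ipw_nonneg z _ _), withDensity_ipw,
    integral_map (measurable_armObs z).aemeasurable hG.aestronglyMeasurable]

theorem integrable_arm_iff {T : 𝒳 × ℝ → ℝ} :
    Integrable T (M.arm z) ↔ Integrable (fun a => M.p z a.1 a.2 * T a) (M.PX.prod volume) :=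
  integrable_withDensity_ofReal (M.measurable_p z) (Eventually.of_forall fun _ => M.p_nonneg _ _ _)

theorem integral_arm (T : 𝒳 × ℝ → ℝ) :
    ∫ a, T a ∂(M.arm z) = ∫ a, M.p z a.1 a.2 * T a ∂(M.PX.prod volume) :=
  integral_withDensity_ofReal (M.measurable_p z) (Eventually.of_forall fun _ => M.p_nonneg _ _ _) T

variable {σ : Obs 𝒳 → ℝ} {B : ℝ} (hσ : Measurable σ) (hB : ∀ v, |σ v| ≤ B)
include hσ hB

/-- Given `(X, S)` in the arm, `T` is constant, so only the conditional average of the score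
remains. -/
theorem integral_ipw_base {T : 𝒳 × ℝ → ℝ} (hT : Measurable T) (hTi : Integrable T (M.arm z)) :
    Integrable (fun v => M.ipw z v.1.1.1 v.1.1.2 * (T (v.1.1.1, v.1.2) * σ v)) M.law ∧
      ∫ v, M.ipw z v.1.1.1 v.1.1.2 * (T (v.1.1.1, v.1.2) * σ v) ∂M.law =
        ∫ a, T a * M.avS σ ((a.1, z), a.2) ∂(M.arm z) := by
  have hG : Measurable fun v : Obs 𝒳 => T (v.1.1.1, v.1.2) * σ v :=
    (hT.comp (by fun_prop : Measurable fun v : Obs 𝒳 => (v.1.1.1, v.1.2))).mul hσ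
  have hi : Integrable (fun u : (𝒳 × ℝ) × ℝ => T u.1 * σ (armObs z u)) (M.arm z ⊗ₘ M.armOut z) := by
    have h1 : Integrable T ((M.arm z ⊗ₘ M.armOut z).map Prod.fst) := by
      rw [← Measure.fst, Measure.fst_compProd]
      exact hTi
    exact (h1.comp_measurable measurable_fst).mul_bdd (c := B)
      (hσ.comp (measurable_armObs z)).aestronglyMeasurable (Eventually.of_forall fun u => hB _)
  refine ⟨(integrable_ipw_iff hG).2 hi, ?_⟩
  rw [integral_ipw hG]
  refine (Measure.integral_compProd hi).trans (integral_congr_ae (Eventually.of_forall fun a => ?_))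
  simp only
  rw [integral_const_mul]
  rfl

/-- The conditional covariance of `Y` and the score can be centred on either factor: `(Y - μ) σ` and
`Y (σ - 𝔼 σ)` have the same conditional mean, and the latter is `dmu`. Integrability of `Y` is asked
only where `T ≠ 0`, all that the moment condition provides. -/
theorem integral_ipw_mean {T : 𝒳 × ℝ → ℝ} (hT : Measurable T)
    (hTy : ∀ᵐ a ∂(M.arm z), T a ≠ 0 → Integrable (fun y : ℝ => y) (M.out ((a.1, z), a.2)))
    (hTi : Integrable (fun a => T a * ∫ y, |y| ∂(M.out ((a.1, z), a.2))) (M.arm z)) :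
    Integrable (fun v => M.ipw z v.1.1.1 v.1.1.2 *
      (T (v.1.1.1, v.1.2) * (v.2 - M.mu z v.1.2 v.1.1.1) * σ v)) M.law ∧
      ∫ v, M.ipw z v.1.1.1 v.1.1.2 *
        (T (v.1.1.1, v.1.2) * (v.2 - M.mu z v.1.2 v.1.1.1) * σ v) ∂M.law =
        ∫ a, T a * M.dmu σ z a.2 a.1 ∂(M.arm z) := by
  have hmu : Measurable fun v : Obs 𝒳 => M.mu z v.1.2 v.1.1.1 :=
    (M.measurable_mu z).comp (by fun_prop : Measurable fun v : Obs 𝒳 => (v.1.2, v.1.1.1))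
  have hG : Measurable fun v : Obs 𝒳 => T (v.1.1.1, v.1.2) * (v.2 - M.mu z v.1.2 v.1.1.1) * σ v :=
    ((hT.comp (by fun_prop : Measurable fun v : Obs 𝒳 => (v.1.1.1, v.1.2))).mul
      (measurable_snd.sub hmu)).mul hσ
  have hGa : Measurable fun u => T u.1 * (u.2 - M.mu z u.1.2 u.1.1) * σ (armObs z u) :=
    hG.comp (measurable_armObs z)
  have hs : ∀ a, Measurable fun y => σ (armObs z (a, y)) := fun a =>
    (hσ.comp (measurable_armObs z)).comp measurable_prodMk_left
  have hB0 : ∀ _a : 𝒳 × ℝ, 0 ≤ B := fun a => (abs_nonneg _).trans (hB (armObs z (a, 0)))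
  have hin : ∀ᵐ a ∂(M.arm z), Integrable (fun y => T a * (y - M.mu z a.2 a.1) * σ (armObs z (a, y)))
      (M.armOut z a) ∧ (∫ y, ‖T a * (y - M.mu z a.2 a.1) * σ (armObs z (a, y))‖ ∂(M.armOut z a) ≤
        2 * B * |T a * ∫ y, |y| ∂(M.out ((a.1, z), a.2))|) ∧
      ∫ y, T a * (y - M.mu z a.2 a.1) * σ (armObs z (a, y)) ∂(M.armOut z a) =
        T a * M.dmu σ z a.2 a.1 := by
    filter_upwards [hTy] with a ha
    by_cases hT0 : T a = 0
    · simp [hT0]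
    · have hi := ha hT0
      have hiy : Integrable (fun y : ℝ => y) (M.armOut z a) := hi
      have h1 : Integrable (fun y => (y - M.mu z a.2 a.1)) (M.armOut z a) :=
        hiy.sub (integrable_const _)
      have h2 : Integrable (fun y => T a * (y - M.mu z a.2 a.1) * σ (armObs z (a, y)))
          (M.armOut z a) := (h1.const_mul (T a)).mul_bdd (c := B) (hs a).aestronglyMeasurable
        (Eventually.of_forall fun y => hB _)
      refine ⟨h2, ?_, ?_⟩
      · have h3 : |M.mu z a.2 a.1| ≤ ∫ y, |y| ∂(M.armOut z a) := abs_integral_le_integral_abs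
        have h4 : ∀ y, ‖T a * (y - M.mu z a.2 a.1) * σ (armObs z (a, y))‖ ≤
            |T a| * B * (|y| + |M.mu z a.2 a.1|) := by
          intro y
          rw [norm_mul, norm_mul, Real.norm_eq_abs, Real.norm_eq_abs, Real.norm_eq_abs]
          have := abs_sub y (M.mu z a.2 a.1)
          calc |T a| * |y - M.mu z a.2 a.1| * |σ (armObs z (a, y))|
              ≤ |T a| * (|y| + |M.mu z a.2 a.1|) * B := by
                gcongr
                exact hB _
            _ = _ := by ring
        calc ∫ y, ‖T a * (y - M.mu z a.2 a.1) * σ (armObs z (a, y))‖ ∂(M.armOut z a)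
            ≤ ∫ y, |T a| * B * (|y| + |M.mu z a.2 a.1|) ∂(M.armOut z a) :=
              integral_mono h2.norm ((hiy.abs.add (integrable_const _)).const_mul _) h4
          _ = |T a| * B * ((∫ y, |y| ∂(M.armOut z a)) + |M.mu z a.2 a.1|) := by
              rw [integral_const_mul, integral_add hiy.abs (integrable_const _)]
              simp
          _ ≤ |T a| * B * ((∫ y, |y| ∂(M.armOut z a)) + ∫ y, |y| ∂(M.armOut z a)) := by
              have := hB0 a
              gcongr
          _ = 2 * B * |T a * ∫ y, |y| ∂(M.out ((a.1, z), a.2))| := by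
              rw [abs_mul, abs_of_nonneg (integral_nonneg fun y => abs_nonneg y)]
              change |T a| * B * ((∫ y, |y| ∂(M.out ((a.1, z), a.2))) +
                ∫ y, |y| ∂(M.out ((a.1, z), a.2))) = _
              ring
      · have h5 : Integrable (fun y => y * σ (armObs z (a, y))) (M.armOut z a) :=
          hiy.mul_bdd (c := B) (hs a).aestronglyMeasurable (Eventually.of_forall fun y => hB _)
        have h6 : Integrable (fun y => σ (armObs z (a, y))) (M.armOut z a) :=
          integrable_of_bdd _ (hs a) fun y => hB _
        have e1 : ∀ y, T a * (y - M.mu z a.2 a.1) * σ (armObs z (a, y)) =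
            T a * (y * σ (armObs z (a, y)) - M.mu z a.2 a.1 * σ (armObs z (a, y))) := fun y => by ring
        have e2 : ∀ y, (σ (armObs z (a, y)) - M.avS σ ((a.1, z), a.2)) * y =
            y * σ (armObs z (a, y)) - M.avS σ ((a.1, z), a.2) * y := fun y => by ring
        have e3 : M.dmu σ z a.2 a.1 = ∫ y, (σ (armObs z (a, y)) - M.avS σ ((a.1, z), a.2)) * y
            ∂(M.armOut z a) := rfl
        rw [e3]
        simp only [e1, e2]
        rw [integral_const_mul, integral_sub h5 (h6.const_mul _), integral_sub h5 (hiy.const_mul _),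
          integral_const_mul, integral_const_mul]
        change T a * (_ - M.mu z a.2 a.1 * M.avS σ ((a.1, z), a.2)) =
          T a * (_ - M.avS σ ((a.1, z), a.2) * M.mu z a.2 a.1)
        ring
  have hi : Integrable (fun u : (𝒳 × ℝ) × ℝ => T u.1 * (u.2 - M.mu z u.1.2 u.1.1) *
      σ (armObs z u)) (M.arm z ⊗ₘ M.armOut z) := by
    refine (Measure.integrable_compProd_iff hGa.aestronglyMeasurable).2 ⟨hin.mono fun a ha => ha.1, ?_⟩
    refine Integrable.mono' (hTi.abs.const_mul (2 * B)) ?_ (hin.mono fun a ha => ?_)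
    · exact (hGa.norm.stronglyMeasurable.integral_kernel_prod_right').aestronglyMeasurable
    · rw [Real.norm_eq_abs, abs_of_nonneg (integral_nonneg fun y => norm_nonneg _)]
      exact ha.2.1
  refine ⟨(integrable_ipw_iff hG).2 hi, ?_⟩
  rw [integral_ipw hG]
  exact (Measure.integral_compProd hi).trans (integral_congr_ae (hin.mono fun a ha => ha.2.2))

end Arm

/-! ### Slices -/

section Slice

variable {M} {z : Bool}

/-- Averages over one of the two principal stratum coordinates. -/
theorem integral_arm_slice {n : 𝒳 × ℝ × ℝ → ℝ} (hn : Integrable n (M.PX.prod volume))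
    (h0 : ∀ x s t, M.p z x s = 0 → n (x, s, t) = 0) {h : 𝒳 × ℝ → ℝ} (hh : Measurable h) {C : ℝ}
    (hC : ∀ a, |h a| ≤ C) :
    Integrable (fun a : 𝒳 × ℝ => (∫ t, n (a.1, a.2, t)) / M.p z a.1 a.2) (M.arm z) ∧
      Integrable (fun v => n v * h (v.1, v.2.1)) (M.PX.prod volume) ∧
      ∫ a : 𝒳 × ℝ, (∫ t, n (a.1, a.2, t)) / M.p z a.1 a.2 * h a ∂(M.arm z) =
        ∫ v, n v * h (v.1, v.2.1) ∂(M.PX.prod volume) := by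
  have hmp := measurePreserving_prodAssoc M.PX (volume : Measure ℝ) (volume : Measure ℝ)
  -- Division by a vanishing density is harmless because the slice of `n` is then zero.
  have hp : ∀ a : 𝒳 × ℝ, M.p z a.1 a.2 * ((∫ t, n (a.1, a.2, t)) / M.p z a.1 a.2) =
      ∫ t, n (a.1, a.2, t) := by
    intro a
    rcases eq_or_ne (M.p z a.1 a.2) 0 with h1 | h1
    · simp [h0 _ _ _ h1]
    · rw [mul_div_cancel₀ _ h1]
  have hnh : Integrable (fun v : 𝒳 × ℝ × ℝ => n v * h (v.1, v.2.1)) (M.PX.prod volume) :=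
    hn.mul_bdd (c := C)
      (hh.comp (by fun_prop : Measurable fun v : 𝒳 × ℝ × ℝ => (v.1, v.2.1))).aestronglyMeasurable
      (Eventually.of_forall fun v => hC _)
  have hna : ∀ {m : 𝒳 × ℝ × ℝ → ℝ}, Integrable m (M.PX.prod volume) →
      Integrable (fun u : (𝒳 × ℝ) × ℝ => m (u.1.1, u.1.2, u.2)) ((M.PX.prod volume).prod volume) := by
    intro m hm
    exact (hmp.integrable_comp_emb MeasurableEquiv.prodAssoc.measurableEmbedding).2 hm
  refine ⟨?_, hnh, ?_⟩
  · rw [integrable_arm_iff]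
    simp only [hp]
    exact (hna hn).integral_prod_left
  · rw [integral_arm]
    simp only [← mul_assoc, hp]
    have e1 := hmp.integral_comp' (fun v : 𝒳 × ℝ × ℝ => n v * h (v.1, v.2.1))
    have e2 := integral_prod _ (hna hnh)
    refine Eq.trans ?_ (e2.symm.trans e1)
    refine integral_congr_ae (Eventually.of_forall fun a => ?_)
    simp only
    rw [integral_mul_const]

/-- Interchange of the average over the principal strata with the average over one arm. -/
theorem integral_arm_swap {G : (𝒳 × ℝ × ℝ) × ℝ → ℝ} (hG : Measurable G) {D : 𝒳 × ℝ × ℝ → ℝ}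
    (hD : Integrable D (M.PX.prod volume)) (hGD : ∀ᵐ v ∂(M.PX.prod volume),
      ∫⁻ s, ENNReal.ofReal (M.p z v.1 s) * ‖G (v, s)‖ₑ ≤ ENNReal.ofReal (D v))
    {h : 𝒳 × ℝ → ℝ} (hh : Measurable h) {C : ℝ} (hC : ∀ a, |h a| ≤ C) :
    Measurable (fun a : 𝒳 × ℝ => ∫ t : ℝ × ℝ, G ((a.1, t), a.2)) ∧
    Integrable (fun a : 𝒳 × ℝ => ∫ t : ℝ × ℝ, G ((a.1, t), a.2)) (M.arm z) ∧
      Integrable (fun v => ∫ s, M.p z v.1 s * (G (v, s) * h (v.1, s))) (M.PX.prod volume) ∧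
      ∫ a : 𝒳 × ℝ, (∫ t : ℝ × ℝ, G ((a.1, t), a.2)) * h a ∂(M.arm z) =
        ∫ v, (∫ s, M.p z v.1 s * (G (v, s) * h (v.1, s))) ∂(M.PX.prod volume) := by
  have hpm : Measurable fun u : (𝒳 × ℝ × ℝ) × ℝ => M.p z u.1.1 u.2 :=
    (M.measurable_p z).comp (by fun_prop : Measurable fun u : (𝒳 × ℝ × ℝ) × ℝ => (u.1.1, u.2))
  have hpG : Measurable fun u : (𝒳 × ℝ × ℝ) × ℝ => M.p z u.1.1 u.2 * G u := hpm.mul hG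
  have hi : Integrable (fun u : (𝒳 × ℝ × ℝ) × ℝ => M.p z u.1.1 u.2 * G u)
      ((M.PX.prod volume).prod volume) := by
    refine ⟨hpG.aestronglyMeasurable, ?_⟩
    rw [hasFiniteIntegral_iff_enorm, lintegral_prod _ hpG.enorm.aemeasurable]
    refine lt_of_le_of_lt (lintegral_mono_ae (hGD.mono fun v hv => ?_)) hD.lintegral_lt_top
    refine le_trans (le_of_eq (lintegral_congr fun s => ?_)) hv
    rw [enorm_mul, Real.enorm_of_nonneg (M.p_nonneg _ _ _)]
  have hih : Integrable (fun u : (𝒳 × ℝ × ℝ) × ℝ => M.p z u.1.1 u.2 * (G u * h (u.1.1, u.2)))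
      ((M.PX.prod volume).prod volume) := by
    have := hi.mul_bdd (c := C) (hh.comp
      (by fun_prop : Measurable fun u : (𝒳 × ℝ × ℝ) × ℝ => (u.1.1, u.2))).aestronglyMeasurable
      (Eventually.of_forall fun v => hC _)
    simpa only [mul_assoc, Function.comp_apply] using this
  -- exchange of coordinates
  set e : (𝒳 × ℝ) × (ℝ × ℝ) ≃ᵐ (𝒳 × ℝ × ℝ) × ℝ :=
    (MeasurableEquiv.prodAssoc.trans ((MeasurableEquiv.refl 𝒳).prodCongr MeasurableEquiv.prodComm)).trans
      MeasurableEquiv.prodAssoc.symm with he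
  have hee : ∀ u, e u = ((u.1.1, u.2), u.1.2) := fun u => rfl
  have hmp : MeasurePreserving e ((M.PX.prod (volume : Measure ℝ)).prod (volume : Measure (ℝ × ℝ)))
      ((M.PX.prod (volume : Measure (ℝ × ℝ))).prod (volume : Measure ℝ)) :=
    ((measurePreserving_prodAssoc M.PX (volume : Measure ℝ) (volume : Measure (ℝ × ℝ))).trans
      ((MeasurePreserving.id M.PX).prod Measure.measurePreserving_swap)).trans
        (measurePreserving_prodAssoc M.PX (volume : Measure (ℝ × ℝ)) (volume : Measure ℝ)).symm
  have hGm : Measurable fun a : 𝒳 × ℝ => ∫ t : ℝ × ℝ, G ((a.1, t), a.2) := by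
    have : Measurable fun u : (𝒳 × ℝ) × (ℝ × ℝ) => G ((u.1.1, u.2), u.1.2) := hG.comp (by fun_prop)
    exact this.stronglyMeasurable.integral_prod_right'.measurable
  refine ⟨hGm, ?_, hih.integral_prod_left, ?_⟩
  · rw [integrable_arm_iff]
    have h1 : Integrable (fun u : (𝒳 × ℝ) × (ℝ × ℝ) => M.p z u.1.1 u.1.2 * G ((u.1.1, u.2), u.1.2))
        ((M.PX.prod volume).prod volume) := (hmp.integrable_comp_emb e.measurableEmbedding).2 hi
    refine h1.integral_prod_left.congr (Eventually.of_forall fun a => ?_)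
    simp only
    rw [integral_const_mul]
  · have h1 : Integrable (fun u : (𝒳 × ℝ) × (ℝ × ℝ) =>
        M.p z u.1.1 u.1.2 * (G ((u.1.1, u.2), u.1.2) * h (u.1.1, u.1.2)))
        ((M.PX.prod volume).prod volume) := (hmp.integrable_comp_emb e.measurableEmbedding).2 hih
    have e1 := hmp.integral_comp' (fun u : (𝒳 × ℝ × ℝ) × ℝ => M.p z u.1.1 u.2 * (G u * h (u.1.1, u.2)))
    rw [integral_prod _ hih] at e1
    have e2 := integral_prod _ h1
    rw [integral_arm]
    refine Eq.trans ?_ (e2.symm.trans e1)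
    refine integral_congr_ae (Eventually.of_forall fun a => ?_)
    simp only
    rw [integral_const_mul, integral_mul_const]

end Slice

end ObsModel

end

/-! ### Partial derivatives of the copula density -/

namespace IsCopulaDensity

variable {c : ℝ → ℝ → ℝ} (hc : IsCopulaDensity c)
include hc

theorem fderiv_left {u v : ℝ} (hu : u ∈ Set.Ioo (0 : ℝ) 1) (hv : v ∈ Set.Ioo (0 : ℝ) 1) :
    fderiv ℝ (Function.uncurry c) (u, v) (1, 0) = dcu c u v := by
  rw [(hc.hasFDerivAt hu hv).fderiv]
  simp

theorem fderiv_right {u v : ℝ} (hu : u ∈ Set.Ioo (0 : ℝ) 1) (hv : v ∈ Set.Ioo (0 : ℝ) 1) :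
    fderiv ℝ (Function.uncurry c) (u, v) (0, 1) = dcv c u v := by
  rw [(hc.hasFDerivAt hu hv).fderiv]
  simp

/-- The partial derivatives vanish at the interior zeros of `c`. -/
theorem dcu_eq_zero {u v : ℝ} (hu : u ∈ Set.Ioo (0 : ℝ) 1) (hv : v ∈ Set.Ioo (0 : ℝ) 1)
    (h : c u v = 0) : dcu c u v = 0 := by
  refine IsLocalMin.deriv_eq_zero ?_
  filter_upwards [isOpen_Ioo.mem_nhds hu] with a ha
  rw [h]
  exact hc.nonneg a ha v hv

theorem dcv_eq_zero {u v : ℝ} (hu : u ∈ Set.Ioo (0 : ℝ) 1) (hv : v ∈ Set.Ioo (0 : ℝ) 1)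
    (h : c u v = 0) : dcv c u v = 0 := by
  refine IsLocalMin.deriv_eq_zero ?_
  filter_upwards [isOpen_Ioo.mem_nhds hv] with a ha
  rw [h]
  exact hc.nonneg u hu a ha

end IsCopulaDensity

/-! ### Averages of indicators and scores over one arm -/

namespace ObsModel

variable {𝒳 : Type*} [MeasurableSpace 𝒳] (M : ObsModel 𝒳)

theorem F_nonneg (z : Bool) (s : ℝ) (x : 𝒳) : 0 ≤ M.F z s x := by
  rw [F_eq]
  exact measureReal_nonneg

theorem F_le_one (z : Bool) (s : ℝ) (x : 𝒳) : M.F z s x ≤ 1 := by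
  rw [F_eq]
  exact measureReal_le_one

theorem integrable_p_mul (z : Bool) (x : 𝒳) {h : ℝ → ℝ} (hh : Measurable h) {C : ℝ}
    (hC : ∀ s, |h s| ≤ C) : Integrable fun s => M.p z x s * h s :=
  (M.integrable_p z x).mul_bdd (c := C) hh.aestronglyMeasurable (Eventually.of_forall hC)

theorem integral_p_indicator (z : Bool) (x : 𝒳) (a : ℝ) (h : ℝ → ℝ) :
    ∫ s, M.p z x s * ((Set.Iic a).indicator (fun _ => (1 : ℝ)) s * h s) =
      ∫ s in Set.Iic a, M.p z x s * h s := by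
  rw [← integral_indicator measurableSet_Iic]
  refine integral_congr_ae (Eventually.of_forall fun s => ?_)
  by_cases hs : s ∈ Set.Iic a
  · simp only [Set.indicator_of_mem hs, one_mul]
  · simp only [Set.indicator_of_notMem hs, zero_mul, mul_zero]

theorem measurable_Iic_indicator (a : ℝ) : Measurable ((Set.Iic a).indicator fun _ => (1 : ℝ)) :=
  measurable_const.indicator measurableSet_Iic

theorem abs_Iic_indicator_le (a s : ℝ) : |(Set.Iic a).indicator (fun _ => (1 : ℝ)) s| ≤ 1 := by
  by_cases hs : s ∈ Set.Iic a
  · rw [Set.indicator_of_mem hs, abs_one]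
  · rw [Set.indicator_of_notMem hs, abs_zero]
    exact zero_le_one

/-- The mean absolute deviation of a Bernoulli variable with success probability `F`. This is how
the residual `1(S ≤ a) - F` produces the weight `F (1 - F)` that `Ψ` controls. -/
theorem integral_p_abs (z : Bool) (x : 𝒳) (a : ℝ) :
    ∫ s, M.p z x s * |(Set.Iic a).indicator (fun _ => (1 : ℝ)) s - M.F z a x| =
      2 * (M.F z a x * (1 - M.F z a x)) := by
  have h0 := M.F_nonneg z a x
  have h1 := M.F_le_one z a x
  have e : ∀ s, M.p z x s * |(Set.Iic a).indicator (fun _ => (1 : ℝ)) s - M.F z a x| =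
      (1 - 2 * M.F z a x) * (M.p z x s * ((Set.Iic a).indicator (fun _ => (1 : ℝ)) s * 1)) +
        M.F z a x * M.p z x s := by
    intro s
    by_cases hs : s ∈ Set.Iic a
    · rw [Set.indicator_of_mem hs, abs_of_nonneg (by linarith)]
      ring
    · rw [Set.indicator_of_notMem hs, zero_sub, abs_neg, abs_of_nonneg h0]
      ring
  have hi : Integrable fun s => M.p z x s * ((Set.Iic a).indicator (fun _ => (1 : ℝ)) s * 1) :=
    M.integrable_p_mul z x ((measurable_Iic_indicator a).mul measurable_const) (C := 1) fun s => by
      rw [mul_one]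
      exact abs_Iic_indicator_le a s
  simp only [e]
  rw [integral_add (hi.const_mul _) ((M.integrable_p z x).const_mul _), integral_const_mul,
    integral_const_mul, M.integral_p_indicator, M.integral_p]
  simp only [mul_one]
  change (1 - 2 * M.F z a x) * M.F z a x + _ = _
  ring

section Score

variable {M} {σ : Obs 𝒳 → ℝ} {B : ℝ} (hσ : Measurable σ) (hB : ∀ v, |σ v| ≤ B)
include hσ hB

theorem integral_p_avS (z : Bool) (x : 𝒳) :
    (Integrable fun s => M.p z x s * M.avS σ ((x, z), s)) ∧
      ∫ s, M.p z x s * M.avS σ ((x, z), s) = M.avZ σ (x, z) :=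
  ⟨M.integrable_p_mul z x ((M.measurable_avS hσ).comp measurable_prodMk_left) (C := B) fun _ =>
    abs_kav_le _ hB _, (M.integral_post (x, z) _).symm⟩

/-- The covariance of `1(S ≤ a)` with the conditional score is the derivative of the distribution
function; centring the indicator or the score gives the same value. -/
theorem integral_p_indicator_avS (z : Bool) (x : 𝒳) (a : ℝ) :
    (Integrable fun s => M.p z x s *
      (((Set.Iic a).indicator (fun _ => (1 : ℝ)) s - M.F z a x) * M.avS σ ((x, z), s))) ∧
    ∫ s, M.p z x s * (((Set.Iic a).indicator (fun _ => (1 : ℝ)) s - M.F z a x) *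
      M.avS σ ((x, z), s)) = M.dF σ z a x := by
  obtain ⟨i1, e1⟩ := integral_p_avS (M := M) hσ hB z x
  have i2 : Integrable fun s => M.p z x s *
      ((Set.Iic a).indicator (fun _ => (1 : ℝ)) s * M.avS σ ((x, z), s)) :=
    M.integrable_p_mul z x ((measurable_Iic_indicator a).mul
      ((M.measurable_avS hσ).comp measurable_prodMk_left)) (C := 1 * B) fun s => by
        rw [abs_mul]
        exact mul_le_mul (abs_Iic_indicator_le a s) (abs_kav_le _ hB _) (abs_nonneg _) zero_le_one
  have e : ∀ s, M.p z x s * (((Set.Iic a).indicator (fun _ => (1 : ℝ)) s - M.F z a x) *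
      M.avS σ ((x, z), s)) = M.p z x s *
      ((Set.Iic a).indicator (fun _ => (1 : ℝ)) s * M.avS σ ((x, z), s)) -
      M.F z a x * (M.p z x s * M.avS σ ((x, z), s)) := fun s => by ring
  simp only [e]
  refine ⟨i2.sub (i1.const_mul _), ?_⟩
  rw [integral_sub i2 (i1.const_mul _), integral_const_mul, e1, M.integral_p_indicator, dF]
  have e3 : ∀ t, M.scoreS σ z t x * M.p z x t =
      M.p z x t * M.avS σ ((x, z), t) - M.avZ σ (x, z) * M.p z x t := fun t => by
    rw [scoreS]
    ring
  simp only [e3]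
  rw [integral_sub i1.integrableOn ((M.integrable_p z x).integrableOn.const_mul _),
    integral_const_mul, mul_comm (M.F z a x)]
  rfl

/-- The average of the residual terms over one arm. -/
theorem integral_arm_resid (z : Bool) {π : ℝ × ℝ → ℝ} (hπ : Measurable π) {n m : 𝒳 × ℝ × ℝ → ℝ}
    (hn : Measurable n) (hm : Measurable m) (hni : Integrable n (M.PX.prod volume))
    (hmi : Integrable (fun v => m v * (M.F z (π v.2) v.1 * (1 - M.F z (π v.2) v.1)))
      (M.PX.prod volume)) :
    Measurable (fun a : 𝒳 × ℝ => ∫ t, (n (a.1, t) - m (a.1, t) *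
      ((Set.Iic (π t)).indicator (fun _ => (1 : ℝ)) a.2 - M.F z (π t) a.1))) ∧
    Integrable (fun a : 𝒳 × ℝ => ∫ t, (n (a.1, t) - m (a.1, t) *
      ((Set.Iic (π t)).indicator (fun _ => (1 : ℝ)) a.2 - M.F z (π t) a.1))) (M.arm z) ∧
    Integrable (fun v => n v * M.avZ σ (v.1, z) - m v * M.dF σ z (π v.2) v.1) (M.PX.prod volume) ∧
    ∫ a : 𝒳 × ℝ, (∫ t, (n (a.1, t) - m (a.1, t) *
      ((Set.Iic (π t)).indicator (fun _ => (1 : ℝ)) a.2 - M.F z (π t) a.1))) *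
        M.avS σ ((a.1, z), a.2) ∂(M.arm z) =
      ∫ v, (n v * M.avZ σ (v.1, z) - m v * M.dF σ z (π v.2) v.1) ∂(M.PX.prod volume) := by
  have hFm : Measurable fun v : 𝒳 × ℝ × ℝ => M.F z (π v.2) v.1 :=
    (M.measurable_F z).comp (f := fun v : 𝒳 × ℝ × ℝ => (π v.2, v.1))
      ((hπ.comp measurable_snd).prodMk measurable_fst)
  set G : (𝒳 × ℝ × ℝ) × ℝ → ℝ := fun u => n u.1 - m u.1 *
    ((Set.Iic (π u.1.2)).indicator (fun _ => (1 : ℝ)) u.2 - M.F z (π u.1.2) u.1.1) with hG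
  have hGm : Measurable G := by
    refine (hn.comp measurable_fst).sub ((hm.comp measurable_fst).mul
      (Measurable.sub ?_ (hFm.comp measurable_fst)))
    have : (fun u : (𝒳 × ℝ × ℝ) × ℝ => (Set.Iic (π u.1.2)).indicator (fun _ => (1 : ℝ)) u.2) =
        {u : (𝒳 × ℝ × ℝ) × ℝ | u.2 ≤ π u.1.2}.indicator fun _ => 1 := by
      ext u
      simp [Set.indicator]
    rw [this]
    exact measurable_const.indicator (measurableSet_le measurable_snd
      (hπ.comp (measurable_snd.comp measurable_fst)))
  -- The arm average of the absolute residual term is at most this function; it is computed by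
  -- `integral_p_abs` and licenses Fubini's theorem.
  have hD : Integrable (fun v => |n v| + 2 * |m v * (M.F z (π v.2) v.1 * (1 - M.F z (π v.2) v.1))|)
      (M.PX.prod volume) := hni.abs.add (hmi.abs.const_mul 2)
  have hGD : ∀ v, ∫⁻ s, ENNReal.ofReal (M.p z v.1 s) * ‖G (v, s)‖ₑ ≤
      ENNReal.ofReal (|n v| + 2 * |m v * (M.F z (π v.2) v.1 * (1 - M.F z (π v.2) v.1))|) := by
    intro v
    have h0 := M.F_nonneg z (π v.2) v.1
    have h1 := M.F_le_one z (π v.2) v.1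
    have i1 : Integrable fun s => M.p z v.1 s *
        |(Set.Iic (π v.2)).indicator (fun _ => (1 : ℝ)) s - M.F z (π v.2) v.1| :=
      M.integrable_p_mul z v.1 (C := 2)
        ((measurable_Iic_indicator (π v.2)).sub_const (M.F z (π v.2) v.1)).abs fun s => by
          rw [abs_abs]
          refine (abs_sub _ _).trans ?_
          rw [abs_of_nonneg h0]
          linarith [abs_Iic_indicator_le (π v.2) s]
    have i2 : Integrable fun s => |n v| * M.p z v.1 s + |m v| * (M.p z v.1 s *
        |(Set.Iic (π v.2)).indicator (fun _ => (1 : ℝ)) s - M.F z (π v.2) v.1|) :=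
      ((M.integrable_p z v.1).const_mul _).add (i1.const_mul _)
    have e : |n v| + 2 * |m v * (M.F z (π v.2) v.1 * (1 - M.F z (π v.2) v.1))| =
        ∫ s, |n v| * M.p z v.1 s + |m v| * (M.p z v.1 s *
          |(Set.Iic (π v.2)).indicator (fun _ => (1 : ℝ)) s - M.F z (π v.2) v.1|) := by
      rw [integral_add ((M.integrable_p z v.1).const_mul _) (i1.const_mul _), integral_const_mul,
        integral_const_mul, M.integral_p, M.integral_p_abs, abs_mul,
        abs_of_nonneg (mul_nonneg h0 (sub_nonneg.2 h1))]
      ring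
    rw [e, ofReal_integral_eq_lintegral_ofReal i2]
    · refine lintegral_mono fun s => ?_
      rw [← ofReal_norm, Real.norm_eq_abs, ← ENNReal.ofReal_mul (M.p_nonneg _ _ _)]
      refine ENNReal.ofReal_le_ofReal ?_
      have h2 : |G (v, s)| ≤ |n v| + |m v| *
          |(Set.Iic (π v.2)).indicator (fun _ => (1 : ℝ)) s - M.F z (π v.2) v.1| := by
        rw [← abs_mul]
        exact abs_sub _ _
      calc M.p z v.1 s * |G (v, s)| ≤ M.p z v.1 s * (|n v| + |m v| *
          |(Set.Iic (π v.2)).indicator (fun _ => (1 : ℝ)) s - M.F z (π v.2) v.1|) :=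
            mul_le_mul_of_nonneg_left h2 (M.p_nonneg _ _ _)
        _ = _ := by ring
    · refine Eventually.of_forall fun s => ?_
      have := M.p_nonneg z v.1 s
      positivity
  have hh : Measurable fun a : 𝒳 × ℝ => M.avS σ ((a.1, z), a.2) :=
    (M.measurable_avS hσ).comp (measurable_armIdx z)
  obtain ⟨k1, k2, k3, k4⟩ := integral_arm_swap hGm hD (Eventually.of_forall hGD) hh (C := B)
    fun a => abs_kav_le _ hB _
  have hin : ∀ v : 𝒳 × ℝ × ℝ, ∫ s, M.p z v.1 s * (G (v, s) * M.avS σ ((v.1, z), s)) =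
      n v * M.avZ σ (v.1, z) - m v * M.dF σ z (π v.2) v.1 := by
    intro v
    obtain ⟨i1, e1⟩ := integral_p_avS (M := M) hσ hB z v.1
    obtain ⟨i2, e2⟩ := integral_p_indicator_avS (M := M) hσ hB z v.1 (π v.2)
    have e : ∀ s, M.p z v.1 s * (G (v, s) * M.avS σ ((v.1, z), s)) =
        n v * (M.p z v.1 s * M.avS σ ((v.1, z), s)) - m v * (M.p z v.1 s *
          (((Set.Iic (π v.2)).indicator (fun _ => (1 : ℝ)) s - M.F z (π v.2) v.1) *
            M.avS σ ((v.1, z), s))) := fun s => by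
      simp only [hG]
      ring
    simp only [e]
    rw [integral_sub (i1.const_mul _) (i2.const_mul _), integral_const_mul, integral_const_mul, e1, e2]
  simp only [hin] at k3 k4
  exact ⟨k1, k2, k3, k4⟩

/-- The average of a function of the covariates against the score. -/
theorem integral_law_cov {T : 𝒳 → ℝ} (hTi : Integrable T M.PX) :
    Integrable (fun v : Obs 𝒳 => T v.1.1.1 * σ v) M.law ∧
      ∫ v : Obs 𝒳, T v.1.1.1 * σ v ∂M.law = ∫ x, T x * M.avX σ x ∂M.PX := by
  have h1 : M.law.map (fun v : Obs 𝒳 => v.1.1.1) = M.PX := by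
    have : M.law.map (fun v : Obs 𝒳 => v.1.1.1) = M.law.fst.fst.fst := by
      rw [Measure.fst, Measure.fst, Measure.fst, Measure.map_map measurable_fst measurable_fst,
        Measure.map_map (measurable_fst.comp measurable_fst) measurable_fst]
      rfl
    rw [this, law, Measure.fst_compProd, Measure.fst_compProd, Measure.fst_compProd]
  have h2 : Integrable (fun v : Obs 𝒳 => T v.1.1.1) M.law := by
    rw [← h1] at hTi
    exact hTi.comp_measurable (by fun_prop)
  have h3 : Integrable (fun v : Obs 𝒳 => T v.1.1.1 * σ v) M.law :=
    h2.mul_bdd (c := B) hσ.aestronglyMeasurable (Eventually.of_forall hB)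
  refine ⟨h3, ?_⟩
  rw [← M.integral_avX h3]
  refine integral_congr_ae (Eventually.of_forall fun x => ?_)
  simp only [avX, avZ, avS, kav, integral_const_mul]

end Score

end ObsModel

/-! ### The average of the influence function against a score -/

theorem integral_add_add_sub_add_sub_add {α : Type*} [MeasurableSpace α] {μ : Measure α}
    {a₁ a₂ a₃ a₄ a₅ a₆ : α → ℝ} (h₁ : Integrable a₁ μ) (h₂ : Integrable a₂ μ)
    (h₃ : Integrable a₃ μ) (h₄ : Integrable a₄ μ) (h₅ : Integrable a₅ μ) (h₆ : Integrable a₆ μ) :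
    ∫ x, (a₁ x + a₂ x - a₃ x + a₄ x - a₅ x + a₆ x) ∂μ =
      ∫ x, a₁ x ∂μ + ∫ x, a₂ x ∂μ - ∫ x, a₃ x ∂μ + ∫ x, a₄ x ∂μ - ∫ x, a₅ x ∂μ +
        ∫ x, a₆ x ∂μ := by
  have h := integral_add' ((((h₁.add h₂).sub h₃).add h₄).sub h₅) h₆
  rw [integral_sub' (((h₁.add h₂).sub h₃).add h₄) h₅, integral_add' ((h₁.add h₂).sub h₃) h₄,
    integral_sub' (h₁.add h₂) h₃, integral_add' h₁ h₂] at h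
  exact h

namespace ObsModel

variable {𝒳 : Type*} [MeasurableSpace 𝒳] (M : ObsModel 𝒳) {q : ℕ}

/-- `ν₀ ċ_u / c`. -/
def nuU (c w : ℝ → ℝ → ℝ) (f : ℝ → ℝ → (Fin q → ℝ) → ℝ) (η : Fin q → ℝ) (i : Fin q)
    (v : 𝒳 × ℝ × ℝ) : ℝ :=
  w v.2.1 v.2.2 * df f v.2.1 v.2.2 η i *
    (fderiv ℝ (Function.uncurry c) (M.F true v.2.1 v.1, M.F false v.2.2 v.1) (1, 0) *
      M.p true v.1 v.2.1 * M.p false v.1 v.2.2) * (M.mu false v.2.2 v.1 - f v.2.1 v.2.2 η)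

/-- `ν₀ ċ_v / c`. -/
def nuV (c w : ℝ → ℝ → ℝ) (f : ℝ → ℝ → (Fin q → ℝ) → ℝ) (η : Fin q → ℝ) (i : Fin q)
    (v : 𝒳 × ℝ × ℝ) : ℝ :=
  w v.2.1 v.2.2 * df f v.2.1 v.2.2 η i *
    (fderiv ℝ (Function.uncurry c) (M.F true v.2.1 v.1, M.F false v.2.2 v.1) (0, 1) *
      M.p true v.1 v.2.1 * M.p false v.1 v.2.2) * (M.mu false v.2.2 v.1 - f v.2.1 v.2.2 η)

/-- `w ḟ e`. -/
def nuY (c w : ℝ → ℝ → ℝ) (f : ℝ → ℝ → (Fin q → ℝ) → ℝ) (η : Fin q → ℝ) (i : Fin q)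
    (v : 𝒳 × ℝ × ℝ) : ℝ :=
  w v.2.1 v.2.2 * df f v.2.1 v.2.2 η i * M.e c v.2.1 v.2.2 v.1

variable {M} {c w : ℝ → ℝ → ℝ} {f : ℝ → ℝ → (Fin q → ℝ) → ℝ} {η₀ : Fin q → ℝ} {b Ψ : ℝ → ℝ → ℝ}
  {δ : ℝ} (hc : IsCopulaDensity c) (hR : IsRegular c w f M η₀ b Ψ δ)
include hc hR

theorem measurable_df (i : Fin q) : Measurable fun v : 𝒳 × ℝ × ℝ => df f v.2.1 v.2.2 η₀ i :=
  (isBase hc hR).measurable_pd η₀ i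

theorem measurable_nuY (i : Fin q) : Measurable (M.nuY c w f η₀ i) :=
  ((hR.measurable_w.comp measurable_snd).mul (measurable_df hc hR i)).mul
    (M.measurable_e hc.measurable)

omit hc in
theorem measurable_resid : Measurable fun v : 𝒳 × ℝ × ℝ =>
    M.mu false v.2.2 v.1 - f v.2.1 v.2.2 η₀ :=
  M.measurable_mu'.sub ((hR.measurable_f η₀).comp measurable_snd)

theorem measurable_nu0 (i : Fin q) : Measurable fun v : 𝒳 × ℝ × ℝ => M.nu0 c w f η₀ v.2.1 v.2.2 v.1 i :=
  (measurable_nuY hc hR i).mul (measurable_resid hR)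

/-- The Fréchet derivative of any function on the plane, applied to a fixed vector, is measurable.
Hence `nuU` and `nuV` are written with `fderiv`, which agrees with the partial derivatives inside
the square. -/
theorem measurable_nu_deriv (d : ℝ × ℝ) (i : Fin q) : Measurable fun v : 𝒳 × ℝ × ℝ =>
    w v.2.1 v.2.2 * df f v.2.1 v.2.2 η₀ i *
    (fderiv ℝ (Function.uncurry c) (M.F true v.2.1 v.1, M.F false v.2.2 v.1) d *
      M.p true v.1 v.2.1 * M.p false v.1 v.2.2) * (M.mu false v.2.2 v.1 - f v.2.1 v.2.2 η₀) := by
  have h1 : Measurable fun v : 𝒳 × ℝ × ℝ =>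
      fderiv ℝ (Function.uncurry c) (M.F true v.2.1 v.1, M.F false v.2.2 v.1) d :=
    M.measurable_comp_F (h := fun u v => fderiv ℝ (Function.uncurry c) (u, v) d)
      (measurable_fderiv_apply_const ℝ (Function.uncurry c) d)
  exact (((hR.measurable_w.comp measurable_snd).mul (measurable_df hc hR i)).mul
    ((h1.mul M.measurable_p1).mul M.measurable_p0)).mul (measurable_resid hR)

theorem measurable_nuU (i : Fin q) : Measurable (M.nuU c w f η₀ i) := measurable_nu_deriv hc hR _ i

theorem measurable_nuV (i : Fin q) : Measurable (M.nuV c w f η₀ i) := measurable_nu_deriv hc hR _ i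

/-- The dominating function. -/
theorem integrable_dominating : Integrable (fun v => M.domDensity c w Ψ v *
    (M.absMean v + b v.2.1 v.2.2) ^ 2) (M.PX.prod volume) := by
  rw [← integrable_withDensity_ofReal (measurable_domDensity hc hR) (ae_domDensity_nonneg hc hR)]
  exact (isBase hc hR).moment

omit hc in
theorem weighted_dcu_le {u v : ℝ} (hu : u ∈ Set.Ioo (0 : ℝ) 1) (hv : v ∈ Set.Ioo (0 : ℝ) 1) :
    u * (1 - u) * |dcu c u v| + v * (1 - v) * |dcv c u v| ≤ Ψ u v := by
  have h1 : 0 < u * (1 - u) := mul_pos hu.1 (by linarith [hu.2])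
  have h2 : 0 < v * (1 - v) := mul_pos hv.1 (by linarith [hv.2])
  have h3 := hR.pos
  refine hR.bound_c u hu v hv u hu v hv ?_ ?_
  · rw [sub_self, abs_zero]
    positivity
  · rw [sub_self, abs_zero]
    positivity

/-- The terms of the influence function are dominated. -/
theorem ae_bounds (i : Fin q) : ∀ᵐ v ∂(M.PX.prod volume),
    |M.nu0 c w f η₀ v.2.1 v.2.2 v.1 i| ≤
      M.domDensity c w Ψ v * (M.absMean v + b v.2.1 v.2.2) ^ 2 ∧
    |M.nuU c w f η₀ i v * (M.F true v.2.1 v.1 * (1 - M.F true v.2.1 v.1))| ≤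
      M.domDensity c w Ψ v * (M.absMean v + b v.2.1 v.2.2) ^ 2 ∧
    |M.nuV c w f η₀ i v * (M.F false v.2.2 v.1 * (1 - M.F false v.2.2 v.1))| ≤
      M.domDensity c w Ψ v * (M.absMean v + b v.2.1 v.2.2) ^ 2 ∧
    |M.nuY c w f η₀ i v * M.absMean v| ≤
      M.domDensity c w Ψ v * (M.absMean v + b v.2.1 v.2.2) ^ 2 ∧
    (M.nuY c w f η₀ i v ≠ 0 → Integrable (fun y : ℝ => y) (M.out ((v.1, false), v.2.2))) := by
  filter_upwards [M.ae_F_mem_prod', (ae_dom_iff hc hR).1 (ae_dom_integrable hc hR),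
    (ae_dom_iff hc hR).1 (isBase hc hR).bound_m] with v hv hi hmu
  rcases (hR.w_nonneg v.2.1 v.2.2).eq_or_lt with hw | hw
  · simp [nu0, nuU, nuV, nuY, domDensity, ← hw]
  rcases (M.p_nonneg true v.1 v.2.1).eq_or_lt with hp1 | hp1
  · simp [nu0, nuU, nuV, nuY, domDensity, e, ← hp1]
  rcases (M.p_nonneg false v.1 v.2.2).eq_or_lt with hp0 | hp0
  · simp [nu0, nuU, nuV, nuY, domDensity, e, ← hp0]
  obtain ⟨hF1, hF0⟩ := hv hp1 hp0
  have hd := weighted_dcu_le hR hF1 hF0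
  have hC := hc.nonneg _ hF1 _ hF0
  have hΨ := Psi_nonneg hR hF1 hF0
  have hf1 := hc.fderiv_left hF1 hF0
  have hf0 := hc.fderiv_right hF1 hF0
  have hu1 : 0 < M.F true v.2.1 v.1 * (1 - M.F true v.2.1 v.1) :=
    mul_pos hF1.1 (by linarith [hF1.2])
  have hu0 : 0 < M.F false v.2.2 v.1 * (1 - M.F false v.2.2 v.1) :=
    mul_pos hF0.1 (by linarith [hF0.2])
  have hA := M.absMean_nonneg v
  have hη := Metric.mem_ball_self (x := η₀) hR.pos
  have hbf := hR.bound_f v.2.1 v.2.2 η₀ hη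
  have hbd := hR.bound_df v.2.1 v.2.2 η₀ hη i
  have hb : 0 ≤ b v.2.1 v.2.2 := (abs_nonneg _).trans hbf
  have hd1 : M.F true v.2.1 v.1 * (1 - M.F true v.2.1 v.1) *
      |dcu c (M.F true v.2.1 v.1) (M.F false v.2.2 v.1)| ≤ M.env c Ψ v := by
    rw [env]
    have := mul_nonneg hu0.le (abs_nonneg (dcv c (M.F true v.2.1 v.1) (M.F false v.2.2 v.1)))
    linarith
  have hd0 : M.F false v.2.2 v.1 * (1 - M.F false v.2.2 v.1) *
      |dcv c (M.F true v.2.1 v.1) (M.F false v.2.2 v.1)| ≤ M.env c Ψ v := by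
    rw [env]
    have := mul_nonneg hu1.le (abs_nonneg (dcu c (M.F true v.2.1 v.1) (M.F false v.2.2 v.1)))
    linarith
  have hCe : c (M.F true v.2.1 v.1) (M.F false v.2.2 v.1) ≤ M.env c Ψ v := by
    rw [env]
    linarith
  -- If `c + Ψ = 0` then `c` has an interior minimum, its partial derivatives vanish, and all terms
  -- are zero.
  rcases (env_nonneg hc hR hF1 hF0).eq_or_lt with hE | hE
  · rw [← hE] at hCe hd1 hd0
    have hC0 : c (M.F true v.2.1 v.1) (M.F false v.2.2 v.1) = 0 := le_antisymm hCe hC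
    simp [nu0, nuU, nuV, nuY, domDensity, e, hf1, hf0, hC0, ← hE, hc.dcu_eq_zero hF1 hF0 hC0,
      hc.dcv_eq_zero hF1 hF0 hC0]
  have hiy := hi hw hp1 hp0 hF1 hF0 hE
  have hm := hmu hw hp1 hp0 hF1 hF0 hE
  have hr : |M.mu false v.2.2 v.1 - f v.2.1 v.2.2 η₀| ≤ M.absMean v + b v.2.1 v.2.2 :=
    (abs_sub _ _).trans (add_le_add hm hbf)
  have hE0 := hE.le
  -- the common bound
  have key : ∀ x y : ℝ, |x| ≤ M.env c Ψ v → |y| ≤ M.absMean v + b v.2.1 v.2.2 →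
      |w v.2.1 v.2.2 * df f v.2.1 v.2.2 η₀ i * (x * M.p true v.1 v.2.1 * M.p false v.1 v.2.2) * y| ≤
        M.domDensity c w Ψ v * (M.absMean v + b v.2.1 v.2.2) ^ 2 := by
    intro x y hx hy
    rw [abs_mul, abs_mul, abs_mul, abs_mul, abs_mul, abs_of_pos hw, abs_of_pos hp1, abs_of_pos hp0,
      domDensity]
    calc w v.2.1 v.2.2 * |df f v.2.1 v.2.2 η₀ i| * (|x| * M.p true v.1 v.2.1 * M.p false v.1 v.2.2) * |y|
        ≤ w v.2.1 v.2.2 * (M.absMean v + b v.2.1 v.2.2) *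
          (M.env c Ψ v * M.p true v.1 v.2.1 * M.p false v.1 v.2.2) *
          (M.absMean v + b v.2.1 v.2.2) := by
          gcongr
          linarith
      _ = _ := by ring
  refine ⟨?_, ?_, ?_, ?_, fun _ => hiy⟩
  · exact key _ _ (by rw [abs_of_nonneg hC]; exact hCe) hr
  · have := key (M.F true v.2.1 v.1 * (1 - M.F true v.2.1 v.1) *
      dcu c (M.F true v.2.1 v.1) (M.F false v.2.2 v.1)) _
      (by rw [abs_mul, abs_of_pos hu1]; exact hd1) hr
    refine le_trans (le_of_eq ?_) this
    rw [nuU, hf1]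
    congr 1
    ring
  · have := key (M.F false v.2.2 v.1 * (1 - M.F false v.2.2 v.1) *
      dcv c (M.F true v.2.1 v.1) (M.F false v.2.2 v.1)) _
      (by rw [abs_mul, abs_of_pos hu0]; exact hd0) hr
    refine le_trans (le_of_eq ?_) this
    rw [nuV, hf0]
    congr 1
    ring
  · exact key _ _ (by rw [abs_of_nonneg hC]; exact hCe) (by rw [abs_of_nonneg hA]; linarith)

omit hc hR in
theorem measurable_F_true : Measurable fun v : 𝒳 × ℝ × ℝ => M.F true v.2.1 v.1 :=
  (M.measurable_F true).comp (f := fun v : 𝒳 × ℝ × ℝ => (v.2.1, v.1)) (by fun_prop)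

omit hc hR in
theorem measurable_F_false : Measurable fun v : 𝒳 × ℝ × ℝ => M.F false v.2.2 v.1 :=
  (M.measurable_F false).comp (f := fun v : 𝒳 × ℝ × ℝ => (v.2.2, v.1)) (by fun_prop)

theorem integrable_nu0 (i : Fin q) : Integrable (fun v : 𝒳 × ℝ × ℝ =>
    M.nu0 c w f η₀ v.2.1 v.2.2 v.1 i) (M.PX.prod volume) :=
  (integrable_dominating hc hR).mono' (measurable_nu0 hc hR i).aestronglyMeasurable
    ((ae_bounds hc hR i).mono fun _ h => h.1)

theorem integrable_nuU (i : Fin q) : Integrable (fun v : 𝒳 × ℝ × ℝ =>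
    M.nuU c w f η₀ i v * (M.F true v.2.1 v.1 * (1 - M.F true v.2.1 v.1))) (M.PX.prod volume) :=
  (integrable_dominating hc hR).mono' ((measurable_nuU hc hR i).mul
    ((measurable_F_true).mul ((measurable_F_true).const_sub 1))).aestronglyMeasurable
    ((ae_bounds hc hR i).mono fun _ h => h.2.1)

theorem integrable_nuV (i : Fin q) : Integrable (fun v : 𝒳 × ℝ × ℝ =>
    M.nuV c w f η₀ i v * (M.F false v.2.2 v.1 * (1 - M.F false v.2.2 v.1))) (M.PX.prod volume) :=
  (integrable_dominating hc hR).mono' ((measurable_nuV hc hR i).mul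
    ((measurable_F_false).mul ((measurable_F_false).const_sub 1))).aestronglyMeasurable
    ((ae_bounds hc hR i).mono fun _ h => h.2.2.1)

theorem integrable_nuY (i : Fin q) : Integrable (fun v : 𝒳 × ℝ × ℝ =>
    M.nuY c w f η₀ i v * M.absMean v) (M.PX.prod volume) :=
  (integrable_dominating hc hR).mono'
    ((measurable_nuY hc hR i).mul M.measurable_absMean).aestronglyMeasurable
    ((ae_bounds hc hR i).mono fun _ h => h.2.2.2.1)

-- The quotient `ċ_u / c` is cleared against the factor `c` in `ν₀`. At an interior zero of `c` the
-- derivative vanishes too, so nothing is lost.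
omit hR in
theorem integral_nu0_ru (i : Fin q) (x : 𝒳) (s : ℝ) :
    ∫ t : ℝ × ℝ, M.nu0 c w f η₀ t.1 t.2 x i * M.ru c t.1 t.2 s x =
      ∫ t : ℝ × ℝ, (M.nu0 c w f η₀ t.1 t.2 x i - M.nuU c w f η₀ i (x, t) *
        ((Set.Iic t.1).indicator (fun _ => (1 : ℝ)) s - M.F true t.1 x)) := by
  refine integral_congr_ae ?_
  filter_upwards [M.ae_F_mem_prod x] with t ht
  rcases (M.p_nonneg true x t.1).eq_or_lt with hp1 | hp1
  · simp [nu0, nuU, e, ← hp1]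
  rcases (M.p_nonneg false x t.2).eq_or_lt with hp0 | hp0
  · simp [nu0, nuU, e, ← hp0]
  obtain ⟨hF1, hF0⟩ := ht hp1 hp0
  rw [nu0, nuU, ru, e, hc.fderiv_left hF1 hF0]
  rcases eq_or_ne (c (M.F true t.1 x) (M.F false t.2 x)) 0 with hC0 | hC0
  · rw [hC0, hc.dcu_eq_zero hF1 hF0 hC0]
    ring
  · field_simp

omit hR in
theorem integral_nu0_rv (i : Fin q) (x : 𝒳) (s : ℝ) :
    ∫ t : ℝ × ℝ, M.nu0 c w f η₀ t.1 t.2 x i * M.rv c t.1 t.2 s x =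
      ∫ t : ℝ × ℝ, (M.nu0 c w f η₀ t.1 t.2 x i - M.nuV c w f η₀ i (x, t) *
        ((Set.Iic t.2).indicator (fun _ => (1 : ℝ)) s - M.F false t.2 x)) := by
  refine integral_congr_ae ?_
  filter_upwards [M.ae_F_mem_prod x] with t ht
  rcases (M.p_nonneg true x t.1).eq_or_lt with hp1 | hp1
  · simp [nu0, nuV, e, ← hp1]
  rcases (M.p_nonneg false x t.2).eq_or_lt with hp0 | hp0
  · simp [nu0, nuV, e, ← hp0]
  obtain ⟨hF1, hF0⟩ := ht hp1 hp0
  rw [nu0, nuV, rv, e, hc.fderiv_right hF1 hF0]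
  rcases eq_or_ne (c (M.F true t.1 x) (M.F false t.2 x)) 0 with hC0 | hC0
  · rw [hC0, hc.dcv_eq_zero hF1 hF0 hC0]
    ring
  · field_simp

/-- The integrand of the pathwise derivative. -/
theorem ae_integrand_eq (σ : Obs 𝒳 → ℝ) (i : Fin q) : ∀ᵐ v ∂(M.PX.prod volume),
    M.domDensity c w Ψ v * (df f v.2.1 v.2.2 η₀ i * (M.dmu σ false v.2.2 v.1 *
      (c (M.F true v.2.1 v.1) (M.F false v.2.2 v.1) / M.env c Ψ v) +
      (M.mu false v.2.2 v.1 - f v.2.1 v.2.2 η₀) * (M.dc c σ v / M.env c Ψ v))) =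
    M.nu0 c w f η₀ v.2.1 v.2.2 v.1 i * M.avX σ v.1 +
      M.nu0 c w f η₀ v.2.1 v.2.2 v.1 i * M.avS σ ((v.1, true), v.2.1) -
      (M.nu0 c w f η₀ v.2.1 v.2.2 v.1 i * M.avZ σ (v.1, true) -
        M.nuU c w f η₀ i v * M.dF σ true v.2.1 v.1) +
      M.nu0 c w f η₀ v.2.1 v.2.2 v.1 i * M.avS σ ((v.1, false), v.2.2) -
      (M.nu0 c w f η₀ v.2.1 v.2.2 v.1 i * M.avZ σ (v.1, false) -
        M.nuV c w f η₀ i v * M.dF σ false v.2.2 v.1) +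
      M.nuY c w f η₀ i v * M.dmu σ false v.2.2 v.1 := by
  filter_upwards [M.ae_F_mem_prod'] with v hv
  rcases (M.p_nonneg true v.1 v.2.1).eq_or_lt with hp1 | hp1
  · simp [nu0, nuU, nuV, nuY, domDensity, e, ← hp1]
  rcases (M.p_nonneg false v.1 v.2.2).eq_or_lt with hp0 | hp0
  · simp [nu0, nuU, nuV, nuY, domDensity, e, ← hp0]
  obtain ⟨hF1, hF0⟩ := hv hp1 hp0
  rw [nu0, nuU, nuV, nuY, e, domDensity, hc.fderiv_left hF1 hF0, hc.fderiv_right hF1 hF0, dc,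
    scoreS, scoreS]
  rcases (env_nonneg hc hR hF1 hF0).eq_or_lt with hE | hE
  · have hC0 : c (M.F true v.2.1 v.1) (M.F false v.2.2 v.1) = 0 := by
      have h1 := hc.nonneg _ hF1 _ hF0
      have h2 := Psi_nonneg hR hF1 hF0
      rw [env] at hE
      linarith
    rw [← hE, hC0, hc.dcu_eq_zero hF1 hF0 hC0, hc.dcv_eq_zero hF1 hF0 hC0]
    ring
  · field_simp
    ring

variable {σ : Obs 𝒳 → ℝ} {B : ℝ} (hσ : Measurable σ) (hB : ∀ v, |σ v| ≤ B)
include hσ hB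

/-- The average of the influence function against a bounded score. -/
theorem integral_kSum_mul (i : Fin q) :
    ∫ v, M.kSum c w f η₀ v i * σ v ∂M.law =
      ∫ v, df f v.2.1 v.2.2 η₀ i * (M.dmu σ false v.2.2 v.1 *
        (c (M.F true v.2.1 v.1) (M.F false v.2.2 v.1) / M.env c Ψ v) +
        (M.mu false v.2.2 v.1 - f v.2.1 v.2.2 η₀) * (M.dc c σ v / M.env c Ψ v))
          ∂(M.dom c w Ψ) := by
  have hN := integrable_nu0 hc hR i
  have hNm := measurable_nu0 hc hR i
  set N : 𝒳 × ℝ × ℝ → ℝ := fun v => M.nu0 c w f η₀ v.2.1 v.2.2 v.1 i with hNdef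
  -- exchange of the two coordinates of the principal stratum
  set e' : 𝒳 × (ℝ × ℝ) ≃ᵐ 𝒳 × (ℝ × ℝ) :=
    (MeasurableEquiv.refl 𝒳).prodCongr MeasurableEquiv.prodComm with he'
  have hmp : MeasurePreserving e' (M.PX.prod (volume : Measure (ℝ × ℝ)))
      (M.PX.prod (volume : Measure (ℝ × ℝ))) :=
    (MeasurePreserving.id M.PX).prod Measure.measurePreserving_swap
  have hsw : ∀ {n : 𝒳 × ℝ × ℝ → ℝ}, Integrable n (M.PX.prod volume) →
      Integrable (fun v : 𝒳 × ℝ × ℝ => n (v.1, v.2.2, v.2.1)) (M.PX.prod volume) := fun hn =>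
    (hmp.integrable_comp_emb e'.measurableEmbedding).2 hn
  have hsw' : ∀ {n : 𝒳 × ℝ × ℝ → ℝ}, ∫ v : 𝒳 × ℝ × ℝ, n (v.1, v.2.2, v.2.1) ∂(M.PX.prod volume) =
      ∫ v, n v ∂(M.PX.prod volume) := fun {n} => hmp.integral_comp' n
  have hS : ∀ z, Measurable fun a : 𝒳 × ℝ => M.avS σ ((a.1, z), a.2) := fun z =>
    (M.measurable_avS hσ).comp (measurable_armIdx z)
  have hSb : ∀ z (a : 𝒳 × ℝ), |M.avS σ ((a.1, z), a.2)| ≤ B := fun z a => abs_kav_le _ hB _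
  have hslm : ∀ {z} {n : 𝒳 × ℝ × ℝ → ℝ}, Measurable n →
      Measurable fun a : 𝒳 × ℝ => (∫ t, n (a.1, a.2, t)) / M.p z a.1 a.2 := by
    intro z n hn
    refine Measurable.div ?_ (M.measurable_p z)
    have h1 : Measurable fun u : (𝒳 × ℝ) × ℝ => n (u.1.1, u.1.2, u.2) := hn.comp (by fun_prop)
    exact h1.stronglyMeasurable.integral_prod_right'.measurable
  -- the covariate term
  have a1 : Integrable (fun v : Obs 𝒳 => M.k1 c w f η₀ v.1.1.1 i * σ v) M.law ∧
      ∫ v : Obs 𝒳, M.k1 c w f η₀ v.1.1.1 i * σ v ∂M.law =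
        ∫ v, N v * M.avX σ v.1 ∂(M.PX.prod volume) := by
    obtain ⟨h1, h2⟩ := integral_law_cov (M := M) hσ hB (T := fun x => M.k1 c w f η₀ x i)
      hN.integral_prod_left
    refine ⟨h1, h2.trans ?_⟩
    have h3 : Integrable (fun v => N v * M.avX σ v.1) (M.PX.prod volume) :=
      hN.mul_bdd (c := B) ((M.measurable_avX hσ).comp measurable_fst).aestronglyMeasurable
        (Eventually.of_forall fun v => abs_kav_le _ (abs_kav_le _ (abs_kav_le _ hB)) _)
    rw [integral_prod _ h3]
    refine integral_congr_ae (Eventually.of_forall fun x => ?_)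
    simp only
    rw [integral_mul_const]
    rfl
  -- the treated arm
  have hN1 : ∀ x s t, M.p true x s = 0 → N (x, s, t) = 0 := fun x s t h => by
    simp [hNdef, nu0, e, h]
  obtain ⟨b1, b2, b3⟩ := integral_arm_slice hN hN1 (hS true) (hSb true)
  obtain ⟨c1, c2⟩ := integral_ipw_base hσ hB (hslm (z := true) hNm) b1
  obtain ⟨d1, d2, d3, d4⟩ := integral_arm_resid (M := M) hσ hB true measurable_fst hNm
    (measurable_nuU hc hR i) hN (integrable_nuU hc hR i)
  obtain ⟨f1, f2⟩ := integral_ipw_base hσ hB d1 d2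
  -- the control arm
  have hN0 : ∀ x s t, M.p false x s = 0 → N (x, t, s) = 0 := fun x s t h => by
    simp [hNdef, nu0, e, h]
  have hNsm : Measurable fun v : 𝒳 × ℝ × ℝ => N (v.1, v.2.2, v.2.1) := hNm.comp (by fun_prop)
  obtain ⟨g1, g2, g3⟩ := integral_arm_slice (n := fun v => N (v.1, v.2.2, v.2.1)) (hsw hN) hN0
    (hS false) (hSb false)
  obtain ⟨h1, h2⟩ := integral_ipw_base hσ hB (hslm (z := false) hNsm) g1
  obtain ⟨k1, k2, k3, k4⟩ := integral_arm_resid (M := M) hσ hB false measurable_snd hNm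
    (measurable_nuV hc hR i) hN (integrable_nuV hc hR i)
  obtain ⟨l1, l2⟩ := integral_ipw_base hσ hB k1 k2
  -- the outcome term
  have hY := measurable_nuY hc hR i
  have hYi := integrable_nuY hc hR i
  set Y : 𝒳 × ℝ × ℝ → ℝ := M.nuY c w f η₀ i with hYdef
  have hY0 : ∀ x s t, M.p false x s = 0 → Y (x, t, s) = 0 := fun x s t h => by
    simp [hYdef, nuY, e, h]
  have hYsm : Measurable fun v : 𝒳 × ℝ × ℝ => Y (v.1, v.2.2, v.2.1) := hY.comp (by fun_prop)
  have hdm : Measurable fun v : 𝒳 × ℝ × ℝ => M.dmu σ false v.2.2 v.1 := by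
    have h3 : Measurable fun u : ((𝒳 × Bool) × ℝ) × ℝ => (σ u - M.avS σ u.1) * u.2 :=
      (hσ.sub ((M.measurable_avS hσ).comp measurable_fst)).mul measurable_snd
    exact (measurable_kav M.out h3).comp
      (by fun_prop : Measurable fun v : 𝒳 × ℝ × ℝ => ((v.1, false), v.2.2))
  have hdb : ∀ v : 𝒳 × ℝ × ℝ, Integrable (fun y : ℝ => y) (M.out ((v.1, false), v.2.2)) →
      |M.dmu σ false v.2.2 v.1| ≤ 2 * B * M.absMean v := by
    intro v hv
    rw [absMean_eq_integral hv, ← integral_const_mul]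
    refine norm_integral_le_of_norm_le
      (f := fun y => (σ (((v.1, false), v.2.2), y) - M.avS σ ((v.1, false), v.2.2)) * y)
      (hv.abs.const_mul _) (Eventually.of_forall fun y => ?_)
    rw [norm_mul]
    refine mul_le_mul_of_nonneg_right ?_ (abs_nonneg y)
    have h3 := abs_sub (σ (((v.1, false), v.2.2), y)) (M.avS σ ((v.1, false), v.2.2))
    have h4 : |M.avS σ ((v.1, false), v.2.2)| ≤ B := abs_kav_le _ hB _
    rw [Real.norm_eq_abs]
    linarith [hB (((v.1, false), v.2.2), y)]
  have hYd : Integrable (fun v => Y v * M.dmu σ false v.2.2 v.1) (M.PX.prod volume) := by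
    refine (hYi.abs.const_mul (2 * B)).mono' (hY.mul hdm).aestronglyMeasurable ?_
    filter_upwards [ae_bounds hc hR i] with v hv
    by_cases h3 : Y v = 0
    · simp [h3]
    · have h4 := hdb v (hv.2.2.2.2 h3)
      rw [norm_mul, Real.norm_eq_abs, Real.norm_eq_abs, abs_mul, abs_of_nonneg (M.absMean_nonneg v)]
      calc |Y v| * |M.dmu σ false v.2.2 v.1| ≤ |Y v| * (2 * B * M.absMean v) := by gcongr
        _ = _ := by ring
  -- Slicing with `absMean` gives the integrability demanded by `integral_ipw_mean`; the next
  -- application, with `dmu`, gives the value. The bounded factor is `1` in both.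
  obtain ⟨m1, -, -⟩ := integral_arm_slice (z := false)
    (n := fun v => Y (v.1, v.2.2, v.2.1) * M.absMean (v.1, v.2.2, v.2.1)) (hsw hYi)
    (fun x s t h => by simp [hY0 x s t h]) (h := fun _ => 1) measurable_const (C := 1) (by simp)
  obtain ⟨n1, -, n3⟩ := integral_arm_slice (z := false)
    (n := fun v => Y (v.1, v.2.2, v.2.1) * M.dmu σ false v.2.1 v.1) (hsw hYd)
    (fun x s t h => by simp [hY0 x s t h]) (h := fun _ => 1) measurable_const (C := 1) (by simp)
  set T : 𝒳 × ℝ → ℝ := fun a => (∫ t, Y (a.1, t, a.2)) / M.p false a.1 a.2 with hTdef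
  have hT : Measurable T := hslm (z := false) hYsm
  have hTA : ∀ a : 𝒳 × ℝ, (∫ t, Y (a.1, t, a.2) * M.absMean (a.1, t, a.2)) / M.p false a.1 a.2 =
      T a * M.absMean (a.1, 0, a.2) := by
    intro a
    have h3 : ∀ t, M.absMean (a.1, t, a.2) = M.absMean (a.1, 0, a.2) := fun t => rfl
    simp only [h3]
    rw [integral_mul_const, hTdef]
    ring
  have hTd : ∀ a : 𝒳 × ℝ, (∫ t, Y (a.1, t, a.2) * M.dmu σ false a.2 a.1) / M.p false a.1 a.2 =
      T a * M.dmu σ false a.2 a.1 := by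
    intro a
    rw [integral_mul_const, hTdef]
    ring
  simp only [hTA] at m1
  simp only [hTd, mul_one] at n1 n3
  have hTy : ∀ᵐ a ∂(M.arm false), T a ≠ 0 →
      Integrable (fun y : ℝ => y) (M.out ((a.1, false), a.2)) := by
    have h3 : ∀ᵐ v : 𝒳 × ℝ × ℝ ∂(M.PX.prod volume), Y (v.1, v.2.2, v.2.1) ≠ 0 →
        Integrable (fun y : ℝ => y) (M.out ((v.1, false), v.2.1)) :=
      hmp.quasiMeasurePreserving.ae ((ae_bounds hc hR i).mono fun v hv => hv.2.2.2.2)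
    have h4 : ∀ᵐ u : (𝒳 × ℝ) × ℝ ∂((M.PX.prod volume).prod volume), Y (u.1.1, u.2, u.1.2) ≠ 0 →
        Integrable (fun y : ℝ => y) (M.out ((u.1.1, false), u.1.2)) :=
      (measurePreserving_prodAssoc M.PX (volume : Measure ℝ)
        (volume : Measure ℝ)).quasiMeasurePreserving.ae h3
    have h5 := Measure.ae_ae_of_ae_prod h4
    refine (withDensity_absolutelyContinuous _ _).ae_le ?_
    filter_upwards [h5] with a ha hTa
    -- `Y` is integrable as soon as `nuY` is nonzero at almost any first coordinate; otherwise the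
    -- slice vanishes and `T a = 0`.
    by_contra hcon
    have h6 : (fun t => Y (a.1, t, a.2)) =ᵐ[volume] 0 := by
      filter_upwards [ha] with t ht
      by_contra h7
      exact hcon (ht h7)
    exact hTa (by rw [hTdef]; simp only; rw [integral_congr_ae h6]; simp)
  have hTi : Integrable (fun a => T a * ∫ y, |y| ∂(M.out ((a.1, false), a.2))) (M.arm false) := by
    refine m1.congr ?_
    filter_upwards [hTy] with a ha
    by_cases h3 : T a = 0
    · rw [h3, zero_mul, zero_mul]
    · rw [absMean_eq_integral (v := (a.1, 0, a.2)) (ha h3)]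
  obtain ⟨r1, r2⟩ := integral_ipw_mean hσ hB hT hTy hTi
  -- assembly
  have hk : ∀ v : Obs 𝒳, M.kSum c w f η₀ v i * σ v = M.k1 c w f η₀ v.1.1.1 i * σ v +
      M.ipw true v.1.1.1 v.1.1.2 * ((∫ t, N (v.1.1.1, v.1.2, t)) / M.p true v.1.1.1 v.1.2 * σ v) -
      M.ipw true v.1.1.1 v.1.1.2 * ((∫ t : ℝ × ℝ, (N (v.1.1.1, t) - M.nuU c w f η₀ i (v.1.1.1, t) *
        ((Set.Iic t.1).indicator (fun _ => (1 : ℝ)) v.1.2 - M.F true t.1 v.1.1.1))) * σ v) +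
      M.ipw false v.1.1.1 v.1.1.2 * ((∫ t, N (v.1.1.1, t, v.1.2)) / M.p false v.1.1.1 v.1.2 * σ v) -
      M.ipw false v.1.1.1 v.1.1.2 * ((∫ t : ℝ × ℝ, (N (v.1.1.1, t) - M.nuV c w f η₀ i (v.1.1.1, t) *
        ((Set.Iic t.2).indicator (fun _ => (1 : ℝ)) v.1.2 - M.F false t.2 v.1.1.1))) * σ v) +
      M.ipw false v.1.1.1 v.1.1.2 *
        (T (v.1.1.1, v.1.2) * (v.2 - M.mu false v.1.2 v.1.1.1) * σ v) := by
    intro v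
    rw [kSum, ObsModel.k2, ObsModel.k3, integral_nu0_ru hc, integral_nu0_rv hc, ipw1_eq, ipw0_eq]
    simp only [hNdef, hTdef, hYdef, nuY]
    ring
  simp only [hk]
  refine (integral_add_add_sub_add_sub_add a1.1 c1 f1 h1 l1 r1).trans ?_
  rw [a1.2, c2, f2, h2, l2, r2, b3, d4, g3, k4, n3]
  have hX : Integrable (fun v => N v * M.avX σ v.1) (M.PX.prod volume) :=
    hN.mul_bdd (c := B) ((M.measurable_avX hσ).comp measurable_fst).aestronglyMeasurable
      (Eventually.of_forall fun v => abs_kav_le _ (abs_kav_le _ (abs_kav_le _ hB)) _)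
  have g2' := hsw g2
  have e1 := hsw' (n := fun v => N v * M.avS σ ((v.1, false), v.2.2))
  have e2 := hsw' (n := fun v => Y v * M.dmu σ false v.2.2 v.1)
  simp only at e1 e2
  rw [e1, e2, dom, integral_withDensity_ofReal (measurable_domDensity hc hR)
    (ae_domDensity_nonneg hc hR), integral_congr_ae (ae_integrand_eq hc hR σ i)]
  exact (integral_add_add_sub_add_sub_add hX b2 d3 g2' k3 hYd).symm

end ObsModel

/-! ### Bounded scores and the tangent space -/

namespace ObsModel

variable {𝒳 : Type*} [MeasurableSpace 𝒳] (M : ObsModel 𝒳)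

/-- Every bounded function with mean zero is a score. -/
theorem exists_isRegularSubmodel {s : Obs 𝒳 → ℝ} (hs : Measurable s) {B : ℝ} (hB : ∀ v, |s v| ≤ B)
    (h0 : ∫ v, s v ∂M.law = 0) : ∃ Mθ, IsRegularSubmodel M Mθ s := by
  classical
  -- For small `θ` the linear curve `1 + θ s` is a valid ratio; for larger `θ` the submodel below is
  -- `M` itself.
  have hr : ∀ θ : ℝ, |θ| * B ≤ 1 / 2 → IsRatio fun v => 1 + θ * s v := by
    intro θ hθ
    have h : ∀ v, |θ * s v| ≤ 1 / 2 := fun v => by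
      rw [abs_mul]
      exact (mul_le_mul_of_nonneg_left (hB v) (abs_nonneg θ)).trans hθ
    exact ⟨(hs.const_mul θ).const_add 1, fun v => by linarith [(abs_le.1 (h v)).1],
      fun v => by linarith [(abs_le.1 (h v)).2]⟩
  have hi : Integrable s M.law := integrable_of_bdd _ hs hB
  have h1 : ∀ θ : ℝ, ∫ v, (1 + θ * s v) ∂M.law = 1 := fun θ => by
    rw [integral_add (integrable_const 1) (hi.const_mul θ), integral_const_mul, h0]
    simp
  refine ⟨fun θ => if h : |θ| * B ≤ 1 / 2 then M.tilt _ (hr θ h) (h1 θ) else M,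
    fun θ v => 1 + θ * s v, B, ?_, Eventually.of_forall fun v => ?_⟩
  · have h2 : ∀ᶠ θ : ℝ in 𝓝 0, |θ| * B < 1 / 2 :=
      (by fun_prop : Continuous fun θ : ℝ => |θ| * B).continuousAt.eventually_lt
        continuousAt_const (by norm_num)
    filter_upwards [h2] with θ hθ
    refine ⟨(hr θ hθ.le).measurable, fun v => ((hr θ hθ.le).pos v).le, ?_,
      Eventually.of_forall fun v => ?_⟩
    · rw [dif_pos hθ.le, tilt_law]
    · rw [add_sub_cancel_left, abs_mul, mul_comm]
      exact mul_le_mul_of_nonneg_right (hB v) (abs_nonneg θ)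
  · simpa using ((hasDerivAt_id (0 : ℝ)).mul_const (s v)).const_add 1

/-- The tangent space contains all square integrable functions with mean zero. -/
theorem toLp_mem_tangentSpace {h : Obs 𝒳 → ℝ} (hh : MemLp h 2 M.law) (h0 : ∫ v, h v ∂M.law = 0) :
    hh.toLp h ∈ tangentSpace M := by
  refine Metric.mem_closure_iff.2 fun ε hε => ?_
  have hε3 : ENNReal.ofReal (ε / 3) ≠ 0 := (ENNReal.ofReal_pos.2 (by positivity)).ne'
  -- A simple function within `ε / 3` is recentred to mean zero. Since `h` has mean zero, the mean
  -- of `g` is at most `‖h - g‖` in `L¹`, hence in `L²`, so recentring costs another `ε / 3`.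
  obtain ⟨g, hg, hg2⟩ := hh.exists_simpleFunc_eLpNorm_sub_lt ENNReal.ofNat_ne_top hε3
  obtain ⟨C, hC⟩ := g.exists_forall_norm_le
  set m := ∫ v, g v ∂M.law with hm
  have hgi : Integrable g M.law := hg2.integrable one_le_two
  have hhi : Integrable h M.law := hh.integrable one_le_two
  have hmle : eLpNorm (fun _ : Obs 𝒳 => m) 2 M.law ≤ ENNReal.ofReal (ε / 3) := by
    rw [eLpNorm_const m two_ne_zero (IsProbabilityMeasure.ne_zero _), measure_univ,
      ENNReal.one_rpow, mul_one]
    have h1 : m = - ∫ v, (h - ⇑g) v ∂M.law := by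
      rw [integral_sub' hhi hgi, h0]
      ring
    rw [h1, enorm_neg]
    refine (enorm_integral_le_lintegral_enorm _).trans ?_
    rw [← eLpNorm_one_eq_lintegral_enorm]
    exact (eLpNorm_le_eLpNorm_of_exponent_le one_le_two (hh.sub hg2).aestronglyMeasurable).trans hg.le
  have hs : MemLp (fun v => g v - m) 2 M.law := hg2.sub (memLp_const m)
  have hsm : Measurable fun v => g v - m := g.measurable.sub_const m
  obtain ⟨Mθ, hMθ⟩ := M.exists_isRegularSubmodel hsm (B := C + |m|)
    (fun v => (abs_sub _ _).trans (add_le_add_left (hC v) _)) (by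
      rw [integral_sub hgi (integrable_const m)]
      simp [hm])
  refine ⟨hs.toLp _, Submodule.subset_span ⟨Mθ, _, hMθ, hs.coeFn_toLp⟩, ?_⟩
  rw [dist_edist, Lp.edist_toLp_toLp]
  have h2 : h - (fun v => g v - m) = (h - ⇑g) + fun _ => m := by
    ext v
    simp only [Pi.sub_apply, Pi.add_apply]
    ring
  have h3 : eLpNorm (h - fun v => g v - m) 2 M.law ≤
      ENNReal.ofReal (ε / 3) + ENNReal.ofReal (ε / 3) := by
    rw [h2]
    exact (eLpNorm_add_le (hh.sub hg2).aestronglyMeasurable aestronglyMeasurable_const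
      one_le_two).trans (add_le_add hg.le hmle)
  rw [← ENNReal.ofReal_add (by positivity) (by positivity)] at h3
  calc _ ≤ (ENNReal.ofReal (ε / 3 + ε / 3)).toReal := ENNReal.toReal_mono ENNReal.ofReal_ne_top h3
    _ = ε / 3 + ε / 3 := ENNReal.toReal_ofReal (by positivity)
    _ < ε := by linarith

end ObsModel

/-! ### The efficient influence function -/

namespace ObsModel

variable {𝒳 : Type*} [MeasurableSpace 𝒳] {M : ObsModel 𝒳} {q : ℕ} {c w : ℝ → ℝ → ℝ}
  {f : ℝ → ℝ → (Fin q → ℝ) → ℝ} {η₀ : Fin q → ℝ} {b Ψ : ℝ → ℝ → ℝ} {δ : ℝ}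
  (hc : IsCopulaDensity c) (hR : IsRegular c w f M η₀ b Ψ δ)

/-! ### The objective as a least squares criterion plus a constant -/

section Loss

variable {g : ℝ → Obs 𝒳 → ℝ} {σ : Obs 𝒳 → ℝ} {B : ℝ}
include hc hR

-- The zero working model turns the criterion into `∬ w μ₀² e`, whose finiteness is the hypothesis
-- of the bias-variance identity.
omit hc in
theorem isRegular_zero : IsRegular c w (fun _ _ (_ : Fin q → ℝ) => (0 : ℝ)) M η₀ b Ψ δ := by
  have hb : ∀ s₁ s₀, 0 ≤ b s₁ s₀ := fun s₁ s₀ =>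
    (abs_nonneg _).trans (hR.bound_f s₁ s₀ η₀ (Metric.mem_ball_self hR.pos))
  have h1 : ∀ s₁ s₀ (η : Fin q → ℝ) i, df (fun _ _ (_ : Fin q → ℝ) => (0 : ℝ)) s₁ s₀ η i = 0 := by
    simp [df]
  exact { hR with
    measurable_f := fun _ => measurable_const
    contDiff_f := fun _ _ => contDiff_const
    bound_f := fun s₁ s₀ _ _ => by simpa using hb s₁ s₀
    bound_df := fun s₁ s₀ η _ i => by
      rw [h1, abs_zero]
      exact hb s₁ s₀
    bound_ddf := fun s₁ s₀ η _ i j => by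
      simp only [ddf, h1]
      simpa using hb s₁ s₀ }

/-- The objective of a tilt is, up to a finite constant, a least squares criterion. -/
theorem exists_loss_tilt_add (hC : IsCurve M.law g σ B) (h1 : ∀ θ, ∫ v, g θ v ∂M.law = 1) {ε : ℝ}
    (hε : 0 < ε) (hBε : 32 * (B * ε) ≤ 1) (hδε : 8 * (B * ε) ≤ δ) {θ : ℝ} (hθ : |θ| < ε) :
    ∃ V : ℝ≥0∞, V ≠ ∞ ∧ ∀ η, (M.tilt (g θ) (hC.ratio θ) (h1 θ)).loss c w f η + V =
      lsLoss (M.dom c w Ψ) (fun v => f v.2.1 v.2.2) (M.tiltMu (g θ)) (M.relDensity c Ψ (g θ)) η := by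
  have hB0 := hC.B_nonneg
  have hθ1 : 32 * (B * |θ|) ≤ 1 := le_trans (by gcongr) hBε
  have hθ2 : 8 * (B * |θ|) ≤ δ := le_trans (by gcongr) hδε
  have hR0 := isRegular_zero hR
  have h0 := fullLoss_tilt hc hR0 (hC.ratio θ) (h1 θ) (hC.lip θ) hθ1 hθ2 η₀
  rw [(isPath hc hR0 hC h1 hε hBε hδε).lsLoss_eq (isBase hc hR0) hθ
    (Metric.mem_ball_self hR.pos)] at h0
  have h2 : (M.tilt (g θ) (hC.ratio θ) (h1 θ)).fullLoss c w
      (fun _ _ (_ : Fin q → ℝ) => (0 : ℝ)) η₀ < ∞ := by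
    rw [h0]
    exact ENNReal.ofReal_lt_top
  simp only [fullLoss, sub_zero] at h2
  have key := fun η => (loss_add_varLoss _ hc hR.measurable_w hR.w_nonneg hR.measurable_f h2 η).trans
    (fullLoss_tilt hc hR (hC.ratio θ) (h1 θ) (hC.lip θ) hθ1 hθ2 η)
  refine ⟨_, ?_, key⟩
  refine (lt_of_le_of_lt le_add_self ((key η₀).trans_lt ?_)).ne
  rw [(isPath hc hR hC h1 hε hBε hδε).lsLoss_eq (isBase hc hR) hθ (Metric.mem_ball_self hR.pos)]
  exact ENNReal.ofReal_lt_top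

end Loss

/-- The tilt by the constant ratio `1` has the law of `M`, so this is the case of the constant
curve. -/
theorem exists_loss_add [StandardBorelSpace 𝒳] (hc : IsCopulaDensity c)
    (hR : IsRegular c w f M η₀ b Ψ δ) : ∃ V : ℝ≥0∞, V ≠ ∞ ∧ ∀ η, M.loss c w f η + V =
      lsLoss (M.dom c w Ψ) (fun v => f v.2.1 v.2.2) (fun v => M.mu false v.2.2 v.1)
        (fun v => c (M.F true v.2.1 v.1) (M.F false v.2.2 v.1) / M.env c Ψ v) η := by
  have hC : IsCurve M.law (fun _ _ => 1) (fun _ => 0) 0 :=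
    ⟨measurable_const, by simp, le_rfl, fun _ => ⟨measurable_const, by norm_num, by norm_num⟩,
      by simp, Eventually.of_forall fun _ => hasDerivAt_const _ _⟩
  have h1 : ∀ _ : ℝ, ∫ _v, (1 : ℝ) ∂M.law = 1 := by simp
  have hδ := hR.pos
  obtain ⟨V, hV, h⟩ := exists_loss_tilt_add hc hR hC h1 one_pos (by simp) (by simp [hδ.le])
    (θ := 0) (by simp)
  have hP := isPath hc hR hC h1 one_pos (by simp) (by simp [hδ.le])
  have hm := hP.zero_m
  have hr := hP.zero_r
  have hl : M.law = (M.tilt (fun _ => 1) (hC.ratio 0) (h1 0)).law := by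
    rw [tilt_law]
    simp
  refine ⟨V, hV, fun η => ?_⟩
  rw [loss_eq_of_law_eq hl hc.measurable w f η, h η]
  rw [hm, hr]

/-! ### The matrix `H₀` as half the Hessian of the criterion -/

section Hessian

include hc hR

theorem ae_domDensity_mul : ∀ᵐ v ∂(M.PX.prod volume), M.domDensity c w Ψ v *
    (c (M.F true v.2.1 v.1) (M.F false v.2.2 v.1) / M.env c Ψ v) =
      w v.2.1 v.2.2 * M.e c v.2.1 v.2.2 v.1 := by
  filter_upwards [M.ae_F_mem_prod'] with v hv
  rw [domDensity, e]
  rcases (M.p_nonneg true v.1 v.2.1).eq_or_lt with hp1 | hp1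
  · simp [← hp1]
  rcases (M.p_nonneg false v.1 v.2.2).eq_or_lt with hp0 | hp0
  · simp [← hp0]
  obtain ⟨hF1, hF0⟩ := hv hp1 hp0
  rcases (env_nonneg hc hR hF1 hF0).eq_or_lt with hE | hE
  · have hC0 : c (M.F true v.2.1 v.1) (M.F false v.2.2 v.1) = 0 := by
      have h1 := hc.nonneg _ hF1 _ hF0
      have h2 := Psi_nonneg hR hF1 hF0
      rw [env] at hE
      linarith
    simp [hC0]
  · field_simp

/-- The matrix `H₀` is the Hessian of the least squares criterion. -/
theorem H0_eq_lsHess [StandardBorelSpace 𝒳] {Q : Measure (Full 𝒳)} [IsProbabilityMeasure Q]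
    (hQ : IsCausalLaw c Q) (hM : Q.map Full.obs = M.law) :
    H0 w f Q η₀ = lsHess (M.dom c w Ψ) (fun v => f v.2.1 v.2.2) (fun v => M.mu false v.2.2 v.1)
      (fun v => c (M.F true v.2.1 v.1) (M.F false v.2.2 v.1) / M.env c Ψ v) η₀ := by
  ext i j
  have hd : ∀ s : ℝ × ℝ, ContDiff ℝ 2 (f s.1 s.2) := fun s => hR.contDiff_f s.1 s.2
  have hdm : ∀ η i, Measurable fun s : ℝ × ℝ => df f s.1 s.2 η i := fun η i =>
    measurable_pd (f := fun s : ℝ × ℝ => f s.1 s.2) hR.measurable_f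
      (fun s => (hd s).differentiable (by norm_num)) η i
  have hddm : Measurable fun s : ℝ × ℝ => ddf f s.1 s.2 η₀ i j :=
    measurable_pd (f := fun (s : ℝ × ℝ) η => df f s.1 s.2 η j) (fun η => hdm η j)
      (fun s => differentiable_pd (hd s) j) η₀ i
  have hp : Measurable fun v : ℝ × ℝ × ℝ => (v.1, v.2.1) := by fun_prop
  have e1 := integral_U hc hQ hM (h := fun s₁ s₀ m => w s₁ s₀ *
    (df f s₁ s₀ η₀ i * df f s₁ s₀ η₀ j - (m - f s₁ s₀ η₀) * ddf f s₁ s₀ η₀ i j))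
    ((hR.measurable_w.comp hp).mul ((((hdm η₀ i).comp hp).mul ((hdm η₀ j).comp hp)).sub
      (((measurable_snd.comp measurable_snd).sub ((hR.measurable_f η₀).comp hp)).mul
        (hddm.comp hp))))
  have hi := (isBase hc hR).isPath_const.integrable_hess (isBase hc hR) (θ := 0) (by simp)
    (Metric.mem_ball_self hR.pos) i j
  rw [dom, integrable_withDensity_ofReal (measurable_domDensity hc hR)
    (ae_domDensity_nonneg hc hR)] at hi
  have hcongr : (fun v : 𝒳 × ℝ × ℝ => M.domDensity c w Ψ v * ((pd (f v.2.1 v.2.2) η₀ i *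
      pd (f v.2.1 v.2.2) η₀ j - (M.mu false v.2.2 v.1 - f v.2.1 v.2.2 η₀) *
        pd (fun η' => pd (f v.2.1 v.2.2) η' j) η₀ i) *
      (c (M.F true v.2.1 v.1) (M.F false v.2.2 v.1) / M.env c Ψ v))) =ᵐ[M.PX.prod volume]
      fun v => w v.2.1 v.2.2 * (M.e c v.2.1 v.2.2 v.1 *
        (df f v.2.1 v.2.2 η₀ i * df f v.2.1 v.2.2 η₀ j -
          (M.mu false v.2.2 v.1 - f v.2.1 v.2.2 η₀) * ddf f v.2.1 v.2.2 η₀ i j)) := by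
    filter_upwards [ae_domDensity_mul hc hR] with v hv
    rw [mul_left_comm, hv, mul_comm, mul_assoc]
    rfl
  have hi2 := hi.congr hcongr
  refine e1.trans ?_
  rw [lsHess, Matrix.of_apply, dom, integral_withDensity_ofReal (measurable_domDensity hc hR)
    (ae_domDensity_nonneg hc hR), integral_congr_ae hcongr, integral_prod_symm _ hi2]
  refine integral_congr_ae ?_
  filter_upwards [hi2.prod_left_ae, M.ae_integrable_e hc, ae_m0_mul_eU (M := M) hc] with s h1 h2 h3
  rw [integral_const_mul]
  set D := ddf f s.1 s.2 η₀ i j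
  set T := df f s.1 s.2 η₀ i * df f s.1 s.2 η₀ j
  rcases eq_or_ne (w s.1 s.2) 0 with hw | hw
  · simp [hw]
  -- Only the whole Hessian integrand is known to be integrable in `x`. If `D = 0` the outcome mean
  -- does not occur; otherwise integrability of `e μ₀` is recovered by solving for it.
  rcases eq_or_ne D 0 with hD | hD
  · simp only [hD, mul_zero, sub_zero]
    rw [integral_mul_const, eU]
    ring
  have hem : Integrable (fun x => M.e c s.1 s.2 x * M.mu false s.2 x) M.PX := by
    refine ((h2.2.mul_const (T / D + f s.1 s.2 η₀)).sub (h1.const_mul (w s.1 s.2 * D)⁻¹)).congr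
      (Eventually.of_forall fun x => ?_)
    simp only [Pi.sub_apply]
    field_simp
    ring
  have e2 : ∀ x, M.e c s.1 s.2 x * (T - (M.mu false s.2 x - f s.1 s.2 η₀) * D) =
      M.e c s.1 s.2 x * (T + f s.1 s.2 η₀ * D) - M.e c s.1 s.2 x * M.mu false s.2 x * D := by
    intro x
    ring
  simp only [e2]
  rw [integral_sub (h2.2.mul_const _) (hem.mul_const _), integral_mul_const, integral_mul_const, ← h3,
    ← eU]
  ring

end Hessian

/-- The derivative along the constant score vanishes at a stationary point. -/
theorem integral_kSum (hc : IsCopulaDensity c) (hR : IsRegular c w f M η₀ b Ψ δ) (i : Fin q) :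
    ∫ v, M.kSum c w f η₀ v i ∂M.law =
      lsGrad (M.dom c w Ψ) (fun v => f v.2.1 v.2.2) (fun v => M.mu false v.2.2 v.1)
        (fun v => c (M.F true v.2.1 v.1) (M.F false v.2.2 v.1) / M.env c Ψ v) η₀ i := by
  -- The constant `1` is not a score, but the identity needs only boundedness. Every centred score
  -- then vanishes and `avX = 1`, which leaves the gradient.
  have h := integral_kSum_mul hc hR (σ := fun _ => 1) measurable_const (B := 1) (by simp) i
  have hS : ∀ a, M.avS (fun _ => 1) a = 1 := fun a => by simp [avS, kav]
  have hZ : ∀ a, M.avZ (fun _ => 1) a = 1 := fun a => by simp [avZ, kav, hS]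
  have hX : ∀ a, M.avX (fun _ => 1) a = 1 := fun a => by
    simp only [avX, kav, hZ, integral_const, probReal_univ, smul_eq_mul, mul_one]
  have hs : ∀ z s x, M.scoreS (fun _ => 1) z s x = 0 := fun z s x => by simp [scoreS, hS, hZ]
  have hF : ∀ z s x, M.dF (fun _ => 1) z s x = 0 := fun z s x => by simp [dF, hs]
  have hm : ∀ z s x, M.dmu (fun _ => 1) z s x = 0 := fun z s x => by simp [dmu, hS]
  simp only [mul_one, hm, zero_mul, zero_add, dc, hX, hs, hF, add_zero, mul_zero, one_mul] at h
  rw [h]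
  refine integral_congr_ae (Eventually.of_forall fun v => ?_)
  simp only
  rw [← mul_assoc]
  rfl

end ObsModel

/-- Finiteness of `V` permits cancelling it from a strict inequality of extended values. -/
theorem isUniqueMinOn_of_add {E : Type*} {L L' : E → ℝ≥0∞} {V : ℝ≥0∞} (hV : V ≠ ∞)
    (h : ∀ η, L η + V = L' η) {N : Set E} {η : E} (hL : IsUniqueMinOn L' N η) :
    IsUniqueMinOn L N η := by
  refine ⟨hL.1, fun η' hη' hne => ?_⟩
  have := hL.2 η' hη' hne
  rw [← h, ← h] at this
  exact (ENNReal.add_lt_add_iff_right hV).1 this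

section

/-! ### Minimizers along regular submodels -/

section Minimizers

variable {𝒳 : Type*} [MeasurableSpace 𝒳] [StandardBorelSpace 𝒳] {M : ObsModel 𝒳} {q : ℕ}
  {c w : ℝ → ℝ → ℝ} {f : ℝ → ℝ → (Fin q → ℝ) → ℝ} {η₀ : Fin q → ℝ} {b Ψ : ℝ → ℝ → ℝ} {δ : ℝ}

/-- The minimizers along regular submodels and their derivative. -/
theorem exists_nhds_min_curve (hc : IsCopulaDensity c) (hR : IsRegular c w f M η₀ b Ψ δ)
    (hmin : ∀ η, M.loss c w f η₀ ≤ M.loss c w f η) {H : Matrix (Fin q) (Fin q) ℝ}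
    (hH : H = lsHess (M.dom c w Ψ) (fun v => f v.2.1 v.2.2) (fun v => M.mu false v.2.2 v.1)
      (fun v => c (M.F true v.2.1 v.1) (M.F false v.2.2 v.1) / M.env c Ψ v) η₀)
    (hdet : IsUnit H.det) (hvar : ∀ i, MemLp (fun v => M.kSum c w f η₀ v i) 2 M.law) :
    ∃ ρ > 0, ∀ (Mθ : ℝ → ObsModel 𝒳) (s : Obs 𝒳 → ℝ), IsRegularSubmodel M Mθ s →
      ∃ η : ℝ → Fin q → ℝ, η 0 = η₀ ∧
        (∀ᶠ θ in 𝓝 (0 : ℝ), IsUniqueMinOn ((Mθ θ).loss c w f) (Metric.ball η₀ ρ) (η θ)) ∧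
        HasDerivAt η (fun i => ∫ v, (H⁻¹.mulVec (M.kSum c w f η₀ v)) i * s v ∂M.law) 0 ∧
        (IsGloballyStable f b (M.loss c w f) η₀ →
          ∀ᶠ θ in 𝓝 (0 : ℝ), IsUniqueMinOn ((Mθ θ).loss c w f) Set.univ (η θ)) := by
  have hB := ObsModel.isBase hc hR
  obtain ⟨V, hV, hVL⟩ := ObsModel.exists_loss_add hc hR
  obtain ⟨ρ, hρ, -, hcurve⟩ := hB.exists_min_curve (hH ▸ hdet) fun η => by
    rw [← hVL, ← hVL]
    exact add_le_add_left (hmin η) V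
  refine ⟨ρ, hρ, fun Mθ s hs => ?_⟩
  obtain ⟨g, s', B, hC, h1, hss, hlaw⟩ := hs.exists_curve
  have hB0 := hC.B_nonneg
  have hδ := hR.pos
  -- Chosen so that `32 B ε ≤ min δ 1`, which covers both smallness conditions of `isPath`.
  set ε := min δ 1 / (32 * (B + 1)) with hε
  have hε0 : 0 < ε := by positivity
  have hBε : 32 * (B * ε) ≤ min δ 1 := by
    rw [hε]
    calc 32 * (B * (min δ 1 / (32 * (B + 1)))) = B / (B + 1) * min δ 1 := by field_simp
      _ ≤ 1 * min δ 1 := by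
        gcongr
        rw [div_le_one (by positivity)]
        linarith
      _ = _ := one_mul _
  have hBε1 : 32 * (B * ε) ≤ 1 := hBε.trans (min_le_right _ _)
  have hBεδ : 8 * (B * ε) ≤ δ := by
    have h2 : 0 ≤ B * ε := by positivity
    linarith [hBε.trans (min_le_left _ _)]
  have hP := ObsModel.isPath hc hR hC h1 hε0 hBε1 hBεδ
  obtain ⟨η, hη0, hη, hder⟩ := hcurve _ _ _ _ _ _ hP
  have hnear : ∀ᶠ θ : ℝ in 𝓝 0, |θ| < ε := by
    filter_upwards [Metric.ball_mem_nhds (0 : ℝ) hε0] with θ hθ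
    simpa using hθ
  -- The added constant is a variance term that may change with `θ`; being finite and free of `η`,
  -- it does not move the minimizer.
  have hloss : ∀ᶠ θ in 𝓝 (0 : ℝ), ∃ V : ℝ≥0∞, V ≠ ∞ ∧ ∀ η, (Mθ θ).loss c w f η + V =
      lsLoss (M.dom c w Ψ) (fun v => f v.2.1 v.2.2) (M.tiltMu (g θ)) (M.relDensity c Ψ (g θ)) η := by
    filter_upwards [hlaw, hnear] with θ hθ hθε
    obtain ⟨W, hW, h⟩ := ObsModel.exists_loss_tilt_add hc hR hC h1 hε0 hBε1 hBεδ hθε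
    refine ⟨W, hW, fun η => ?_⟩
    rw [ObsModel.loss_eq_of_law_eq hθ hc.measurable w f η, h η]
  refine ⟨η, hη0, ?_, ?_, fun hst => ?_⟩
  · filter_upwards [hη, hloss] with θ h2 ⟨W, hW, h⟩
    exact isUniqueMinOn_of_add hW h h2
  · have hint : ∀ j, Integrable (fun v => M.kSum c w f η₀ v j * s' v) M.law := fun j =>
      ((hvar j).integrable one_le_two).mul_bdd (c := B) hC.measurable_s.aestronglyMeasurable
        (Eventually.of_forall hC.bound_s)
    refine hder.congr_deriv ?_
    rw [← hH]
    ext i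
    rw [Matrix.mulVec, dotProduct]
    have e1 : ∫ v, (H⁻¹.mulVec (M.kSum c w f η₀ v)) i * s v ∂M.law =
        ∫ v, ∑ j, H⁻¹ i j * (M.kSum c w f η₀ v j * s' v) ∂M.law := by
      refine integral_congr_ae (hss.mono fun v hv => ?_)
      simp only [hv, Matrix.mulVec, dotProduct, Finset.sum_mul, mul_assoc]
    rw [e1, integral_finsetSum _ fun j _ => (hint j).const_mul _]
    refine Finset.sum_congr rfl fun j _ => ?_
    rw [integral_const_mul, ObsModel.integral_kSum_mul hc hR hC.measurable_s hC.bound_s j]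
    rfl
  · have hglob : ∀ᶠ θ in 𝓝 (0 : ℝ), IsUniqueMinOn (lsLoss (M.dom c w Ψ) (fun v => f v.2.1 v.2.2)
        (M.tiltMu (g θ)) (M.relDensity c Ψ (g θ))) Set.univ (η θ) := by
      rcases hst with haff | ⟨hb, hsep⟩
      · filter_upwards [hη, hnear] with θ h2 hθ
        exact isUniqueMinOn_univ_of_affine (f := fun v : 𝒳 × ℝ × ℝ => f v.2.1 v.2.2)
          (m := M.tiltMu (g θ)) (r := M.relDensity c Ψ (g θ)) (τ := M.dom c w Ψ) (fun v => haff v.2.1 v.2.2)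
          (fun η => hP.aemeasurable_loss hB hθ η) (hP.r_nonneg.mono fun v h => h θ hθ)
          (Metric.isOpen_ball.mem_nhds h2.1) h2
      · obtain ⟨κ, hκ, hκL⟩ := hsep ρ hρ
        refine hP.isUniqueMinOn_univ_of_separated hB (fun v η => hb v.2.1 v.2.2 η) hρ hκ
          (fun η' hη' => ?_) hη
        rw [← hVL, ← hVL, add_right_comm]
        exact add_le_add_left (hκL η' hη') V
    filter_upwards [hglob, hloss] with θ h2 ⟨W, hW, h⟩
    exact isUniqueMinOn_of_add hW h h2

end Minimizers

end

end PCE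

end

/-! ### Identification and the efficient influence function -/

theorem theoremS1 {𝒳 : Type*} [MeasurableSpace 𝒳] [StandardBorelSpace 𝒳] {q : ℕ}
    (c : ℝ → ℝ → ℝ) (hc : PCE.IsCopulaDensity c)
    (w : ℝ → ℝ → ℝ) (f : ℝ → ℝ → (Fin q → ℝ) → ℝ)
    (Q : Measure (PCE.Full 𝒳)) [IsProbabilityMeasure Q] (hQ : PCE.IsCausalLaw c Q)
    (M : PCE.ObsModel 𝒳) (hM : Q.map PCE.Full.obs = M.law)
    (η₀ : Fin q → ℝ) (hη₀ : PCE.IsUniqueMinOn (PCE.causalLoss w f Q) Set.univ η₀)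
    (b Ψ : ℝ → ℝ → ℝ) (δ : ℝ) (hreg : PCE.IsRegular c w f M η₀ b Ψ δ)
    (hH : IsUnit (PCE.H0 w f Q η₀).det)
    (hvar : ∀ i, MemLp (fun v => M.kSum c w f η₀ v i) 2 M.law) :
    (∀ (M' : PCE.ObsModel 𝒳) (Q' : Measure (PCE.Full 𝒳)) [IsProbabilityMeasure Q'],
      PCE.IsCausalLaw c Q' → Q'.map PCE.Full.obs = M'.law →
        ∀ η, PCE.causalLoss w f Q' η = M'.loss c w f η) ∧
    ∃ N ∈ 𝓝 η₀, (PCE.IsGloballyStable f b (PCE.causalLoss w f Q) η₀ → N = Set.univ) ∧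
      PCE.IsEIF (fun M' => M'.loss c w f) N M η₀
        (fun v => (PCE.H0 w f Q η₀)⁻¹.mulVec (M.kSum c w f η₀ v)) := by
  refine ⟨fun M' Q' _ hQ' hM' η =>
    PCE.causalLoss_eq hc hQ' hM' hreg.measurable_w hreg.measurable_f η, ?_⟩
  have hL : PCE.causalLoss w f Q = M.loss c w f :=
    funext fun η => PCE.causalLoss_eq hc hQ hM hreg.measurable_w hreg.measurable_f η
  rw [hL] at hη₀ ⊢
  have hmin : ∀ η, M.loss c w f η₀ ≤ M.loss c w f η := fun η => by
    rcases eq_or_ne η η₀ with rfl | h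
    · exact le_rfl
    · exact (hη₀.2 η (Set.mem_univ _) h).le
  have hH0 := PCE.ObsModel.H0_eq_lsHess hc hreg hQ hM
  obtain ⟨ρ, hρ, hcurve⟩ := PCE.exists_nhds_min_curve hc hreg hmin hH0 hH hvar
  obtain ⟨V, hV, hVL⟩ := PCE.ObsModel.exists_loss_add hc hreg
  have hgrad := ((PCE.ObsModel.isBase hc hreg).lsGrad_eq_zero fun η => by
    rw [← hVL, ← hVL]
    exact add_le_add_left (hmin η) V).1
  set H := PCE.H0 w f Q η₀
  have hint : ∀ j, Integrable (fun v => M.kSum c w f η₀ v j) M.law := fun j =>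
    (hvar j).integrable one_le_two
  have hmem : ∀ i, MemLp (fun v => (H⁻¹.mulVec (M.kSum c w f η₀ v)) i) 2 M.law := fun i =>
    memLp_finsetSum (f := fun j v => H⁻¹ i j * M.kSum c w f η₀ v j) Finset.univ fun j _ =>
      (hvar j).const_mul (H⁻¹ i j)
  have hmean : ∀ i, ∫ v, (H⁻¹.mulVec (M.kSum c w f η₀ v)) i ∂M.law = 0 := fun i => by
    simp only [Matrix.mulVec, dotProduct]
    rw [integral_finsetSum _ fun j _ => (hint j).const_mul _]
    refine Finset.sum_eq_zero fun j _ => ?_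
    rw [integral_const_mul, PCE.ObsModel.integral_kSum hc hreg, hgrad, Pi.zero_apply, mul_zero]
  -- A curve of global minimizers tending to `η₀` eventually enters the ball, where it must coincide
  -- with the unique local minimizer.
  have hargmin : ∀ (Mθ : ℝ → PCE.ObsModel 𝒳) (s : PCE.Obs 𝒳 → ℝ),
      PCE.IsRegularSubmodel M Mθ s → ∀ η : ℝ → Fin q → ℝ, Tendsto η (𝓝 0) (𝓝 η₀) →
      (∀ᶠ θ in 𝓝 (0 : ℝ), ∀ η', (Mθ θ).loss c w f (η θ) ≤ (Mθ θ).loss c w f η') →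
      HasDerivAt η (fun i => ∫ v, (H⁻¹.mulVec (M.kSum c w f η₀ v)) i * s v ∂M.law) 0 := by
    intro Mθ s hs η hη hle
    obtain ⟨η₁, -, h1, h2, -⟩ := hcurve Mθ s hs
    refine h2.congr_of_eventuallyEq ?_
    filter_upwards [h1, hle, hη.eventually (Metric.ball_mem_nhds η₀ hρ)] with θ h3 h4 h5
    by_contra hne
    exact (h3.2 _ h5 hne).not_ge (h4 _)
  -- `N` is the whole space under global stability and the ball of radius `ρ` otherwise.
  by_cases hst : PCE.IsGloballyStable f b (M.loss c w f) η₀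
  · refine ⟨Set.univ, univ_mem, fun _ => rfl, hmem, hmean,
      fun i => M.toLp_mem_tangentSpace (hmem i) (hmean i), fun Mθ s hs => ?_, hargmin⟩
    obtain ⟨η₁, h0, -, h2, h3⟩ := hcurve Mθ s hs
    exact ⟨η₁, h0, h3 hst, h2⟩
  · refine ⟨Metric.ball η₀ ρ, Metric.ball_mem_nhds η₀ hρ, fun h => absurd h hst, hmem, hmean,
      fun i => M.toLp_mem_tangentSpace (hmem i) (hmean i), fun Mθ s hs => ?_, hargmin⟩
    obtain ⟨η₁, h0, h1, h2, -⟩ := hcurve Mθ s hs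
    exact ⟨η₁, h0, h1, h2⟩
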